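/- **Setting.** Let $\mathbb F$ be an algebraically closed field of characteristic $p>3$, $\mathbb F_p\subset\mathbb F$ its prime field, and $n\ge 1$. Let $\mathcal O(n)$ be the divided power superalgebra in the even variables $x_1,\dots,x_n$ and the odd variables $x_{n+1},\dots,x_{2n}$, with basis the monomials $x^{(r)}$, $r=(r_1,\dots,r_{2n})$, $0\le r_i<p$ for $i\le n$ and $r_i\in\{0,1\}$ for $i>n$; let $\partial_i$ be the distinguished partial superderivations, $i'=i\pm n$, and $\deg x^{(r)}=\sum_i r_i$. Put $$\mathrm{De}_f=\sum_{i=1}^{2n}(-1)^{|\partial_i||f|}\partial_i(f)\partial_{i'},\qquad \overline{\mathfrak{le}}(n)=\{\mathrm{De}_f\mid f\in\mathcal O(n)\}\oplus\mathbb F E,\quad E=\sum_{i=1}^{2n}x_i\partial_i ,$$ a restricted Lie superalgebra of operators on $\mathcal O(n)$ under the supercommutator, with $p$-mapping the $p$-th power of operators. Let $\bar{\mathfrak h}$ be the span of the $\mathrm{De}_{x_ix_{i'}}$ ($i\le n$) and $E$, let $\varepsilon_1,\dots,\varepsilon_n,\delta$ be the dual basis of $\bar{\mathfrak h}^*$,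 let $\Lambda$ be the $\mathbb F_p$-span of $\varepsilon_1,\dots,\varepsilon_n,\delta$, and let $\mathfrak h_i$ be the span of the $\mathrm{De}_{x_jx_{j'}}$ with $j\le n$, $j\ne i$. **Borel subalgebras.** Write $\epsilon_i$ for the $i$-th unit tuple. Each $\mathfrak n_m^+$ ($0\le m\le 2n$) is spanned by some of the $\mathrm{De}_{x^{(r)}}$. First, $\mathfrak n_0^+$ is spanned by all $\mathrm{De}_{x^{(r)}}$ with $\deg x^{(r)}\ge 3$, all $\mathrm{De}_{x_ix_{n+j}}$ with $i<j\le n$, and all $\mathrm{De}_{x^{(\epsilon_k+\epsilon_l)}}$ with $k,l\le n$. For a tuple $r$ of nonnegative integers let $M(r)$ be the set of all $\mathrm{De}_{x^{(r+\epsilon_{n+i}+\epsilon_{n+j})}}$ and $\mathrm{De}_{x^{(r+\epsilon_i+\epsilon_{n+j})}}$ with $n\ge i\ge j\ge1$ (exponents out of range being ignored). * For $1\le k\le n$, $\mathfrak n_k^+$ arises from $\mathfrak n_{k-1}^+$ by removing the basis elements in $M(r)$ for all $r$ with $r_1=\dots=r_n=0$, $r_{n+k}=1$, $r_{n+k+1}=\dots=r_{2n}=0$,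 and adding $\mathrm{De}_{x_k}$. * For $1\le i\le n$ and $k=n-i+1$, $\mathfrak n_{n+i}^+$ arises from $\mathfrak n_{n+i-1}^+$ by removing the basis elements in $M(r)$ for all $r$ with $r_1=\dots=r_{k-1}=0$, $r_k\ge1$, and adding $\mathrm{De}_{x_{n+k}}$; in the last step ($i=n$) all $\mathrm{De}_{x^{(r)}}$ with $\deg x^{(r)}\ge3$ that are left are removed as well, so that $\mathfrak n^+_{2n}$ is spanned by $\mathrm{De}_{x_1},\dots,\mathrm{De}_{x_{2n}}$, the $\mathrm{De}_{x_ix_{n+j}}$ with $i<j\le n$, and the $\mathrm{De}_{x^{(\epsilon_k+\epsilon_l)}}$ with $k,l\le n$. Let $\mathfrak b_m=\bar{\mathfrak h}\oplus\mathfrak n_m^+$. For $\lambda\in\Lambda$ let $L^{\mathfrak b_m}(\lambda)$ be the unique irreducible $\mathbb Z_2$-graded quotient (the quotient by the sum of all proper graded submodules) of the restricted Verma module $\mathbf u(\overline{\mathfrak{le}}(n))\otimes_{\mathbf u(\mathfrak b_m)}\mathbb F v_\lambda$, where $\mathfrak n_m^+v_\lambda=0$, $hv_\lambda=\lambda(h)v_\lambda$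 for $h\in\bar{\mathfrak h}$, and $\mathbf u$ is the restricted enveloping superalgebra. Below, $\cong$ means isomorphic by a homogeneous (even or odd) bijective $\mathbf u(\overline{\mathfrak{le}}(n))$-linear map. **Proposition.** Let $1\le i\le n$ and $\lambda\in\Lambda$. 1. If $\lambda(\mathfrak h_i)=0$, then $L^{\mathfrak b_{i-1}}(\lambda)\cong L^{\mathfrak b_i}(\lambda)$. 2. If $\lambda(\mathfrak h_i)\ne0$, then $L^{\mathfrak b_{i-1}}(\lambda)\cong L^{\mathfrak b_i}(\lambda-\varepsilon_i-\delta)$. 3. If $\lambda(\mathfrak h_{n-i+1})\ne0$, then $L^{\mathfrak b_{n+i-1}}(\lambda)\cong L^{\mathfrak b_{n+i}}(\lambda+(p-1)(\varepsilon_{n-i+1}-\delta))$. 4. If $\lambda=a\delta$ with $a\in\mathbb F_p$, then $L^{\mathfrak b_{n+i-1}}(\lambda)\cong L^{\mathfrak b_{n+i}}(\lambda)$. 5. If $\lambda=a\varepsilon_{n-i+1}+b\delta$ with $a,b\in\mathbb F_p$, $a\ne0,1$, then $L^{\mathfrak b_{n+i-1}}(\lambda)\cong L^{\mathfrak b_{n+i}}(\lambda+(p-1)(\varepsilon_{n-i+1}-\delta))$.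 6. If $\lambda=\varepsilon_{n-i+1}+b\delta$ with $b\in\mathbb F_p$, then $L^{\mathfrak b_{n+i-1}}(\lambda)\cong L^{\mathfrak b_{n+i}}(\lambda+(p-2)(\varepsilon_{n-i+1}-\delta))$. -/

import Mathlib

noncomputable section

namespace OddHam

/-- Labels of the `2 n` variables: `Sum.inl i` is the even variable `x_i` and `Sum.inr i` is the
odd variable `x_{n+i}` (`1 ≤ i ≤ n`; indices in `Fin n` start at `0`). The involution `i ↦ i'` is
`Sum.swap`. -/
abbrev Var (n : ℕ) : Type := Fin n ⊕ Fin n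

/-- The tuple with `1` at one slot and `0` elsewhere. -/
abbrev unit {n : ℕ} (v : Var n) : Var n → ℕ := Pi.single v 1

/-- Exponents `r` with `r_i < p` on even variables and `r_i ∈ {0, 1}` on odd variables. -/
abbrev Valid (p n : ℕ) (r : Var n → ℕ) : Prop :=
  (∀ i : Fin n, r (Sum.inl i) < p) ∧ ∀ i : Fin n, r (Sum.inr i) ≤ 1

/-- The index set of the monomial basis `x^{(r)}`. -/
abbrev Mono (p n : ℕ) : Type := {r : Var n → ℕ // Valid p n r}

/-- The degree `∑ r_i` of a monomial. -/
def deg {n : ℕ} (r : Var n → ℕ) : ℕ := ∑ v, r v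

/-- The number of odd variables in a monomial; its class modulo `2` is the parity. -/
def oddDeg {n : ℕ} (r : Var n → ℕ) : ℕ := ∑ i : Fin n, r (Sum.inr i)

section Algebra

variable (F : Type*) [Field F] (p n : ℕ)

/-- The underlying vector space of the divided power superalgebra `O(n)` (all heights equal
to `1`): it has the monomials `x^{(r)}` as a basis. -/
abbrev O : Type _ := Mono p n →₀ F

variable {n} in
/-- The monomial `x^{(r)}`, understood to be `0` if `r` is out of range. -/
def mon (r : Var n → ℕ) : O F p n :=
  if h : Valid p n r then Finsupp.single ⟨r, h⟩ 1 else 0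

/-- The exponent of the sign in `x^{(r)} x^{(s)}`: the number of pairs `i < j` of odd variables
such that `j` occurs in `r` and `i` occurs in `s`. -/
def signExp {n : ℕ} (r s : Var n → ℕ) : ℕ :=
  ∑ j : Fin n, ∑ i : Fin n, if i < j then r (Sum.inr j) * s (Sum.inr i) else 0

/-- The multiplication of `O(n)`, as the map `f ↦ (g ↦ f g)`. On monomials
`x^{(r)} x^{(s)} = ± binom(r + s, r) x^{(r + s)}`, which is `0` if `r + s` is out of range. -/
def mul : O F p n →ₗ[F] Module.End F (O F p n) :=
  Finsupp.linearCombination F fun r : Mono p n =>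
    (Finsupp.linearCombination F fun s : Mono p n =>
      ((-1 : F) ^ signExp r.1 s.1 * ∏ v, ((Nat.choose (r.1 v + s.1 v) (r.1 v) : ℕ) : F)) •
        mon F p (r.1 + s.1) : O F p n →ₗ[F] O F p n)

variable {n} in
/-- The exponent of the sign in `∂_v x^{(r)}`: if `v` is odd, the number of odd variables
of `x^{(r)}` in front of `v`. -/
def dSign : Var n → (Var n → ℕ) → ℕ
  | Sum.inl _, _ => 0
  | Sum.inr i, r => ∑ j : Fin n, if j < i then r (Sum.inr j) else 0

variable {n} in
/-- The distinguished partial derivative `∂_v`: the superderivation of `O(n)` of the same parity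
as `x_v` that lowers the (divided) exponent of `x_v` by one. -/
def pd (v : Var n) : Module.End F (O F p n) :=
  Finsupp.linearCombination F fun r : Mono p n =>
    if r.1 v = 0 then 0 else (-1 : F) ^ dSign v r.1 • mon F p (r.1 - unit v)

/-- The parity involution of `O(n)`: `f ↦ (-1)^{|f|} f`. -/
def sig : Module.End F (O F p n) :=
  Finsupp.linearCombination F fun r : Mono p n => (-1 : F) ^ oddDeg r.1 • mon F p r.1

/-- `De_f = ∑_i (-1)^{|∂_i| |f|} ∂_i(f) ∂_{i'}`. The first sum runs over the even and the second
over the odd variables; the sign `(-1)^{|f|}` in the latter is the parity involution. -/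
def De : O F p n →ₗ[F] Module.End F (O F p n) where
  toFun f := ∑ i : Fin n, (mul F p n (pd F p (Sum.inl i) f) * pd F p (Sum.inr i) +
    mul F p n (pd F p (Sum.inr i) (sig F p n f)) * pd F p (Sum.inl i))
  map_add' f g := by
    simp only [map_add, add_mul, ← Finset.sum_add_distrib]
    exact Finset.sum_congr rfl fun i _ => by abel
  map_smul' c f := by
    simp only [map_smul, smul_mul_assoc, ← smul_add, Finset.smul_sum, RingHom.id_apply]

/-- The Euler operator `∑_{i = 1}^{2n} x_i ∂_i`. -/
def euler : Module.End F (O F p n) :=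
  ∑ v : Var n, mul F p n (mon F p (unit v)) * pd F p v

/-- `De_{x_i x_{i'}}`. -/
def hDe {n : ℕ} (i : Fin n) : Module.End F (O F p n) :=
  De F p n (mon F p (unit (Sum.inl i) + unit (Sum.inr i)))

/-- The Hamiltonian superalgebra of odd type `le(n)`, extended by the Euler operator. It is a
superspace of operators on `O(n)`, closed under the supercommutator and under `p`-th powers of
even elements; these are its bracket and its `p`-mapping. -/
def leBar : Submodule F (Module.End F (O F p n)) :=
  LinearMap.range (De F p n) ⊔ Submodule.span F {euler F p n}

/-- The operator `A` is homogeneous of parity `θ`. -/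
def IsHomog {F : Type*} [Field F] {p n : ℕ} (θ : ZMod 2) (A : Module.End F (O F p n)) : Prop :=
  sig F p n * A = (-1 : F) ^ θ.val • (A * sig F p n)

/-- The Cartan subalgebra spanned by the `De_{x_i x_{i'}}` and the Euler operator. -/
def hBar : Submodule F (Module.End F (O F p n)) :=
  Submodule.span F (Set.range (hDe F p (n := n)) ∪ {euler F p n})

/-- `𝔥_i`, the span of the `De_{x_j x_{j'}}` with `j ≠ i`. -/
def hSub {n : ℕ} (i : Fin n) : Submodule F (Module.End F (O F p n)) :=
  Submodule.span F (hDe F p '' {j | j ≠ i})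

/-- The coefficient of `x_v` in `A (x_v)`, as a linear form in the operator `A`. -/
def diagCoeff {n : ℕ} (v : Var n) : Module.Dual F (Module.End F (O F p n)) where
  toFun A := if h : Valid p n (unit v) then A (mon F p (unit v)) ⟨unit v, h⟩ else 0
  map_add' A B := by split_ifs <;> simp
  map_smul' c A := by split_ifs <;> simp

/-- The linear form `ε_i` on the Cartan subalgebra. Together with `δ` these forms are the basis
dual to the `De_{x_j x_{j'}}` and the Euler operator: see `eps_hDe` to `delta_euler`. -/
def eps {n : ℕ} (i : Fin n) : Module.Dual F (hBar F p n) :=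
  ((2 : F)⁻¹ • (diagCoeff F p (Sum.inr i) - diagCoeff F p (Sum.inl i))) ∘ₗ (hBar F p n).subtype

/-- The linear form `δ` on the Cartan subalgebra. -/
def delta [NeZero n] : Module.Dual F (hBar F p n) :=
  ((2 : F)⁻¹ • (diagCoeff F p (Sum.inr (0 : Fin n)) + diagCoeff F p (Sum.inl (0 : Fin n)))) ∘ₗ
    (hBar F p n).subtype

/-- The `𝔽_p`-span of `ε_1, …, ε_n, δ`, where `𝔽_p` is the prime field of `F`. -/
def Lam [NeZero n] : Submodule (⊥ : Subfield F) (Module.Dual F (hBar F p n)) :=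
  Submodule.span (⊥ : Subfield F) (Set.range (eps F p (n := n)) ∪ {delta F p n})

end Algebra

section DualBasis

variable (F : Type*) [Field F] (p : ℕ) {n : ℕ}

theorem mul_mon {r s : Var n → ℕ} (hr : Valid p n r) (hs : Valid p n s) :
    mul F p n (mon F p r) (mon F p s) = ((-1 : F) ^ signExp r s *
      ∏ v, ((Nat.choose (r v + s v) (r v) : ℕ) : F)) • mon F p (r + s) := by
  have h1 : mon F p r = Finsupp.single ⟨r, hr⟩ 1 := dif_pos hr
  have h2 : mon F p s = Finsupp.single ⟨s, hs⟩ 1 := dif_pos hs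
  rw [h1, h2, mul, Finsupp.linearCombination_single, one_smul, Finsupp.linearCombination_single,
    one_smul]

theorem pd_mon (v : Var n) {r : Var n → ℕ} (hr : Valid p n r) :
    pd F p v (mon F p r) =
      if r v = 0 then 0 else (-1 : F) ^ dSign v r • mon F p (r - unit v) := by
  have h1 : mon F p r = Finsupp.single ⟨r, hr⟩ 1 := dif_pos hr
  rw [h1, pd, Finsupp.linearCombination_single, one_smul]

theorem sig_mon {r : Var n → ℕ} (hr : Valid p n r) :
    sig F p n (mon F p r) = (-1 : F) ^ oddDeg r • mon F p r := by
  have h1 : mon F p r = Finsupp.single ⟨r, hr⟩ 1 := dif_pos hr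
  conv_lhs => rw [h1]
  rw [sig, Finsupp.linearCombination_single, one_smul]

variable [hp : Fact p.Prime]

theorem valid_unit (v : Var n) : Valid p n (unit v) := by
  have := hp.out.two_le
  refine ⟨fun i => ?_, fun i => ?_⟩ <;> rw [unit, Pi.single_apply] <;> split_ifs <;> omega

theorem valid_pair (j : Fin n) : Valid p n (unit (Sum.inl j) + unit (Sum.inr j)) := by
  have := hp.out.two_le
  refine ⟨fun i => ?_, fun i => ?_⟩ <;> simp [Pi.single_apply] <;> split_ifs <;> omega

theorem pd_unit (v w : Var n) :
    pd F p v (mon F p (unit w)) = if v = w then mon F p 0 else 0 := by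
  rw [pd_mon F p v (valid_unit p w)]
  by_cases h : v = w
  · subst h
    have : dSign v (unit v) = 0 := by
      cases v with
      | inl i => rfl
      | inr i =>
        refine Finset.sum_eq_zero fun j _ => ?_
        split_ifs with hj
        · simp [hj.ne]
        · rfl
    simp [this]
  · simp [h]

theorem mul_unit_zero (w : Var n) :
    mul F p n (mon F p (unit w)) (mon F p 0) = mon F p (unit w) := by
  have h0 : Valid p n 0 := ⟨fun _ => hp.out.pos, fun _ => Nat.zero_le _⟩
  rw [mul_mon F p (valid_unit p w) h0]
  simp [signExp]

theorem hDe_eq (j : Fin n) : hDe F p j =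
    mul F p n (mon F p (unit (Sum.inr j))) * pd F p (Sum.inr j) -
      mul F p n (mon F p (unit (Sum.inl j))) * pd F p (Sum.inl j) := by
  have hv := valid_pair p j
  have h1 : ∀ i : Fin n, pd F p (Sum.inl i) (mon F p (unit (Sum.inl j) + unit (Sum.inr j))) =
      if i = j then mon F p (unit (Sum.inr j)) else 0 := by
    intro i
    rw [pd_mon F p _ hv]
    by_cases h : i = j
    · subst h; simp [dSign]
    · simp [h]
  have h2 : ∀ i : Fin n, pd F p (Sum.inr i) (sig F p n
      (mon F p (unit (Sum.inl j) + unit (Sum.inr j)))) =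
      if i = j then -mon F p (unit (Sum.inl j)) else 0 := by
    intro i
    have ho : oddDeg (unit (Sum.inl j) + unit (Sum.inr j) : Var n → ℕ) = 1 := by
      simp [oddDeg, Pi.single_apply]
    rw [sig_mon F p hv, map_smul, pd_mon F p _ hv, ho]
    by_cases h : i = j
    · subst h
      have : dSign (Sum.inr i) (unit (Sum.inl i) + unit (Sum.inr i) : Var n → ℕ) = 0 := by
        refine Finset.sum_eq_zero fun l _ => ?_
        split_ifs with hl
        · simp [hl.ne]
        · rfl
      simp [this]
    · simp [h]
  change ∑ i : Fin n, _ = _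
  simp only [h1, h2]
  rw [Finset.sum_eq_single j]
  · rw [if_pos rfl, if_pos rfl, map_neg]
    refine LinearMap.ext fun x => ?_
    rw [LinearMap.sub_apply, LinearMap.add_apply, Module.End.mul_apply, Module.End.mul_apply,
      Module.End.mul_apply, LinearMap.neg_apply, sub_eq_add_neg]
  · intro i _ hi; simp [hi]
  · simp

theorem hDe_unit (j : Fin n) (w : Var n) : hDe F p j (mon F p (unit w)) =
    ((if Sum.inr j = w then 1 else 0) - (if Sum.inl j = w then 1 else 0) : F) •
      mon F p (unit w) := by
  rw [hDe_eq, LinearMap.sub_apply, Module.End.mul_apply, Module.End.mul_apply, pd_unit, pd_unit]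
  by_cases h1 : Sum.inr j = w <;> by_cases h2 : Sum.inl j = w
  · rw [← h1] at h2; cases h2
  · subst h1; simp [mul_unit_zero]
  · subst h2; simp [mul_unit_zero]
  · simp [h1, h2]

theorem euler_unit (w : Var n) : euler F p n (mon F p (unit w)) = mon F p (unit w) := by
  rw [euler, LinearMap.sum_apply, Finset.sum_eq_single w]
  · rw [Module.End.mul_apply, pd_unit, if_pos rfl, mul_unit_zero]
  · intro v _ hv; rw [Module.End.mul_apply, pd_unit, if_neg hv, map_zero]
  · simp

theorem diagCoeff_of_eigen (A : Module.End F (O F p n)) (v : Var n) (c : F)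
    (h : A (mon F p (unit v)) = c • mon F p (unit v)) : diagCoeff F p v A = c := by
  have hv := valid_unit p v
  change (if h : Valid p n (unit v) then A (mon F p (unit v)) ⟨unit v, h⟩ else 0) = c
  rw [dif_pos hv, h, mon, dif_pos hv]
  simp

/-- `De_{x_j x_{j'}}` as an element of the Cartan subalgebra. -/
def hDe' (j : Fin n) : hBar F p n := ⟨hDe F p j, Submodule.subset_span (Or.inl ⟨j, rfl⟩)⟩

/-- The Euler operator as an element of the Cartan subalgebra. -/
def euler' : hBar F p n := ⟨euler F p n, Submodule.subset_span (Or.inr rfl)⟩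

theorem eps_hDe (h2 : (2 : F) ≠ 0) (i j : Fin n) :
    eps F p i (hDe' F p j) = if i = j then 1 else 0 := by
  change (2 : F)⁻¹ * (diagCoeff F p (Sum.inr i) (hDe F p j) -
    diagCoeff F p (Sum.inl i) (hDe F p j)) = _
  rw [diagCoeff_of_eigen F p _ _ _ (hDe_unit F p j _),
    diagCoeff_of_eigen F p _ _ _ (hDe_unit F p j _)]
  by_cases h : i = j
  · subst h; simp; norm_num [h2]
  · simp [h, Ne.symm h]

theorem eps_euler (i : Fin n) : eps F p i (euler' F p) = 0 := by
  change (2 : F)⁻¹ * (diagCoeff F p (Sum.inr i) (euler F p n) -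
    diagCoeff F p (Sum.inl i) (euler F p n)) = _
  rw [diagCoeff_of_eigen F p _ _ 1 (by rw [euler_unit, one_smul]),
    diagCoeff_of_eigen F p _ _ 1 (by rw [euler_unit, one_smul])]
  simp

theorem delta_hDe [NeZero n] (j : Fin n) : delta F p n (hDe' F p j) = 0 := by
  change (2 : F)⁻¹ * (diagCoeff F p (Sum.inr (0 : Fin n)) (hDe F p j) +
    diagCoeff F p (Sum.inl (0 : Fin n)) (hDe F p j)) = _
  rw [diagCoeff_of_eigen F p _ _ _ (hDe_unit F p j _),
    diagCoeff_of_eigen F p _ _ _ (hDe_unit F p j _)]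
  simp

theorem delta_euler [NeZero n] (h2 : (2 : F) ≠ 0) : delta F p n (euler' F p) = 1 := by
  change (2 : F)⁻¹ * (diagCoeff F p (Sum.inr (0 : Fin n)) (euler F p n) +
    diagCoeff F p (Sum.inl (0 : Fin n)) (euler F p n)) = _
  rw [diagCoeff_of_eigen F p _ _ 1 (by rw [euler_unit, one_smul]),
    diagCoeff_of_eigen F p _ _ 1 (by rw [euler_unit, one_smul])]
  norm_num [h2]

end DualBasis

section Borel

variable {n : ℕ}

/-- The exponents of the `De_{x^{(r)}}` that span `𝔫_0^+`: all those of degree at least `3`,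
`x_i x_{n+j}` with `i < j`, and `x_k x_l` with `k, l ≤ n`. -/
def pos0 (n : ℕ) : Set (Var n → ℕ) :=
  {a | 3 ≤ deg a} ∪
  {a | ∃ i j : Fin n, i < j ∧ a = unit (Sum.inl i) + unit (Sum.inr j)} ∪
  {a | ∃ k l : Fin n, a = unit (Sum.inl k) + unit (Sum.inl l)}

/-- `a` is `r + ε_{n+i} + ε_{n+j}` or `r + ε_i + ε_{n+j}` for some `i ≥ j`. -/
def LowerOver (r a : Var n → ℕ) : Prop :=
  ∃ i j : Fin n, j ≤ i ∧ (a = r + unit (Sum.inr i) + unit (Sum.inr j) ∨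
    a = r + unit (Sum.inl i) + unit (Sum.inr j))

/-- The exponents removed by the reflection in `-ε_k - δ`. -/
def W₁ (k : Fin n) : Set (Var n → ℕ) :=
  {a | ∃ r : Var n → ℕ, (∀ l, r (Sum.inl l) = 0) ∧ (∀ l, k < l → r (Sum.inr l) = 0) ∧
    r (Sum.inr k) = 1 ∧ LowerOver r a}

/-- The exponents removed by the reflection in `ε_k - δ`. The last reflection of the chain (the
one in `ε_1 - δ`) moreover removes everything that is left in positive degrees. -/
def W₂ (k : Fin n) : Set (Var n → ℕ) :=
  {a | (∃ r : Var n → ℕ, (∀ l, l < k → r (Sum.inl l) = 0) ∧ 1 ≤ r (Sum.inl k) ∧ LowerOver r a) ∨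
    (k.val = 0 ∧ 3 ≤ deg a)}

/-- The exponents of the `De_{x^{(r)}}` that span `𝔫_m^+`, for `0 ≤ m ≤ 2n`. The first `n` steps
are the reflections in `-ε_1 - δ, …, -ε_n - δ`, adding `De_{x_1}, …, De_{x_n}`, and the last `n`
steps are those in `ε_n - δ, …, ε_1 - δ`, adding `De_{x_{2n}}, …, De_{x_{n+1}}`. -/
def posExp (n : ℕ) : ℕ → Set (Var n → ℕ)
  | 0 => pos0 n
  | m + 1 =>
    if h : m < n then (posExp n m \ W₁ ⟨m, h⟩) ∪ {unit (Sum.inl ⟨m, h⟩)}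
    else if h' : m - n < n then
      (posExp n m \ W₂ (Fin.rev ⟨m - n, h'⟩)) ∪ {unit (Sum.inr (Fin.rev ⟨m - n, h'⟩))}
    else posExp n m

/-- `𝔫_m^+`, for `0 ≤ m ≤ 2n`. -/
def nPlus (F : Type*) [Field F] (p n m : ℕ) : Submodule F (Module.End F (O F p n)) :=
  Submodule.span F ((fun r => De F p n (mon F p r)) '' {r | Valid p n r ∧ r ∈ posExp n m})

end Borel

section Modules

variable (F : Type*) [Field F] (p n : ℕ)

/-- The relations of the restricted enveloping algebra, imposed on the tensor algebra:
`x y - (-1)^{|x| |y|} y x = [x, y]` for homogeneous `x, y`, and `x^p = x^{[p]}` for even `x`. -/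
inductive URel : TensorAlgebra F (leBar F p n) → TensorAlgebra F (leBar F p n) → Prop
  | bracket (α β : ZMod 2) (x y z : leBar F p n)
      (hx : IsHomog α (x : Module.End F (O F p n)))
      (hy : IsHomog β (y : Module.End F (O F p n)))
      (hz : (z : Module.End F (O F p n)) =
        x.1 * y.1 - (-1 : F) ^ (α.val * β.val) • (y.1 * x.1)) :
      URel (TensorAlgebra.ι F x * TensorAlgebra.ι F y -
          (-1 : F) ^ (α.val * β.val) • (TensorAlgebra.ι F y * TensorAlgebra.ι F x))
        (TensorAlgebra.ι F z)
  | power (x y : leBar F p n) (hx : IsHomog 0 (x : Module.End F (O F p n)))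
      (hy : (y : Module.End F (O F p n)) = x.1 ^ p) :
      URel (TensorAlgebra.ι F x ^ p) (TensorAlgebra.ι F y)

/-- The restricted enveloping algebra of the extended Hamiltonian superalgebra of odd type. Its
modules are the restricted modules. -/
abbrev U : Type _ := RingQuot (URel F p n)

/-- The canonical map from the Lie superalgebra to its restricted enveloping algebra. -/
def iota : leBar F p n →ₗ[F] U F p n :=
  (RingQuot.mkAlgHom F (URel F p n)).toLinearMap ∘ₗ TensorAlgebra.ι F

/-- The `ℤ₂`-grading of the restricted enveloping algebra: the part of parity `θ` is spanned by
the products of homogeneous elements whose parities sum up to `θ`. -/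
def uPart (θ : ZMod 2) : Submodule F (U F p n) :=
  Submodule.span F {u | ∃ l : List (leBar F p n × ZMod 2),
    (∀ t ∈ l, IsHomog t.2 (t.1 : Module.End F (O F p n))) ∧ (l.map Prod.snd).sum = θ ∧
      u = (l.map fun t => iota F p n t.1).prod}

/-- The left ideal of the restricted enveloping algebra generated by `𝔫_m^+` and by the
`h - lam(h)` for `h` in the Cartan subalgebra. -/
def vermaIdeal (m : ℕ) (lam : Module.Dual F (hBar F p n)) : Submodule (U F p n) (U F p n) :=
  Submodule.span (U F p n)
    ({u | ∃ x : leBar F p n, (x : Module.End F (O F p n)) ∈ nPlus F p n m ∧ u = iota F p n x} ∪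
     {u | ∃ (x : leBar F p n) (h : hBar F p n),
        (x : Module.End F (O F p n)) = h ∧
          u = iota F p n x - algebraMap F (U F p n) (lam h)})

/-- The restricted Verma module with respect to `𝔟_m = 𝔫_m^+ ⊕ hBar`, that is, the module induced
from the one-dimensional `𝔟_m`-module of weight `lam`, on which `𝔫_m^+` acts by zero. -/
abbrev Verma (m : ℕ) (lam : Module.Dual F (hBar F p n)) : Type _ :=
  U F p n ⧸ vermaIdeal F p n m lam

/-- The part of parity `θ` of the Verma module; the canonical generator is even. -/
def vermaPart (m : ℕ) (lam : Module.Dual F (hBar F p n)) (θ : ZMod 2) : Set (Verma F p n m lam) :=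
  (vermaIdeal F p n m lam).mkQ '' (uPart F p n θ : Set (U F p n))

variable {F p n} in
/-- A submodule of the Verma module is graded if it contains the homogeneous components of its
elements. -/
def IsGraded {m : ℕ} {lam : Module.Dual F (hBar F p n)}
    (N : Submodule (U F p n) (Verma F p n m lam)) : Prop :=
  ∀ x ∈ N, ∃ x₀ ∈ N, ∃ x₁ ∈ N,
    x₀ ∈ vermaPart F p n m lam 0 ∧ x₁ ∈ vermaPart F p n m lam 1 ∧ x = x₀ + x₁

/-- The unique maximal graded submodule of the Verma module: the sum of all the proper ones. -/
def vermaRad (m : ℕ) (lam : Module.Dual F (hBar F p n)) :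
    Submodule (U F p n) (Verma F p n m lam) :=
  sSup {N | IsGraded N ∧ N ≠ ⊤}

/-- `L^{𝔟_m}(lam)`, the irreducible `ℤ₂`-graded quotient of the restricted Verma module. -/
abbrev L (m : ℕ) (lam : Module.Dual F (hBar F p n)) : Type _ :=
  Verma F p n m lam ⧸ vermaRad F p n m lam

/-- The part of parity `θ` of `L^{𝔟_m}(lam)`. -/
def lPart (m : ℕ) (lam : Module.Dual F (hBar F p n)) (θ : ZMod 2) : Set (L F p n m lam) :=
  (vermaRad F p n m lam).mkQ '' vermaPart F p n m lam θ

/-- `L^{𝔟_m}(lam) ≅ L^{𝔟_m'}(lam')`: there is a bijective module homomorphism that is homogeneous,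
of parity `0` or `1` (the parity of a highest weight vector is not part of the data). -/
def LIso (m : ℕ) (lam : Module.Dual F (hBar F p n)) (m' : ℕ)
    (lam' : Module.Dual F (hBar F p n)) : Prop :=
  ∃ (e : L F p n m lam ≃ₗ[U F p n] L F p n m' lam') (θ : ZMod 2),
    ∀ η x, x ∈ lPart F p n m lam η ↔ e x ∈ lPart F p n m' lam' (η + θ)

end Modules

end OddHam

end

/-!
Write `U` for the restricted enveloping algebra, `v` for the highest weight vector of
`L^{𝔟_m}(lam)` and `R = annIdeal` for its annihilator, the largest proper left ideal that is stable
under the parity automorphism `tau` and contains `vermaIdeal`. A vector `w v` that is homogeneous,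
nonzero, of weight `lam'` and killed by `𝔫_{m'}^+` identifies `L^{𝔟_m}(lam)` with `L^{𝔟_m'}(lam')`
(`lIso_of_singular`). So each statement is about finding such a vector for the next Borel
subalgebra and about deciding whether it vanishes.

For every `m` the exponents have an integral weight that is additive under the bracket and whose
nonnegative part is contained in `𝔟_m` (`exists_good`). Its negative part `N` generates a nilpotent
algebra, since the even `De_{x^{(a)}}` outside the Cartan subalgebra have `p`-th power zero
(`De_pow_char`, `negPart_nilpotent`). Straightening products then gives two substitutes for the
theorem of Poincaré, Birkhoff and Witt. The irreducible module is nonzero if the Verma module is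
(`annIdeal_ne_top`). And a set of homogeneous elements of `U` that is stable, modulo `R`, under the
part of nonnegative weight, and that lies in `N U + R`, already lies in `R`
(`mem_annIdeal_of_stable`); this is how all the vanishing statements are proved.

* In the reflection in `-ε_k - δ` the element `x = De_{x_k}` has square zero, and the new highest
  weight vector is `x v` if it is nonzero and `v` otherwise. If `lam(h_j) ≠ 0` for some `j ≠ k`,
  then `x v` is mapped to a nonzero multiple of `v`; in the other case it generates a proper
  submodule (`step_first_generic`, `step_first_special`).
* In the reflection in `ε_k - δ` the element `P = -De_{x_{n+k}}` satisfies `P ^ p = 0`, and the new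
  highest weight vector is the last nonzero `P ^ s v` (`step_second`). Explicit elements of `𝔫_m^+`
  map `P ^ s v` to nonzero multiples of `v` or of `P v`, with `s = p - 1`, or `s = p - 2` in the
  exceptional case. In the exceptional case it remains to see that `P ^ (p - 1) v = 0`
  (`lowOp_pow_pred_mem_ann`). On the polynomials `f` in the even variables with index larger than
  `k` the map `f ↦ De_{x_k x_{n+k} f}` is, on `v`, multiplicative (`opT_mem_ann`), and
  `De_{x_{n+k} f} v = De_{x_{n+k}} De_{x_k x_{n+k} f} v` (`opU_mem_ann`); these relations make
  `P ^ (p - 1) v` generate a proper submodule.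

That the Verma modules are nonzero is not needed. Two zero modules are isomorphic, so it suffices
that the Verma modules of `lam` for `𝔟_m` and of the reflected weight for `𝔟_{m+1}` vanish
simultaneously (`lIso_of_injective`). This follows from the uniqueness of the highest weight of a
nonzero irreducible module, from the existence of a highest weight vector for `𝔟_0`, and from the
injectivity of the reflections on weights.
-/

noncomputable section

namespace OddHam

/-! ### The superalgebra structure of `O(n)` -/

section Superalgebra

variable {F : Type*} [Field F] {p n : ℕ}

theorem mon_of_not_valid {r : Var n → ℕ} (h : ¬ Valid p n r) : mon F p r = 0 := dif_neg h

theorem single_eq_smul_mon (r : Mono p n) (c : F) :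
    (Finsupp.single r c : O F p n) = c • mon F p r.1 := by
  rw [mon, dif_pos r.2, Finsupp.smul_single, smul_eq_mul, mul_one]

@[elab_as_elim]
theorem mon_induction {P : O F p n → Prop} (f : O F p n)
    (mon : ∀ r, Valid p n r → P (mon F p r)) (zero : P 0)
    (add : ∀ f g, P f → P g → P (f + g)) (smul : ∀ (c : F) f, P f → P (c • f)) : P f :=
  Finsupp.induction_linear f zero add fun r c => by
    rw [single_eq_smul_mon]; exact smul c _ (mon _ r.2)

theorem lin_ext {M : Type*} [AddCommGroup M] [Module F M] {A B : O F p n →ₗ[F] M}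
    (h : ∀ r, Valid p n r → A (mon F p r) = B (mon F p r)) : A = B := by
  refine LinearMap.ext fun f => mon_induction f h (by rw [map_zero, map_zero]) ?_ ?_
  · intro f g hf hg; rw [map_add, map_add, hf, hg]
  · intro c f hf; rw [map_smul, map_smul, hf]

theorem Valid.mono {r s : Var n → ℕ} (h : Valid p n s) (hrs : ∀ v, r v ≤ s v) : Valid p n r :=
  ⟨fun i => (hrs _).trans_lt (h.1 i), fun i => (hrs _).trans (h.2 i)⟩

/-- The structure constant of `x^{(r)} x^{(s)}`. -/
def mulCoeff (F : Type*) [Field F] {n : ℕ} (r s : Var n → ℕ) : F :=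
  (-1 : F) ^ signExp r s * ∏ v, ((Nat.choose (r v + s v) (r v) : ℕ) : F)

theorem mul_mon_mon (r s : Var n → ℕ) :
    mul F p n (mon F p r) (mon F p s) = mulCoeff F r s • mon F p (r + s) := by
  by_cases hr : Valid p n r
  · by_cases hs : Valid p n s
    · exact mul_mon F p hr hs
    · rw [mon_of_not_valid hs, map_zero, mon_of_not_valid, smul_zero]
      exact fun h => hs (h.mono fun v => Nat.le_add_left _ _)
  · rw [mon_of_not_valid hr, map_zero, LinearMap.zero_apply, mon_of_not_valid, smul_zero]
    exact fun h => hr (h.mono fun v => Nat.le_add_right _ _)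

theorem signExp_add_left (r s t : Var n → ℕ) :
    signExp (r + s) t = signExp r t + signExp s t := by
  simp only [signExp, ← Finset.sum_add_distrib]
  refine Finset.sum_congr rfl fun j _ => Finset.sum_congr rfl fun i _ => ?_
  split_ifs <;> simp [add_mul]

theorem signExp_add_right (r s t : Var n → ℕ) :
    signExp r (s + t) = signExp r s + signExp r t := by
  simp only [signExp, ← Finset.sum_add_distrib]
  refine Finset.sum_congr rfl fun j _ => Finset.sum_congr rfl fun i _ => ?_
  split_ifs <;> simp [mul_add]

theorem oddDeg_add (r s : Var n → ℕ) : oddDeg (r + s) = oddDeg r + oddDeg s := by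
  simp [oddDeg, Finset.sum_add_distrib]

theorem deg_add (r s : Var n → ℕ) : deg (r + s) = deg r + deg s := by
  simp [deg, Finset.sum_add_distrib]

theorem oddDeg_unit_inl (i : Fin n) : oddDeg (unit (Sum.inl i)) = 0 := by
  simp [oddDeg]

theorem oddDeg_unit_inr (i : Fin n) : oddDeg (unit (Sum.inr i)) = 1 := by
  simp [oddDeg, Pi.single_apply]

theorem deg_unit (v : Var n) : deg (unit v) = 1 := by
  simp only [deg, Pi.single_apply]; simp

theorem dSign_add (v : Var n) (r s : Var n → ℕ) : dSign v (r + s) = dSign v r + dSign v s := by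
  cases v with
  | inl i => rfl
  | inr i =>
    simp only [dSign, ← Finset.sum_add_distrib]
    refine Finset.sum_congr rfl fun j _ => ?_
    split_ifs <;> simp

theorem dSign_unit_inr (i : Fin n) : dSign (Sum.inr i) (unit (Sum.inr i)) = 0 := by
  refine Finset.sum_eq_zero fun j _ => ?_
  split_ifs with hj
  · simp [hj.ne]
  · rfl

theorem dSign_unit_inl (v : Var n) (i : Fin n) : dSign v (unit (Sum.inl i)) = 0 := by
  cases v <;> simp [dSign]

/-- The number of odd variables of `x^{(r)}` behind the `i`-th one. -/
def tailDeg (i : Fin n) (r : Var n → ℕ) : ℕ := ∑ j : Fin n, if i < j then r (Sum.inr j) else 0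

theorem signExp_unit_right (r : Var n → ℕ) (i : Fin n) :
    signExp r (unit (Sum.inr i)) = tailDeg i r := by
  rw [signExp, tailDeg]
  refine Finset.sum_congr rfl fun j _ => ?_
  rw [Finset.sum_eq_single i]
  · simp
  · intro l _ hl
    simp [hl]
  · simp

theorem signExp_unit_left (i : Fin n) (s : Var n → ℕ) :
    signExp (unit (Sum.inr i)) s = dSign (Sum.inr i) s := by
  rw [signExp, Finset.sum_eq_single i]
  · simp [dSign]
  · intro l _ hl
    exact Finset.sum_eq_zero fun j _ => by simp [hl]
  · simp

theorem signExp_unit_inl_left (i : Fin n) (s : Var n → ℕ) :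
    signExp (unit (Sum.inl i)) s = 0 := by simp [signExp]

theorem signExp_unit_inl_right (i : Fin n) (s : Var n → ℕ) :
    signExp s (unit (Sum.inl i)) = 0 := by simp [signExp]

theorem oddDeg_eq (i : Fin n) (r : Var n → ℕ) :
    oddDeg r = dSign (Sum.inr i) r + r (Sum.inr i) + tailDeg i r := by
  have h : r (Sum.inr i) = ∑ j, if j = i then r (Sum.inr j) else 0 := by simp
  rw [oddDeg, dSign, h, tailDeg, ← Finset.sum_add_distrib, ← Finset.sum_add_distrib]
  refine Finset.sum_congr rfl fun j _ => ?_
  rcases lt_trichotomy j i with hj | hj | hj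
  · simp [hj, hj.ne, hj.le.not_gt]
  · simp [hj]
  · simp [hj, hj.ne', hj.le.not_gt]

theorem signExp_comm (r s : Var n → ℕ) :
    signExp r s + signExp s r + ∑ i : Fin n, r (Sum.inr i) * s (Sum.inr i) =
      oddDeg r * oddDeg s := by
  have h : ∑ i : Fin n, r (Sum.inr i) * s (Sum.inr i) =
      ∑ j : Fin n, ∑ i : Fin n, if i = j then r (Sum.inr j) * s (Sum.inr i) else 0 := by simp
  have h2 : signExp s r = ∑ j : Fin n, ∑ i : Fin n,
      if j < i then r (Sum.inr j) * s (Sum.inr i) else 0 := by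
    rw [signExp, Finset.sum_comm]
    refine Finset.sum_congr rfl fun j _ => Finset.sum_congr rfl fun i _ => ?_
    rw [mul_comm]
  rw [h, h2, oddDeg, oddDeg, Finset.sum_mul_sum, signExp, ← Finset.sum_add_distrib,
    ← Finset.sum_add_distrib]
  refine Finset.sum_congr rfl fun j _ => ?_
  rw [← Finset.sum_add_distrib, ← Finset.sum_add_distrib]
  refine Finset.sum_congr rfl fun i _ => ?_
  rcases lt_trichotomy j i with hj | hj | hj
  · simp [hj, hj.ne', hj.le.not_gt]
  · simp [hj]
  · simp [hj, hj.ne, hj.le.not_gt]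

theorem mul_assoc' (f g h : O F p n) :
    mul F p n (mul F p n f g) h = mul F p n f (mul F p n g h) := by
  induction f using mon_induction with
  | zero => simp
  | add a b ha hb => simp [ha, hb]
  | smul c a ha => simp [ha]
  | mon r _ => ?_
  induction g using mon_induction with
  | zero => simp
  | add a b ha hb => simp [ha, hb]
  | smul c a ha => simp [ha]
  | mon s _ => ?_
  induction h using mon_induction with
  | zero => simp
  | add a b ha hb => simp [ha, hb]
  | smul c a ha => simp [ha]
  | mon t _ => ?_
  simp only [mul_mon_mon, map_smul, LinearMap.smul_apply, smul_smul, add_assoc]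
  congr 1
  simp only [mulCoeff, signExp_add_left, signExp_add_right, pow_add]
  have : (∏ v, ((Nat.choose (r v + s v) (r v) : ℕ) : F)) *
      ∏ v, ((Nat.choose ((r + s) v + t v) ((r + s) v) : ℕ) : F) =
      (∏ v, ((Nat.choose (s v + t v) (s v) : ℕ) : F)) *
      ∏ v, ((Nat.choose (r v + (s + t) v) (r v) : ℕ) : F) := by
    rw [← Finset.prod_mul_distrib, ← Finset.prod_mul_distrib]
    refine Finset.prod_congr rfl fun v _ => ?_
    have h := Nat.choose_mul (n := r v + s v + t v) (k := r v + s v) (s := r v)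
      (by omega)
    rw [show r v + s v + t v - r v = s v + t v by omega,
      show r v + s v - r v = s v by omega] at h
    simp only [Pi.add_apply]
    rw [show r v + (s v + t v) = r v + s v + t v by omega]
    rw [← Nat.cast_mul, ← Nat.cast_mul]
    congr 1
    rw [mul_comm, h, mul_comm]
  linear_combination ((-1 : F) ^ signExp r s * (-1 : F) ^ signExp r t *
    (-1 : F) ^ signExp s t) * this

theorem mul_comm_mon (r s : Var n → ℕ) :
    mul F p n (mon F p r) (mon F p s) =
      (-1 : F) ^ (oddDeg r * oddDeg s) • mul F p n (mon F p s) (mon F p r) := by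
  rw [mul_mon_mon, mul_mon_mon, add_comm s r]
  by_cases h : Valid p n (r + s)
  · rw [smul_smul]
    congr 1
    have h0 : ∑ i : Fin n, r (Sum.inr i) * s (Sum.inr i) = 0 := by
      refine Finset.sum_eq_zero fun i _ => ?_
      have := h.2 i
      simp only [Pi.add_apply] at this
      rcases Nat.eq_zero_or_pos (r (Sum.inr i)) with h1 | h1
      · simp [h1]
      · have : s (Sum.inr i) = 0 := by omega
        simp [this]
    have h1 := signExp_comm r s
    rw [h0, add_zero] at h1
    rw [← h1, mulCoeff, mulCoeff, pow_add]
    have h2 : ∀ v, Nat.choose (s v + r v) (s v) = Nat.choose (r v + s v) (r v) := fun v => by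
      rw [add_comm, Nat.choose_symm_add]
    simp only [h2]
    have h3 : (-1 : F) ^ signExp s r * (-1 : F) ^ signExp s r = 1 := by
      rw [← mul_pow]; simp
    linear_combination (-(-1 : F) ^ signExp r s *
      ∏ v, ((Nat.choose (r v + s v) (r v) : ℕ) : F)) * h3
  · simp [mon_of_not_valid h]

/-- `f` is homogeneous of parity `α` (modulo `2`). -/
def IsPar (α : ℕ) (f : O F p n) : Prop := sig F p n f = (-1 : F) ^ α • f

theorem isPar_mon (r : Var n → ℕ) : IsPar (oddDeg r) (mon F p r) := by
  by_cases h : Valid p n r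
  · exact sig_mon F p h
  · rw [mon_of_not_valid h, IsPar, map_zero, smul_zero]

theorem sig_mon' (r : Var n → ℕ) : sig F p n (mon F p r) = (-1 : F) ^ oddDeg r • mon F p r :=
  isPar_mon r

theorem sig_sq : sig F p n * sig F p n = 1 := by
  refine lin_ext fun r hr => ?_
  rw [Module.End.mul_apply, sig_mon', map_smul, sig_mon', smul_smul, ← mul_pow]
  simp

theorem sig_mul (f g : O F p n) :
    sig F p n (mul F p n f g) = mul F p n (sig F p n f) (sig F p n g) := by
  induction f using mon_induction with
  | zero => simp
  | add a b ha hb => simp [ha, hb]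
  | smul c a ha => simp [ha]
  | mon r _ => ?_
  induction g using mon_induction with
  | zero => simp
  | add a b ha hb => simp [ha, hb]
  | smul c a ha => simp [ha]
  | mon s _ => ?_
  simp only [sig_mon', mul_mon_mon, map_smul, LinearMap.smul_apply, smul_smul, oddDeg_add,
    pow_add]
  congr 1; ring

/-- Powers of the parity involution on a monomial. -/
theorem sig_pow_mon (k : ℕ) (r : Var n → ℕ) :
    (sig F p n ^ k) (mon F p r) = (-1 : F) ^ (k * oddDeg r) • mon F p r := by
  induction k with
  | zero => simp
  | succ k ih =>
    rw [pow_succ', Module.End.mul_apply, ih, map_smul, sig_mon', smul_smul, add_mul, pow_add,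
      one_mul]

/-- Supercommutativity of `O(n)`. -/
theorem IsPar.mul_comm {α : ℕ} {f : O F p n} (hf : IsPar α f) (g : O F p n) :
    mul F p n f g = mul F p n ((sig F p n ^ α) g) f := by
  have key : ∀ r, mul F p n f (mon F p r) =
      (-1 : F) ^ (α * oddDeg r) • mul F p n (mon F p r) f := by
    intro r
    have hrf : ∀ f : O F p n, mul F p n f (mon F p r) =
        mul F p n (mon F p r) ((sig F p n ^ oddDeg r) f) := by
      intro f
      induction f using mon_induction with
      | zero => simp
      | add a b ha hb => simp [ha, hb]
      | smul c a ha => simp [ha]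
      | mon s _ => ?_
      rw [sig_pow_mon, map_smul, mul_comm_mon, _root_.mul_comm (oddDeg r)]
    rw [hrf]
    have : ∀ k, (sig F p n ^ k) f = (-1 : F) ^ (α * k) • f := by
      intro k
      induction k with
      | zero => simp
      | succ k ih =>
        rw [pow_succ', Module.End.mul_apply, ih, map_smul, hf, smul_smul, ← pow_add]
        rfl
    rw [this, map_smul]
  induction g using mon_induction with
  | zero => simp
  | add a b ha hb => simp [ha, hb]
  | smul c a ha => simp [ha]
  | mon r _ => ?_
  rw [key, sig_pow_mon, map_smul, LinearMap.smul_apply]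

end Superalgebra

/-! ### Partial derivatives -/

section Derivatives

variable {F : Type*} [Field F] {p n : ℕ}

theorem pd_mon_of_eq_zero {v : Var n} {r : Var n → ℕ} (h : r v = 0) :
    pd F p v (mon F p r) = 0 := by
  by_cases hr : Valid p n r
  · rw [pd_mon F p v hr, if_pos h]
  · rw [mon_of_not_valid hr, map_zero]

theorem pd_mon_add_unit {v : Var n} {r : Var n → ℕ} (h : Valid p n (r + unit v)) :
    pd F p v (mon F p (r + unit v)) = (-1 : F) ^ dSign v r • mon F p r := by
  rw [pd_mon F p v h, if_neg (by simp), add_tsub_cancel_right, dSign_add]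
  cases v with
  | inl i => simp [dSign]
  | inr i => rw [dSign_unit_inr, add_zero]

theorem eq_add_unit {v : Var n} {r : Var n → ℕ} (h : r v ≠ 0) : ∃ s, r = s + unit v := by
  refine ⟨r - unit v, funext fun w => ?_⟩
  by_cases hw : w = v
  · subst hw; simp; omega
  · simp [hw]

theorem pd_mon_inl {i : Fin n} {r : Var n → ℕ} (h : Valid p n (r + unit (Sum.inl i))) :
    pd F p (Sum.inl i) (mon F p (r + unit (Sum.inl i))) = mon F p r := by
  rw [pd_mon_add_unit h]; simp [dSign]

theorem sig_pd_inl (i : Fin n) (f : O F p n) :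
    sig F p n (pd F p (Sum.inl i) f) = pd F p (Sum.inl i) (sig F p n f) := by
  induction f using mon_induction with
  | zero => simp
  | add a b ha hb => simp [ha, hb]
  | smul c a ha => simp [ha]
  | mon r hr =>
    rw [sig_mon', map_smul]
    by_cases h : r (Sum.inl i) = 0
    · rw [pd_mon_of_eq_zero h]; simp
    · obtain ⟨s, rfl⟩ := eq_add_unit h
      rw [pd_mon_inl hr, sig_mon', oddDeg_add, oddDeg_unit_inl, add_zero]

theorem sig_pd_inr (i : Fin n) (f : O F p n) :
    sig F p n (pd F p (Sum.inr i) f) = -pd F p (Sum.inr i) (sig F p n f) := by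
  induction f using mon_induction with
  | zero => simp
  | add a b ha hb => simp [ha, hb]; abel
  | smul c a ha => simp [ha]
  | mon r hr =>
    rw [sig_mon', map_smul]
    by_cases h : r (Sum.inr i) = 0
    · rw [pd_mon_of_eq_zero h]; simp
    · obtain ⟨s, rfl⟩ := eq_add_unit h
      rw [pd_mon_add_unit hr, map_smul, sig_mon', oddDeg_add, oddDeg_unit_inr, pow_succ,
        smul_smul, smul_smul, ← neg_smul]
      congr 1; ring

theorem pd_comm_aux (i j : Fin n) (f : O F p n) :
    pd F p (Sum.inl i) (pd F p (Sum.inl j) f) = pd F p (Sum.inl j) (pd F p (Sum.inl i) f) := by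
  by_cases hij : i = j
  · rw [hij]
  induction f using mon_induction with
  | zero => simp
  | add a b ha hb => simp [ha, hb]
  | smul c a ha => simp [ha]
  | mon r hr =>
    by_cases h : r (Sum.inl i) = 0
    · rw [pd_mon_of_eq_zero h, map_zero, pd_mon F p _ hr]
      split_ifs with h2
      · simp
      · rw [map_smul, pd_mon_of_eq_zero, smul_zero]
        simp [h]
    · obtain ⟨s, rfl⟩ := eq_add_unit h
      rw [pd_mon_inl hr]
      by_cases h' : s (Sum.inl j) = 0
      · rw [pd_mon_of_eq_zero h', pd_mon_of_eq_zero (by simp [h', Ne.symm hij]), map_zero]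
      · obtain ⟨t, rfl⟩ := eq_add_unit h'
        have h1 : Valid p n (t + unit (Sum.inl i) + unit (Sum.inl j)) := by
          rwa [add_right_comm]
        rw [add_right_comm, pd_mon_inl h1, pd_mon_inl (h1.mono fun v => by simp),
          pd_mon_inl (hr.mono fun v => by simp)]

theorem pd_comm_inl_inr (i j : Fin n) (f : O F p n) :
    pd F p (Sum.inl i) (pd F p (Sum.inr j) f) = pd F p (Sum.inr j) (pd F p (Sum.inl i) f) := by
  induction f using mon_induction with
  | zero => simp
  | add a b ha hb => simp [ha, hb]
  | smul c a ha => simp [ha]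
  | mon r hr =>
    by_cases h : r (Sum.inl i) = 0
    · rw [pd_mon_of_eq_zero h, map_zero, pd_mon F p _ hr]
      split_ifs with h2
      · simp
      · rw [map_smul, pd_mon_of_eq_zero, smul_zero]
        simp [h]
    · obtain ⟨s, rfl⟩ := eq_add_unit h
      rw [pd_mon_inl hr]
      by_cases h' : s (Sum.inr j) = 0
      · rw [pd_mon_of_eq_zero h', pd_mon_of_eq_zero (by simp [h']), map_zero]
      · obtain ⟨t, rfl⟩ := eq_add_unit h'
        have h1 : Valid p n (t + unit (Sum.inl i) + unit (Sum.inr j)) := by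
          rwa [add_right_comm]
        rw [add_right_comm, pd_mon_add_unit h1, map_smul, pd_mon_inl (h1.mono fun v => by simp),
          pd_mon_add_unit (hr.mono fun v => by simp), dSign_add, dSign_unit_inl, add_zero]

theorem dSign_unit_inr_of_ne {i j : Fin n} (hij : i ≠ j) :
    dSign (Sum.inr i) (unit (Sum.inr j)) + dSign (Sum.inr j) (unit (Sum.inr i)) = 1 := by
  have h : ∀ i j : Fin n, dSign (Sum.inr i) (unit (Sum.inr j)) = if j < i then 1 else 0 := by
    intro i j
    rw [dSign, Finset.sum_eq_single j]
    · simp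
    · intro l _ hl; simp [hl]
    · simp
  rw [h, h]
  rcases lt_or_gt_of_ne hij with h1 | h1
  · rw [if_neg h1.le.not_gt, if_pos h1]
  · rw [if_neg h1.le.not_gt, if_pos h1]

theorem pd_anticomm_inr (i j : Fin n) (f : O F p n) :
    pd F p (Sum.inr i) (pd F p (Sum.inr j) f) = -pd F p (Sum.inr j) (pd F p (Sum.inr i) f) := by
  induction f using mon_induction with
  | zero => simp
  | add a b ha hb => simp [ha, hb]; abel
  | smul c a ha => simp [ha]
  | mon r hr =>
    by_cases h : r (Sum.inr i) = 0
    · rw [pd_mon_of_eq_zero h, map_zero, neg_zero, pd_mon F p _ hr]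
      split_ifs with h2
      · simp
      · rw [map_smul, pd_mon_of_eq_zero, smul_zero]
        simp [h]
    · obtain ⟨s, rfl⟩ := eq_add_unit h
      rw [pd_mon_add_unit hr, map_smul]
      by_cases hij : i = j
      · subst hij
        have : s (Sum.inr i) = 0 := by
          have := hr.2 i
          simp at this; exact this
        rw [pd_mon_add_unit hr, map_smul, pd_mon_of_eq_zero this]; simp
      by_cases h' : s (Sum.inr j) = 0
      · rw [pd_mon_of_eq_zero h', pd_mon_of_eq_zero (by simp [h', Ne.symm hij])]; simp
      · obtain ⟨t, rfl⟩ := eq_add_unit h'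
        have h1 : Valid p n (t + unit (Sum.inr i) + unit (Sum.inr j)) := by
          rwa [add_right_comm]
        rw [add_right_comm, pd_mon_add_unit h1, map_smul,
          pd_mon_add_unit (h1.mono fun v => by simp),
          pd_mon_add_unit (hr.mono fun v => by simp), dSign_add, dSign_add, smul_smul, smul_smul,
          ← neg_smul]
        congr 1
        have h3 := dSign_unit_inr_of_ne hij
        have h4 : (-1 : F) ^ dSign (Sum.inr j) (unit (Sum.inr i)) =
            -(-1 : F) ^ dSign (Sum.inr i) (unit (Sum.inr j)) := by
          have : dSign (Sum.inr i) (unit (Sum.inr j)) = 0 ∧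
              dSign (Sum.inr j) (unit (Sum.inr i)) = 1 ∨
              dSign (Sum.inr i) (unit (Sum.inr j)) = 1 ∧
              dSign (Sum.inr j) (unit (Sum.inr i)) = 0 := by omega
          rcases this with ⟨h5, h6⟩ | ⟨h5, h6⟩ <;> simp [h5, h6]
        rw [pow_add, pow_add, h4]; ring

theorem mulCoeff_eq (v : Var n) (r s : Var n → ℕ) : mulCoeff F r s = (-1 : F) ^ signExp r s *
    (((Nat.choose (r v + s v) (r v) : ℕ) : F) *
      ∏ w ∈ Finset.univ.erase v, ((Nat.choose (r w + s w) (r w) : ℕ) : F)) := by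
  rw [mulCoeff, Finset.mul_prod_erase _ (fun w => ((Nat.choose (r w + s w) (r w) : ℕ) : F))
    (Finset.mem_univ v)]

theorem prod_erase_add_unit_left (v : Var n) (r s : Var n → ℕ) :
    ∏ w ∈ Finset.univ.erase v, ((Nat.choose ((r + unit v) w + s w) ((r + unit v) w) : ℕ) : F) =
      ∏ w ∈ Finset.univ.erase v, ((Nat.choose (r w + s w) (r w) : ℕ) : F) := by
  refine Finset.prod_congr rfl fun w hw => ?_
  simp [(Finset.mem_erase.1 hw).1]

theorem prod_erase_add_unit_right (v : Var n) (r s : Var n → ℕ) :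
    ∏ w ∈ Finset.univ.erase v, ((Nat.choose (r w + (s + unit v) w) (r w) : ℕ) : F) =
      ∏ w ∈ Finset.univ.erase v, ((Nat.choose (r w + s w) (r w) : ℕ) : F) := by
  refine Finset.prod_congr rfl fun w hw => ?_
  simp [(Finset.mem_erase.1 hw).1]

/-- Pascal's rule, in terms of the structure constants of `O(n)`. -/
theorem mulCoeff_pascal (i : Fin n) (r s : Var n → ℕ) :
    mulCoeff F (r + unit (Sum.inl i)) (s + unit (Sum.inl i)) =
      mulCoeff F r (s + unit (Sum.inl i)) + mulCoeff F (r + unit (Sum.inl i)) s := by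
  simp only [mulCoeff_eq (Sum.inl i), prod_erase_add_unit_left, prod_erase_add_unit_right,
    signExp_add_left, signExp_add_right, signExp_unit_inl_left, signExp_unit_inl_right, add_zero]
  have h : Nat.choose ((r + unit (Sum.inl i)) (Sum.inl i) + (s + unit (Sum.inl i)) (Sum.inl i))
      ((r + unit (Sum.inl i)) (Sum.inl i)) =
      Nat.choose (r (Sum.inl i) + (s + unit (Sum.inl i)) (Sum.inl i)) (r (Sum.inl i)) +
      Nat.choose ((r + unit (Sum.inl i)) (Sum.inl i) + s (Sum.inl i))
        ((r + unit (Sum.inl i)) (Sum.inl i)) := by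
    simp only [Pi.add_apply, Pi.single_eq_same]
    rw [show r (Sum.inl i) + 1 + (s (Sum.inl i) + 1) = (r (Sum.inl i) + s (Sum.inl i) + 1) + 1
      by ring, Nat.choose_succ_succ]
    congr 2; ring
  rw [h]; push_cast; ring

theorem mulCoeff_add_unit_inl_left {i : Fin n} {r s : Var n → ℕ} (hs : s (Sum.inl i) = 0) :
    mulCoeff F (r + unit (Sum.inl i)) s = mulCoeff F r s := by
  simp only [mulCoeff_eq (Sum.inl i), prod_erase_add_unit_left, signExp_add_left,
    signExp_unit_inl_left, hs, add_zero, Nat.choose_self]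

theorem mulCoeff_add_unit_inl_right {i : Fin n} {r s : Var n → ℕ} (hr : r (Sum.inl i) = 0) :
    mulCoeff F r (s + unit (Sum.inl i)) = mulCoeff F r s := by
  simp only [mulCoeff_eq (Sum.inl i), prod_erase_add_unit_right, signExp_add_right,
    signExp_unit_inl_right, hr, add_zero, Nat.choose_zero_right]

/-- The even partial derivatives are derivations. -/
theorem pd_inl_mul [hp : Fact p.Prime] [CharP F p] (i : Fin n) (f g : O F p n) :
    pd F p (Sum.inl i) (mul F p n f g) =
      mul F p n (pd F p (Sum.inl i) f) g + mul F p n f (pd F p (Sum.inl i) g) := by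
  induction f using mon_induction with
  | zero => simp
  | add a b ha hb => simp [ha, hb]; abel
  | smul c a ha => simp [ha]
  | mon r hr => ?_
  induction g using mon_induction with
  | zero => simp
  | add a b ha hb => simp [ha, hb]; abel
  | smul c a ha => simp [ha]
  | mon s hs => ?_
  rw [mul_mon_mon, map_smul]
  by_cases h1 : r (Sum.inl i) = 0
  · rw [pd_mon_of_eq_zero h1, map_zero, LinearMap.zero_apply, zero_add]
    by_cases h2 : s (Sum.inl i) = 0
    · rw [pd_mon_of_eq_zero h2, map_zero, pd_mon_of_eq_zero (by simp [h1, h2]), smul_zero]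
    · obtain ⟨t, rfl⟩ := eq_add_unit h2
      rw [pd_mon_inl hs, mul_mon_mon, ← add_assoc, mulCoeff_add_unit_inl_right h1]
      by_cases hv : Valid p n (r + t + unit (Sum.inl i))
      · rw [pd_mon_inl hv]
      · rw [mon_of_not_valid hv, map_zero, smul_zero, mon_of_not_valid, smul_zero]
        refine fun h => hv ⟨fun j => ?_, fun j => ?_⟩
        · by_cases hj : j = i
          · subst hj; have := hs.1 j; simpa [h1] using this
          · simpa [hj] using h.1 j
        · simpa using h.2 j
  · obtain ⟨t, rfl⟩ := eq_add_unit h1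
    rw [pd_mon_inl hr, mul_mon_mon]
    by_cases h2 : s (Sum.inl i) = 0
    · rw [pd_mon_of_eq_zero h2, map_zero, add_zero, add_right_comm, mulCoeff_add_unit_inl_left h2]
      by_cases hv : Valid p n (t + s + unit (Sum.inl i))
      · rw [pd_mon_inl hv]
      · rw [mon_of_not_valid hv, map_zero, smul_zero, mon_of_not_valid, smul_zero]
        refine fun h => hv ⟨fun j => ?_, fun j => ?_⟩
        · by_cases hj : j = i
          · subst hj; have := hr.1 j; simpa [h2] using this
          · simpa [hj] using h.1 j
        · simpa using h.2 j
    · obtain ⟨u, rfl⟩ := eq_add_unit h2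
      rw [pd_mon_inl hs, mul_mon_mon, show t + unit (Sum.inl i) + u = t + (u + unit (Sum.inl i))
        by abel, ← add_smul, ← mulCoeff_pascal, show t + unit (Sum.inl i) + (u + unit (Sum.inl i))
        = t + (u + unit (Sum.inl i)) + unit (Sum.inl i) by abel]
      by_cases hv : Valid p n (t + (u + unit (Sum.inl i)) + unit (Sum.inl i))
      · rw [pd_mon_inl hv]
      · rw [mon_of_not_valid hv, map_zero, smul_zero]
        by_cases h : Valid p n (t + (u + unit (Sum.inl i)))
        · -- the exponent of `x_i` in the product is `p`, and `binom(p, k) = 0` in `F`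
          have he : t (Sum.inl i) + u (Sum.inl i) + 2 = p := by
            have ha := h.1 i
            simp only [Pi.add_apply, Pi.single_eq_same] at ha
            by_contra hne
            refine hv ⟨fun j => ?_, fun j => ?_⟩
            · by_cases hj : j = i
              · subst hj; simp only [Pi.add_apply, Pi.single_eq_same]; omega
              · simpa [hj] using h.1 j
            · simpa using h.2 j
          have hc : ((Nat.choose ((t + unit (Sum.inl i)) (Sum.inl i) +
              (u + unit (Sum.inl i)) (Sum.inl i)) ((t + unit (Sum.inl i)) (Sum.inl i)) : ℕ) : F)
              = 0 := by
            simp only [Pi.add_apply, Pi.single_eq_same]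
            rw [show t (Sum.inl i) + 1 + (u (Sum.inl i) + 1) = p by omega,
              CharP.cast_eq_zero_iff F p]
            exact hp.out.dvd_choose_self (by omega) (by omega)
          rw [mulCoeff_eq (Sum.inl i), hc]
          simp
        · rw [mon_of_not_valid h, smul_zero]

/-- The odd partial derivatives are superderivations. -/
theorem pd_inr_mul (i : Fin n) (f g : O F p n) : pd F p (Sum.inr i) (mul F p n f g) =
    mul F p n (pd F p (Sum.inr i) f) g + mul F p n (sig F p n f) (pd F p (Sum.inr i) g) := by
  induction f using mon_induction with
  | zero => simp
  | add a b ha hb => simp [ha, hb]; abel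
  | smul c a ha => simp [ha]
  | mon r hr => ?_
  induction g using mon_induction with
  | zero => simp
  | add a b ha hb => simp [ha, hb]; abel
  | smul c a ha => simp [ha]
  | mon s hs => ?_
  have hvalid : ∀ t : Var n → ℕ, t (Sum.inr i) = 0 → Valid p n t →
      Valid p n (t + unit (Sum.inr i)) := fun t ht h => by
    refine ⟨fun j => by simpa using h.1 j, fun j => ?_⟩
    by_cases hj : j = i
    · subst hj; simp [ht]
    · simpa [hj] using h.2 j
  have hsq : ∀ k : ℕ, (-1 : F) ^ k * (-1 : F) ^ k = 1 := fun k => by rw [← mul_pow]; simp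
  rw [mul_mon_mon, map_smul, sig_mon', map_smul, LinearMap.smul_apply]
  by_cases h1 : r (Sum.inr i) = 0
  · rw [pd_mon_of_eq_zero h1, map_zero, LinearMap.zero_apply, zero_add]
    by_cases h2 : s (Sum.inr i) = 0
    · rw [pd_mon_of_eq_zero h2, map_zero, pd_mon_of_eq_zero (by simp [h1, h2]), smul_zero,
        smul_zero]
    · obtain ⟨t, rfl⟩ := eq_add_unit h2
      have ht : t (Sum.inr i) = 0 := by have := hs.2 i; simp at this; exact this
      have hc : mulCoeff F r (t + unit (Sum.inr i)) =
          (-1 : F) ^ tailDeg i r * mulCoeff F r t := by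
        simp only [mulCoeff_eq (Sum.inr i), prod_erase_add_unit_right, signExp_add_right,
          signExp_unit_right, pow_add, h1, Nat.choose_zero_right]
        ring
      rw [pd_mon_add_unit hs, map_smul, mul_mon_mon, ← add_assoc, hc]
      by_cases hv : Valid p n (r + t)
      · rw [pd_mon_add_unit (hvalid _ (by simp [h1, ht]) hv), smul_smul, smul_smul, smul_smul,
          oddDeg_eq i r, h1, dSign_add]
        congr 1
        simp only [pow_add, pow_zero]
        ring
      · rw [mon_of_not_valid hv, mon_of_not_valid fun h => hv (h.mono fun v => by simp)]
        simp
  · obtain ⟨t, rfl⟩ := eq_add_unit h1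
    have ht : t (Sum.inr i) = 0 := by have := hr.2 i; simp at this; exact this
    rw [pd_mon_add_unit hr, map_smul, LinearMap.smul_apply, mul_mon_mon]
    by_cases h2 : s (Sum.inr i) = 0
    · have hc : mulCoeff F (t + unit (Sum.inr i)) s =
          (-1 : F) ^ dSign (Sum.inr i) s * mulCoeff F t s := by
        simp only [mulCoeff_eq (Sum.inr i), prod_erase_add_unit_left, signExp_add_left,
          signExp_unit_left, pow_add, h2, add_zero, Nat.choose_self]
        ring
      rw [pd_mon_of_eq_zero h2, map_zero, smul_zero, add_zero, add_right_comm, hc]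
      by_cases hv : Valid p n (t + s)
      · rw [pd_mon_add_unit (hvalid _ (by simp [h2, ht]) hv), smul_smul, smul_smul, dSign_add]
        congr 1
        rw [pow_add]
        linear_combination (mulCoeff F t s * (-1 : F) ^ dSign (Sum.inr i) t) *
          hsq (dSign (Sum.inr i) s)
      · rw [mon_of_not_valid hv, mon_of_not_valid fun h => hv (h.mono fun v => by simp)]
        simp
    · obtain ⟨u, rfl⟩ := eq_add_unit h2
      have hu : u (Sum.inr i) = 0 := by have := hs.2 i; simp at this; exact this
      have hc1 : mulCoeff F t (u + unit (Sum.inr i)) =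
          (-1 : F) ^ tailDeg i t * mulCoeff F t u := by
        simp only [mulCoeff_eq (Sum.inr i), prod_erase_add_unit_right, signExp_add_right,
          signExp_unit_right, pow_add, ht, Nat.choose_zero_right]
        ring
      have hc2 : mulCoeff F (t + unit (Sum.inr i)) u =
          (-1 : F) ^ dSign (Sum.inr i) u * mulCoeff F t u := by
        simp only [mulCoeff_eq (Sum.inr i), prod_erase_add_unit_left, signExp_add_left,
          signExp_unit_left, pow_add, hu, add_zero, Nat.choose_self]
        ring
      rw [pd_mon_add_unit hs, map_smul, mul_mon_mon, hc1, hc2, mon_of_not_valid (r :=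
        t + unit (Sum.inr i) + (u + unit (Sum.inr i))), map_zero, smul_zero,
        show t + unit (Sum.inr i) + u = t + (u + unit (Sum.inr i)) by abel, smul_smul, smul_smul,
        smul_smul, ← add_smul]
      · rw [eq_comm, oddDeg_add, oddDeg_unit_inr, oddDeg_eq i t, ht]
        convert zero_smul F _
        simp only [pow_add, pow_zero, pow_one]
        linear_combination (-(-1 : F) ^ dSign (Sum.inr i) t * (-1 : F) ^ tailDeg i t *
          mulCoeff F t u) * hsq (dSign (Sum.inr i) u)
      · intro h
        have := h.2 i
        simp at this
        omega

end Derivatives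

/-! ### Superderivations and the odd Poisson bracket -/

section Bracket

variable {F : Type*} [Field F] {p n : ℕ}

theorem valid_zero [hp : Fact p.Prime] : Valid p n 0 :=
  ⟨fun _ => hp.out.pos, fun _ => Nat.zero_le _⟩

theorem mul_mon_zero [Fact p.Prime] (f : O F p n) : mul F p n f (mon F p 0) = f := by
  induction f using mon_induction with
  | zero => simp
  | add a b ha hb => simp [ha, hb]
  | smul c a ha => simp [ha]
  | mon r hr => rw [mul_mon_mon]; simp [mulCoeff, signExp]

theorem mul_zero_mon [Fact p.Prime] : mul F p n (mon F p 0) = 1 := by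
  refine lin_ext fun r hr => ?_
  rw [mul_mon_mon]; simp [mulCoeff, signExp]

theorem IsPar.pd_inl {α : ℕ} {f : O F p n} (hf : IsPar α f) (i : Fin n) :
    IsPar α (pd F p (Sum.inl i) f) := by
  rw [IsPar, sig_pd_inl, hf, map_smul]

theorem IsPar.pd_inr {α : ℕ} {f : O F p n} (hf : IsPar α f) (i : Fin n) :
    IsPar (α + 1) (pd F p (Sum.inr i) f) := by
  rw [IsPar, sig_pd_inr, hf, map_smul, pow_succ, mul_neg_one, neg_smul]

theorem IsPar.mul {α β : ℕ} {f g : O F p n} (hf : IsPar α f) (hg : IsPar β g) :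
    IsPar (α + β) (mul F p n f g) := by
  rw [IsPar, sig_mul, hf, hg, map_smul, map_smul, LinearMap.smul_apply, smul_smul, pow_add,
    _root_.mul_comm]

theorem IsPar.sum {ι : Type*} {s : Finset ι} {α : ℕ} {f : ι → O F p n}
    (h : ∀ i ∈ s, IsPar α (f i)) : IsPar α (∑ i ∈ s, f i) := by
  rw [IsPar, map_sum, Finset.smul_sum]
  exact Finset.sum_congr rfl h

theorem IsPar.add {α : ℕ} {f g : O F p n} (hf : IsPar α f) (hg : IsPar α g) :
    IsPar α (f + g) := by rw [IsPar, map_add, hf, hg, smul_add]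

theorem IsPar.smul {α : ℕ} {f : O F p n} (hf : IsPar α f) (c : F) : IsPar α (c • f) := by
  rw [IsPar, map_smul, hf, smul_comm]

theorem IsPar.congr {α β : ℕ} {f : O F p n} (hf : IsPar α f)
    (h : (-1 : F) ^ α = (-1 : F) ^ β) : IsPar β f := by rw [IsPar, hf, h]

theorem IsPar.sig_pow {α : ℕ} {f : O F p n} (hf : IsPar α f) (k : ℕ) :
    (sig F p n ^ k) f = (-1 : F) ^ (k * α) • f := by
  induction k with
  | zero => simp
  | succ k ih =>
    rw [pow_succ', Module.End.mul_apply, ih, map_smul, hf, smul_smul, ← pow_add]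
    congr 2; ring

theorem De_apply {α : ℕ} {f : O F p n} (hf : IsPar α f) (g : O F p n) : De F p n f g =
    ∑ i : Fin n, (mul F p n (pd F p (Sum.inl i) f) (pd F p (Sum.inr i) g) +
      (-1 : F) ^ α • mul F p n (pd F p (Sum.inr i) f) (pd F p (Sum.inl i) g)) := by
  change (∑ i : Fin n, _ : Module.End F (O F p n)) g = _
  rw [LinearMap.sum_apply]
  refine Finset.sum_congr rfl fun i _ => ?_
  rw [hf, map_smul, map_smul]
  rfl

theorem IsPar.De {α β : ℕ} {f g : O F p n} (hf : IsPar α f) (hg : IsPar β g) :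
    IsPar (α + β + 1) (De F p n f g) := by
  rw [De_apply hf]
  refine IsPar.sum fun i _ => IsPar.add ?_ (IsPar.smul ?_ _)
  · exact (hf.pd_inl i).mul (hg.pd_inr i)
  · exact ((hf.pd_inr i).mul (hg.pd_inl i)).congr (by ring)

/-- The operator `D` is a superderivation of parity `d` (modulo `2`). -/
def SDer (d : ℕ) (D : Module.End F (O F p n)) : Prop :=
  ∀ f g, D (mul F p n f g) = mul F p n (D f) g + mul F p n ((sig F p n ^ d) f) (D g)

theorem sig_De {α : ℕ} {f : O F p n} (hf : IsPar α f) (g : O F p n) :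
    sig F p n (De F p n f g) = (-1 : F) ^ (α + 1) • De F p n f (sig F p n g) := by
  rw [De_apply hf, De_apply hf, map_sum, Finset.smul_sum]
  refine Finset.sum_congr rfl fun i _ => ?_
  rw [map_add, map_smul, sig_mul, sig_mul, sig_pd_inl, sig_pd_inl, sig_pd_inr, sig_pd_inr, hf]
  simp only [map_smul, map_neg, LinearMap.smul_apply, LinearMap.neg_apply, pow_succ]
  module

theorem sig_pow_De {α : ℕ} {f : O F p n} (hf : IsPar α f) (d : ℕ) (g : O F p n) :
    (sig F p n ^ d) (De F p n f g) = (-1 : F) ^ (d * (α + 1)) •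
      De F p n f ((sig F p n ^ d) g) := by
  induction d with
  | zero => simp
  | succ d ih =>
    rw [pow_succ', Module.End.mul_apply, ih, map_smul, sig_De hf, smul_smul, ← pow_add,
      Module.End.mul_apply]
    congr 2; ring

/-- The commutator formulas for `De_f` and the partial derivatives. -/
theorem pd_inl_De [Fact p.Prime] [CharP F p] {α : ℕ} {f : O F p n} (hf : IsPar α f) (j : Fin n)
    (g : O F p n) : pd F p (Sum.inl j) (De F p n f g) =
      De F p n (pd F p (Sum.inl j) f) g + De F p n f (pd F p (Sum.inl j) g) := by
  rw [De_apply hf, De_apply hf, De_apply (hf.pd_inl j), map_sum, ← Finset.sum_add_distrib]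
  refine Finset.sum_congr rfl fun i _ => ?_
  rw [map_add, map_smul, pd_inl_mul, pd_inl_mul, pd_comm_aux j i, pd_comm_aux j i,
    pd_comm_inl_inr, pd_comm_inl_inr]
  module

theorem pd_inr_De {α : ℕ} {f : O F p n} (hf : IsPar α f) (j : Fin n)
    (g : O F p n) : pd F p (Sum.inr j) (De F p n f g) =
      De F p n (pd F p (Sum.inr j) f) g -
        (-1 : F) ^ α • De F p n f (pd F p (Sum.inr j) g) := by
  rw [De_apply hf, De_apply hf, De_apply (hf.pd_inr j), map_sum, Finset.smul_sum,
    ← Finset.sum_sub_distrib]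
  refine Finset.sum_congr rfl fun i _ => ?_
  have h1 : (-1 : F) ^ α * (-1 : F) ^ α = 1 := by rw [← mul_pow]; simp
  rw [map_add, map_smul, pd_inr_mul, pd_inr_mul, hf.pd_inl i, hf.pd_inr i, pd_anticomm_inr j i g,
    pd_anticomm_inr j i f, ← pd_comm_inl_inr i j f, ← pd_comm_inl_inr i j g]
  simp only [map_smul, map_neg, LinearMap.smul_apply, LinearMap.neg_apply, pow_succ]
  module

theorem SDer.De [Fact p.Prime] [CharP F p] {α : ℕ} {f : O F p n} (hf : IsPar α f) :
    SDer (α + 1) (De F p n f) := by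
  intro a g
  rw [De_apply hf, De_apply hf, De_apply hf, map_sum, map_sum, LinearMap.sum_apply,
    ← Finset.sum_add_distrib]
  refine Finset.sum_congr rfl fun i _ => ?_
  have h1 : mul F p n (pd F p (Sum.inl i) f) (mul F p n (sig F p n a) (pd F p (Sum.inr i) g)) =
      mul F p n ((sig F p n ^ (α + 1)) a)
        (mul F p n (pd F p (Sum.inl i) f) (pd F p (Sum.inr i) g)) := by
    rw [← mul_assoc', (hf.pd_inl i).mul_comm, mul_assoc', pow_succ, Module.End.mul_apply]
  have h2 : mul F p n (pd F p (Sum.inr i) f) (mul F p n a (pd F p (Sum.inl i) g)) =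
      mul F p n ((sig F p n ^ (α + 1)) a)
        (mul F p n (pd F p (Sum.inr i) f) (pd F p (Sum.inl i) g)) := by
    rw [← mul_assoc', (hf.pd_inr i).mul_comm, mul_assoc']
  rw [pd_inl_mul, pd_inr_mul]
  simp only [map_add, map_smul, LinearMap.add_apply, LinearMap.smul_apply, h1, h2, mul_assoc']
  module

theorem sig_pow_mon_zero [Fact p.Prime] (d : ℕ) : (sig F p n ^ d) (mon F p 0) = mon F p 0 := by
  rw [sig_pow_mon]; simp [oddDeg]

theorem SDer.apply_mon_zero [Fact p.Prime] {d : ℕ} {D : Module.End F (O F p n)} (hD : SDer d D) :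
    D (mon F p 0) = 0 := by
  have h := hD (mon F p 0) (mon F p 0)
  rw [sig_pow_mon_zero, mul_mon_zero, mul_mon_zero, mul_zero_mon, Module.End.one_apply] at h
  exact left_eq_add.1 h

theorem mul_unit_mon [hp : Fact p.Prime] [CharP F p] {v : Var n} {s : Var n → ℕ}
    (h : Valid p n (s + unit v)) :
    ∃ c : F, c ≠ 0 ∧ mul F p n (mon F p (unit v)) (mon F p s) = c • mon F p (s + unit v) := by
  refine ⟨mulCoeff F (unit v) s, ?_, by rw [mul_mon_mon, add_comm]⟩
  have h1 : ∏ w, ((Nat.choose (unit v w + s w) (unit v w) : ℕ) : F) = ((s v + 1 : ℕ) : F) := by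
    rw [Finset.prod_eq_single v]
    · simp [add_comm]
    · intro w _ hw; simp [hw]
    · simp
  rw [mulCoeff, h1]
  refine mul_ne_zero (pow_ne_zero _ (by simp)) ?_
  rw [Ne, CharP.cast_eq_zero_iff F p]
  refine Nat.not_dvd_of_pos_of_lt (by omega) ?_
  cases v with
  | inl i => have := h.1 i; simpa using this
  | inr i => have := h.2 i; have := hp.out.two_le; simp at *; omega

/-- An induction principle: a subspace of `O(n)` that contains `1` and is closed under
multiplication by the variables is everything. -/
theorem mem_of_unit_mul_mem [Fact p.Prime] [CharP F p] {K : Submodule F (O F p n)}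
    (h0 : mon F p 0 ∈ K) (h1 : ∀ v, ∀ f ∈ K, mul F p n (mon F p (unit v)) f ∈ K) (f : O F p n) :
    f ∈ K := by
  induction f using mon_induction with
  | zero => exact K.zero_mem
  | add a b ha hb => exact K.add_mem ha hb
  | smul c a ha => exact K.smul_mem c ha
  | mon r hr =>
    have key : ∀ d, ∀ r : Var n → ℕ, deg r = d → Valid p n r → mon F p r ∈ K := by
      intro d
      induction d with
      | zero =>
        intro r hd _
        have : r = 0 := funext fun v => (Finset.sum_eq_zero_iff.1 hd) v (Finset.mem_univ v)
        rw [this]; exact h0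
      | succ d ih =>
        intro r hd hr
        obtain ⟨v, hv⟩ : ∃ v, r v ≠ 0 := by
          by_contra hcon
          push Not at hcon
          rw [deg, Finset.sum_eq_zero fun v _ => hcon v] at hd
          omega
        obtain ⟨s, rfl⟩ := eq_add_unit hv
        obtain ⟨c, hc, he⟩ := mul_unit_mon (F := F) hr
        rw [deg_add, deg_unit] at hd
        have := h1 v _ (ih s (by omega) (hr.mono fun w => by simp))
        rw [he] at this
        exact (K.smul_mem_iff hc).1 this
    exact key _ r rfl hr

/-- A superderivation that vanishes on the variables is zero. -/
theorem SDer.eq_zero [Fact p.Prime] [CharP F p] {d : ℕ} {D : Module.End F (O F p n)}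
    (hD : SDer d D) (h : ∀ v, D (mon F p (unit v)) = 0) : D = 0 := by
  refine LinearMap.ext fun f => ?_
  refine mem_of_unit_mul_mem (K := LinearMap.ker D) hD.apply_mon_zero (fun v f hf => ?_) f
  rw [LinearMap.mem_ker] at hf ⊢
  rw [hD, h, hf]; simp

theorem SDer.sub {d : ℕ} {D E : Module.End F (O F p n)} (hD : SDer d D) (hE : SDer d E) :
    SDer d (D - E) := fun f g => by
  simp only [LinearMap.sub_apply, hD f g, hE f g, map_sub]; abel

theorem SDer.congr {d e : ℕ} {D : Module.End F (O F p n)} (hD : SDer d D)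
    (h : sig F p n ^ d = sig F p n ^ e) : SDer e D := fun f g => by rw [hD, h]

theorem SDer.bracket {d e : ℕ} {D E : Module.End F (O F p n)} (hD : SDer d D) (hE : SDer e E)
    (hDs : ∀ k f, (sig F p n ^ k) (D f) = (-1 : F) ^ (k * d) • D ((sig F p n ^ k) f))
    (hEs : ∀ k f, (sig F p n ^ k) (E f) = (-1 : F) ^ (k * e) • E ((sig F p n ^ k) f)) :
    SDer (d + e) (D * E - (-1 : F) ^ (d * e) • (E * D)) := fun f g => by
  simp only [LinearMap.sub_apply, LinearMap.smul_apply, Module.End.mul_apply, hE f g, hD f g,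
    map_add, hD _ _, hE _ _, hDs, hEs, map_smul, map_sub]
  have h1 : (sig F p n ^ d) ((sig F p n ^ e) f) = (sig F p n ^ (d + e)) f := by
    rw [pow_add, Module.End.mul_apply]
  have h2 : (sig F p n ^ e) ((sig F p n ^ d) f) = (sig F p n ^ (d + e)) f := by
    rw [add_comm d e, pow_add, Module.End.mul_apply]
  have h3 : (-1 : F) ^ (d * e) * (-1 : F) ^ (d * e) = 1 := by rw [← mul_pow]; simp
  rw [h1, h2, mul_comm e d]
  simp only [smul_add, smul_smul, h3, one_smul]
  module

theorem De_unit_inr [Fact p.Prime] {α : ℕ} {f : O F p n} (hf : IsPar α f) (j : Fin n) :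
    De F p n f (mon F p (unit (Sum.inr j))) = pd F p (Sum.inl j) f := by
  rw [De_apply hf, Finset.sum_eq_single j]
  · rw [pd_unit, pd_unit, if_pos rfl, if_neg (by simp), map_zero, smul_zero, add_zero, mul_mon_zero]
  · intro i _ hi; rw [pd_unit, pd_unit, if_neg (by simpa using hi), if_neg (by simp)]; simp
  · simp

theorem De_unit_inl [Fact p.Prime] {α : ℕ} {f : O F p n} (hf : IsPar α f) (j : Fin n) :
    De F p n f (mon F p (unit (Sum.inl j))) = (-1 : F) ^ α • pd F p (Sum.inr j) f := by
  rw [De_apply hf, Finset.sum_eq_single j]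
  · rw [pd_unit, pd_unit, if_pos rfl, if_neg (by simp), map_zero, zero_add, mul_mon_zero]
  · intro i _ hi; rw [pd_unit, pd_unit, if_neg (by simp), if_neg (by simpa using hi)]; simp
  · simp

/-- The bracket `De_f(g)` of functions is super-antisymmetric for the shifted parity. -/
theorem De_antisymm {α β : ℕ} {f g : O F p n} (hf : IsPar α f) (hg : IsPar β g) :
    De F p n f g = -(-1 : F) ^ ((α + 1) * (β + 1)) • De F p n g f := by
  rw [De_apply hf, De_apply hg, Finset.smul_sum]
  refine Finset.sum_congr rfl fun i _ => ?_
  rw [(hf.pd_inl i).mul_comm, (hf.pd_inr i).mul_comm, (hg.pd_inr i).sig_pow,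
    (hg.pd_inl i).sig_pow]
  simp only [map_smul, LinearMap.smul_apply, smul_add, smul_smul]
  rw [add_comm]
  have h1 : (-1 : F) ^ α * (-1 : F) ^ ((α + 1) * β) = -(-1 : F) ^ ((α + 1) * (β + 1)) := by
    rw [show (α + 1) * (β + 1) = (α + 1) * β + α + 1 by ring, pow_succ, pow_add]; ring
  have h2 : (-1 : F) ^ (α * (β + 1)) =
      -(-1 : F) ^ ((α + 1) * (β + 1)) * (-1 : F) ^ β := by
    have : (-1 : F) ^ β * (-1 : F) ^ β = 1 := by rw [← mul_pow]; simp
    rw [show (α + 1) * (β + 1) = α * (β + 1) + β + 1 by ring, pow_succ, pow_add]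
    linear_combination (-(-1 : F) ^ (α * (β + 1))) * this
  rw [h1, h2]

/-- The operators `De_f` are closed under the supercommutator: `[De_f, De_g] = De_{De_f(g)}`. -/
theorem De_bracket [Fact p.Prime] [CharP F p] {α β : ℕ} {f g : O F p n} (hf : IsPar α f)
    (hg : IsPar β g) :
    De F p n f * De F p n g - (-1 : F) ^ ((α + 1) * (β + 1)) • (De F p n g * De F p n f) =
      De F p n (De F p n f g) := by
  have hfg := hf.De hg
  rw [← sub_eq_zero]
  refine SDer.eq_zero (d := α + 1 + (β + 1)) (SDer.sub (SDer.bracket (SDer.De hf) (SDer.De hg)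
    (sig_pow_De hf) (sig_pow_De hg)) (SDer.congr (SDer.De hfg) (congrArg _ (by ring)))) ?_
  have hsq : ∀ k : ℕ, (-1 : F) ^ k * (-1 : F) ^ k = 1 := fun k => by rw [← mul_pow]; simp
  rintro (j | j)
  · rw [LinearMap.sub_apply, LinearMap.sub_apply, LinearMap.smul_apply, Module.End.mul_apply,
      Module.End.mul_apply, De_unit_inl hf, De_unit_inl hg, De_unit_inl hfg, map_smul, map_smul,
      pd_inr_De hf, De_antisymm (hf.pd_inr j) hg]
    simp only [smul_sub, smul_smul]
    have h1 : (-1 : F) ^ (α + β + 1) * (-1 : F) ^ α = -(-1 : F) ^ β := by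
      rw [show α + β + 1 = β + α + 1 by ring, pow_succ, pow_add]
      linear_combination (-(-1 : F) ^ β) * hsq α
    have h2 : (-1 : F) ^ (α + β + 1) * -(-1 : F) ^ ((α + 1 + 1) * (β + 1)) =
        -((-1 : F) ^ ((α + 1) * (β + 1)) * (-1 : F) ^ α) := by
      rw [show (α + 1 + 1) * (β + 1) = (α + 1) * (β + 1) + β + 1 by ring,
        show α + β + 1 = α + β + 1 by ring, pow_succ, pow_add, pow_succ, pow_add]
      linear_combination (-(-1 : F) ^ ((α + 1) * (β + 1)) * (-1 : F) ^ α) * hsq β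
    rw [h1, h2]
    module
  · rw [LinearMap.sub_apply, LinearMap.sub_apply, LinearMap.smul_apply, Module.End.mul_apply,
      Module.End.mul_apply, De_unit_inr hf, De_unit_inr hg, De_unit_inr hfg, pd_inl_De hf,
      De_antisymm (hf.pd_inl j) hg]
    module

end Bracket

/-! ### Weights of the operators `De_f` -/

section Weights

variable {F : Type*} [Field F] {p n : ℕ}

/-- The exponents `c` that can occur in `De_{x^{(a)}}(x^{(b)})`: one factor `x_i` and one factor
`x_{i'}` disappear from the product. -/
def Contr (p : ℕ) {n : ℕ} (a b : Var n → ℕ) : Set (Var n → ℕ) :=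
  {c | Valid p n c ∧ ∃ i : Fin n, c + unit (Sum.inl i) + unit (Sum.inr i) = a + b}

theorem De_mon_mem (a b : Var n → ℕ) :
    De F p n (mon F p a) (mon F p b) ∈ Submodule.span F (mon F p '' Contr p a b) := by
  by_cases ha : Valid p n a
  swap
  · rw [mon_of_not_valid ha]; simp
  by_cases hb : Valid p n b
  swap
  · rw [mon_of_not_valid hb]; simp
  have key : ∀ (i : Fin n) (c : F) (r s : Var n → ℕ),
      r + s + unit (Sum.inl i) + unit (Sum.inr i) = a + b →
      mul F p n (mon F p r) (mon F p s) ∈ Submodule.span F (mon F p '' Contr p a b) := by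
    intro i c r s h
    rw [mul_mon_mon]
    by_cases hv : Valid p n (r + s)
    · exact Submodule.smul_mem _ _ (Submodule.subset_span ⟨_, ⟨hv, i, h⟩, rfl⟩)
    · rw [mon_of_not_valid hv, smul_zero]; exact Submodule.zero_mem _
  rw [De_apply (isPar_mon a)]
  refine Submodule.sum_mem _ fun i _ => Submodule.add_mem _ ?_ (Submodule.smul_mem _ _ ?_)
  · by_cases h1 : a (Sum.inl i) = 0
    · rw [pd_mon_of_eq_zero h1]; simp
    by_cases h2 : b (Sum.inr i) = 0
    · rw [pd_mon_of_eq_zero h2]; simp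
    obtain ⟨r, rfl⟩ := eq_add_unit h1
    obtain ⟨s, rfl⟩ := eq_add_unit h2
    rw [pd_mon_add_unit ha, pd_mon_add_unit hb, map_smul, map_smul, LinearMap.smul_apply]
    exact Submodule.smul_mem _ _ (Submodule.smul_mem _ _ (key i 1 r s (by abel)))
  · by_cases h1 : a (Sum.inr i) = 0
    · rw [pd_mon_of_eq_zero h1]; simp
    by_cases h2 : b (Sum.inl i) = 0
    · rw [pd_mon_of_eq_zero h2]; simp
    obtain ⟨r, rfl⟩ := eq_add_unit h1
    obtain ⟨s, rfl⟩ := eq_add_unit h2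
    rw [pd_mon_add_unit ha, pd_mon_add_unit hb, map_smul, map_smul, LinearMap.smul_apply]
    exact Submodule.smul_mem _ _ (Submodule.smul_mem _ _ (key i 1 r s (by abel)))

theorem contr_deg {a b c : Var n → ℕ} (h : c ∈ Contr p a b) : deg c + 2 = deg a + deg b := by
  obtain ⟨-, i, h⟩ := h
  have := congrArg OddHam.deg h
  rw [deg_add, deg_add, deg_add, deg_unit, deg_unit] at this
  exact this

theorem contr_oddDeg {a b c : Var n → ℕ} (h : c ∈ Contr p a b) :
    oddDeg c + 1 = oddDeg a + oddDeg b := by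
  obtain ⟨-, i, h⟩ := h
  have := congrArg OddHam.oddDeg h
  rw [oddDeg_add, oddDeg_add, oddDeg_add, oddDeg_unit_inl, oddDeg_unit_inr] at this
  exact this

theorem contr_pair {a b c : Var n → ℕ} (h : c ∈ Contr p a b) (l : Fin n) :
    c (Sum.inl l) = a (Sum.inl l) + b (Sum.inl l) ∧ c (Sum.inr l) = a (Sum.inr l) + b (Sum.inr l) ∨
    c (Sum.inl l) + 1 = a (Sum.inl l) + b (Sum.inl l) ∧
      c (Sum.inr l) + 1 = a (Sum.inr l) + b (Sum.inr l) := by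
  obtain ⟨-, i, h⟩ := h
  have h1 := congrFun h (Sum.inl l)
  have h2 := congrFun h (Sum.inr l)
  by_cases hl : l = i
  · subst hl
    simp at h1 h2
    exact Or.inr ⟨h1, h2⟩
  · simp [hl] at h1 h2
    exact Or.inl ⟨h1, h2⟩

theorem mul_unit_pd [Fact p.Prime] (v : Var n) (b : Var n → ℕ) :
    mul F p n (mon F p (unit v)) (pd F p v (mon F p b)) = (b v : F) • mon F p b := by
  by_cases hb : Valid p n b
  swap
  · rw [mon_of_not_valid hb]; simp
  by_cases h : b v = 0
  · rw [pd_mon_of_eq_zero h, h]; simp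
  obtain ⟨s, rfl⟩ := eq_add_unit h
  rw [pd_mon_add_unit hb, map_smul, mul_mon_mon, smul_smul, add_comm (unit v)]
  congr 1
  have h1 : ∏ w, ((Nat.choose (unit v w + s w) (unit v w) : ℕ) : F) = ((s v + 1 : ℕ) : F) := by
    rw [Finset.prod_eq_single v]
    · simp [add_comm]
    · intro w _ hw; simp [hw]
    · simp
  rw [mulCoeff, h1]
  cases v with
  | inl i => simp [signExp_unit_inl_left, dSign]
  | inr i =>
    rw [signExp_unit_left, ← mul_assoc, ← mul_pow]; simp

theorem euler_mon [Fact p.Prime] (b : Var n → ℕ) :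
    euler F p n (mon F p b) = (deg b : F) • mon F p b := by
  rw [euler, LinearMap.sum_apply, deg, Nat.cast_sum, Finset.sum_smul]
  exact Finset.sum_congr rfl fun v _ => mul_unit_pd v b

theorem hDe_mon [Fact p.Prime] (j : Fin n) (b : Var n → ℕ) :
    hDe F p j (mon F p b) = ((b (Sum.inr j) : F) - b (Sum.inl j)) • mon F p b := by
  rw [hDe_eq, LinearMap.sub_apply, Module.End.mul_apply, Module.End.mul_apply, mul_unit_pd,
    mul_unit_pd, sub_smul]

/-- `[E, De_{x^{(a)}}] = (deg a - 2) De_{x^{(a)}}`. -/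
theorem euler_De [Fact p.Prime] (a : Var n → ℕ) :
    euler F p n * De F p n (mon F p a) - De F p n (mon F p a) * euler F p n =
      ((deg a : F) - 2) • De F p n (mon F p a) := by
  refine lin_ext fun b _ => ?_
  have h : ∀ g ∈ Submodule.span F (mon F p '' Contr p a b), euler F p n g =
      ((deg a : F) + deg b - 2) • g := by
    intro g hg
    induction hg using Submodule.span_induction with
    | mem x hx =>
      obtain ⟨c, hc, rfl⟩ := hx
      rw [euler_mon, ← Nat.cast_add, ← contr_deg hc]
      congr 1; push_cast; ring
    | zero => simp
    | add x y _ _ hx hy => rw [map_add, hx, hy, smul_add]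
    | smul c x _ hx => rw [map_smul, hx, smul_comm]
  rw [LinearMap.sub_apply, Module.End.mul_apply, Module.End.mul_apply, h _ (De_mon_mem a b),
    euler_mon, map_smul, LinearMap.smul_apply]
  module

theorem hDe_eq_De (j : Fin n) :
    hDe F p j = De F p n (mon F p (unit (Sum.inl j) + unit (Sum.inr j))) := rfl

theorem oddDeg_pair (j : Fin n) : oddDeg (unit (Sum.inl j) + unit (Sum.inr j) : Var n → ℕ) = 1 := by
  rw [oddDeg_add, oddDeg_unit_inl, oddDeg_unit_inr]

/-- In characteristic `p` the `p`-th iterate of the commutator with `x` is the commutator with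
`x ^ p`. -/
theorem pow_char_commutator [hp : Fact p.Prime] {A : Type*} [Ring A] [Algebra F A] [Nontrivial A]
    [CharP F p] (x : A) (y : ℕ → A) (h : ∀ k, x * y k - y k * x = y (k + 1)) :
    x ^ p * y 0 - y 0 * x ^ p = y p := by
  have hc : CharP (Module.End F A) p :=
    charP_of_injective_algebraMap (algebraMap F (Module.End F A)).injective p
  set L := LinearMap.mulLeft F x
  set R := LinearMap.mulRight F x
  have hcomm : Commute L R := LinearMap.commute_mulLeft_right x x
  have h1 : ∀ k, ((L - R) ^ k) (y 0) = y k := by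
    intro k
    induction k with
    | zero => simp
    | succ k ih =>
      rw [pow_succ', Module.End.mul_apply, ih, ← h k]
      rfl
  rw [← h1 p, sub_pow_char_of_commute _ hcomm, LinearMap.pow_mulLeft, LinearMap.pow_mulRight]
  rfl

theorem exists_mon_ne_zero [Fact p.Prime] : mon F p (0 : Var n → ℕ) ≠ 0 := by
  rw [mon, dif_pos valid_zero]; simp

instance [Fact p.Prime] : Nontrivial (O F p n) := ⟨⟨_, 0, exists_mon_ne_zero⟩⟩

/-- The `p`-th power of an even derivation is a derivation; if it kills the variables it is `0`. -/
theorem pow_char_eq_zero [Fact p.Prime] [CharP F p] {d : ℕ} {D : Module.End F (O F p n)}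
    (hD : SDer d D) (hd : Even d) (h : ∀ v, (D ^ p) (mon F p (unit v)) = 0) : D ^ p = 0 := by
  have hs : sig F p n ^ d = 1 := by
    obtain ⟨k, rfl⟩ := hd
    rw [← two_mul, pow_mul, pow_two, sig_sq, one_pow]
  have key : ∀ f g, (D ^ p) (mul F p n f g) = mul F p n ((D ^ p) f) g +
      mul F p n f ((D ^ p) g) := by
    intro f g
    have h1 := pow_char_commutator (p := p) (F := F) D (fun k => mul F p n ((D ^ k) f)) fun k => by
      refine LinearMap.ext fun g => ?_
      rw [LinearMap.sub_apply, Module.End.mul_apply, Module.End.mul_apply, hD, hs,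
        Module.End.one_apply, pow_succ', Module.End.mul_apply, add_sub_cancel_right]
    have h2 := LinearMap.congr_fun h1 g
    rw [LinearMap.sub_apply, Module.End.mul_apply, Module.End.mul_apply] at h2
    rw [← h2]
    simp
  refine SDer.eq_zero (d := 0) (fun f g => ?_) h
  rw [key]; simp

/-- The exponents in `D^t(x^{(b)})` satisfy every invariant that propagates along
contractions with `a`. -/
theorem De_pow_mem (a : Var n → ℕ) (W : ℕ → Set (Var n → ℕ))
    (hW : ∀ t, ∀ b ∈ W t, ∀ c ∈ Contr p a b, c ∈ W (t + 1)) (t : ℕ) :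
    ∀ b ∈ W 0, (De F p n (mon F p a) ^ t) (mon F p b) ∈ Submodule.span F (mon F p '' W t) := by
  intro b hb
  induction t with
  | zero => exact Submodule.subset_span ⟨b, hb, rfl⟩
  | succ t ih =>
    rw [pow_succ', Module.End.mul_apply]
    generalize (De F p n (mon F p a) ^ t) (mon F p b) = g at ih
    induction ih using Submodule.span_induction with
    | mem x hx =>
      obtain ⟨c, hc, rfl⟩ := hx
      exact Submodule.span_mono (Set.image_mono (hW t c hc)) (De_mon_mem a c)
    | zero => simp
    | add x y _ _ hx hy => rw [map_add]; exact Submodule.add_mem _ hx hy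
    | smul c x _ hx => rw [map_smul]; exact Submodule.smul_mem _ _ hx

/-- The weights that occur in `O(n)` leave room for `D^p(x_v) ≠ 0`, where `D` is an even
`De_{x^{(a)}}` outside the Cartan subalgebra, only if `a = ε_i + ε_j + ε_{n+i}` and `v = n + j`. -/
theorem exceptional_weight (hp : 3 < p) {a : Var n → ℕ} (ha : Valid p n a)
    (hodd : Odd (oddDeg a)) (hcar : ∀ i, a ≠ unit (Sum.inl i) + unit (Sum.inr i)) {v : Var n}
    {c : Var n → ℕ} (hc : Valid p n c)
    (h1 : ∀ l : Fin n, (c (Sum.inr l) : ℤ) - c (Sum.inl l) = unit v (Sum.inr l) -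
      unit v (Sum.inl l) + p * ((a (Sum.inr l) : ℤ) - a (Sum.inl l)))
    (h2 : oddDeg c + p = oddDeg (unit v) + p * oddDeg a)
    (h3 : ∀ w, a w = 0 → unit v w = 0 → c w = 0) :
    ∃ i j : Fin n, i ≠ j ∧ a = unit (Sum.inl i) + unit (Sum.inl j) + unit (Sum.inr i) ∧
      v = Sum.inr j := by
  have h4 : oddDeg c ≤ oddDeg a + oddDeg (unit v) := by
    rw [oddDeg, oddDeg, oddDeg, ← Finset.sum_add_distrib]
    refine Finset.sum_le_sum fun l _ => ?_
    have := hc.2 l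
    have := h3 (Sum.inr l)
    omega
  have h5 : oddDeg a = 1 := by
    obtain ⟨k, hk⟩ := hodd
    rcases Nat.eq_zero_or_pos k with h | h
    · omega
    · have h6 : p * oddDeg a = p * (2 * k) + p := by rw [hk]; ring
      have h7 : 4 * (2 * k) ≤ p * (2 * k) := Nat.mul_le_mul_right _ hp
      omega
  obtain ⟨i, hi⟩ : ∃ i, a (Sum.inr i) ≠ 0 := by
    by_contra hcon
    push Not at hcon
    rw [oddDeg, Finset.sum_eq_zero fun v _ => hcon v] at h5
    omega
  have hi1 : a (Sum.inr i) = 1 := by have := ha.2 i; omega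
  have hi0 : ∀ l ≠ i, a (Sum.inr l) = 0 := by
    intro l hl
    have := Finset.add_sum_erase Finset.univ (fun l => a (Sum.inr l)) (Finset.mem_univ i)
    have h6 : ∑ l ∈ Finset.univ.erase i, a (Sum.inr l) = 0 := by
      have : ∑ l, a (Sum.inr l) = 1 := h5
      omega
    exact (Finset.sum_eq_zero_iff.1 h6) l (Finset.mem_erase.2 ⟨hl, Finset.mem_univ _⟩)
  -- the weights of `O(n)` lie in an interval of length `p`
  have hw : ∀ l : Fin n, (a (Sum.inr l) : ℤ) = a (Sum.inl l) ∨
      v = Sum.inr l ∧ (a (Sum.inl l) : ℤ) = a (Sum.inr l) + 1 ∧ c (Sum.inr l) + p =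
        c (Sum.inl l) + 1 := by
    intro l
    have e1 := h1 l
    have e2 := hc.1 l
    have e3 := hc.2 l
    have e4 : unit v (Sum.inr l) ≤ 1 := by
      rw [unit, Pi.single_apply]; split_ifs <;> simp
    have e5 : unit v (Sum.inl l) ≤ 1 := by
      rw [unit, Pi.single_apply]; split_ifs <;> simp
    rcases lt_trichotomy ((a (Sum.inr l) : ℤ) - a (Sum.inl l)) 0 with h | h | h
    · right
      have h6 : (a (Sum.inr l) : ℤ) - a (Sum.inl l) = -1 := by
        by_contra hne
        have : (p : ℤ) * ((a (Sum.inr l) : ℤ) - a (Sum.inl l)) ≤ p * (-2) :=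
          mul_le_mul_of_nonneg_left (by omega) (by omega)
        omega
      rw [h6] at e1
      have h7 : v = Sum.inr l := by
        by_contra hne
        have : unit v (Sum.inr l) = 0 := by simp [Ne.symm hne]
        omega
      subst h7
      simp at e1
      refine ⟨rfl, by omega, by omega⟩
    · left; omega
    · have : (p : ℤ) * 1 ≤ (p : ℤ) * ((a (Sum.inr l) : ℤ) - a (Sum.inl l)) :=
        mul_le_mul_of_nonneg_left (by omega) (by omega)
      omega
  have hcartan : ¬ ∀ l, (a (Sum.inr l) : ℤ) = a (Sum.inl l) := by
    intro h
    refine hcar i (funext fun w => ?_)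
    rcases w with l | l
    · have := h l
      by_cases hl : l = i
      · subst hl; simp; omega
      · have := hi0 l hl; simp [hl]; omega
    · by_cases hl : l = i
      · subst hl; simp [hi1]
      · simp [hl, hi0 l hl]
  push Not at hcartan
  obtain ⟨j, hj⟩ := hcartan
  obtain ⟨rfl, hj1, hj2⟩ := (hw j).resolve_left hj
  have hne : ∀ l ≠ j, (a (Sum.inr l) : ℤ) = a (Sum.inl l) := by
    intro l hl
    refine (hw l).resolve_right ?_
    rintro ⟨h, -⟩
    exact hl (Sum.inr.inj h).symm
  have hij : i ≠ j := by
    rintro rfl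
    -- `a = 2 ε_i + ε_{n+i}`: the support of `c` is too small
    have hod : oddDeg c = 1 := by rw [oddDeg_unit_inr] at h2; rw [h5] at h2; omega
    have : oddDeg c = c (Sum.inr i) := by
      rw [oddDeg, Finset.sum_eq_single i]
      · intro l _ hl
        exact h3 _ (hi0 l hl) (by simp [hl])
      · simp
    have := hc.1 i
    omega
  refine ⟨i, j, hij, funext fun w => ?_, rfl⟩
  rcases w with l | l
  · by_cases hl : l = i
    · subst hl; have := hne l hij; simp [hij]; omega
    · by_cases hl' : l = j
      · subst hl'; have := hi0 l hl; simp [hl]; omega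
      · have := hi0 l hl; have := hne l hl'; simp [hl, hl']; omega
  · by_cases hl : l = i
    · subst hl; simp [hi1]
    · simp [hl, hi0 l hl]

/-- Outside the Cartan subalgebra the even operators `De_{x^{(a)}}` have `p`-th power `0`. -/
theorem De_pow_char [Fact p.Prime] [CharP F p] (hp : 3 < p) {a : Var n → ℕ} (ha : Valid p n a)
    (hodd : Odd (oddDeg a)) (hcar : ∀ i, a ≠ unit (Sum.inl i) + unit (Sum.inr i)) :
    De F p n (mon F p a) ^ p = 0 := by
  refine pow_char_eq_zero (SDer.De (isPar_mon a)) hodd.add_one fun v => ?_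
  by_cases hex : ∃ i j : Fin n, i ≠ j ∧
      a = unit (Sum.inl i) + unit (Sum.inl j) + unit (Sum.inr i) ∧ v = Sum.inr j
  · obtain ⟨i, j, hij, rfl, rfl⟩ := hex
    have h1 : pd F p (Sum.inl j) (mon F p (unit (Sum.inl i) + unit (Sum.inl j) +
        unit (Sum.inr i))) = mon F p (unit (Sum.inl i) + unit (Sum.inr i)) := by
      have : unit (Sum.inl i) + unit (Sum.inl j) + unit (Sum.inr i) =
        unit (Sum.inl i) + unit (Sum.inr i) + unit (Sum.inl j) := by abel
      rw [this] at ha ⊢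
      exact pd_mon_inl ha
    have h2 : De F p n (mon F p (unit (Sum.inl i) + unit (Sum.inl j) + unit (Sum.inr i)))
        (mon F p (unit (Sum.inl i) + unit (Sum.inr i))) = 0 := by
      rw [De_antisymm (isPar_mon _) (isPar_mon _), ← hDe_eq_De, hDe_mon]
      simp [hij]
    obtain ⟨k, rfl⟩ : ∃ k, p = k + 2 := ⟨p - 2, by omega⟩
    rw [pow_add, Module.End.mul_apply, pow_two, Module.End.mul_apply, De_unit_inr (isPar_mon _),
      h1, h2, map_zero]
  · have key := De_pow_mem (F := F) (p := p) a (fun t => {c |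
      (∀ l : Fin n, (c (Sum.inr l) : ℤ) - c (Sum.inl l) = unit v (Sum.inr l) -
        unit v (Sum.inl l) + t * ((a (Sum.inr l) : ℤ) - a (Sum.inl l))) ∧
      oddDeg c + t = oddDeg (unit v) + t * oddDeg a ∧
      (∀ w, a w = 0 → unit v w = 0 → c w = 0) ∧ Valid p n c}) ?_ p (unit v) ?_
    · have : {c | (∀ l : Fin n, (c (Sum.inr l) : ℤ) - c (Sum.inl l) = unit v (Sum.inr l) -
          unit v (Sum.inl l) + p * ((a (Sum.inr l) : ℤ) - a (Sum.inl l))) ∧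
          oddDeg c + p = oddDeg (unit v) + p * oddDeg a ∧
          (∀ w, a w = 0 → unit v w = 0 → c w = 0) ∧ Valid p n c} = ∅ := by
        ext c
        simp only [Set.mem_ofPred_eq, Set.mem_empty_iff_false, iff_false]
        rintro ⟨h1, h2, h3, h4⟩
        exact hex (exceptional_weight hp ha hodd hcar h4 h1 h2 h3)
      rw [this] at key
      simpa using key
    · rintro t b ⟨h1, h2, h3, h4⟩ c hc
      refine ⟨fun l => ?_, ?_, fun w hw1 hw2 => ?_, hc.1⟩
      · have := contr_pair hc l
        have := h1 l
        push_cast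
        rw [add_mul, one_mul, ← add_assoc, ← this]
        omega
      · have := contr_oddDeg hc
        rw [add_mul, one_mul]
        omega
      · have h5 := h3 w hw1 hw2
        rcases w with l | l <;> have := contr_pair hc l <;> omega
    · exact ⟨fun l => by simp, by simp, fun w _ hw => hw, valid_unit p v⟩

theorem two_ne_zero' [Fact p.Prime] [CharP F p] (hp : 3 < p) : (2 : F) ≠ 0 := by
  have h : ((2 : ℕ) : F) ≠ 0 := by
    rw [Ne, CharP.cast_eq_zero_iff F p]
    exact Nat.not_dvd_of_pos_of_lt (by omega) (by omega)
  exact_mod_cast h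

end Weights

/-! ### The restricted enveloping algebra -/

section Enveloping

variable {F : Type*} [Field F] {p n : ℕ}

theorem neg_one_pow_val (k : ℕ) : (-1 : F) ^ ((k : ZMod 2)).val = (-1 : F) ^ k := by
  rw [ZMod.val_natCast, ← neg_one_pow_eq_pow_mod_two]

theorem neg_one_pow_val_mul (k l : ℕ) :
    (-1 : F) ^ (((k : ZMod 2)).val * ((l : ZMod 2)).val) = (-1 : F) ^ (k * l) := by
  rw [pow_mul, neg_one_pow_val, ← pow_mul, mul_comm k, pow_mul, neg_one_pow_val, ← pow_mul,
    mul_comm]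

theorem neg_one_pow_val_add (α β : ZMod 2) :
    (-1 : F) ^ (α + β).val = (-1 : F) ^ α.val * (-1 : F) ^ β.val := by
  rw [← pow_add, ← neg_one_pow_val (α.val + β.val)]
  simp

theorem isHomog_De {α : ℕ} {f : O F p n} (hf : IsPar α f) :
    IsHomog ((α + 1 : ℕ) : ZMod 2) (De F p n f) := by
  rw [IsHomog, neg_one_pow_val]
  refine LinearMap.ext fun g => ?_
  rw [Module.End.mul_apply, sig_De hf]
  rfl

theorem isHomog_euler [Fact p.Prime] : IsHomog 0 (euler F p n) := by
  rw [IsHomog, ZMod.val_zero, pow_zero, one_smul]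
  refine lin_ext fun b _ => ?_
  rw [Module.End.mul_apply, Module.End.mul_apply, euler_mon, map_smul, sig_mon', map_smul,
    euler_mon, smul_comm]

/-- Conjugation of operators with the parity involution. -/
def conj (F : Type*) [Field F] (p n : ℕ) : Module.End F (O F p n) →ₗ[F] Module.End F (O F p n) :=
  LinearMap.mulLeft F (sig F p n) ∘ₗ LinearMap.mulRight F (sig F p n)

theorem conj_apply (A : Module.End F (O F p n)) :
    conj F p n A = sig F p n * (A * sig F p n) := rfl

theorem IsHomog.conj {θ : ZMod 2} {A : Module.End F (O F p n)} (h : IsHomog θ A) :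
    conj F p n A = (-1 : F) ^ θ.val • A := by
  rw [conj_apply, ← mul_assoc, h, smul_mul_assoc, mul_assoc, sig_sq, mul_one]

theorem conj_mul (A B : Module.End F (O F p n)) :
    conj F p n (A * B) = conj F p n A * conj F p n B := by
  rw [conj_apply, conj_apply, conj_apply]
  calc sig F p n * (A * B * sig F p n) = sig F p n * (A * 1 * (B * sig F p n)) := by
        rw [mul_one, mul_assoc]
    _ = _ := by rw [← sig_sq]; simp only [mul_assoc]

theorem conj_De (f : O F p n) : conj F p n (De F p n f) = De F p n ((-1 : F) • sig F p n f) := by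
  induction f using mon_induction with
  | zero => simp
  | add a b ha hb => simp only [map_add, ha, hb, smul_add]
  | smul c a ha => rw [map_smul, map_smul, ha, ← map_smul, smul_comm, map_smul (sig F p n)]
  | mon r hr =>
    rw [(isHomog_De (isPar_mon r)).conj, neg_one_pow_val, sig_mon', smul_smul, map_smul, pow_succ,
      mul_comm]

theorem conj_mem [Fact p.Prime] {A : Module.End F (O F p n)} (h : A ∈ leBar F p n) :
    conj F p n A ∈ leBar F p n := by
  obtain ⟨x, ⟨f, rfl⟩, y, hy, rfl⟩ := Submodule.mem_sup.1 h
  obtain ⟨c, rfl⟩ := Submodule.mem_span_singleton.1 hy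
  rw [map_add, map_smul, conj_De, isHomog_euler.conj]
  refine Submodule.add_mem_sup ⟨_, rfl⟩ ?_
  exact Submodule.smul_mem _ _ (Submodule.smul_mem _ _ (Submodule.mem_span_singleton_self _))

/-- The parity involution of the Lie superalgebra. -/
def conjLe (F : Type*) [Field F] (p n : ℕ) [Fact p.Prime] : leBar F p n →ₗ[F] leBar F p n :=
  (conj F p n).restrict fun _ h => conj_mem h

variable (F p n) in
/-- A linear map from the Lie superalgebra to an associative algebra that satisfies the defining
relations of the restricted enveloping algebra. -/
structure IsRep {A : Type*} [Ring A] [Algebra F A] (ρ : leBar F p n →ₗ[F] A) : Prop where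
  bracket : ∀ (α β : ZMod 2) (x y z : leBar F p n),
    IsHomog α (x : Module.End F (O F p n)) → IsHomog β (y : Module.End F (O F p n)) →
    (z : Module.End F (O F p n)) = x.1 * y.1 - (-1 : F) ^ (α.val * β.val) • (y.1 * x.1) →
    ρ x * ρ y - (-1 : F) ^ (α.val * β.val) • (ρ y * ρ x) = ρ z
  power : ∀ x y : leBar F p n, IsHomog 0 (x : Module.End F (O F p n)) →
    (y : Module.End F (O F p n)) = x.1 ^ p → ρ x ^ p = ρ y

/-- The universal property of the restricted enveloping algebra. -/
def uLift {A : Type*} [Ring A] [Algebra F A] {ρ : leBar F p n →ₗ[F] A} (h : IsRep F p n ρ) :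
    U F p n →ₐ[F] A :=
  RingQuot.liftAlgHom F ⟨TensorAlgebra.lift F ρ, fun {x y} hxy => by
    cases hxy with
    | bracket α β x y z hx hy hz =>
      simpa using h.bracket α β x y z hx hy hz
    | power x y hx hy => simpa using h.power x y hx hy⟩

theorem uLift_iota {A : Type*} [Ring A] [Algebra F A] {ρ : leBar F p n →ₗ[F] A}
    (h : IsRep F p n ρ) (x : leBar F p n) : uLift h (iota F p n x) = ρ x := by
  rw [uLift, iota, LinearMap.comp_apply, AlgHom.toLinearMap_apply,
    RingQuot.liftAlgHom_mkAlgHom_apply, TensorAlgebra.lift_ι_apply]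

theorem isRep_iota : IsRep F p n (iota F p n) where
  bracket α β x y z hx hy hz := by
    have := RingQuot.mkAlgHom_rel F (URel.bracket α β x y z hx hy hz)
    simpa [iota] using this
  power x y hx hy := by
    have := RingQuot.mkAlgHom_rel F (URel.power x y hx hy)
    simpa [iota] using this

theorem adjoin_iota : Algebra.adjoin F (Set.range (iota F p n)) = ⊤ := by
  have h1 : Set.range (iota F p n) = RingQuot.mkAlgHom F (URel F p n) ''
      Set.range (TensorAlgebra.ι F (M := leBar F p n)) := by
    rw [← Set.range_comp]; rfl
  rw [h1, ← AlgHom.map_adjoin, TensorAlgebra.adjoin_range_ι, Algebra.map_top]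
  exact AlgHom.range_eq_top _ |>.2 (RingQuot.mkAlgHom_surjective F _)

theorem isRep_conj [Fact p.Prime] : IsRep F p n (iota F p n ∘ₗ conjLe F p n) where
  bracket α β x y z hx hy hz := by
    have hx' : conjLe F p n x = (-1 : F) ^ α.val • x := Subtype.ext hx.conj
    have hy' : conjLe F p n y = (-1 : F) ^ β.val • y := Subtype.ext hy.conj
    have hz' : conjLe F p n z = ((-1 : F) ^ α.val * (-1 : F) ^ β.val) • z := by
      refine Subtype.ext ?_
      change conj F p n z.1 = _ • z.1
      rw [hz]
      refine (map_sub (conj F p n) _ _).trans ?_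
      rw [map_smul, conj_mul, conj_mul, hx.conj, hy.conj]
      refine LinearMap.ext fun g => ?_
      simp only [smul_mul_assoc, mul_smul_comm, smul_smul, LinearMap.sub_apply,
        LinearMap.smul_apply, smul_sub]
      congr 2 <;> ring
    rw [LinearMap.comp_apply, LinearMap.comp_apply, LinearMap.comp_apply, hx', hy', hz', map_smul,
      map_smul, map_smul, ← isRep_iota.bracket α β x y z hx hy hz]
    simp only [smul_mul_assoc, mul_smul_comm, smul_smul, smul_sub]
    congr 2 <;> ring
  power x y hx hy := by
    have hx' : conjLe F p n x = x := Subtype.ext (by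
      have := hx.conj
      rw [ZMod.val_zero, pow_zero, one_smul] at this
      exact this)
    have hy' : conjLe F p n y = y := by
      refine Subtype.ext ?_
      change conj F p n y.1 = y.1
      rw [hy]
      have : ∀ k, conj F p n (x.1 ^ k) = x.1 ^ k := by
        intro k
        induction k with
        | zero => rw [pow_zero, conj_apply, one_mul, sig_sq]
        | succ k ih => rw [pow_succ, conj_mul, ih, hx.conj]; simp
      exact this p
    rw [LinearMap.comp_apply, LinearMap.comp_apply, hx', hy', isRep_iota.power x y hx hy]

/-- The parity automorphism of the restricted enveloping algebra. -/
def tau (F : Type*) [Field F] (p n : ℕ) [Fact p.Prime] : U F p n →ₐ[F] U F p n :=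
  uLift (isRep_conj (F := F) (p := p) (n := n))

theorem tau_iota [Fact p.Prime] {θ : ZMod 2} {x : leBar F p n}
    (h : IsHomog θ (x : Module.End F (O F p n))) :
    tau F p n (iota F p n x) = (-1 : F) ^ θ.val • iota F p n x := by
  rw [tau, uLift_iota, LinearMap.comp_apply, ← map_smul]
  congr 1
  exact Subtype.ext h.conj

variable (F p n) in
/-- The element of the restricted enveloping algebra given by `De_f`. -/
def iD : O F p n →ₗ[F] U F p n :=
  iota F p n ∘ₗ (De F p n).codRestrict (leBar F p n) fun f => Submodule.mem_sup_left ⟨f, rfl⟩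

variable (F p n) in
/-- The element of the restricted enveloping algebra given by the Euler operator. -/
def iE : U F p n :=
  iota F p n ⟨euler F p n, Submodule.mem_sup_right (Submodule.mem_span_singleton_self _)⟩

theorem exists_iota_eq (x : leBar F p n) : ∃ (f : O F p n) (c : F),
    (x : Module.End F (O F p n)) = De F p n f + c • euler F p n ∧
      iota F p n x = iD F p n f + c • iE F p n := by
  obtain ⟨y, ⟨f, rfl⟩, z, hz, h⟩ := Submodule.mem_sup.1 x.2
  obtain ⟨c, rfl⟩ := Submodule.mem_span_singleton.1 hz
  refine ⟨f, c, h.symm, ?_⟩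
  rw [iE, ← map_smul, iD, LinearMap.comp_apply, ← map_add]
  exact congrArg _ (Subtype.ext h.symm)

theorem iD_bracket [Fact p.Prime] [CharP F p] {α β : ℕ} {f g : O F p n} (hf : IsPar α f)
    (hg : IsPar β g) : iD F p n f * iD F p n g =
      (-1 : F) ^ ((α + 1) * (β + 1)) • (iD F p n g * iD F p n f) +
        iD F p n (De F p n f g) := by
  have h := isRep_iota.bracket (F := F) (p := p) (n := n) ((α + 1 : ℕ) : ZMod 2)
    ((β + 1 : ℕ) : ZMod 2) ⟨De F p n f, Submodule.mem_sup_left ⟨f, rfl⟩⟩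
    ⟨De F p n g, Submodule.mem_sup_left ⟨g, rfl⟩⟩
    ⟨De F p n (De F p n f g), Submodule.mem_sup_left ⟨_, rfl⟩⟩ (isHomog_De hf) (isHomog_De hg)
    (by rw [neg_one_pow_val_mul]; exact (De_bracket hf hg).symm)
  rw [neg_one_pow_val_mul, sub_eq_iff_eq_add'] at h
  exact h

theorem iE_iD [Fact p.Prime] (a : Var n → ℕ) : iE F p n * iD F p n (mon F p a) =
    iD F p n (mon F p a) * iE F p n + ((deg a : F) - 2) • iD F p n (mon F p a) := by
  have h := isRep_iota.bracket (F := F) (p := p) (n := n) 0 ((oddDeg a + 1 : ℕ) : ZMod 2)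
    ⟨euler F p n, Submodule.mem_sup_right (Submodule.mem_span_singleton_self _)⟩
    ⟨De F p n (mon F p a), Submodule.mem_sup_left ⟨_, rfl⟩⟩
    (((deg a : F) - 2) • ⟨De F p n (mon F p a), Submodule.mem_sup_left ⟨_, rfl⟩⟩) isHomog_euler
    (isHomog_De (isPar_mon a)) (by
      rw [ZMod.val_zero, zero_mul, pow_zero, one_smul]
      exact (euler_De a).symm)
  rw [ZMod.val_zero, zero_mul, pow_zero, one_smul, map_smul, sub_eq_iff_eq_add'] at h
  exact h

/-- `h_j`, as an element of the restricted enveloping algebra. -/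
abbrev iH (F : Type*) [Field F] (p : ℕ) {n : ℕ} (j : Fin n) : U F p n :=
  iD F p n (mon F p (unit (Sum.inl j) + unit (Sum.inr j)))

theorem iH_iD [Fact p.Prime] [CharP F p] (j : Fin n) (a : Var n → ℕ) :
    iH F p j * iD F p n (mon F p a) = iD F p n (mon F p a) * iH F p j +
      ((a (Sum.inr j) : F) - a (Sum.inl j)) • iD F p n (mon F p a) := by
  rw [iD_bracket (isPar_mon _) (isPar_mon a), oddDeg_pair, ← hDe_eq_De, hDe_mon, map_smul]
  simp

theorem iD_pow_char [Fact p.Prime] [CharP F p] (hp : 3 < p) {a : Var n → ℕ} (ha : Valid p n a)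
    (hodd : Odd (oddDeg a)) (hcar : ∀ i, a ≠ unit (Sum.inl i) + unit (Sum.inr i)) :
    iD F p n (mon F p a) ^ p = 0 := by
  have h := isRep_iota.power (F := F) (p := p) (n := n)
    ⟨De F p n (mon F p a), Submodule.mem_sup_left ⟨_, rfl⟩⟩ 0 (by
      have := isHomog_De (isPar_mon (F := F) (p := p) a)
      rwa [(ZMod.natCast_eq_zero_iff _ _).2 (even_iff_two_dvd.1 hodd.add_one)] at this)
    (by change 0 = _; rw [De_pow_char hp ha hodd hcar])
  rw [map_zero] at h
  exact h

theorem iD_mon_zero [Fact p.Prime] [CharP F p] : iD F p n (mon F p 0) = 0 := by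
  rw [iD, LinearMap.comp_apply]
  have : De F p n (mon F p 0) = 0 := by
    refine LinearMap.ext fun g => ?_
    rw [De_apply (isPar_mon 0)]
    refine Finset.sum_eq_zero fun i _ => ?_
    rw [pd_mon_of_eq_zero rfl, pd_mon_of_eq_zero rfl]; simp
  exact (congrArg _ (Subtype.ext this)).trans (map_zero _)

theorem tau_iD [Fact p.Prime] {α : ℕ} {f : O F p n} (hf : IsPar α f) :
    tau F p n (iD F p n f) = (-1 : F) ^ (α + 1) • iD F p n f := by
  have h := tau_iota (x := ⟨De F p n f, Submodule.mem_sup_left ⟨f, rfl⟩⟩) (isHomog_De hf)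
  rw [neg_one_pow_val] at h
  exact h

theorem tau_iE [Fact p.Prime] : tau F p n (iE F p n) = iE F p n := by
  have h := tau_iota (F := F) (p := p) (n := n) (x := ⟨euler F p n, Submodule.mem_sup_right
    (Submodule.mem_span_singleton_self _)⟩) isHomog_euler
  rw [ZMod.val_zero, pow_zero, one_smul] at h
  exact h

/-! ### The grading of the restricted enveloping algebra -/

theorem one_mem_uPart : (1 : U F p n) ∈ uPart F p n 0 :=
  Submodule.subset_span ⟨[], by simp, by simp, by simp⟩

theorem iota_mem_uPart {θ : ZMod 2} {x : leBar F p n}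
    (h : IsHomog θ (x : Module.End F (O F p n))) : iota F p n x ∈ uPart F p n θ :=
  Submodule.subset_span ⟨[(x, θ)], by simpa using h, by simp, by simp⟩

theorem mul_mem_uPart {α β : ZMod 2} {u v : U F p n} (hu : u ∈ uPart F p n α)
    (hv : v ∈ uPart F p n β) : u * v ∈ uPart F p n (α + β) := by
  have h : uPart F p n α * uPart F p n β ≤ uPart F p n (α + β) := by
    rw [uPart, uPart, Submodule.span_mul_span, Submodule.span_le]
    rintro _ ⟨_, ⟨l, hl, hs, rfl⟩, _, ⟨l', hl', hs', rfl⟩, rfl⟩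
    refine Submodule.subset_span ⟨l ++ l', ?_, ?_, ?_⟩
    · intro t ht
      rcases List.mem_append.1 ht with h | h
      · exact hl t h
      · exact hl' t h
    · rw [List.map_append, List.sum_append, hs, hs']
    · simp
  exact h (Submodule.mul_mem_mul hu hv)

theorem iD_mem_uPart {α : ℕ} {f : O F p n} (hf : IsPar α f) :
    iD F p n f ∈ uPart F p n ((α + 1 : ℕ) : ZMod 2) := iota_mem_uPart (isHomog_De hf)

theorem iE_mem_uPart [Fact p.Prime] : iE F p n ∈ uPart F p n 0 := iota_mem_uPart isHomog_euler

theorem tau_of_mem_uPart [Fact p.Prime] {θ : ZMod 2} {u : U F p n} (hu : u ∈ uPart F p n θ) :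
    tau F p n u = (-1 : F) ^ θ.val • u := by
  induction hu using Submodule.span_induction with
  | zero => simp
  | add x y _ _ hx hy => rw [map_add, hx, hy, smul_add]
  | smul c x _ hx => rw [map_smul, hx, smul_comm]
  | mem x hx =>
    obtain ⟨l, hl, rfl, rfl⟩ := hx
    induction l with
    | nil => simp
    | cons t l ih =>
      rw [List.map_cons, List.prod_cons, List.map_cons, List.sum_cons, map_mul,
        ih fun t ht => hl t (List.mem_cons_of_mem _ ht), tau_iota (hl t List.mem_cons_self),
        neg_one_pow_val_add, smul_mul_smul_comm]

theorem zmod_two_cases (θ : ZMod 2) : θ = 0 ∨ θ = 1 := by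
  revert θ; decide

theorem uPart_sup [Fact p.Prime] : uPart F p n 0 ⊔ uPart F p n 1 = ⊤ := by
  have hle : ∀ θ, uPart F p n θ ≤ uPart F p n 0 ⊔ uPart F p n 1 := fun θ => by
    rcases zmod_two_cases θ with rfl | rfl
    · exact le_sup_left
    · exact le_sup_right
  have hD : ∀ f, iD F p n f ∈ uPart F p n 0 ⊔ uPart F p n 1 := fun f => by
    induction f using mon_induction with
    | zero => rw [map_zero]; exact zero_mem _
    | add a b ha hb => rw [map_add]; exact add_mem ha hb
    | smul c a ha => rw [map_smul]; exact Submodule.smul_mem _ _ ha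
    | mon r hr => exact hle _ (iD_mem_uPart (isPar_mon r))
  refine eq_top_iff.2 fun u _ => ?_
  have hu : u ∈ Algebra.adjoin F (Set.range (iota F p n)) := by rw [adjoin_iota]; trivial
  induction hu using Algebra.adjoin_induction with
  | mem x hx =>
    obtain ⟨y, rfl⟩ := hx
    obtain ⟨f, c, -, h⟩ := exists_iota_eq y
    rw [h]
    exact add_mem (hD f) (Submodule.smul_mem _ _ (hle 0 iE_mem_uPart))
  | algebraMap r =>
    rw [Algebra.algebraMap_eq_smul_one]
    exact Submodule.smul_mem _ _ (hle 0 one_mem_uPart)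
  | add x y _ _ hx hy => exact add_mem (hx trivial) (hy trivial)
  | mul x y _ _ hx hy =>
    obtain ⟨x0, hx0, x1, hx1, rfl⟩ := Submodule.mem_sup.1 (hx trivial)
    obtain ⟨y0, hy0, y1, hy1, rfl⟩ := Submodule.mem_sup.1 (hy trivial)
    rw [add_mul, mul_add, mul_add]
    exact add_mem (add_mem (hle _ (mul_mem_uPart hx0 hy0)) (hle _ (mul_mem_uPart hx0 hy1)))
      (add_mem (hle _ (mul_mem_uPart hx1 hy0)) (hle _ (mul_mem_uPart hx1 hy1)))

theorem exists_parts [Fact p.Prime] (u : U F p n) :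
    ∃ u₀ ∈ uPart F p n 0, ∃ u₁ ∈ uPart F p n 1, u = u₀ + u₁ := by
  have h : u ∈ uPart F p n 0 ⊔ uPart F p n 1 := by rw [uPart_sup]; trivial
  obtain ⟨x0, hx0, x1, hx1, rfl⟩ := Submodule.mem_sup.1 h
  exact ⟨x0, hx0, x1, hx1, rfl⟩

end Enveloping

/-! ### Subspaces of an algebra and nilpotency -/

section Subspaces

variable {F A : Type*} [Field F] [Ring A] [Algebra F A]

theorem sub_mul_mono_right {S T V : Submodule F A} (h : S ≤ T) : V * S ≤ V * T :=
  Submodule.smul_mono le_rfl h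

theorem sub_mul_mono_left {S T V : Submodule F A} (h : S ≤ T) : S * V ≤ T * V :=
  Submodule.smul_mono h le_rfl

theorem sub_pow_mul_le {V S : Submodule F A} (h : V * S ≤ S * V) (j : ℕ) :
    V ^ j * S ≤ S * V ^ j := by
  induction j with
  | zero => simp
  | succ j ih =>
    calc V ^ (j + 1) * S = V ^ j * (V * S) := by rw [pow_succ, mul_assoc]
      _ ≤ V ^ j * (S * V) := sub_mul_mono_right h
      _ = V ^ j * S * V := by rw [mul_assoc]
      _ ≤ S * V ^ j * V := sub_mul_mono_left ih
      _ = S * V ^ (j + 1) := by rw [pow_succ, mul_assoc]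

theorem sub_mul_pow_le {V S : Submodule F A} (h : V * S ≤ S * V) (j : ℕ) :
    (S * V) ^ j ≤ S ^ j * V ^ j := by
  induction j with
  | zero => simp
  | succ j ih =>
    calc (S * V) ^ (j + 1) = (S * V) ^ j * (S * V) := pow_succ _ _
      _ ≤ S ^ j * V ^ j * (S * V) := sub_mul_mono_left ih
      _ = S ^ j * (V ^ j * S) * V := by simp only [mul_assoc]
      _ ≤ S ^ j * (S * V ^ j) * V :=
        sub_mul_mono_left (sub_mul_mono_right (sub_pow_mul_le h j))
      _ = S ^ (j + 1) * V ^ (j + 1) := by simp only [pow_succ, mul_assoc]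

/-- A nilpotent subspace `S` stays nilpotent if a subspace `T` with a power in `S` that normalizes
`S` is added. -/
theorem nilpotent_sup {S T : Submodule F A} (h : T * S ≤ S * T ⊔ S) {k M : ℕ} (hk : T ^ k ≤ S)
    (hM : S ^ M = ⊥) : ∃ M', (S ⊔ T) ^ M' = ⊥ := by
  set V : Submodule F A := 1 ⊔ (S ⊔ T) with hV
  have h1 : (1 : Submodule F A) ≤ V := le_sup_left
  have hS : S ≤ S * V := by
    calc S = S * 1 := (mul_one S).symm
      _ ≤ S * V := sub_mul_mono_right h1
  have hTS : T * S ≤ S * V := by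
    refine h.trans (sup_le (sub_mul_mono_right ?_) hS)
    exact le_sup_right.trans le_sup_right
  have hVS : V * S ≤ S * V := by
    rw [hV, Submodule.sup_mul, Submodule.sup_mul, one_mul]
    exact sup_le hS (sup_le (sub_mul_mono_right (le_sup_left.trans le_sup_right)) hTS)
  have key : ∀ j, (S ⊔ T) ^ j ≤ T ^ j ⊔ S * V ^ j := by
    intro j
    induction j with
    | zero => simp
    | succ j ih =>
      have h2 : (S * V) * V ^ j = S * V ^ (j + 1) := by rw [mul_assoc, ← pow_succ']
      have h3 : T ^ j ≤ V ^ j := pow_le_pow_left' (le_sup_right.trans le_sup_right) j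
      have h4 : V ^ j ≤ V ^ (j + 1) := by
        calc V ^ j = V ^ j * 1 := (mul_one _).symm
          _ ≤ V ^ j * V := sub_mul_mono_right h1
          _ = _ := (pow_succ _ _).symm
      have h5 : S ≤ V := le_sup_left.trans le_sup_right
      calc (S ⊔ T) ^ (j + 1) = (S ⊔ T) * (S ⊔ T) ^ j := pow_succ' _ _
        _ ≤ (S ⊔ T) * (T ^ j ⊔ S * V ^ j) := sub_mul_mono_right ih
        _ = (S * T ^ j ⊔ S * (S * V ^ j)) ⊔ (T * T ^ j ⊔ T * (S * V ^ j)) := by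
          rw [Submodule.sup_mul, Submodule.mul_sup, Submodule.mul_sup]
        _ ≤ T ^ (j + 1) ⊔ S * V ^ (j + 1) := by
          refine sup_le (sup_le ?_ ?_) (sup_le ?_ ?_)
          · exact le_sup_of_le_right (sub_mul_mono_right (h3.trans h4))
          · refine le_sup_of_le_right (sub_mul_mono_right ?_)
            rw [pow_succ']
            exact sub_mul_mono_left h5
          · rw [pow_succ']; exact le_sup_left
          · refine le_sup_of_le_right ?_
            rw [← mul_assoc, ← h2]
            exact sub_mul_mono_left hTS
  have hk1 : (1 : Submodule F A) ≤ V ^ k := by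
    calc (1 : Submodule F A) = 1 ^ k := (one_pow k).symm
      _ ≤ V ^ k := pow_le_pow_left' h1 k
  have hk' : (S ⊔ T) ^ k ≤ S * V ^ k := by
    refine (key k).trans (sup_le (hk.trans ?_) le_rfl)
    calc S = S * 1 := (mul_one S).symm
      _ ≤ S * V ^ k := sub_mul_mono_right hk1
  refine ⟨k * M, eq_bot_iff.2 ?_⟩
  rw [pow_mul]
  refine (pow_le_pow_left' hk' M).trans ((sub_mul_pow_le (sub_pow_mul_le hVS k) M).trans ?_)
  rw [hM, Submodule.bot_mul]

theorem one_sup_pow_le (N : Submodule F A) (j : ℕ) :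
    (1 ⊔ N) ^ (j + 1) ≤ (1 ⊔ N) ^ j ⊔ N ^ (j + 1) := by
  induction j with
  | zero => simp
  | succ j ih =>
    calc (1 ⊔ N) ^ (j + 1 + 1) = (1 ⊔ N) * (1 ⊔ N) ^ (j + 1) := pow_succ' _ _
      _ ≤ (1 ⊔ N) * ((1 ⊔ N) ^ j ⊔ N ^ (j + 1)) := sub_mul_mono_right ih
      _ = (1 ⊔ N) ^ (j + 1) ⊔ (N ^ (j + 1) ⊔ N ^ (j + 1 + 1)) := by
        rw [Submodule.mul_sup, ← pow_succ', Submodule.sup_mul, one_mul, ← pow_succ']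
      _ ≤ _ := by
        refine sup_le le_sup_left (sup_le (le_sup_of_le_left ?_) le_sup_right)
        exact pow_le_pow_left' le_sup_right _

theorem one_le_one_sup_pow (N : Submodule F A) (j : ℕ) : (1 : Submodule F A) ≤ (1 ⊔ N) ^ j := by
  calc (1 : Submodule F A) = 1 ^ j := (one_pow j).symm
    _ ≤ _ := pow_le_pow_left' le_sup_left j

theorem one_sup_pow_le' (N : Submodule F A) (j : ℕ) :
    (1 ⊔ N) ^ j ≤ 1 ⊔ N * (1 ⊔ N) ^ j := by
  induction j with
  | zero => simp
  | succ j ih =>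
    have h : (1 ⊔ N) ^ j ≤ (1 ⊔ N) ^ (j + 1) := by
      calc (1 ⊔ N) ^ j = 1 * (1 ⊔ N) ^ j := (one_mul _).symm
        _ ≤ _ := by rw [pow_succ']; exact sub_mul_mono_left le_sup_left
    calc (1 ⊔ N) ^ (j + 1) = (1 ⊔ N) ^ j ⊔ N * (1 ⊔ N) ^ j := by
          rw [pow_succ', Submodule.sup_mul, one_mul]
      _ ≤ (1 ⊔ N * (1 ⊔ N) ^ j) ⊔ N * (1 ⊔ N) ^ j := sup_le_sup_right ih _
      _ ≤ _ := by
        have h2 : N * (1 ⊔ N) ^ j ≤ N * (1 ⊔ N) ^ (j + 1) := sub_mul_mono_right h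
        exact sup_le (sup_le le_sup_left (le_sup_of_le_right h2)) (le_sup_of_le_right h2)

/-- If `N` is nilpotent, then `(1 + N) ^ M` is closed under multiplication by `N`. -/
theorem mul_one_sup_pow_le {N : Submodule F A} {M : ℕ} (hM : N ^ M = ⊥) :
    N * (1 ⊔ N) ^ M ≤ (1 ⊔ N) ^ M := by
  calc N * (1 ⊔ N) ^ M ≤ (1 ⊔ N) * (1 ⊔ N) ^ M := sub_mul_mono_left le_sup_right
    _ = (1 ⊔ N) ^ (M + 1) := (pow_succ' _ _).symm
    _ ≤ (1 ⊔ N) ^ M ⊔ N ^ (M + 1) := one_sup_pow_le N M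
    _ ≤ _ := by rw [pow_succ, hM, Submodule.bot_mul, sup_bot_eq]

theorem one_sup_pow_mul_le_mul (N : Submodule F A) (M : ℕ) :
    (1 ⊔ N) ^ M * N ≤ N * (1 ⊔ N) ^ M := by
  refine sub_pow_mul_le ?_ M
  rw [Submodule.sup_mul, Submodule.mul_sup, one_mul, mul_one]

/-- Straightening: if `B` normalizes `N` and maps `M₀` to itself modulo `J`, then it also maps
`(1 + N) ^ j M₀` to itself modulo `J`. -/
theorem straighten {B N M₀ J : Submodule F A} (h : B * N ≤ N * B ⊔ (B ⊔ N))
    (hB : B * M₀ ≤ M₀ ⊔ J) (hJ : N * J ≤ J) (j : ℕ) :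
    B * ((1 ⊔ N) ^ j * M₀) ≤ (1 ⊔ N) ^ j * M₀ ⊔ J := by
  induction j with
  | zero => simpa using hB
  | succ j ih =>
    set G : Submodule F A := (1 ⊔ N) ^ j * M₀ with hG
    have h0 : (1 ⊔ N) ^ (j + 1) * M₀ = G ⊔ N * G := by
      rw [pow_succ', mul_assoc, Submodule.sup_mul, one_mul]
    have hNG : N * (G ⊔ J) ≤ (G ⊔ N * G) ⊔ J := by
      rw [Submodule.mul_sup]
      exact sup_le (le_sup_of_le_left le_sup_right) (hJ.trans le_sup_right)
    rw [h0, Submodule.mul_sup]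
    refine sup_le (ih.trans (sup_le_sup_right le_sup_left _)) ?_
    calc B * (N * G) = B * N * G := (mul_assoc _ _ _).symm
      _ ≤ (N * B ⊔ (B ⊔ N)) * G := sub_mul_mono_left h
      _ = N * (B * G) ⊔ (B * G ⊔ N * G) := by rw [Submodule.sup_mul, Submodule.sup_mul, mul_assoc]
      _ ≤ _ := by
        refine sup_le ((sub_mul_mono_right ih).trans hNG) (sup_le ?_ ?_)
        · exact ih.trans (sup_le_sup_right le_sup_left _)
        · exact le_sup_of_le_left le_sup_right

end Subspaces

/-! ### Weights and triangular decompositions -/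

section Triangular

variable {F : Type*} [Field F] {p n : ℕ}

theorem neg_one_smul_U (x : U F p n) : (-1 : F) • x = -x := neg_one_smul F x

/-- A grading of the Lie superalgebra that vanishes on the Cartan subalgebra. -/
structure IsGrading (p n : ℕ) (φ : (Var n → ℕ) → ℤ) : Prop where
  contr : ∀ a b c, c ∈ Contr p a b → φ c = φ a + φ b
  cartan : ∀ i : Fin n, φ (unit (Sum.inl i) + unit (Sum.inr i)) = 0

/-- A grading whose part of nonnegative degree is, up to the Cartan subalgebra, contained in
`𝔫_m^+`. -/
structure Good (p n m : ℕ) (φ : (Var n → ℕ) → ℤ) : Prop extends IsGrading p n φ where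
  pos : ∀ a, Valid p n a → 0 ≤ φ a →
    a = 0 ∨ (∃ i : Fin n, a = unit (Sum.inl i) + unit (Sum.inr i)) ∨ a ∈ posExp n m

variable (F p) in
/-- The span of the `De_{x^{(a)}}`, `a ∈ S`, in the restricted enveloping algebra. -/
def iDS (S : Set (Var n → ℕ)) : Submodule F (U F p n) :=
  Submodule.span F ((fun a => iD F p n (mon F p a)) '' S)

theorem iD_mem_iDS {S : Set (Var n → ℕ)} {f : O F p n}
    (h : f ∈ Submodule.span F ((fun a => mon F p a) '' S)) : iD F p n f ∈ iDS F p S := by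
  have h2 := Submodule.mem_map_of_mem (f := iD F p n) h
  rw [Submodule.map_span, ← Set.image_comp] at h2
  exact h2

theorem mem_iDS {S : Set (Var n → ℕ)} {a : Var n → ℕ} (h : a ∈ S) :
    iD F p n (mon F p a) ∈ iDS F p S := Submodule.subset_span ⟨a, h, rfl⟩

theorem iDS_mono {S T : Set (Var n → ℕ)} (h : S ⊆ T) : iDS F p S ≤ iDS F p T :=
  Submodule.span_mono (Set.image_mono h)

/-- The bracket of two monomials is in the span of the contractions. -/
theorem iD_mul_mem [Fact p.Prime] [CharP F p] (a b : Var n → ℕ) : ∃ s : F,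
    iD F p n (mon F p a) * iD F p n (mon F p b) -
      s • (iD F p n (mon F p b) * iD F p n (mon F p a)) ∈ iDS F p (Contr p a b) := by
  refine ⟨(-1) ^ ((oddDeg a + 1) * (oddDeg b + 1)), ?_⟩
  rw [iD_bracket (isPar_mon a) (isPar_mon b), add_sub_cancel_left]
  exact iD_mem_iDS (De_mon_mem a b)

theorem iDS_nilpotent_aux [Fact p.Prime] [CharP F p] (hp : 3 < p) {φ : (Var n → ℕ) → ℤ}
    (hφ : IsGrading p n φ) (s : Finset (Var n → ℕ)) :
    (∀ a ∈ s, Valid p n a ∧ φ a < 0) →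
    (∀ a ∈ s, ∀ b, Valid p n b → φ b < φ a → b ∈ s) →
    ∃ M, iDS F p (s : Set (Var n → ℕ)) ^ M = ⊥ := by
  induction s using Finset.induction_on_max_value φ with
  | empty => exact fun _ _ => ⟨1, by simp [iDS]⟩
  | insert a s has hmax ih =>
    intro hneg hlow
    obtain ⟨M, hM⟩ := ih (fun b hb => hneg b (Finset.mem_insert_of_mem hb)) fun b hb c hc hcb => by
      rcases Finset.mem_insert.1 (hlow b (Finset.mem_insert_of_mem hb) c hc hcb) with rfl | h
      · exact absurd (hmax b hb) (not_le.2 hcb)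
      · exact h
    obtain ⟨hva, hna⟩ := hneg a (Finset.mem_insert_self _ _)
    -- everything of smaller weight than `a` lies in `s`
    have hlt : ∀ c, Valid p n c → φ c < φ a → c ∈ s := fun c hc hca => by
      rcases Finset.mem_insert.1 (hlow a (Finset.mem_insert_self _ _) c hc hca) with rfl | h
      · exact absurd hca (lt_irrefl _)
      · exact h
    have hbr : ∀ b ∈ insert a s, Contr p a b ⊆ (s : Set (Var n → ℕ)) := fun b hb c hc => by
      refine hlt c hc.1 ?_
      have := hφ.contr a b c hc
      have := (hneg b hb).2
      omega
    have hsup : iDS F p ((insert a s : Finset _) : Set (Var n → ℕ)) =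
        iDS F p (s : Set _) ⊔ Submodule.span F {iD F p n (mon F p a)} := by
      rw [iDS, Finset.coe_insert, Set.image_insert_eq, Submodule.span_insert, sup_comm]
      rfl
    have hTS : Submodule.span F {iD F p n (mon F p a)} * iDS F p (s : Set _) ≤
        iDS F p (s : Set _) * Submodule.span F {iD F p n (mon F p a)} ⊔ iDS F p (s : Set _) := by
      rw [iDS, Submodule.span_mul_span, Submodule.span_le]
      rintro _ ⟨x, rfl, _, ⟨b, hb, rfl⟩, rfl⟩
      obtain ⟨c, hc⟩ := iD_mul_mem (F := F) (p := p) a b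
      change iD F p n (mon F p a) * iD F p n (mon F p b) ∈ _
      rw [← sub_add_cancel (iD F p n (mon F p a) * iD F p n (mon F p b))
        (c • (iD F p n (mon F p b) * iD F p n (mon F p a)))]
      refine add_mem (Submodule.mem_sup_right ?_) (Submodule.mem_sup_left ?_)
      · exact iDS_mono (hbr b (Finset.mem_insert_of_mem hb)) hc
      · exact Submodule.smul_mem _ _ (Submodule.mul_mem_mul (mem_iDS hb)
          (Submodule.mem_span_singleton_self _))
    have hpow : ∃ k, Submodule.span F {iD F p n (mon F p a)} ^ k ≤ iDS F p (s : Set _) := by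
      rcases Nat.even_or_odd (oddDeg a) with he | ho
      · refine ⟨2, ?_⟩
        rw [Submodule.span_pow, Set.singleton_pow, Submodule.span_singleton_le_iff_mem]
        have h1 := iD_bracket (F := F) (p := p) (isPar_mon a) (isPar_mon a)
        have h2 : (-1 : F) ^ ((oddDeg a + 1) * (oddDeg a + 1)) = -1 :=
          (he.add_one.mul he.add_one).neg_one_pow
        have h3 : (2 : F) • iD F p n (mon F p a) ^ 2 ∈ iDS F p (s : Set _) := by
          have : (2 : F) • iD F p n (mon F p a) ^ 2 =
              iD F p n (De F p n (mon F p a) (mon F p a)) := by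
            rw [h2, neg_one_smul_U] at h1
            rw [two_smul, pow_two]
            exact eq_neg_add_iff_add_eq.1 h1
          rw [this]
          exact iDS_mono (hbr a (Finset.mem_insert_self _ _)) (iD_mem_iDS (De_mon_mem a a))
        exact (Submodule.smul_mem_iff _ (two_ne_zero' hp)).1 h3
      · refine ⟨p, ?_⟩
        rw [Submodule.span_pow, Set.singleton_pow, Submodule.span_singleton_le_iff_mem,
          iD_pow_char hp hva ho fun i hi => ?_]
        · exact zero_mem _
        · rw [hi, hφ.cartan] at hna; exact lt_irrefl _ hna
    obtain ⟨k, hk⟩ := hpow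
    rw [hsup]
    exact nilpotent_sup hTS hk hM

theorem finite_valid (p n : ℕ) : {a | Valid p n a}.Finite := by
  refine (Set.Finite.pi' (t := fun _ : Var n => Set.Iic (p + 1)) fun _ =>
    Set.finite_Iic _).subset fun a ha v => ?_
  rcases v with i | i
  · exact (ha.1 i).le.trans (Nat.le_succ _)
  · exact (ha.2 i).trans (by omega)

variable (F p) in
/-- The part of negative degree. -/
abbrev negPart (φ : (Var n → ℕ) → ℤ) : Submodule F (U F p n) := iDS F p {a | Valid p n a ∧ φ a < 0}

variable (F p) in
/-- The part of nonnegative degree. -/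
abbrev nonnegPart (φ : (Var n → ℕ) → ℤ) : Submodule F (U F p n) :=
  iDS F p {a | Valid p n a ∧ 0 ≤ φ a} ⊔ Submodule.span F {iE F p n}

/-- The negative part generates a nilpotent algebra: its basis elements can be added one by one in
the order of their weights, each of them normalizing the span of the previous ones. -/
theorem negPart_nilpotent [Fact p.Prime] [CharP F p] (hp : 3 < p) {φ : (Var n → ℕ) → ℤ}
    (hφ : IsGrading p n φ) : ∃ M, negPart F p φ ^ M = ⊥ := by
  have hf : {a | Valid p n a ∧ φ a < 0}.Finite := (finite_valid p n).subset fun a h => h.1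
  obtain ⟨M, hM⟩ := iDS_nilpotent_aux (F := F) hp hφ hf.toFinset (by simp) (by
    simp only [Set.Finite.mem_toFinset, Set.mem_ofPred_eq]
    exact fun a ha b hb hba => ⟨hb, hba.trans ha.2⟩)
  rw [Set.Finite.coe_toFinset] at hM
  exact ⟨M, hM⟩

theorem iDS_valid_le (φ : (Var n → ℕ) → ℤ) (S : Set (Var n → ℕ)) (hS : ∀ a ∈ S, Valid p n a) :
    iDS F p S ≤ nonnegPart F p φ ⊔ negPart F p φ := by
  rw [iDS, Submodule.span_le]
  rintro _ ⟨a, ha, rfl⟩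
  rcases le_or_gt 0 (φ a) with h | h
  · exact Submodule.mem_sup_left (Submodule.mem_sup_left (mem_iDS ⟨hS a ha, h⟩))
  · exact Submodule.mem_sup_right (mem_iDS ⟨hS a ha, h⟩)

theorem nonnegPart_mul_negPart [Fact p.Prime] [CharP F p] (φ : (Var n → ℕ) → ℤ) :
    nonnegPart F p φ * negPart F p φ ≤
      negPart F p φ * nonnegPart F p φ ⊔ (nonnegPart F p φ ⊔ negPart F p φ) := by
  rw [nonnegPart, Submodule.sup_mul]
  refine sup_le ?_ ?_
  · nth_rewrite 1 [iDS]
    nth_rewrite 1 [negPart, iDS]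
    rw [Submodule.span_mul_span, Submodule.span_le]
    rintro _ ⟨_, ⟨a, ha, rfl⟩, _, ⟨b, hb, rfl⟩, rfl⟩
    obtain ⟨c, hc⟩ := iD_mul_mem (F := F) (p := p) a b
    change iD F p n (mon F p a) * iD F p n (mon F p b) ∈ _
    rw [← sub_add_cancel (iD F p n (mon F p a) * iD F p n (mon F p b))
      (c • (iD F p n (mon F p b) * iD F p n (mon F p a)))]
    refine add_mem (Submodule.mem_sup_right ?_) (Submodule.mem_sup_left ?_)
    · exact iDS_valid_le φ _ (fun _ h => h.1) hc
    · exact Submodule.smul_mem _ _ (Submodule.mul_mem_mul (mem_iDS hb)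
        (Submodule.mem_sup_left (mem_iDS ha)))
  · nth_rewrite 1 [negPart, iDS]
    rw [Submodule.span_mul_span, Submodule.span_le]
    rintro _ ⟨_, rfl, _, ⟨b, hb, rfl⟩, rfl⟩
    rw [SetLike.mem_coe]
    change iE F p n * iD F p n (mon F p b) ∈ _
    rw [iE_iD]
    refine add_mem (Submodule.mem_sup_left ?_) (Submodule.mem_sup_right ?_)
    · exact Submodule.mul_mem_mul (mem_iDS hb)
        (Submodule.mem_sup_right (Submodule.mem_span_singleton_self _))
    · exact Submodule.mem_sup_right (Submodule.smul_mem _ _ (mem_iDS hb))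

theorem iD_mem_parts (φ : (Var n → ℕ) → ℤ) (f : O F p n) :
    iD F p n f ∈ nonnegPart F p φ ⊔ negPart F p φ := by
  induction f using mon_induction with
  | zero => rw [map_zero]; exact zero_mem _
  | add a b ha hb => rw [map_add]; exact add_mem ha hb
  | smul c a ha => rw [map_smul]; exact Submodule.smul_mem _ _ ha
  | mon r hr => exact iDS_valid_le φ {r} (by simpa using hr) (mem_iDS rfl)

/-- A subspace stable under the two parts is a left ideal. -/
theorem top_mul_le_of_parts (φ : (Var n → ℕ) → ℤ) {K : Submodule F (U F p n)}
    (h1 : nonnegPart F p φ * K ≤ K) (h2 : negPart F p φ * K ≤ K) :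
    ∀ u, ∀ x ∈ K, u * x ∈ K := by
  intro u
  have hu : u ∈ Algebra.adjoin F (Set.range (iota F p n)) := by rw [adjoin_iota]; trivial
  induction hu using Algebra.adjoin_induction with
  | mem y hy =>
    obtain ⟨z, rfl⟩ := hy
    intro x hx
    obtain ⟨f, c, -, h⟩ := exists_iota_eq z
    have h3 : iota F p n z ∈ nonnegPart F p φ ⊔ negPart F p φ := by
      rw [h]
      exact add_mem (iD_mem_parts φ f) (Submodule.smul_mem _ _ (Submodule.mem_sup_left
        (Submodule.mem_sup_right (Submodule.mem_span_singleton_self _))))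
    have h4 : (nonnegPart F p φ ⊔ negPart F p φ) * K ≤ K := by
      rw [Submodule.sup_mul]; exact sup_le h1 h2
    exact h4 (Submodule.mul_mem_mul h3 hx)
  | algebraMap r =>
    intro x hx
    rw [Algebra.algebraMap_eq_smul_one, smul_mul_assoc, one_mul]
    exact Submodule.smul_mem _ _ hx
  | add y z _ _ hy hz => intro x hx; rw [add_mul]; exact add_mem (hy x hx) (hz x hx)
  | mul y z _ _ hy hz => intro x hx; rw [mul_assoc]; exact hy _ (hz x hx)

end Triangular

/-! ### The maximal left ideal of a weight -/

section MaxIdeal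

variable {F : Type*} [Field F] {p n : ℕ}

variable (F p n) in
/-- The left ideal of the restricted enveloping algebra that annihilates the highest weight vector
of `L^{𝔟_m}(lam)`. -/
def annIdeal (m : ℕ) (lam : Module.Dual F (hBar F p n)) : Submodule (U F p n) (U F p n) :=
  (vermaRad F p n m lam).comap (vermaIdeal F p n m lam).mkQ

variable {m : ℕ} {lam : Module.Dual F (hBar F p n)}

theorem hBar_le : hBar F p n ≤ leBar F p n := by
  rw [hBar, Submodule.span_le]
  rintro _ (⟨j, rfl⟩ | rfl)
  · exact Submodule.mem_sup_left ⟨_, rfl⟩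
  · exact Submodule.mem_sup_right (Submodule.mem_span_singleton_self _)

theorem nPlus_le : nPlus F p n m ≤ leBar F p n := by
  rw [nPlus, Submodule.span_le]
  rintro _ ⟨a, -, rfl⟩
  exact Submodule.mem_sup_left ⟨_, rfl⟩

theorem vermaIdeal_le {J : Submodule (U F p n) (U F p n)} [Fact p.Prime]
    (h1 : ∀ a, Valid p n a → a ∈ posExp n m → iD F p n (mon F p a) ∈ J)
    (h2 : ∀ j, iH F p j - algebraMap F _ (lam (hDe' F p j)) ∈ J)
    (h3 : iE F p n - algebraMap F _ (lam (euler' F p)) ∈ J) : vermaIdeal F p n m lam ≤ J := by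
  have hsm : ∀ (c : F) x, x ∈ J → c • x ∈ J := fun c x hx => by
    rw [Algebra.smul_def]; exact J.smul_mem _ hx
  rw [vermaIdeal, Submodule.span_le]
  rintro _ (⟨x, hx, rfl⟩ | ⟨x, h, hxh, rfl⟩)
  · have : ∀ (y) (hy : y ∈ nPlus F p n m), iota F p n ⟨y, nPlus_le hy⟩ ∈ J := fun y hy => by
      induction hy using Submodule.span_induction with
      | zero => exact (map_zero (iota F p n)).symm ▸ zero_mem J
      | add y z hy hz h1 h2 =>
        have : iota F p n ⟨y + z, nPlus_le (add_mem hy hz)⟩ = iota F p n ⟨y, nPlus_le hy⟩ +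
          iota F p n ⟨z, nPlus_le hz⟩ := by rw [← map_add]; rfl
        rw [this]; exact add_mem h1 h2
      | smul c y hy h1 =>
        have : iota F p n ⟨c • y, nPlus_le (Submodule.smul_mem _ _ hy)⟩ =
          c • iota F p n ⟨y, nPlus_le hy⟩ := by rw [← map_smul]; rfl
        rw [this]; exact hsm _ _ h1
      | mem y hy =>
        obtain ⟨a, ⟨ha, ha'⟩, rfl⟩ := hy
        exact h1 a ha ha'
    exact this x.1 hx
  · have : ∀ (y) (hy : y ∈ hBar F p n), iota F p n ⟨y, hBar_le hy⟩ -
        algebraMap F _ (lam ⟨y, hy⟩) ∈ J := fun y hy => by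
      induction hy using Submodule.span_induction with
      | zero =>
        have e1 : iota F p n ⟨0, hBar_le (zero_mem _)⟩ = 0 := map_zero (iota F p n)
        have e2 : lam ⟨0, zero_mem _⟩ = 0 := map_zero lam
        rw [e1, e2, map_zero, sub_zero]; exact zero_mem _
      | add y z hy hz h1 h2 =>
        have e1 : iota F p n ⟨y + z, hBar_le (add_mem hy hz)⟩ = iota F p n ⟨y, hBar_le hy⟩ +
          iota F p n ⟨z, hBar_le hz⟩ := by rw [← map_add]; rfl
        have e2 : lam ⟨y + z, add_mem hy hz⟩ = lam ⟨y, hy⟩ + lam ⟨z, hz⟩ := by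
          rw [← map_add]; rfl
        rw [e1, e2, map_add, add_sub_add_comm]; exact add_mem h1 h2
      | smul c y hy h1 =>
        have e1 : iota F p n ⟨c • y, hBar_le (Submodule.smul_mem _ _ hy)⟩ =
          c • iota F p n ⟨y, hBar_le hy⟩ := by rw [← map_smul]; rfl
        have e2 : lam ⟨c • y, Submodule.smul_mem _ _ hy⟩ = c * lam ⟨y, hy⟩ := by
          rw [← smul_eq_mul, ← map_smul]; rfl
        rw [e1, e2, map_mul, ← Algebra.smul_def]
        exact (smul_sub c _ _).subst (motive := fun t => t ∈ J) (hsm c _ h1)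
      | mem y hy =>
        rcases hy with ⟨j, rfl⟩ | rfl
        · exact h2 j
        · exact h3
    have h4 := this h.1 h.2
    have h5 : x = ⟨h.1, hBar_le h.2⟩ := Subtype.ext hxh
    rw [h5]
    exact h4

theorem iD_mem_vermaIdeal {a : Var n → ℕ} (h : Valid p n a) (ha : a ∈ posExp n m) :
    iD F p n (mon F p a) ∈ vermaIdeal F p n m lam :=
  Submodule.subset_span (Or.inl ⟨_, Submodule.subset_span ⟨a, ⟨h, ha⟩, rfl⟩, rfl⟩)

theorem iH_mem_vermaIdeal [Fact p.Prime] (j : Fin n) :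
    iH F p j - algebraMap F _ (lam (hDe' F p j)) ∈ vermaIdeal F p n m lam :=
  Submodule.subset_span (Or.inr ⟨_, hDe' F p j, rfl, rfl⟩)

theorem iE_mem_vermaIdeal [Fact p.Prime] :
    iE F p n - algebraMap F _ (lam (euler' F p)) ∈ vermaIdeal F p n m lam :=
  Submodule.subset_span (Or.inr ⟨_, euler' F p, rfl, rfl⟩)

theorem vermaIdeal_le_annIdeal : vermaIdeal F p n m lam ≤ annIdeal F p n m lam := fun u hu => by
  rw [annIdeal, Submodule.mem_comap]
  have : (vermaIdeal F p n m lam).mkQ u = 0 := by simpa using hu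
  rw [this]; exact zero_mem _

/-- A left ideal is stable under the parity automorphism. -/
def TauStable [Fact p.Prime] (J : Submodule (U F p n) (U F p n)) : Prop :=
  ∀ u ∈ J, tau F p n u ∈ J

theorem tauStable_of_span [Fact p.Prime] {S : Set (U F p n)}
    (h : ∀ u ∈ S, ∃ c : F, tau F p n u = c • u) : TauStable (Submodule.span (U F p n) S) := by
  intro u hu
  induction hu using Submodule.span_induction with
  | zero => rw [map_zero]; exact zero_mem _
  | add x y _ _ hx hy => rw [map_add]; exact add_mem hx hy
  | smul c x _ hx => rw [smul_eq_mul, map_mul]; exact Submodule.smul_mem _ _ hx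
  | mem x hx =>
    obtain ⟨c, hc⟩ := h x hx
    rw [hc, Algebra.smul_def]
    exact Submodule.smul_mem _ _ (Submodule.subset_span hx)

theorem tau_iD_mon [Fact p.Prime] (a : Var n → ℕ) :
    tau F p n (iD F p n (mon F p a)) = (-1 : F) ^ (oddDeg a + 1) • iD F p n (mon F p a) :=
  tau_iD (isPar_mon a)

theorem tau_iH [Fact p.Prime] (j : Fin n) : tau F p n (iH F p j) = iH F p j := by
  rw [iH, tau_iD_mon, oddDeg_pair]; simp

theorem tauStable_vermaIdeal [Fact p.Prime] : TauStable (vermaIdeal F p n m lam) := by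
  set J : Submodule (U F p n) (U F p n) := Submodule.span (U F p n)
    ((fun a => iD F p n (mon F p a)) '' {a | Valid p n a ∧ a ∈ posExp n m} ∪
      (Set.range (fun j => iH F p j - algebraMap F _ (lam (hDe' F p j))) ∪
        {iE F p n - algebraMap F _ (lam (euler' F p))})) with hJ
  have h : vermaIdeal F p n m lam = J := by
    refine le_antisymm (vermaIdeal_le (fun a h1 h2 => ?_) (fun j => ?_) ?_) ?_
    · exact Submodule.subset_span (Or.inl ⟨a, ⟨h1, h2⟩, rfl⟩)
    · exact Submodule.subset_span (Or.inr (Or.inl ⟨j, rfl⟩))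
    · exact Submodule.subset_span (Or.inr (Or.inr rfl))
    · rw [hJ, Submodule.span_le]
      rintro _ (⟨a, ⟨h1, h2⟩, rfl⟩ | ⟨j, rfl⟩ | rfl)
      · exact iD_mem_vermaIdeal h1 h2
      · exact iH_mem_vermaIdeal j
      · exact iE_mem_vermaIdeal
  rw [h]
  refine tauStable_of_span ?_
  rintro _ (⟨a, ⟨h1, h2⟩, rfl⟩ | ⟨j, rfl⟩ | rfl)
  · exact ⟨_, tau_iD_mon a⟩
  · exact ⟨1, by rw [map_sub, tau_iH, AlgHom.commutes, one_smul]⟩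
  · exact ⟨1, by rw [map_sub, tau_iE, AlgHom.commutes, one_smul]⟩

theorem tau_add_of_parts [Fact p.Prime] {u₀ u₁ : U F p n} (h0 : u₀ ∈ uPart F p n 0)
    (h1 : u₁ ∈ uPart F p n 1) : tau F p n (u₀ + u₁) = u₀ - u₁ := by
  rw [map_add, tau_of_mem_uPart h0, tau_of_mem_uPart h1, sub_eq_add_neg, ← neg_one_smul_U]
  simp [ZMod.val_one]

theorem half_mem (h2 : (2 : F) ≠ 0) {J : Submodule (U F p n) (U F p n)} {x : U F p n}
    (h : x + x ∈ J) : x ∈ J := by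
  have : x = algebraMap F (U F p n) (2 : F)⁻¹ • (x + x) := by
    rw [smul_eq_mul, ← Algebra.smul_def, ← two_smul F x, smul_smul, inv_mul_cancel₀ h2, one_smul]
  rw [this]
  exact J.smul_mem _ h

theorem tauStable_parts [Fact p.Prime] (h2 : (2 : F) ≠ 0) {J : Submodule (U F p n) (U F p n)}
    (hJ : TauStable J) {u₀ u₁ : U F p n} (h0 : u₀ ∈ uPart F p n 0)
    (h1 : u₁ ∈ uPart F p n 1) (h : u₀ + u₁ ∈ J) : u₀ ∈ J ∧ u₁ ∈ J := by
  have h3 := hJ _ h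
  rw [tau_add_of_parts h0 h1] at h3
  have h4 : u₀ ∈ J := half_mem h2 (by simpa using add_mem h h3)
  exact ⟨h4, by simpa using sub_mem h h4⟩

theorem le_annIdeal [Fact p.Prime] (h2 : (2 : F) ≠ 0) {J : Submodule (U F p n) (U F p n)}
    (hI : vermaIdeal F p n m lam ≤ J) (hJ : TauStable J) (htop : J ≠ ⊤) :
    J ≤ annIdeal F p n m lam := by
  have hcm : (J.map (vermaIdeal F p n m lam).mkQ).comap (vermaIdeal F p n m lam).mkQ = J := by
    rw [Submodule.comap_map_mkQ]; exact sup_eq_right.2 hI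
  have h : J.map (vermaIdeal F p n m lam).mkQ ≤ vermaRad F p n m lam := by
    refine le_sSup ⟨?_, fun h => htop ?_⟩
    · rintro _ ⟨u, hu, rfl⟩
      obtain ⟨u₀, h0, u₁, h1, rfl⟩ := exists_parts u
      obtain ⟨h3, h4⟩ := tauStable_parts h2 hJ h0 h1 hu
      exact ⟨_, ⟨u₀, h3, rfl⟩, _, ⟨u₁, h4, rfl⟩, ⟨u₀, h0, rfl⟩, ⟨u₁, h1, rfl⟩, map_add _ _ _⟩
    · rw [← hcm, h, Submodule.comap_top]
  exact Submodule.map_le_iff_le_comap.1 h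

/-- Elements of the radical lift to sums of elements of proper left ideals. -/
theorem annIdeal_induction {P : U F p n → Prop}
    (hmem : ∀ N : Submodule (U F p n) (Verma F p n m lam), IsGraded N → N ≠ ⊤ →
      ∀ u, (vermaIdeal F p n m lam).mkQ u ∈ N → P u)
    (hzero : ∀ u ∈ vermaIdeal F p n m lam, P u) (hadd : ∀ u v, P u → P v → P (u + v))
    {u : U F p n} (hu : u ∈ annIdeal F p n m lam) : P u := by
  have key : ∀ x ∈ vermaRad F p n m lam, ∀ u, (vermaIdeal F p n m lam).mkQ u = x → P u := by
    intro x hx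
    rw [vermaRad, sSup_eq_iSup'] at hx
    induction hx using Submodule.iSup_induction' with
    | mem N x hx => rintro u rfl; exact hmem N.1 N.2.1 N.2.2 u hx
    | zero => intro u h; exact hzero u (by simpa using h)
    | add x y hx hy h1 h2 =>
      intro u h
      obtain ⟨v, rfl⟩ := Submodule.mkQ_surjective _ x
      have := hadd v (u - v) (h1 v rfl) (h2 _ (by rw [map_sub, h, add_sub_cancel_left]))
      rwa [add_sub_cancel] at this
  exact key _ hu u rfl

theorem tauStable_annIdeal [Fact p.Prime] : TauStable (annIdeal F p n m lam) := by
  intro u hu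
  refine annIdeal_induction (P := fun u => tau F p n u ∈ annIdeal F p n m lam) ?_
    (fun u hu => vermaIdeal_le_annIdeal (tauStable_vermaIdeal u hu))
    (fun u v hu hv => by rw [map_add]; exact add_mem hu hv) hu
  intro N hN hN' u hu
  obtain ⟨_, hx0, _, hx1, ⟨u₀, h0, rfl⟩, ⟨u₁, h1, rfl⟩, h⟩ := hN _ hu
  have h3 : u - (u₀ + u₁) ∈ vermaIdeal F p n m lam := by
    rw [← map_add] at h
    exact (Submodule.Quotient.eq _).1 h
  have h4 := vermaIdeal_le_annIdeal (tauStable_vermaIdeal _ h3)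
  rw [map_sub, tau_add_of_parts h0 h1] at h4
  have hle : N ≤ vermaRad F p n m lam := le_sSup ⟨hN, hN'⟩
  have h5 : u₀ - u₁ ∈ annIdeal F p n m lam := by
    have e0 : u₀ ∈ annIdeal F p n m lam := hle hx0
    have e1 : u₁ ∈ annIdeal F p n m lam := hle hx1
    exact sub_mem e0 e1
  have h6 := add_mem h4 h5
  rwa [sub_add_cancel] at h6

end MaxIdeal

/-! ### Singular vectors -/

section Singular

variable {F : Type*} [Field F] {p n : ℕ}

theorem mul_mem_of_leftIdeal (J : Submodule (U F p n) (U F p n)) (N : Submodule F (U F p n)) :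
    N * J.restrictScalars F ≤ J.restrictScalars F := by
  rw [Submodule.mul_le]
  intro u _ x hx
  exact J.smul_mem u hx

/-- The left ideal given by an `F`-subspace stable under the two parts. -/
def toLeftIdeal (K : Submodule F (U F p n)) (h : ∀ u, ∀ x ∈ K, u * x ∈ K) :
    Submodule (U F p n) (U F p n) where
  carrier := K
  add_mem' := K.add_mem
  zero_mem' := K.zero_mem
  smul_mem' u x hx := h u x hx

variable {m : ℕ} {lam : Module.Dual F (hBar F p n)} {φ : (Var n → ℕ) → ℤ}

theorem leftIdeal_eq_top {J : Submodule (U F p n) (U F p n)} {x : U F p n} (hx : x ∈ J)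
    (h : IsUnit x) : J = ⊤ := by
  obtain ⟨u, rfl⟩ := h
  rw [Submodule.eq_top_iff']
  intro y
  have := J.smul_mem (y * ↑u⁻¹) hx
  rwa [smul_eq_mul, mul_assoc, Units.inv_mul, mul_one] at this

/-- The subspace `(1 + N)^M M₀ + J` generated from `M₀` by the negative part is a left ideal. -/
theorem straighten_leftIdeal [Fact p.Prime] [CharP F p] {M : ℕ} (hM : negPart F p φ ^ M = ⊥)
    (J : Submodule (U F p n) (U F p n)) {M₀ : Submodule F (U F p n)}
    (hB : nonnegPart F p φ * M₀ ≤ M₀ ⊔ J.restrictScalars F) : ∀ u,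
    ∀ x ∈ (1 ⊔ negPart F p φ) ^ M * M₀ ⊔ J.restrictScalars F,
      u * x ∈ (1 ⊔ negPart F p φ) ^ M * M₀ ⊔ J.restrictScalars F := by
  refine top_mul_le_of_parts φ ?_ ?_
  · rw [Submodule.mul_sup]
    exact sup_le (straighten (nonnegPart_mul_negPart φ) hB (mul_mem_of_leftIdeal J _) M)
      ((mul_mem_of_leftIdeal J _).trans le_sup_right)
  · rw [Submodule.mul_sup]
    refine sup_le (le_sup_of_le_left ?_) ((mul_mem_of_leftIdeal J _).trans le_sup_right)
    rw [← mul_assoc]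
    exact sub_mul_mono_left (mul_one_sup_pow_le hM)

theorem nonnegPart_le [Fact p.Prime] [CharP F p] (hφ : Good p n m φ) :
    nonnegPart F p φ ≤ 1 ⊔ (vermaIdeal F p n m lam).restrictScalars F := by
  have h1 : ∀ (x : U F p n) (c : F), x - algebraMap F _ c ∈ vermaIdeal F p n m lam →
      x ∈ 1 ⊔ (vermaIdeal F p n m lam).restrictScalars F := fun x c h => by
    rw [← add_sub_cancel (algebraMap F _ c) x]
    exact Submodule.add_mem_sup (Submodule.algebraMap_mem c) h
  refine sup_le ?_ ?_
  · rw [iDS, Submodule.span_le]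
    rintro _ ⟨a, ⟨ha, ha0⟩, rfl⟩
    rcases hφ.pos a ha ha0 with rfl | ⟨i, rfl⟩ | h
    · change iD F p n (mon F p 0) ∈ _
      rw [iD_mon_zero]; exact zero_mem _
    · exact h1 _ _ (iH_mem_vermaIdeal i)
    · exact Submodule.mem_sup_right (iD_mem_vermaIdeal ha h)
  · rw [Submodule.span_singleton_le_iff_mem]
    exact h1 _ _ iE_mem_vermaIdeal

/-- If the Verma module is nonzero, then so is its irreducible quotient: the elements of proper
left ideals have no constant term with respect to the triangular decomposition. -/
theorem annIdeal_ne_top [Fact p.Prime] [CharP F p] (hp : 3 < p) (hφ : Good p n m φ)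
    (hI : vermaIdeal F p n m lam ≠ ⊤) : annIdeal F p n m lam ≠ ⊤ := by
  obtain ⟨M, hM⟩ := negPart_nilpotent (F := F) hp hφ.toIsGrading
  set N := negPart F p φ with hN
  set H := (1 ⊔ N) ^ M with hH
  set I := (vermaIdeal F p n m lam).restrictScalars F with hIdef
  have htop : ∀ u : U F p n, u ∈ H ⊔ I := fun u => by
    have h := straighten_leftIdeal hM (vermaIdeal F p n m lam) (M₀ := 1)
      (by rw [mul_one]; exact nonnegPart_le hφ) u 1
      (Submodule.mem_sup_left (by rw [mul_one]; exact Submodule.one_le.1 (one_le_one_sup_pow N M)))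
    rwa [mul_one, mul_one] at h
  have hdec : ∀ u : U F p n, ∃ (c : F) (ν : U F p n) (i : U F p n), ν ∈ N * H ∧
      i ∈ vermaIdeal F p n m lam ∧ u = algebraMap F _ c + ν + i := fun u => by
    obtain ⟨x, hx, i, hi, rfl⟩ := Submodule.mem_sup.1 (htop u)
    obtain ⟨y, hy, ν, hν, rfl⟩ := Submodule.mem_sup.1 (one_sup_pow_le' N M hx)
    obtain ⟨c, rfl⟩ := Submodule.mem_one.1 hy
    exact ⟨c, ν, i, hν, hi, rfl⟩
  have hnil : ∀ ν ∈ N * H, IsNilpotent ν := fun ν hν => by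
    refine ⟨M, ?_⟩
    have h := (sub_mul_pow_le (one_sup_pow_mul_le_mul N M) M) (Submodule.pow_mem_pow _ hν M)
    rw [hM, Submodule.bot_mul] at h
    exact h
  have hproper : ∀ J : Submodule (U F p n) (U F p n), vermaIdeal F p n m lam ≤ J → J ≠ ⊤ →
      ∀ u ∈ J, u ∈ N * H ⊔ I := by
    intro J hJ htop u hu
    obtain ⟨c, ν, i, hν, hi, rfl⟩ := hdec u
    by_cases hc : c = 0
    · rw [hc, map_zero, zero_add]
      exact Submodule.add_mem_sup hν hi
    · have h1 : algebraMap F _ c + ν ∈ J := by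
        have := sub_mem hu (hJ hi)
        rwa [add_sub_cancel_right] at this
      have hunit : IsUnit (algebraMap F (U F p n) c) := (IsUnit.mk0 c hc).map _
      have hcomm : Commute ν (algebraMap F (U F p n) c) := Algebra.commute_algebraMap_right _ _
      exact absurd (leftIdeal_eq_top h1 ((hnil ν hν).isUnit_add_left_of_commute hunit hcomm)) htop
  intro h
  have h1 : (1 : U F p n) ∈ N * H ⊔ I := by
    have h2 : (1 : U F p n) ∈ annIdeal F p n m lam := by rw [h]; trivial
    refine annIdeal_induction (P := fun u => u ∈ N * H ⊔ I) ?_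
      (fun u hu => Submodule.mem_sup_right hu) (fun u v => add_mem) h2
    intro K _ hK u hu
    refine hproper (K.comap (vermaIdeal F p n m lam).mkQ) ?_ ?_ u hu
    · intro x hx
      have : (vermaIdeal F p n m lam).mkQ x = 0 := by simpa using hx
      rw [Submodule.mem_comap, this]; exact zero_mem _
    · intro h3
      refine hK ?_
      rw [eq_top_iff]
      intro x _
      obtain ⟨y, rfl⟩ := Submodule.mkQ_surjective _ x
      have : y ∈ K.comap (vermaIdeal F p n m lam).mkQ := by rw [h3]; trivial
      exact this
  obtain ⟨ν, hν, i, hi, h2⟩ := Submodule.mem_sup.1 h1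
  have h3 : i = 1 - ν := eq_sub_of_add_eq' h2
  refine hI (leftIdeal_eq_top (x := i) hi ?_)
  rw [h3]
  exact (hnil ν hν).isUnit_one_sub

/-- Nakayama's lemma for the nilpotent negative part. -/
theorem eq_top_of_le_negPart_mul_sup {M : ℕ} (hM : negPart F p φ ^ M = ⊥)
    (J : Submodule (U F p n) (U F p n))
    (h : (⊤ : Submodule F (U F p n)) ≤ negPart F p φ * ⊤ ⊔ J.restrictScalars F) : J = ⊤ := by
  have h2 : ∀ j, (⊤ : Submodule F (U F p n)) ≤ negPart F p φ ^ j * ⊤ ⊔ J.restrictScalars F := by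
    intro j
    induction j with
    | zero => rw [pow_zero, one_mul]; exact le_sup_left
    | succ j ih =>
      refine h.trans (sup_le ?_ le_sup_right)
      refine (sub_mul_mono_right ih).trans ?_
      rw [Submodule.mul_sup, ← mul_assoc, ← pow_succ']
      exact sup_le_sup_left (mul_mem_of_leftIdeal _ _) _
  have h3 := h2 M
  rw [hM, Submodule.bot_mul, bot_sup_eq] at h3
  exact eq_top_iff.2 fun u _ => h3 trivial

/-- A set of homogeneous elements that is stable under the part of nonnegative degree modulo the
maximal left ideal `R`, and that lies in `N U + R`, lies in `R`: it generates a proper graded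
submodule of the irreducible module. -/
theorem mem_annIdeal_of_stable [Fact p.Prime] [CharP F p] (hp : 3 < p) (hφ : Good p n m φ)
    {X : Set (U F p n)} (htau : ∀ x ∈ X, ∃ c : F, tau F p n x = c • x)
    (hB : ∀ x ∈ X, ∀ a, Valid p n a → 0 ≤ φ a → iD F p n (mon F p a) * x ∈
      Submodule.span F X ⊔ (annIdeal F p n m lam).restrictScalars F)
    (hE : ∀ x ∈ X, iE F p n * x ∈
      Submodule.span F X ⊔ (annIdeal F p n m lam).restrictScalars F)
    (hX : ∀ x ∈ X, x ∈ negPart F p φ * ⊤ ⊔ (annIdeal F p n m lam).restrictScalars F) :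
    ∀ x ∈ X, x ∈ annIdeal F p n m lam := by
  by_cases htop : annIdeal F p n m lam = ⊤
  · rw [htop]; exact fun _ _ => trivial
  obtain ⟨M, hM⟩ := negPart_nilpotent (F := F) hp hφ.toIsGrading
  set N := negPart F p φ with hN
  set H := (1 ⊔ N) ^ M with hH
  set R := (annIdeal F p n m lam).restrictScalars F with hR
  have hBX : nonnegPart F p φ * Submodule.span F X ≤ Submodule.span F X ⊔ R := by
    rw [nonnegPart, iDS, ← Submodule.span_union, Submodule.span_mul_span, Submodule.span_le]
    rintro _ ⟨_, ⟨a, ha, rfl⟩ | rfl, x, hx, rfl⟩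
    · exact hB x hx a ha.1 ha.2
    · exact hE x hx
  have hK := straighten_leftIdeal hM (annIdeal F p n m lam) hBX
  obtain ⟨K, hKmem⟩ : ∃ K : Submodule (U F p n) (U F p n),
      ∀ x, x ∈ K ↔ x ∈ H * Submodule.span F X ⊔ R := ⟨toLeftIdeal _ hK, fun x => Iff.rfl⟩
  have hRK : annIdeal F p n m lam ≤ K := fun x hx =>
    (hKmem x).2 (Submodule.mem_sup_right hx)
  have hXK : ∀ x ∈ X, x ∈ K := fun x hx => by
    refine (hKmem x).2 (Submodule.mem_sup_left ?_)
    rw [← one_mul x]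
    exact Submodule.mul_mem_mul (Submodule.one_le.1 (one_le_one_sup_pow N M))
      (Submodule.subset_span hx)
  have hKtop : K ≠ ⊤ := by
    intro h
    have h1 : (⊤ : Submodule F (U F p n)) ≤ N * ⊤ ⊔ R := by
      intro u _
      have hu : u ∈ H * Submodule.span F X ⊔ R := by
        have : u ∈ K := by rw [h]; trivial
        exact (hKmem u).1 this
      refine (sup_le ?_ le_sup_right : H * Submodule.span F X ⊔ R ≤ N * ⊤ ⊔ R) hu
      have hXN : Submodule.span F X ≤ N * ⊤ ⊔ R := Submodule.span_le.2 hX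
      refine (sub_mul_mono_left (one_sup_pow_le' N M)).trans ?_
      rw [Submodule.sup_mul, one_mul]
      refine sup_le hXN (le_sup_of_le_left ?_)
      rw [mul_assoc]
      exact sub_mul_mono_right le_top
    exact htop (eq_top_of_le_negPart_mul_sup hM _ h1)
  have hKtau : TauStable K := by
    have hsp : ∀ S : Set (U F p n), (∀ x ∈ S, ∃ c : F, tau F p n x = c • x) →
        (Submodule.span F S).map (tau F p n).toLinearMap ≤ Submodule.span F S := fun S hS => by
      rw [Submodule.map_span, Submodule.span_le]
      rintro _ ⟨x, hx, rfl⟩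
      obtain ⟨c, hc⟩ := hS x hx
      rw [SetLike.mem_coe, AlgHom.toLinearMap_apply, hc]
      exact Submodule.smul_mem _ _ (Submodule.subset_span hx)
    have hNt : N.map (tau F p n).toLinearMap ≤ N := hsp _ (by
      rintro _ ⟨a, -, rfl⟩
      exact ⟨_, tau_iD_mon a⟩)
    have hHt : H.map (tau F p n).toLinearMap ≤ H := by
      rw [hH, Submodule.map_pow]
      refine pow_le_pow_left' ?_ M
      rw [Submodule.map_sup, Submodule.map_one]
      exact sup_le_sup_left hNt _
    intro u hu
    have h1 : tau F p n u ∈ (H * Submodule.span F X ⊔ R).map (tau F p n).toLinearMap :=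
      Submodule.mem_map_of_mem (f := (tau F p n).toLinearMap) ((hKmem u).1 hu)
    rw [Submodule.map_sup, Submodule.map_mul] at h1
    refine (hKmem _).2 ((sup_le_sup ?_ ?_ : _ ≤ H * Submodule.span F X ⊔ R) h1)
    · exact (sub_mul_mono_left hHt).trans (sub_mul_mono_right (hsp _ htau))
    · rintro _ ⟨x, hx, rfl⟩
      exact tauStable_annIdeal x hx
  exact fun x hx => le_annIdeal (two_ne_zero' hp) (vermaIdeal_le_annIdeal.trans hRK) hKtau hKtop
    (hXK x hx)

end Singular

section Isomorphism

variable {F : Type*} [Field F] {p n : ℕ}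

variable {m : ℕ} {lam : Module.Dual F (hBar F p n)}

variable (F p n) in
/-- The projection of the restricted enveloping algebra to the irreducible module. -/
def toL (m : ℕ) (lam : Module.Dual F (hBar F p n)) : U F p n →ₗ[U F p n] L F p n m lam :=
  (vermaRad F p n m lam).mkQ ∘ₗ (vermaIdeal F p n m lam).mkQ

theorem toL_surjective : Function.Surjective (toL F p n m lam) :=
  (Submodule.mkQ_surjective _).comp (Submodule.mkQ_surjective _)

theorem toL_eq_zero {u : U F p n} : toL F p n m lam u = 0 ↔ u ∈ annIdeal F p n m lam := by
  rw [toL, LinearMap.comp_apply, annIdeal, Submodule.mem_comap, Submodule.mkQ_apply,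
    Submodule.Quotient.mk_eq_zero]

theorem toL_eq {u v : U F p n} :
    toL F p n m lam u = toL F p n m lam v ↔ u - v ∈ annIdeal F p n m lam := by
  rw [← toL_eq_zero, map_sub, sub_eq_zero]

theorem mem_lPart {θ : ZMod 2} {x : L F p n m lam} :
    x ∈ lPart F p n m lam θ ↔ ∃ u ∈ uPart F p n θ, toL F p n m lam u = x := by
  constructor
  · rintro ⟨_, ⟨u, hu, rfl⟩, rfl⟩; exact ⟨u, hu, rfl⟩
  · rintro ⟨u, hu, rfl⟩; exact ⟨_, ⟨u, hu, rfl⟩, rfl⟩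

theorem lPart_sub {θ : ZMod 2} {x y : L F p n m lam} (hx : x ∈ lPart F p n m lam θ)
    (hy : y ∈ lPart F p n m lam θ) : x - y ∈ lPart F p n m lam θ := by
  obtain ⟨u, hu, rfl⟩ := mem_lPart.1 hx
  obtain ⟨v, hv, rfl⟩ := mem_lPart.1 hy
  exact mem_lPart.2 ⟨u - v, sub_mem hu hv, map_sub _ _ _⟩

theorem tau_uPart_mem [Fact p.Prime] {θ : ZMod 2} {u : U F p n} (hu : u ∈ uPart F p n θ) :
    ∃ c : F, tau F p n u = c • u := ⟨_, tau_of_mem_uPart hu⟩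

theorem lPart_disjoint [Fact p.Prime] (h2 : (2 : F) ≠ 0) {θ : ZMod 2} {x : L F p n m lam}
    (h0 : x ∈ lPart F p n m lam θ) (h1 : x ∈ lPart F p n m lam (θ + 1)) : x = 0 := by
  have key : ∀ x : L F p n m lam, x ∈ lPart F p n m lam 0 → x ∈ lPart F p n m lam 1 → x = 0 := by
    intro x h0 h1
    obtain ⟨u, hu, rfl⟩ := mem_lPart.1 h0
    obtain ⟨v, hv, h⟩ := mem_lPart.1 h1
    have h3 := toL_eq.1 h.symm
    rw [sub_eq_add_neg] at h3
    exact toL_eq_zero.2 (tauStable_parts h2 tauStable_annIdeal hu (neg_mem hv) h3).1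
  rcases zmod_two_cases θ with rfl | rfl
  · exact key x h0 h1
  · exact key x h1 h0

theorem exists_lPart [Fact p.Prime] (x : L F p n m lam) (θ : ZMod 2) :
    ∃ y ∈ lPart F p n m lam θ, ∃ z ∈ lPart F p n m lam (θ + 1), x = y + z := by
  obtain ⟨u, rfl⟩ := toL_surjective x
  obtain ⟨u₀, h0, u₁, h1, rfl⟩ := exists_parts u
  rcases zmod_two_cases θ with rfl | rfl
  · exact ⟨_, mem_lPart.2 ⟨u₀, h0, rfl⟩, _, mem_lPart.2 ⟨u₁, h1, rfl⟩, map_add _ _ _⟩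
  · exact ⟨_, mem_lPart.2 ⟨u₁, h1, rfl⟩, _, mem_lPart.2 ⟨u₀, h0, rfl⟩, by
      rw [← map_add, add_comm]⟩

/-- A homogeneous highest weight vector of the irreducible module `L^{𝔟_m}(lam)` with respect to
`𝔟_m'` identifies this module with an irreducible module for `𝔟_m'`. -/
theorem lIso_of_singular [Fact p.Prime] (h2 : (2 : F) ≠ 0) {m' : ℕ}
    {lam' : Module.Dual F (hBar F p n)}
    (hm' : vermaIdeal F p n m' lam' ≠ ⊤ → annIdeal F p n m' lam' ≠ ⊤)
    {w : U F p n} {θ : ZMod 2} (hθ : w ∈ uPart F p n θ) (hw : w ∉ annIdeal F p n m lam)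
    (h1 : ∀ a, Valid p n a → a ∈ posExp n m' → iD F p n (mon F p a) * w ∈ annIdeal F p n m lam)
    (h3 : ∀ j, iH F p j * w - lam' (hDe' F p j) • w ∈ annIdeal F p n m lam)
    (h4 : iE F p n * w - lam' (euler' F p) • w ∈ annIdeal F p n m lam) :
    LIso F p n m lam m' lam' ∧ vermaIdeal F p n m' lam' ≠ ⊤ := by
  set R := annIdeal F p n m lam with hR
  set R' := annIdeal F p n m' lam' with hR'
  obtain ⟨cw, hcw⟩ := tau_uPart_mem hθ
  -- the annihilator of the class of `w`
  set K : Submodule (U F p n) (U F p n) := R.comap (LinearMap.toSpanSingleton (U F p n) _ w) with hK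
  have hKmem : ∀ u, u ∈ K ↔ u * w ∈ R := fun u => Iff.rfl
  have hIK : vermaIdeal F p n m' lam' ≤ K := by
    refine vermaIdeal_le (fun a ha ha' => h1 a ha ha') (fun j => ?_) ?_
    · rw [hKmem, sub_mul, ← Algebra.smul_def]; exact h3 j
    · rw [hKmem, sub_mul, ← Algebra.smul_def]; exact h4
  have hKtop : K ≠ ⊤ := fun h => hw (by
    have : (1 : U F p n) ∈ K := by rw [h]; trivial
    rwa [hKmem, one_mul] at this)
  have hI' : vermaIdeal F p n m' lam' ≠ ⊤ := fun h => hKtop (top_le_iff.1 (h ▸ hIK))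
  -- a multiple of `w` by a homogeneous operator is homogeneous; the sign of `w` is invertible
  have hcw0 : cw ≠ 0 := by
    rintro rfl
    rw [zero_smul] at hcw
    have hsign : (-1 : F) ^ θ.val • w = 0 := by rw [← tau_of_mem_uPart hθ, hcw]
    rcases smul_eq_zero.1 hsign with h | h
    · exact pow_ne_zero _ (neg_ne_zero.2 one_ne_zero) h
    · exact hw (h ▸ zero_mem R)
  have hKtau : TauStable K := by
    intro u hu
    have h5 := tauStable_annIdeal _ ((hKmem u).1 hu)
    rw [map_mul, hcw, mul_smul_comm, Algebra.smul_def] at h5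
    have h6 := Submodule.smul_mem _ (algebraMap F (U F p n) cw⁻¹) h5
    rw [smul_eq_mul, ← mul_assoc, ← map_mul, inv_mul_cancel₀ hcw0, map_one, one_mul] at h6
    exact h6
  have hKR' : K ≤ R' := le_annIdeal h2 hIK hKtau hKtop
  -- left ideals of the form `J w + R` are `⊤` or `R`
  have hdich : ∀ J : Submodule (U F p n) (U F p n), TauStable J →
      J.map (LinearMap.toSpanSingleton (U F p n) _ w) ⊔ R = ⊤ ∨
        J.map (LinearMap.toSpanSingleton (U F p n) _ w) ⊔ R ≤ R := by
    intro J hJ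
    by_cases htop : J.map (LinearMap.toSpanSingleton (U F p n) _ w) ⊔ R = ⊤
    · exact Or.inl htop
    refine Or.inr (le_annIdeal h2 (vermaIdeal_le_annIdeal.trans le_sup_right) ?_ htop)
    intro x hx
    obtain ⟨_, ⟨u, hu, rfl⟩, r, hr, rfl⟩ := Submodule.mem_sup.1 hx
    rw [map_add]
    refine Submodule.add_mem_sup ?_ (tauStable_annIdeal r hr)
    rw [LinearMap.toSpanSingleton_apply, smul_eq_mul, map_mul, hcw, mul_smul_comm,
      ← smul_mul_assoc]
    refine ⟨cw • tau F p n u, ?_, rfl⟩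
    rw [Algebra.smul_def]
    exact J.smul_mem _ (hJ u hu)
  have hR'K : R' ≤ K := by
    rcases hdich R' tauStable_annIdeal with h | h
    · exfalso
      have hwt : w ∈ R'.map (LinearMap.toSpanSingleton (U F p n) _ w) ⊔ R := by rw [h]; trivial
      obtain ⟨_, ⟨u, hu, rfl⟩, r, hr, hur⟩ := Submodule.mem_sup.1 hwt
      rw [LinearMap.toSpanSingleton_apply, smul_eq_mul] at hur
      have h5 : 1 - u ∈ K := by
        rw [hKmem, sub_mul, one_mul]
        have : w - u * w = r := sub_eq_of_eq_add' hur.symm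
        rw [this]; exact hr
      have h6 : (1 : U F p n) ∈ R' := by simpa using add_mem (hKR' h5) hu
      exact hm' hI' (leftIdeal_eq_top h6 isUnit_one)
    · intro u hu
      exact h (Submodule.mem_sup_left ⟨u, hu, rfl⟩)
  have hsurj : ∀ x : U F p n, ∃ u, x - u * w ∈ R := by
    rcases hdich ⊤ (fun _ _ => trivial) with h | h
    · intro x
      have hx : x ∈ (⊤ : Submodule (U F p n) (U F p n)).map
          (LinearMap.toSpanSingleton (U F p n) _ w) ⊔ R := by rw [h]; trivial
      obtain ⟨_, ⟨u, hu, rfl⟩, r, hr, hur⟩ := Submodule.mem_sup.1 hx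
      exact ⟨u, by rw [← hur, LinearMap.toSpanSingleton_apply, smul_eq_mul,
        add_sub_cancel_left]; exact hr⟩
    · exact absurd (h (Submodule.mem_sup_left ⟨1, trivial, one_mul w⟩)) hw
  -- the map `u ↦ u w`
  set g₀ : U F p n →ₗ[U F p n] L F p n m lam :=
    toL F p n m lam ∘ₗ LinearMap.toSpanSingleton (U F p n) _ w with hg₀
  have hg₀_apply : ∀ u, g₀ u = toL F p n m lam (u * w) := fun u => rfl
  have hker : ∀ u, g₀ u = 0 ↔ u ∈ R' := fun u => by
    rw [hg₀_apply, toL_eq_zero]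
    exact ⟨fun h => hKR' h, fun h => hR'K h⟩
  let g₁ : Verma F p n m' lam' →ₗ[U F p n] L F p n m lam :=
    (vermaIdeal F p n m' lam').liftQ g₀ fun u hu => (hker u).2 (vermaIdeal_le_annIdeal hu)
  let g : L F p n m' lam' →ₗ[U F p n] L F p n m lam :=
    (vermaRad F p n m' lam').liftQ g₁ fun x hx => by
      obtain ⟨u, rfl⟩ := Submodule.mkQ_surjective _ x
      exact (hker u).2 hx
  have hg : ∀ u, g (toL F p n m' lam' u) = toL F p n m lam (u * w) := fun u => rfl
  have hinj : Function.Injective g := by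
    rw [injective_iff_map_eq_zero]
    intro x hx
    obtain ⟨u, rfl⟩ := toL_surjective x
    exact toL_eq_zero.2 ((hker u).1 hx)
  have hgsurj : Function.Surjective g := by
    intro x
    obtain ⟨u, rfl⟩ := toL_surjective x
    obtain ⟨v, hv⟩ := hsurj u
    exact ⟨toL F p n m' lam' v, by rw [hg]; exact (toL_eq.2 hv).symm⟩
  have hpart : ∀ η x, x ∈ lPart F p n m' lam' η → g x ∈ lPart F p n m lam (η + θ) := by
    intro η x hx
    obtain ⟨u, hu, rfl⟩ := mem_lPart.1 hx
    exact mem_lPart.2 ⟨u * w, mul_mem_uPart hu hθ, rfl⟩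
  have hpart' : ∀ η x, g x ∈ lPart F p n m lam (η + θ) → x ∈ lPart F p n m' lam' η := by
    intro η x hx
    obtain ⟨y, hy, z, hz, rfl⟩ := exists_lPart x η
    have h5 : g z ∈ lPart F p n m lam (η + θ) := by
      have := lPart_sub hx (hpart η y hy)
      rwa [map_add, add_sub_cancel_left] at this
    have h6 := hpart _ z hz
    rw [add_right_comm] at h6
    have h7 : z = 0 := hinj ((lPart_disjoint h2 h5 h6).trans (map_zero g).symm)
    rw [h7, add_zero]; exact hy
  refine ⟨⟨(LinearEquiv.ofBijective g ⟨hinj, hgsurj⟩).symm, θ, fun η x => ?_⟩, hI'⟩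
  obtain ⟨y, rfl⟩ := (LinearEquiv.ofBijective g ⟨hinj, hgsurj⟩).surjective x
  rw [LinearEquiv.symm_apply_apply]
  change g y ∈ _ ↔ _
  have hθθ : η + θ + θ = η := by
    rw [add_assoc]; rcases zmod_two_cases θ with rfl | rfl
    · simp
    · rw [show (1 : ZMod 2) + 1 = 0 from rfl, add_zero]
  constructor
  · intro h; exact hpart' _ _ (by rwa [hθθ])
  · intro h; have := hpart _ _ h; rwa [hθθ] at this

end Isomorphism

/-! ### Combinatorics of the Borel subalgebras -/

section Combinatorics

variable {p n : ℕ}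

theorem LowerOver.deg {r a : Var n → ℕ} (h : LowerOver r a) : deg a = deg r + 2 := by
  obtain ⟨i, j, -, rfl | rfl⟩ := h <;> rw [deg_add, deg_add, deg_unit, deg_unit]

theorem LowerOver.add {r a : Var n → ℕ} (h : LowerOver r a) (s : Var n → ℕ) :
    LowerOver (r + s) (a + s) := by
  obtain ⟨i, j, hij, rfl | rfl⟩ := h
  · exact ⟨i, j, hij, Or.inl (by abel)⟩
  · exact ⟨i, j, hij, Or.inr (by abel)⟩

theorem le_deg (r : Var n → ℕ) (v : Var n) : r v ≤ deg r :=
  Finset.single_le_sum (f := r) (fun _ _ => Nat.zero_le _) (Finset.mem_univ v)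

theorem deg_of_mem_W₁ {k : Fin n} {a : Var n → ℕ} (h : a ∈ W₁ k) : 3 ≤ deg a := by
  obtain ⟨r, -, -, hr, h⟩ := h
  have := le_deg r (Sum.inr k)
  rw [h.deg]; omega

theorem deg_of_mem_W₂ {k : Fin n} {a : Var n → ℕ} (h : a ∈ W₂ k) : 3 ≤ deg a := by
  obtain ⟨r, -, hr, h⟩ | h := h
  · have := le_deg r (Sum.inl k)
    rw [h.deg]; omega
  · exact h.2

theorem posExp_succ_first {m : ℕ} (h : m < n) :
    posExp n (m + 1) = (posExp n m \ W₁ ⟨m, h⟩) ∪ {unit (Sum.inl ⟨m, h⟩)} := by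
  rw [posExp, dif_pos h]

theorem posExp_succ_second {t : ℕ} (h : t < n) : posExp n (n + t + 1) =
    (posExp n (n + t) \ W₂ (Fin.rev ⟨t, h⟩)) ∪ {unit (Sum.inr (Fin.rev ⟨t, h⟩))} := by
  have h1 : ¬ n + t < n := by omega
  have h2 : n + t - n = t := by omega
  rw [posExp, dif_neg h1]
  simp only [h2]
  rw [dif_pos h]

/-- The three ways in which a step can change the set of exponents. -/
theorem posExp_succ_cases (m : ℕ) :
    (∃ h : m < n, posExp n (m + 1) = (posExp n m \ W₁ ⟨m, h⟩) ∪ {unit (Sum.inl ⟨m, h⟩)}) ∨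
    (∃ k : Fin n, m + k.val + 1 = 2 * n ∧
      posExp n (m + 1) = (posExp n m \ W₂ k) ∪ {unit (Sum.inr k)}) ∨
    (2 * n ≤ m ∧ posExp n (m + 1) = posExp n m) := by
  by_cases h : m < n
  · exact Or.inl ⟨h, posExp_succ_first h⟩
  · obtain ⟨t, rfl⟩ := Nat.exists_eq_add_of_le (not_lt.1 h)
    by_cases h' : t < n
    · refine Or.inr (Or.inl ⟨Fin.rev ⟨t, h'⟩, ?_, posExp_succ_second h'⟩)
      rw [Fin.val_rev]; simp only; omega
    · refine Or.inr (Or.inr ⟨by omega, ?_⟩)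
      have h2 : n + t - n = t := by omega
      rw [posExp, dif_neg h]
      simp only [h2]
      rw [dif_neg h']

theorem mem_posExp_of_deg_le {m m' : ℕ} (hm : m ≤ m') {a : Var n → ℕ} (ha : a ∈ posExp n m)
    (h : deg a ≤ 2) : a ∈ posExp n m' := by
  induction m', hm using Nat.le_induction with
  | base => exact ha
  | succ m' _ ih =>
    rcases posExp_succ_cases (n := n) m' with ⟨h1, h2⟩ | ⟨k, -, h2⟩ | ⟨-, h2⟩ <;> rw [h2]
    · exact Or.inl ⟨ih, fun h3 => by have := deg_of_mem_W₁ h3; omega⟩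
    · exact Or.inl ⟨ih, fun h3 => by have := deg_of_mem_W₂ h3; omega⟩
    · exact ih

theorem unit_inl_mem {m : ℕ} (i : Fin n) (h : i.val < m) : unit (Sum.inl i) ∈ posExp n m := by
  refine mem_posExp_of_deg_le h ?_ (by rw [deg_unit]; omega)
  rw [posExp_succ_first i.2]
  exact Or.inr rfl

theorem unit_inr_mem {m : ℕ} (i : Fin n) (h : 2 * n ≤ m + i) : unit (Sum.inr i) ∈ posExp n m := by
  have h1 := i.2
  refine mem_posExp_of_deg_le (m := n + (n - 1 - i) + 1) (by omega) ?_ (by rw [deg_unit]; omega)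
  rw [posExp_succ_second (by omega)]
  refine Or.inr ?_
  rw [Set.mem_singleton_iff]
  congr 2
  refine Fin.ext ?_
  rw [Fin.val_rev]; simp only; omega

theorem not_mem_posExp {m : ℕ} {a : Var n → ℕ} (h : a ∉ posExp n m) :
    a ∉ pos0 n ∨ (∃ k : Fin n, k.val < m ∧ a ∈ W₁ k) ∨
      ∃ k : Fin n, 2 * n ≤ m + k.val ∧ a ∈ W₂ k := by
  induction m with
  | zero => exact Or.inl h
  | succ m ih =>
    have key : a ∉ posExp n m → _ := fun h => (ih h).imp id (Or.imp
      (fun ⟨k, hk, h⟩ => (⟨k, hk.trans (Nat.lt_succ_self m), h⟩ :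
        ∃ k : Fin n, k.val < m + 1 ∧ a ∈ W₁ k))
      (fun ⟨k, hk, h⟩ => (⟨k, by omega, h⟩ : ∃ k : Fin n, 2 * n ≤ m + 1 + k.val ∧ a ∈ W₂ k)))
    rcases posExp_succ_cases (n := n) m with ⟨h1, h2⟩ | ⟨k, h1, h2⟩ | ⟨-, h2⟩ <;> rw [h2] at h
    · by_cases h3 : a ∈ posExp n m
      · by_cases h4 : a ∈ W₁ ⟨m, h1⟩
        · exact Or.inr (Or.inl ⟨_, Nat.lt_succ_self m, h4⟩)
        · exact absurd (Or.inl ⟨h3, h4⟩) h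
      · exact key h3
    · by_cases h3 : a ∈ posExp n m
      · by_cases h4 : a ∈ W₂ k
        · exact Or.inr (Or.inr ⟨_, by omega, h4⟩)
        · exact absurd (Or.inl ⟨h3, h4⟩) h
      · exact key h3
    · exact key h

theorem mem_pos0_or_unit {m : ℕ} {a : Var n → ℕ} (h : a ∈ posExp n m) :
    a ∈ pos0 n ∨ ∃ v, a = unit v := by
  induction m with
  | zero => exact Or.inl h
  | succ m ih =>
    rcases posExp_succ_cases (n := n) m with ⟨h1, h2⟩ | ⟨k, h1, h2⟩ | ⟨-, h2⟩ <;> rw [h2] at h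
    · rcases h with h | h
      · exact ih h.1
      · exact Or.inr ⟨_, h⟩
    · rcases h with h | h
      · exact ih h.1
      · exact Or.inr ⟨_, h⟩
    · exact ih h

theorem exists_unit_of_deg_one {a : Var n → ℕ} (h : deg a = 1) : ∃ v, a = unit v := by
  have : ∃ v, a v ≠ 0 := by
    by_contra! h0
    simp [deg, h0] at h
  obtain ⟨v, hv⟩ := this
  obtain ⟨s, rfl⟩ := eq_add_unit hv
  rw [deg_add, deg_unit] at h
  have hs : s = 0 := funext fun w => by
    have := le_deg s w
    simp only [Pi.zero_apply]; omega
  exact ⟨v, by rw [hs, zero_add]⟩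

theorem not_mem_pos0 {a : Var n → ℕ} (ha : a ∉ pos0 n) :
    a = 0 ∨ (∃ v, a = unit v) ∨ LowerOver 0 a := by
  have h3 : deg a ≤ 2 := by
    by_contra h; exact ha (Or.inl (Or.inl (by rw [Set.mem_ofPred_eq]; omega)))
  by_cases h0 : ∃ v, a v ≠ 0
  · obtain ⟨v, hv⟩ := h0
    obtain ⟨s, rfl⟩ := eq_add_unit hv
    rw [deg_add, deg_unit] at h3
    by_cases hs : deg s = 1
    · obtain ⟨w, rfl⟩ := exists_unit_of_deg_one hs
      refine Or.inr (Or.inr ?_)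
      rcases v with i | i <;> rcases w with j | j
      · exact absurd (Or.inr ⟨j, i, rfl⟩) ha
      · rcases lt_or_ge i j with hij | hij
        · exact absurd (Or.inl (Or.inr ⟨i, j, hij, add_comm _ _⟩)) ha
        · exact ⟨i, j, hij, Or.inr (by rw [zero_add, add_comm])⟩
      · rcases lt_or_ge j i with hij | hij
        · exact absurd (Or.inl (Or.inr ⟨j, i, hij, rfl⟩)) ha
        · exact ⟨j, i, hij, Or.inr (by rw [zero_add])⟩
      · rcases le_total i j with hij | hij
        · exact ⟨j, i, hij, Or.inl (by rw [zero_add])⟩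
        · exact ⟨i, j, hij, Or.inl (by rw [zero_add, add_comm])⟩
    · have hs : s = 0 := funext fun w => by
        have := le_deg s w
        simp only [Pi.zero_apply]; omega
      exact Or.inr (Or.inl ⟨v, by rw [hs, zero_add]⟩)
  · push Not at h0
    exact Or.inl (funext h0)

/-- Exponents in `pos0` are not below the diagonal. -/
theorem not_pos0_of_lowerOver {a : Var n → ℕ} (h : LowerOver 0 a) : a ∉ pos0 n := by
  have hd := h.deg
  have h0 : deg (0 : Var n → ℕ) = 0 := by simp [deg]
  have e1 : ∀ i j : Fin n, oddDeg (unit (Sum.inl i) + unit (Sum.inl j) : Var n → ℕ) = 0 :=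
    fun i j => by rw [oddDeg_add, oddDeg_unit_inl, oddDeg_unit_inl]
  have e2 : ∀ i j : Fin n, oddDeg (unit (Sum.inl i) + unit (Sum.inr j) : Var n → ℕ) = 1 :=
    fun i j => by rw [oddDeg_add, oddDeg_unit_inl, oddDeg_unit_inr]
  have e3 : ∀ i j : Fin n, oddDeg (unit (Sum.inr i) + unit (Sum.inr j) : Var n → ℕ) = 2 :=
    fun i j => by rw [oddDeg_add, oddDeg_unit_inr, oddDeg_unit_inr]
  rintro ((h3 | ⟨i, j, hij, rfl⟩) | ⟨i, j, rfl⟩)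
  · rw [Set.mem_ofPred_eq] at h3; omega
  · obtain ⟨i', j', hij', h | h⟩ := h
    · have := congrArg oddDeg h
      rw [zero_add, e2, e3] at this; omega
    · rw [zero_add] at h
      have hi : i = i' := by
        by_contra hne
        have := congrFun h (Sum.inl i)
        simp [hne] at this
      have hj : j = j' := by
        by_contra hne
        have := congrFun h (Sum.inr j)
        simp [hne] at this
      subst hi hj
      exact absurd hij (not_lt.2 hij')
  · obtain ⟨i', j', hij', h | h⟩ := h
    · have := congrArg oddDeg h
      rw [zero_add, e1, e3] at this; omega
    · have := congrArg oddDeg h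
      rw [zero_add, e1, e2] at this; omega

/-- Removing `x_{n+k}` from an exponent of `𝔫_k^+` that survives the reflection in `-ε_k - δ`. -/
theorem sub_inr_mem {k : Fin n} {s : Var n → ℕ}
    (h : s + unit (Sum.inr k) ∈ posExp n k.val) (hW : s + unit (Sum.inr k) ∉ W₁ k)
    (hk : s (Sum.inr k) = 0) : s = 0 ∨ s ∈ posExp n k.val := by
  by_contra! hs
  rcases not_mem_posExp hs.2 with h1 | ⟨k', hk', r, h1, h2, h3, h4⟩ | ⟨k', hk', -⟩
  · rcases not_mem_pos0 h1 with h2 | ⟨v, rfl⟩ | h2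
    · exact hs.1 h2
    · have hlow : LowerOver 0 (unit v + unit (Sum.inr k)) := by
        rcases v with i | i
        · have : k ≤ i := by
            by_contra hik
            exact hs.2 (unit_inl_mem i (not_le.1 hik))
          exact ⟨i, k, this, Or.inr (by rw [zero_add])⟩
        · rcases le_total i k with hik | hik
          · exact ⟨k, i, hik, Or.inl (by rw [zero_add, add_comm])⟩
          · exact ⟨i, k, hik, Or.inl (by rw [zero_add])⟩
      rcases mem_pos0_or_unit h with h5 | ⟨w, h5⟩
      · exact not_pos0_of_lowerOver hlow h5
      · have := congrArg deg h5
        rw [deg_add, deg_unit, deg_unit, deg_unit] at this; omega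
    · refine hW ⟨unit (Sum.inr k), by simp, fun l hl => by simp [hl.ne], by simp, ?_⟩
      have := h2.add (unit (Sum.inr k))
      rwa [zero_add] at this
  · refine hW ⟨r + unit (Sum.inr k), fun l => by simp [h1], fun l hl => ?_, ?_, h4.add _⟩
    · have : k' < l := lt_trans hk' hl
      simp [h2 l this, hl.ne]
    · simp [h2 k hk']
  · have := k.2; have := k'.2; omega

/-- Lowering the exponent of `x_k` in an exponent of `𝔫_{n+t}^+` that survives the reflection in
`ε_k - δ`, `k = n - 1 - t`. -/
theorem sub_inl_mem {m : ℕ} {k : Fin n} (hm : m + k.val + 1 = 2 * n) {s : Var n → ℕ}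
    (h : s + unit (Sum.inl k) ∈ posExp n m) (hW : s + unit (Sum.inl k) ∉ W₂ k) :
    s = 0 ∨ (s ∈ posExp n m ∧ s ∉ W₂ k) := by
  by_contra! hs
  have hW2 : s ∉ W₂ k := by
    rintro (⟨r, h1, h2, h3⟩ | ⟨h1, h2⟩)
    · exact hW (Or.inl ⟨r + unit (Sum.inl k), fun l hl => by simp [h1 l hl, hl.ne], by simp,
        h3.add _⟩)
    · exact hW (Or.inr ⟨h1, by rw [deg_add]; omega⟩)
  have hsn : s ∉ posExp n m := fun h => hW2 (hs.2 h)
  have hkn := k.2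
  rcases not_mem_posExp hsn with h1 | ⟨k', hk', r, h1, h2, h3, h4⟩ | ⟨k', hk', h1⟩
  · rcases not_mem_pos0 h1 with h2 | ⟨v, rfl⟩ | h2
    · exact hs.1 h2
    · rcases v with i | i
      · exact hsn (unit_inl_mem i (by have := i.2; omega))
      · have hik : i ≤ k := by
          by_contra hik
          refine hsn (unit_inr_mem i ?_)
          have : k.val < i.val := not_le.1 hik
          omega
        have hlow : LowerOver 0 (unit (Sum.inr i) + unit (Sum.inl k)) :=
          ⟨k, i, hik, Or.inr (by rw [zero_add, add_comm])⟩
        rcases mem_pos0_or_unit h with h5 | ⟨w, h5⟩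
        · exact not_pos0_of_lowerOver hlow h5
        · have := congrArg deg h5
          rw [deg_add, deg_unit, deg_unit, deg_unit] at this; omega
    · refine hW (Or.inl ⟨unit (Sum.inl k), fun l hl => by simp [hl.ne], by simp, ?_⟩)
      have := h2.add (unit (Sum.inl k))
      rwa [zero_add] at this
  · refine hW (Or.inl ⟨r + unit (Sum.inl k), fun l hl => by simp [h1, hl.ne], by simp,
      h4.add _⟩)
  · have hkk : k < k' := by change k.val < k'.val; omega
    rcases h1 with ⟨r, h2, h3, h4⟩ | ⟨h2, -⟩
    · exact hW (Or.inl ⟨r + unit (Sum.inl k), fun l hl => by simp [h2 l (hl.trans hkk), hl.ne],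
        by simp, h4.add _⟩)
    · have : k.val < k'.val := hkk
      omega

end Combinatorics

/-! ### Weights adapted to the Borel subalgebras -/

section Weights

variable {p n : ℕ}

/-- The weight of an exponent given by the weights `c_i`, `d_i` of the variables `x_i`,
`x_{n+i}`. -/
def lw (c d : Fin n → ℤ) (a : Var n → ℕ) : ℤ :=
  ∑ i, ((a (Sum.inl i) : ℤ) * c i + (a (Sum.inr i) : ℤ) * d i)

variable {c d : Fin n → ℤ}

theorem lw_add (a b : Var n → ℕ) : lw c d (a + b) = lw c d a + lw c d b := by
  rw [lw, lw, lw, ← Finset.sum_add_distrib]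
  refine Finset.sum_congr rfl fun i _ => ?_
  simp only [Pi.add_apply]; push_cast; ring

theorem lw_zero : lw c d 0 = 0 := by simp [lw]

theorem lw_unit_inl (i : Fin n) : lw c d (unit (Sum.inl i)) = c i := by
  rw [lw, Finset.sum_eq_single i]
  · simp
  · intro j _ hj; simp [hj]
  · simp

theorem lw_unit_inr (i : Fin n) : lw c d (unit (Sum.inr i)) = d i := by
  rw [lw, Finset.sum_eq_single i]
  · simp
  · intro j _ hj; simp [hj]
  · simp

theorem lw_contr {D : ℤ} (hcd : ∀ i, c i + d i = D) {a b e : Var n → ℕ} (h : e ∈ Contr p a b) :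
    lw c d e - D = (lw c d a - D) + (lw c d b - D) := by
  obtain ⟨-, i, h⟩ := h
  have := congrArg (lw c d) h
  rw [lw_add, lw_add, lw_add, lw_unit_inl, lw_unit_inr] at this
  have := hcd i
  linarith

theorem lw_nonpos {a : Var n → ℕ} (h1 : ∀ i, a (Sum.inl i) ≠ 0 → c i ≤ 0)
    (h2 : ∀ i, a (Sum.inr i) ≠ 0 → d i ≤ 0) : lw c d a ≤ 0 := by
  refine Finset.sum_nonpos fun i _ => ?_
  have key : ∀ (x : ℕ) (e : ℤ), (x ≠ 0 → e ≤ 0) → (x : ℤ) * e ≤ 0 := fun x e h => by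
    rcases Nat.eq_zero_or_pos x with rfl | hx
    · simp
    · exact mul_nonpos_of_nonneg_of_nonpos (Int.natCast_nonneg x) (h hx.ne')
  exact add_nonpos (key _ _ (h1 i)) (key _ _ (h2 i))

theorem lw_neg {a : Var n → ℕ} (h1 : ∀ i, a (Sum.inl i) ≠ 0 → c i < 0)
    (h2 : ∀ i, a (Sum.inr i) ≠ 0 → d i < 0) (ha : a ≠ 0) : lw c d a < 0 := by
  obtain ⟨v, hv⟩ := Function.ne_iff.1 ha
  obtain ⟨s, rfl⟩ := eq_add_unit (r := a) (v := v) hv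
  rw [lw_add]
  have h3 : lw c d s ≤ 0 := lw_nonpos
    (fun i hi => (h1 i (by rw [Pi.add_apply]; omega)).le)
    (fun i hi => (h2 i (by rw [Pi.add_apply]; omega)).le)
  rcases v with i | i
  · have := h1 i (by simp)
    rw [lw_unit_inl]; omega
  · have := h2 i (by simp)
    rw [lw_unit_inr]; omega

/-- Conditions on the weights of the variables for the part of nonnegative degree to lie in
`𝔟_m`. -/
theorem good_of_weights {m : ℕ} {D : ℤ} (hcd : ∀ i, c i + d i = D) (hmono : StrictMono d)
    (hdd : ∀ i j, d i + d j < D) (hc : ∀ i : Fin n, m ≤ i.val → c i < D)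
    (hd : ∀ i : Fin n, m + i.val < 2 * n → d i < D)
    (h₁ : ∀ k l : Fin n, k.val < m → l ≤ k → d l < 0)
    (h₂ : ∀ k l : Fin n, 2 * n ≤ m + k.val → k ≤ l → c l < 0)
    (h₃ : 2 * n ≤ m → ∀ a : Var n → ℕ, 3 ≤ deg a → lw c d a < D) :
    Good p n m fun a => lw c d a - D where
  contr a b e h := lw_contr hcd h
  cartan i := by
    have := hcd i
    simp only [lw_add, lw_unit_inl, lw_unit_inr]; omega
  pos a _ h0 := by
    -- the weight of a product with a pair on or below the diagonal
    have hlow : ∀ r, LowerOver r a →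
        lw c d a ≤ lw c d r + D ∧ (lw c d a < lw c d r + D ∨
          ∃ i : Fin n, a = r + unit (Sum.inl i) + unit (Sum.inr i)) := by
      rintro r ⟨i, j, hij, rfl | rfl⟩
      · have := hdd i j
        rw [lw_add, lw_add, lw_unit_inr, lw_unit_inr]
        exact ⟨by omega, Or.inl (by omega)⟩
      · have := hcd i
        rw [lw_add, lw_add, lw_unit_inl, lw_unit_inr]
        rcases hij.lt_or_eq with hij | rfl
        · have := hmono hij
          exact ⟨by omega, Or.inl (by omega)⟩
        · exact ⟨by omega, Or.inr ⟨j, rfl⟩⟩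
    by_contra! hcon
    obtain ⟨ha0, hcar, hmem⟩ := hcon
    rcases not_mem_posExp hmem with h1 | ⟨k, hk, r, r1, r2, r3, r4⟩ | ⟨k, hk, h1⟩
    · rcases not_mem_pos0 h1 with h2 | ⟨i | i, rfl⟩ | h2
      · exact ha0 h2
      · have := hc i (by
          by_contra hi
          exact hmem (unit_inl_mem i (by omega)))
        rw [lw_unit_inl] at h0; omega
      · have := hd i (by
          by_contra hi
          exact hmem (unit_inr_mem i (by omega)))
        rw [lw_unit_inr] at h0; omega
      · have h3 := hlow 0 h2
        rw [lw_zero] at h3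
        rcases h3.2 with h4 | ⟨i, h4⟩
        · omega
        · rw [zero_add] at h4; exact hcar i h4
    · have h3 : lw c d r < 0 := by
        refine lw_neg (fun i hi => absurd (r1 i) hi) (fun i hi => h₁ k i hk ?_) fun h => ?_
        · by_contra hki
          exact hi (r2 i (not_le.1 hki))
        · rw [h] at r3; simp at r3
      have := (hlow r r4).1
      omega
    · rcases h1 with ⟨r, r1, r2, r3⟩ | ⟨h2, h3⟩
      · have h4 : lw c d r < 0 := by
          refine lw_neg (fun i hi => h₂ k i hk ?_) (fun i hi => ?_) fun h => ?_
          · by_contra hki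
            exact hi (r1 i (not_le.1 hki))
          · refine h₁ i i ?_ le_rfl
            have := i.2; have := k.2; omega
          · rw [h] at r2; simp at r2
        have := (hlow r r3).1
        omega
      · have := h₃ (by omega) a h3
        omega

/-- The weights used for `𝔫_{2n}^+`. -/
theorem good_last (p n : ℕ) : ∃ φ, Good p n (2 * n) φ := by
  refine ⟨_, good_of_weights (c := fun i => -(4 * n : ℤ) + (n - i.val))
    (d := fun i => -(4 * n : ℤ) + (i.val - n)) (D := -(8 * n)) (fun i => by ring)
    (fun i j h => ?_) (fun i j => ?_) (fun i hi => ?_) (fun i hi => ?_) (fun k l _ _ => ?_)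
    (fun k l _ _ => ?_) fun _ a ha => ?_⟩
  · have : i.val < j.val := h
    simp only; omega
  · have := i.2; have := j.2; omega
  · have := i.2; omega
  · omega
  · have := l.2; omega
  · have := l.2; omega
  · have h1 : lw (fun i : Fin n => -(4 * n : ℤ) + (n - i.val))
        (fun i : Fin n => -(4 * n : ℤ) + (i.val - n)) a ≤ ∑ v : Var n, (a v : ℤ) * (-(3 * n)) := by
      rw [lw, Fintype.sum_sum_type, ← Finset.sum_add_distrib]
      refine Finset.sum_le_sum fun i _ => add_le_add ?_ ?_
      · exact mul_le_mul_of_nonneg_left (by have := i.2; omega) (Int.natCast_nonneg _)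
      · exact mul_le_mul_of_nonneg_left (by have := i.2; omega) (Int.natCast_nonneg _)
    have h2 : ∑ v : Var n, (a v : ℤ) * (-(3 * n)) = (deg a : ℤ) * (-(3 * n)) := by
      rw [← Finset.sum_mul, deg]; push_cast; rfl
    have h3 : (0 : ℤ) < n := by
      rcases Nat.eq_zero_or_pos n with rfl | h
      · have : deg a = 0 := by simp [deg]
        omega
      · exact_mod_cast h
    have h4 : (3 : ℤ) ≤ deg a := by exact_mod_cast ha
    nlinarith

/-! The weights for the reflection in `-ε_k - δ`. -/

/-- The dominant part of the weight that is used for `𝔫_k^+`, `k < n`. The weights of `x_i` and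
`x_{n+i}` add up to `4`, as is needed for additivity under the bracket; `De_{x_i}` is nonnegative
for `i < k` only. -/
def piFirst (k : Fin n) (a : Var n → ℕ) : ℤ :=
  lw (fun i => if i < k then 4 else if i = k then 3 else 2)
    (fun i => if i < k then 0 else if i = k then 1 else 2) a - 4

/-- The subordinate part of the weights. It makes `De_{x_i x_{n+j}}` positive for `i < j` and
negative for `j < i`. -/
def psiFirst (a : Var n → ℕ) : ℤ := lw (fun i => (n - i.val : ℤ)) (fun i => (i.val - n : ℤ)) a

theorem lw_lin (c d c' d' : Fin n → ℤ) (x : ℤ) (a : Var n → ℕ) :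
    lw (fun i => x * c i + c' i) (fun i => x * d i + d' i) a = x * lw c d a + lw c' d' a := by
  rw [lw, lw, lw, Finset.mul_sum, ← Finset.sum_add_distrib]
  exact Finset.sum_congr rfl fun i _ => by ring

theorem abs_lw_le {a : Var n → ℕ} (ha : Valid p n a) {B : ℕ} (hc : ∀ i, |c i| ≤ B)
    (hd : ∀ i, |d i| ≤ B) : |lw c d a| ≤ n * ((p + 1) * B) := by
  have h1 : |lw c d a| ≤ ∑ _i : Fin n, (((p + 1) * B : ℕ) : ℤ) := by
    refine (Finset.abs_sum_le_sum_abs _ _).trans (Finset.sum_le_sum fun i _ => ?_)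
    refine (abs_add_le _ _).trans ?_
    rw [abs_mul, abs_mul, Nat.abs_cast, Nat.abs_cast]
    have h2 : ((a (Sum.inl i) : ℤ)) ≤ p := by exact_mod_cast (ha.1 i).le
    have h3 : ((a (Sum.inr i) : ℤ)) ≤ 1 := by exact_mod_cast ha.2 i
    have h4 := mul_le_mul h2 (hc i) (abs_nonneg _) (by positivity)
    have h5 := mul_le_mul h3 (hd i) (abs_nonneg _) (by positivity)
    push_cast
    linarith
  refine h1.trans ?_
  simp

/-- A number larger than all the values of the subordinate weights. -/
abbrev bigX (p n : ℕ) : ℤ := 2 * (n * ((p + 1) * (n + 1))) + n + 2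

/-- The weight that is used for `𝔫_k^+`, `k < n`. -/
def phiFirst (p : ℕ) (k : Fin n) (a : Var n → ℕ) : ℤ := bigX p n * piFirst k a + psiFirst a

theorem good_first (p : ℕ) (k : Fin n) : Good p n k.val (phiFirst p k) := by
  have hX : (n : ℤ) < bigX p n := by
    have : (0 : ℤ) ≤ n * ((p + 1) * (n + 1)) := by positivity
    rw [bigX]; omega
  have he : phiFirst p k = fun a => lw
      (fun i => bigX p n * (if i < k then 4 else if i = k then 3 else 2) + (n - i.val : ℤ))
      (fun i => bigX p n * (if i < k then 0 else if i = k then 1 else 2) + (i.val - n : ℤ)) a -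
      4 * bigX p n := by
    funext a
    rw [phiFirst, piFirst, psiFirst, lw_lin]; ring
  generalize bigX p n = X at *
  have hk := k.2
  rw [he]
  refine good_of_weights (fun i => ?_) (fun i j h => ?_) (fun i j => ?_) (fun i hi => ?_)
    (fun i hi => ?_) (fun k' l hk' hl => ?_) (fun k' l hk' _ => ?_) fun h => ?_
  · have := i.2
    split_ifs <;> ring
  · have h1 : i.val < j.val := h
    have := j.2
    simp only [Fin.lt_def, Fin.ext_iff]
    split_ifs <;> omega
  · have := i.2; have := j.2
    simp only [Fin.lt_def, Fin.ext_iff]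
    split_ifs <;> omega
  · have := i.2
    simp only [Fin.lt_def, Fin.ext_iff]
    split_ifs <;> omega
  · have := i.2
    simp only [Fin.lt_def, Fin.ext_iff]
    split_ifs <;> omega
  · have h1 : l.val ≤ k'.val := hl
    simp only [Fin.lt_def, Fin.ext_iff]
    split_ifs <;> omega
  · have := k'.2; omega
  · omega

theorem psiFirst_abs {a : Var n → ℕ} (ha : Valid p n a) :
    |psiFirst a| ≤ n * ((p + 1) * (n + 1)) := by
  have := abs_lw_le (B := n + 1) ha (c := fun i : Fin n => (n - i.val : ℤ))
    (d := fun i : Fin n => (i.val - n : ℤ)) (fun i => by have := i.2; rw [abs_le]; omega)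
    (fun i => by have := i.2; rw [abs_le]; omega)
  simpa [psiFirst] using this

theorem phiFirst_pos {k : Fin n} {a : Var n → ℕ} (ha : Valid p n a) (h : 0 < piFirst k a) :
    0 < phiFirst p k a := by
  have h1 := abs_le.1 (psiFirst_abs ha)
  have h2 : (0 : ℤ) ≤ n * ((p + 1) * (n + 1)) := by positivity
  have h3 : bigX p n ≤ bigX p n * piFirst k a := by
    have : 0 < bigX p n := by rw [bigX]; omega
    nlinarith
  rw [phiFirst]
  rw [bigX] at h3 ⊢
  omega

theorem piFirst_nonneg {k : Fin n} {a : Var n → ℕ} (ha : Valid p n a) (h : 0 ≤ phiFirst p k a) :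
    0 ≤ piFirst k a := by
  by_contra hneg
  have h1 := abs_le.1 (psiFirst_abs ha)
  have h2 : (0 : ℤ) ≤ n * ((p + 1) * (n + 1)) := by positivity
  have h3 : bigX p n * piFirst k a ≤ - bigX p n := by
    have : 0 < bigX p n := by rw [bigX]; omega
    nlinarith
  rw [phiFirst] at h
  rw [bigX] at h3 h
  omega

theorem piFirst_contr {k : Fin n} {a b e : Var n → ℕ} (h : e ∈ Contr p a b) :
    piFirst k e = piFirst k a + piFirst k b := by
  refine lw_contr (fun i => ?_) h
  split_ifs <;> rfl

theorem piFirst_eq (k : Fin n) (z : Var n → ℕ) : ∃ S : ℕ,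
    piFirst k z = 3 * z (Sum.inl k) + z (Sum.inr k) + 2 * S - 4 ∧
      (S = 0 → ∀ i, i ≠ k → z (Sum.inl i) = 0) := by
  refine ⟨∑ i ∈ Finset.univ.erase k,
    if i < k then 2 * z (Sum.inl i) else z (Sum.inl i) + z (Sum.inr i), ?_, fun h i hi => ?_⟩
  · rw [piFirst, lw, ← Finset.add_sum_erase _ _ (Finset.mem_univ k)]
    push_cast
    rw [Finset.mul_sum]
    simp only [lt_irrefl, if_false, if_true]
    have h : ∀ i ∈ Finset.univ.erase k, ((z (Sum.inl i) : ℤ) * (if i < k then 4 else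
        if i = k then 3 else 2) + (z (Sum.inr i) : ℤ) * (if i < k then 0 else
        if i = k then 1 else 2)) = 2 * (if i < k then 2 * (z (Sum.inl i) : ℤ) else
        (z (Sum.inl i) : ℤ) + z (Sum.inr i)) := fun i hi => by
      rw [if_neg (Finset.ne_of_mem_erase hi), if_neg (Finset.ne_of_mem_erase hi)]
      split_ifs <;> ring
    rw [Finset.sum_congr rfl h]
    ring
  · have h1 := Finset.sum_eq_zero_iff.1 h i (Finset.mem_erase.2 ⟨hi, Finset.mem_univ i⟩)
    split_ifs at h1 <;> omega

/-- An exponent of nonnegative weight and of degree `0` with respect to `piFirst` does not involve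
`x_k` and `x_{n+k}`, unless it is the one of `h_k`. -/
theorem piFirst_cases {k : Fin n} {z : Var n → ℕ} (hz : Valid p n z) (h0 : 0 ≤ phiFirst p k z)
    (h1 : piFirst k z = 0) :
    (z (Sum.inl k) = 0 ∧ z (Sum.inr k) = 0) ∨ z = unit (Sum.inl k) + unit (Sum.inr k) := by
  obtain ⟨S, h2, h3⟩ := piFirst_eq k z
  have h4 := hz.2 k
  rcases (show (z (Sum.inl k) = 0 ∧ z (Sum.inr k) = 0) ∨
    (z (Sum.inl k) = 1 ∧ z (Sum.inr k) = 1 ∧ S = 0) by omega) with h5 | ⟨h5, h6, rfl⟩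
  · exact Or.inl h5
  · refine Or.inr ?_
    obtain ⟨s, rfl⟩ := eq_add_unit (r := z) (v := Sum.inr k) (by omega)
    obtain ⟨s, rfl⟩ := eq_add_unit (r := s) (v := Sum.inl k) (by
      intro h; simp [h] at h5)
    rw [phiFirst, h1, mul_zero, zero_add, psiFirst, lw_add, lw_add, lw_unit_inl, lw_unit_inr] at h0
    have hs : s = 0 := by
      by_contra hs
      have : lw (fun i : Fin n => (n - i.val : ℤ)) (fun i => (i.val - n : ℤ)) s < 0 := by
        refine lw_neg (fun i hi => absurd ?_ hi) (fun i _ => by have := i.2; omega) hs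
        by_cases hik : i = k
        · subst hik; simpa using h5
        · have := h3 rfl i hik
          simpa [hik] using this
      omega
    rw [hs, zero_add]

theorem piFirst_one {k : Fin n} {z : Var n → ℕ} (h1 : piFirst k z = 1)
    (h2 : z (Sum.inr k) = 1) : z (Sum.inl k) = 0 := by
  obtain ⟨S, h3, -⟩ := piFirst_eq k z
  omega

/-! The weights for the reflection in `ε_k - δ`. -/

/-- The excess of even over odd variables with index below `k`. -/
def aSecond (k : Fin n) (a : Var n → ℕ) : ℤ :=
  lw (fun i => if i < k then 1 else 0) (fun i => if i < k then -1 else 0) a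

/-- The excess of `x_k` over `x_{n+k}`. -/
def kSecond (k : Fin n) (a : Var n → ℕ) : ℤ := a (Sum.inl k) - a (Sum.inr k)

/-- The number of odd variables, normalized so as to be additive under the bracket. -/
def oSecond (a : Var n → ℕ) : ℤ := (oddDeg a : ℤ) - 1

/-- The subordinate part of the weights. It has the signs of `psiFirst` on `De_{x_i x_{n+j}}`, but
is negative on the even variables. -/
def psiSecond (a : Var n → ℕ) : ℤ :=
  lw (fun i : Fin n => -(i.val + 1 : ℤ)) (fun i => (i.val + 1 : ℤ)) a

/-- The weight that is used for `𝔫_m^+`, `m + k + 1 = 2n`: the four parts above, ordered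
lexicographically. -/
def phiSecond (p : ℕ) (k : Fin n) (a : Var n → ℕ) : ℤ :=
  bigX p n ^ 3 * aSecond k a - bigX p n ^ 2 * oSecond a + bigX p n * kSecond k a + psiSecond a

theorem kSecond_eq (k : Fin n) (a : Var n → ℕ) :
    kSecond k a = lw (fun i => if i = k then 1 else 0) (fun i => if i = k then -1 else 0) a := by
  rw [kSecond, lw, Finset.sum_eq_single k]
  · simp; ring
  · intro i _ hi; simp [hi]
  · simp

theorem oddDeg_eq_lw (a : Var n → ℕ) : (oddDeg a : ℤ) = lw (fun _ => 0) (fun _ => 1) a := by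
  rw [oddDeg, lw]; simp

theorem phiSecond_eq (k : Fin n) (a : Var n → ℕ) : phiSecond p k a = lw
    (fun i => bigX p n ^ 3 * (if i < k then 1 else 0) + (bigX p n * (if i = k then 1 else 0) -
      (i.val + 1 : ℤ)))
    (fun i => bigX p n ^ 3 * (if i < k then -1 else 0) + (-bigX p n ^ 2 +
      (bigX p n * (if i = k then -1 else 0) + (i.val + 1 : ℤ)))) a - -bigX p n ^ 2 := by
  have h1 := lw_lin (fun i : Fin n => if i < k then (1 : ℤ) else 0)
    (fun i => if i < k then -1 else 0)
    (fun i => bigX p n * (if i = k then 1 else 0) - (i.val + 1 : ℤ))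
    (fun i => -bigX p n ^ 2 + (bigX p n * (if i = k then -1 else 0) + (i.val + 1 : ℤ)))
    (bigX p n ^ 3) a
  have h2 := lw_lin (fun _ : Fin n => (0 : ℤ)) (fun _ => 1)
    (fun i => bigX p n * (if i = k then 1 else 0) - (i.val + 1 : ℤ))
    (fun i => (bigX p n * (if i = k then -1 else 0) + (i.val + 1 : ℤ)))
    (-bigX p n ^ 2) a
  have h3 := lw_lin (fun i : Fin n => if i = k then (1 : ℤ) else 0)
    (fun i => if i = k then -1 else 0) (fun i : Fin n => -(i.val + 1 : ℤ))
    (fun i => (i.val + 1 : ℤ)) (bigX p n) a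
  simp only [mul_zero, zero_add, mul_one] at h2
  rw [h1, h2]
  simp only [sub_eq_add_neg] at h3 ⊢
  rw [h3, phiSecond, kSecond_eq, oSecond, oddDeg_eq_lw, aSecond, psiSecond]
  ring

theorem bigX_gt (p n : ℕ) : 2 * (n : ℤ) < bigX p n := by
  have h2 : (n : ℤ) ≤ n * ((p + 1) * (n + 1)) := by
    have : (1 : ℤ) ≤ (p + 1) * (n + 1) := by nlinarith [Int.natCast_nonneg p, Int.natCast_nonneg n]
    nlinarith [Int.natCast_nonneg n]
  rw [bigX]; omega

theorem good_second (p : ℕ) (k : Fin n) {m : ℕ} (hm : m + k.val + 1 = 2 * n) :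
    Good p n m (phiSecond p k) := by
  have hX := bigX_gt p n
  have hk := k.2
  have hY : bigX p n ≤ bigX p n ^ 2 := by nlinarith
  have hZ : bigX p n ^ 2 < bigX p n ^ 3 := by nlinarith [sq_nonneg (bigX p n)]
  rw [funext (phiSecond_eq (p := p) k)]
  generalize bigX p n ^ 3 = Z at *
  generalize bigX p n ^ 2 = Y at *
  generalize bigX p n = X at *
  refine good_of_weights (fun i => ?_) (fun i j h => ?_) (fun i j => ?_) (fun i hi => ?_)
    (fun i hi => ?_) (fun k' l hk' hl => ?_) (fun k' l hk' hl => ?_) fun h => ?_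
  · split_ifs <;> ring
  · have h1 : i.val < j.val := h
    have := j.2
    simp only [Fin.lt_def, Fin.ext_iff]
    split_ifs <;> omega
  · have := i.2; have := j.2
    simp only [Fin.lt_def, Fin.ext_iff]
    split_ifs <;> omega
  · have := i.2
    omega
  · have := i.2
    simp only [Fin.lt_def, Fin.ext_iff]
    split_ifs <;> omega
  · have := l.2
    simp only [Fin.lt_def, Fin.ext_iff]
    split_ifs <;> omega
  · have h1 : k'.val ≤ l.val := hl
    simp only [Fin.lt_def, Fin.ext_iff]
    split_ifs <;> omega
  · omega

theorem abs_second (k : Fin n) {a : Var n → ℕ} (ha : Valid p n a) :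
    |aSecond k a| ≤ n * ((p + 1) * (n + 1)) ∧ |oSecond a| ≤ n * ((p + 1) * (n + 1)) ∧
      |kSecond k a| ≤ n * ((p + 1) * (n + 1)) ∧ |psiSecond a| ≤ n * ((p + 1) * (n + 1)) := by
  have hk := k.2
  have key : ∀ c d : Fin n → ℤ, (∀ i, |c i| ≤ n + 1) → (∀ i, |d i| ≤ n + 1) →
      |lw c d a| ≤ n * ((p + 1) * (n + 1)) := fun c d hc hd => by
    have := abs_lw_le (B := n + 1) ha (c := c) (d := d) (by simpa using hc) (by simpa using hd)
    simpa using this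
  refine ⟨key _ _ (fun i => ?_) fun i => ?_, ?_, ?_, key _ _ (fun i => ?_) fun i => ?_⟩
  · rw [abs_le]; split_ifs <;> omega
  · rw [abs_le]; split_ifs <;> omega
  · have h1 : (oddDeg a : ℤ) ≤ n := by
      have : oddDeg a ≤ ∑ _i : Fin n, 1 := Finset.sum_le_sum fun i _ => ha.2 i
      have h2 : oddDeg a ≤ n := by simpa using this
      exact_mod_cast h2
    have h2 : (n : ℤ) ≤ n * ((p + 1) * (n + 1)) := by
      have : (1 : ℤ) ≤ (p + 1) * (n + 1) := by
        nlinarith [Int.natCast_nonneg p, Int.natCast_nonneg n]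
      nlinarith [Int.natCast_nonneg n]
    rw [oSecond, abs_le]
    omega
  · rw [kSecond_eq]
    refine key _ _ (fun i => ?_) fun i => ?_
    · rw [abs_le]; split_ifs <;> omega
    · rw [abs_le]; split_ifs <;> omega
  · have := i.2; rw [abs_le]; omega
  · have := i.2; rw [abs_le]; omega

theorem lex_pos {C X A O K P : ℤ} (hX : 2 * C + 2 ≤ X) (hO : |O| ≤ C) (hK : |K| ≤ C)
    (hP : |P| ≤ C) (h : 0 < A ∨ A = 0 ∧ (O < 0 ∨ O = 0 ∧ 0 < K)) :
    0 < X ^ 3 * A - X ^ 2 * O + X * K + P := by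
  rw [abs_le] at hO hK hP
  have hC : 0 ≤ C := by omega
  have hX0 : 0 < X := by omega
  have hXK : -(X * C) ≤ X * K := by nlinarith
  have h2 : X * C + C < X ^ 2 := by nlinarith
  rcases h with h | ⟨rfl, h | ⟨rfl, h⟩⟩
  · have h3 : X ^ 2 * O ≤ X ^ 2 * C := by nlinarith [sq_nonneg X]
    have h4 : X ^ 2 * C + X ^ 2 ≤ X ^ 3 := by
      have : X ^ 3 = X ^ 2 * X := by ring
      rw [this]; nlinarith [sq_nonneg X]
    have h5 : X ^ 3 ≤ X ^ 3 * A := by nlinarith [pow_pos hX0 3]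
    omega
  · have h3 : X ^ 2 ≤ -(X ^ 2 * O) := by nlinarith [sq_nonneg X]
    rw [mul_zero]; omega
  · have h3 : X ≤ X * K := by nlinarith
    rw [mul_zero, mul_zero]; omega

theorem phiSecond_pos (k : Fin n) {a : Var n → ℕ} (ha : Valid p n a)
    (h : 0 < aSecond k a ∨ aSecond k a = 0 ∧ (oSecond a < 0 ∨ oSecond a = 0 ∧ 0 < kSecond k a)) :
    0 < phiSecond p k a := by
  obtain ⟨-, h2, h3, h4⟩ := abs_second k ha
  exact lex_pos (by rw [bigX]; omega) h2 h3 h4 h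

theorem phiSecond_nonneg (k : Fin n) {a : Var n → ℕ} (ha : Valid p n a)
    (h : 0 ≤ phiSecond p k a) : 0 < aSecond k a ∨ aSecond k a = 0 ∧ (oSecond a < 0 ∨
      oSecond a = 0 ∧ (0 < kSecond k a ∨ kSecond k a = 0 ∧ 0 ≤ psiSecond a)) := by
  obtain ⟨h1, h2, h3, h4⟩ := abs_second k ha
  by_contra hcon
  have hneg : 0 < -aSecond k a ∨ -aSecond k a = 0 ∧ (-oSecond a < 0 ∨
      -oSecond a = 0 ∧ 0 < -kSecond k a) ∨
      (aSecond k a = 0 ∧ oSecond a = 0 ∧ kSecond k a = 0 ∧ psiSecond a < 0) := by omega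
  rcases hneg with h5 | h5 | ⟨h5, h6, h7, h8⟩
  · have := lex_pos (C := n * ((p + 1) * (n + 1))) (X := bigX p n) (A := -aSecond k a)
      (O := -oSecond a) (K := -kSecond k a) (P := -psiSecond a) (by rw [bigX]; omega)
      (by rwa [abs_neg]) (by rwa [abs_neg]) (by rwa [abs_neg]) (Or.inl h5)
    rw [phiSecond] at h
    linarith
  · have := lex_pos (C := n * ((p + 1) * (n + 1))) (X := bigX p n) (A := -aSecond k a)
      (O := -oSecond a) (K := -kSecond k a) (P := -psiSecond a) (by rw [bigX]; omega)
      (by rwa [abs_neg]) (by rwa [abs_neg]) (by rwa [abs_neg]) (Or.inr h5)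
    rw [phiSecond] at h
    linarith
  · rw [phiSecond, h5, h6, h7] at h
    omega

theorem second_contr (k : Fin n) {a b e : Var n → ℕ} (h : e ∈ Contr p a b) :
    aSecond k e = aSecond k a + aSecond k b ∧ oSecond e = oSecond a + oSecond b ∧
      kSecond k e = kSecond k a + kSecond k b ∧ psiSecond e = psiSecond a + psiSecond b := by
  have key : ∀ c d : Fin n → ℤ, (∀ i, c i + d i = 0) → lw c d e = lw c d a + lw c d b :=
    fun c d hcd => by simpa using lw_contr hcd h
  refine ⟨key _ _ fun i => ?_, ?_, ?_, key _ _ fun i => ?_⟩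
  · split_ifs <;> rfl
  · have := contr_oddDeg h
    simp only [oSecond]; omega
  · simp only [kSecond_eq]
    refine key _ _ fun i => ?_
    split_ifs <;> rfl
  · ring

end Weights

/-! ### Highest weight vectors of the irreducible modules -/

section Basic

theorem exists_good (p : ℕ) {n m : ℕ} (hm : m ≤ 2 * n) : ∃ φ, Good p n m φ := by
  rcases lt_or_ge m n with h | h
  · exact ⟨_, good_first p ⟨m, h⟩⟩
  · rcases hm.lt_or_eq with h1 | rfl
    · exact ⟨_, good_second p ⟨2 * n - 1 - m, by omega⟩ (by simp only; omega)⟩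
    · exact good_last p n

variable {F : Type*} [Field F] {p n m : ℕ} {lam : Module.Dual F (hBar F p n)}

theorem mul_mem_ann {x : U F p n} (y : U F p n) (h : x ∈ annIdeal F p n m lam) :
    y * x ∈ annIdeal F p n m lam := Submodule.smul_mem _ y h

theorem smul_mem_ann {x : U F p n} (c : F) (h : x ∈ annIdeal F p n m lam) :
    c • x ∈ annIdeal F p n m lam := by
  rw [Algebra.smul_def]; exact mul_mem_ann _ h

theorem smul_mem_ann_iff {x : U F p n} {c : F} (hc : c ≠ 0) :
    c • x ∈ annIdeal F p n m lam ↔ x ∈ annIdeal F p n m lam := by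
  refine ⟨fun h => ?_, smul_mem_ann c⟩
  have := smul_mem_ann c⁻¹ h
  rwa [smul_smul, inv_mul_cancel₀ hc, one_smul] at this

theorem one_notMem_ann (h : annIdeal F p n m lam ≠ ⊤) : (1 : U F p n) ∉ annIdeal F p n m lam :=
  fun h1 => h (leftIdeal_eq_top h1 isUnit_one)

theorem iD_mem_ann {a : Var n → ℕ} (h : Valid p n a) (ha : a ∈ posExp n m) :
    iD F p n (mon F p a) ∈ annIdeal F p n m lam := vermaIdeal_le_annIdeal (iD_mem_vermaIdeal h ha)

theorem add_smul_U (a b : F) (x : U F p n) : (a + b) • x = a • x + b • x := add_smul a b x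

theorem mul_mem_ann_of_mem_scalar {x : U F p n} {c : F}
    (h : x - algebraMap F _ c ∈ annIdeal F p n m lam) (w : U F p n) :
    w * x - c • w ∈ annIdeal F p n m lam := by
  have := mul_mem_ann w h
  rwa [mul_sub, ← Algebra.commutes, ← Algebra.smul_def] at this

variable [Fact p.Prime]

/-- The eigenvalue of `h_j` on a weight vector of weight `lam`. -/
abbrev ev (lam : Module.Dual F (hBar F p n)) (j : Fin n) : F := lam (hDe' F p j)

theorem iH_mem_ann (j : Fin n) : iH F p j - algebraMap F _ (ev lam j) ∈ annIdeal F p n m lam :=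
  vermaIdeal_le_annIdeal (iH_mem_vermaIdeal j)

theorem iE_mem_ann :
    iE F p n - algebraMap F _ (lam (euler' F p)) ∈ annIdeal F p n m lam :=
  vermaIdeal_le_annIdeal iE_mem_vermaIdeal

theorem mul_iH_mem_ann (w : U F p n) (j : Fin n) :
    w * iH F p j - ev lam j • w ∈ annIdeal F p n m lam := by
  have := mul_mem_ann w (iH_mem_ann (m := m) (lam := lam) j)
  rwa [mul_sub, ← Algebra.commutes, ← Algebra.smul_def] at this

theorem mul_iE_mem_ann (w : U F p n) :
    w * iE F p n - lam (euler' F p) • w ∈ annIdeal F p n m lam := by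
  have := mul_mem_ann w (iE_mem_ann (m := m) (lam := lam))
  rwa [mul_sub, ← Algebra.commutes, ← Algebra.smul_def] at this

/-- A vector of weight `c` with respect to `h_j` has eigenvalue `lam(h_j) + c` in the module. -/
theorem iH_mul_mem_ann {w : U F p n} {j : Fin n} {c e : F}
    (h : iH F p j * w = w * iH F p j + c • w) (he : ev lam j + c = e) :
    iH F p j * w - e • w ∈ annIdeal F p n m lam := by
  rw [h, ← he, add_smul_U, add_sub_add_right_eq_sub]
  exact mul_iH_mem_ann w j

theorem iE_mul_mem_ann {w : U F p n} {c e : F}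
    (h : iE F p n * w = w * iE F p n + c • w) (he : lam (euler' F p) + c = e) :
    iE F p n * w - e • w ∈ annIdeal F p n m lam := by
  rw [h, ← he, add_smul_U, add_sub_add_right_eq_sub]
  exact mul_iE_mem_ann w

variable [CharP F p] {φ : (Var n → ℕ) → ℤ}

theorem iD_mem_ann_of_nonneg (hφ : Good p n m φ) {a : Var n → ℕ} (ha : Valid p n a)
    (h : 0 ≤ φ a) (hcar : ∀ i : Fin n, a ≠ unit (Sum.inl i) + unit (Sum.inr i)) :
    iD F p n (mon F p a) ∈ annIdeal F p n m lam := by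
  rcases hφ.pos a ha h with rfl | ⟨i, h⟩ | h
  · rw [iD_mon_zero]; exact zero_mem _
  · exact absurd h (hcar i)
  · exact iD_mem_ann ha h

theorem iD_mem_ann_of_pos (hφ : Good p n m φ) {a : Var n → ℕ} (ha : Valid p n a)
    (h : 0 < φ a) : iD F p n (mon F p a) ∈ annIdeal F p n m lam :=
  iD_mem_ann_of_nonneg hφ ha h.le fun i hi => by
    rw [hi, hφ.cartan] at h; exact lt_irrefl _ h

theorem exists_scalar (hφ : Good p n m φ) {a : Var n → ℕ} (ha : Valid p n a)
    (h : 0 ≤ φ a) : ∃ c : F, iD F p n (mon F p a) - algebraMap F _ c ∈ annIdeal F p n m lam := by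
  by_cases hcar : ∀ i : Fin n, a ≠ unit (Sum.inl i) + unit (Sum.inr i)
  · exact ⟨0, by rw [map_zero, sub_zero]; exact iD_mem_ann_of_nonneg hφ ha h hcar⟩
  · push Not at hcar
    obtain ⟨i, rfl⟩ := hcar
    exact ⟨_, iH_mem_ann i⟩

/-- A family of `De_{x^{(a)}}` that is stable under brackets with the part of nonnegative degree
kills the highest weight vector, if it does so in nonnegative degrees. -/
theorem iD_mem_ann_of_stable (hp : 3 < p) (hφ : Good p n m φ) {S : Set (Var n → ℕ)}
    (hS : ∀ a ∈ S, Valid p n a)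
    (h0 : ∀ a ∈ S, 0 ≤ φ a → iD F p n (mon F p a) ∈ annIdeal F p n m lam)
    (h1 : ∀ z, Valid p n z → 0 ≤ φ z → z ≠ 0 →
      (∀ i : Fin n, z ≠ unit (Sum.inl i) + unit (Sum.inr i)) →
      ∀ a ∈ S, ∀ c ∈ Contr p z a, c ∈ S ∨ 0 < φ c) :
    ∀ a ∈ S, iD F p n (mon F p a) ∈ annIdeal F p n m lam := by
  set X : Set (U F p n) := (fun a => iD F p n (mon F p a)) '' {a | a ∈ S ∧ φ a < 0} with hX
  have key : ∀ a ∈ S, iD F p n (mon F p a) ∈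
      Submodule.span F X ⊔ (annIdeal F p n m lam).restrictScalars F := fun a ha => by
    rcases lt_or_ge (φ a) 0 with h | h
    · exact Submodule.mem_sup_left (Submodule.subset_span ⟨a, ⟨ha, h⟩, rfl⟩)
    · exact Submodule.mem_sup_right (h0 a ha h)
  have hmain : ∀ x ∈ X, x ∈ annIdeal F p n m lam := by
    refine mem_annIdeal_of_stable hp hφ ?_ ?_ ?_ ?_
    · rintro _ ⟨a, -, rfl⟩
      exact ⟨_, tau_iD_mon a⟩
    · rintro _ ⟨a, ⟨ha, ha0⟩, rfl⟩ z hz hz0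
      have hxa : iD F p n (mon F p a) ∈ Submodule.span F X :=
        Submodule.subset_span ⟨a, ⟨ha, ha0⟩, rfl⟩
      by_cases hz1 : z = 0
      · subst hz1
        rw [iD_mon_zero, zero_mul]; exact zero_mem _
      by_cases hcar : ∀ i : Fin n, z ≠ unit (Sum.inl i) + unit (Sum.inr i)
      · change iD F p n (mon F p z) * iD F p n (mon F p a) ∈ _
        rw [iD_bracket (isPar_mon z) (isPar_mon a)]
        refine add_mem (Submodule.mem_sup_right ?_) ?_
        · exact smul_mem_ann _ (mul_mem_ann _ (iD_mem_ann_of_nonneg hφ hz hz0 hcar))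
        · have h2 : iDS F p (Contr p z a) ≤
              Submodule.span F X ⊔ (annIdeal F p n m lam).restrictScalars F := by
            rw [iDS, Submodule.span_le]
            rintro _ ⟨c, hc, rfl⟩
            rcases h1 z hz hz0 hz1 hcar a ha c hc with h | h
            · exact key c h
            · exact Submodule.mem_sup_right (iD_mem_ann_of_pos hφ hc.1 h)
          exact h2 (iD_mem_iDS (De_mon_mem z a))
      · push Not at hcar
        obtain ⟨i, rfl⟩ := hcar
        have h2 := mul_iH_mem_ann (m := m) (lam := lam) (iD F p n (mon F p a)) i
        change iH F p i * iD F p n (mon F p a) ∈ _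
        rw [iH_iD, ← sub_add_cancel (_ * iH F p i) (ev lam i • iD F p n (mon F p a))]
        exact add_mem (add_mem (Submodule.mem_sup_right h2)
          (Submodule.mem_sup_left (Submodule.smul_mem _ _ hxa)))
          (Submodule.mem_sup_left (Submodule.smul_mem _ _ hxa))
    · rintro _ ⟨a, ⟨ha, ha0⟩, rfl⟩
      have hxa : iD F p n (mon F p a) ∈ Submodule.span F X :=
        Submodule.subset_span ⟨a, ⟨ha, ha0⟩, rfl⟩
      have h2 := mul_iE_mem_ann (m := m) (lam := lam) (iD F p n (mon F p a))
      change iE F p n * iD F p n (mon F p a) ∈ _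
      rw [iE_iD, ← sub_add_cancel (_ * iE F p n) (lam (euler' F p) • iD F p n (mon F p a))]
      exact add_mem (add_mem (Submodule.mem_sup_right h2)
        (Submodule.mem_sup_left (Submodule.smul_mem _ _ hxa)))
        (Submodule.mem_sup_left (Submodule.smul_mem _ _ hxa))
    · rintro _ ⟨a, ⟨ha, ha0⟩, rfl⟩
      refine Submodule.mem_sup_left ?_
      change iD F p n (mon F p a) ∈ _
      rw [← mul_one (iD F p n (mon F p a))]
      exact Submodule.mul_mem_mul (mem_iDS ⟨hS a ha, ha0⟩) trivial
  intro a ha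
  rcases lt_or_ge (φ a) 0 with h | h
  · exact hmain _ ⟨a, ⟨ha, h⟩, rfl⟩
  · exact h0 a ha h

theorem annIdeal_ne_top_of_le (hp : 3 < p) (hm : m ≤ 2 * n) (h : vermaIdeal F p n m lam ≠ ⊤) :
    annIdeal F p n m lam ≠ ⊤ := by
  obtain ⟨φ, hφ⟩ := exists_good p hm
  exact annIdeal_ne_top hp hφ h

end Basic

/-! ### The reflection in `-ε_k - δ` -/

section First

variable {F : Type*} [Field F] {p n : ℕ} [Fact p.Prime]

theorem iE_mul_inl (k : Fin n) : iE F p n * iD F p n (mon F p (unit (Sum.inl k))) =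
    iD F p n (mon F p (unit (Sum.inl k))) * iE F p n +
      (-1 : F) • iD F p n (mon F p (unit (Sum.inl k))) := by
  rw [iE_iD, deg_unit]
  congr 2
  push_cast; ring

variable [CharP F p]{lam : Module.Dual F (hBar F p n)}

theorem iD_mul_inl_of_eq_zero {z : Var n → ℕ} {k : Fin n} (h : z (Sum.inr k) = 0) :
    ∃ e : F, iD F p n (mon F p z) * iD F p n (mon F p (unit (Sum.inl k))) =
      e • (iD F p n (mon F p (unit (Sum.inl k))) * iD F p n (mon F p z)) := by
  refine ⟨(-1) ^ ((oddDeg z + 1) * (oddDeg (unit (Sum.inl k) : Var n → ℕ) + 1)), ?_⟩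
  rw [iD_bracket (isPar_mon z) (isPar_mon _), De_unit_inl (isPar_mon z), pd_mon_of_eq_zero h,
    smul_zero, map_zero, add_zero]

theorem iD_mul_inl {s : Var n → ℕ} {k : Fin n} (h : Valid p n (s + unit (Sum.inr k))) :
    ∃ e c : F, c ≠ 0 ∧ iD F p n (mon F p (s + unit (Sum.inr k))) *
      iD F p n (mon F p (unit (Sum.inl k))) =
      e • (iD F p n (mon F p (unit (Sum.inl k))) * iD F p n (mon F p (s + unit (Sum.inr k)))) +
        c • iD F p n (mon F p s) := by
  refine ⟨(-1) ^ ((oddDeg (s + unit (Sum.inr k)) + 1) *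
    (oddDeg (unit (Sum.inl k) : Var n → ℕ) + 1)), (-1) ^ oddDeg (s + unit (Sum.inr k)) *
    (-1) ^ dSign (Sum.inr k) s, ?_, ?_⟩
  · exact mul_ne_zero (pow_ne_zero _ (neg_ne_zero.2 one_ne_zero))
      (pow_ne_zero _ (neg_ne_zero.2 one_ne_zero))
  · rw [iD_bracket (isPar_mon _) (isPar_mon _), De_unit_inl (isPar_mon _), pd_mon_add_unit h,
      smul_smul, map_smul]

theorem iH_mul_inl (j k : Fin n) : iH F p j * iD F p n (mon F p (unit (Sum.inl k))) =
    iD F p n (mon F p (unit (Sum.inl k))) * iH F p j +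
      (if k = j then -1 else 0 : F) • iD F p n (mon F p (unit (Sum.inl k))) := by
  rw [iH_iD]
  congr 2
  by_cases h : k = j
  · subst h; simp
  · simp [h, Ne.symm h]

theorem mem_posExp_succ_first {k : Fin n} {a : Var n → ℕ} (h : a ∈ posExp n (k.val + 1)) :
    a = unit (Sum.inl k) ∨ (a ∈ posExp n k.val ∧ a ∉ W₁ k) := by
  rw [posExp_succ_first k.2] at h
  rcases h with h | h
  · exact Or.inr h
  · exact Or.inl h

theorem ev_sub_eps_sub_delta [NeZero n] (hp : 3 < p) (j k : Fin n) :
    ev lam j + (if k = j then -1 else 0) = (lam - eps F p k - delta F p n) (hDe' F p j) := by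
  rw [LinearMap.sub_apply, LinearMap.sub_apply, eps_hDe F p (two_ne_zero' hp), delta_hDe]
  split_ifs <;> ring

theorem unit_mul_self_eq_zero (hp : 3 < p) (k : Fin n) :
    iD F p n (mon F p (unit (Sum.inl k))) * iD F p n (mon F p (unit (Sum.inl k))) = 0 := by
  have h1 := iD_bracket (F := F) (p := p) (isPar_mon (unit (Sum.inl k) : Var n → ℕ))
    (isPar_mon (unit (Sum.inl k)))
  rw [oddDeg_unit_inl, De_unit_inl (isPar_mon _), pd_mon_of_eq_zero (by simp), smul_zero, map_zero,
    add_zero, zero_add, one_mul, pow_one, neg_one_smul_U] at h1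
  have h2 : (2 : F) • (iD F p n (mon F p (unit (Sum.inl k))) *
      iD F p n (mon F p (unit (Sum.inl k)))) = 0 := by
    rw [two_smul]
    exact eq_neg_iff_add_eq_zero.1 h1
  exact (smul_eq_zero.1 h2).resolve_left (two_ne_zero' hp)

/-- The generic case: the new highest weight vector is `De_{x_k} v`. It does not vanish, since
`De_{x_j x_{n+j} x_{n+k}}` maps it to a nonzero multiple of `h_j v`. -/
theorem step_first_generic [NeZero n] (hp : 3 < p) (k : Fin n) (hlam : ∃ j, j ≠ k ∧ ev lam j ≠ 0)
    (hI : vermaIdeal F p n k.val lam ≠ ⊤) :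
    LIso F p n k.val lam (k.val + 1) (lam - eps F p k - delta F p n) ∧
      vermaIdeal F p n (k.val + 1) (lam - eps F p k - delta F p n) ≠ ⊤ := by
  have hk := k.2
  obtain ⟨j, hjk, hj⟩ := hlam
  have hR := annIdeal_ne_top_of_le hp (by omega) hI
  refine lIso_of_singular (two_ne_zero' hp) (annIdeal_ne_top_of_le hp (by omega))
    (iD_mem_uPart (isPar_mon (unit (Sum.inl k)))) ?_ ?_ ?_ ?_
  · intro hw
    have hv : Valid p n (unit (Sum.inl j) + unit (Sum.inr j) + unit (Sum.inr k)) := by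
      have h2 : 1 < p := by omega
      refine ⟨fun i => ?_, fun i => ?_⟩
      · simp [Pi.single_apply]; split_ifs <;> omega
      · simp only [Pi.add_apply, Pi.single_apply]
        have h3 : ¬ (i = j ∧ i = k) := fun h => hjk (h.1.symm.trans h.2)
        by_cases h4 : i = j <;> by_cases h5 : i = k <;> simp [h4, h5] <;> simp_all
    have hpos : (unit (Sum.inl j) + unit (Sum.inr j) + unit (Sum.inr k) : Var n → ℕ) |>
        (0 < piFirst k ·) := by
      simp only [piFirst, lw_add, lw_unit_inl, lw_unit_inr]
      rw [if_neg hjk]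
      split_ifs <;> simp_all
    have hy := iD_mem_ann_of_pos (F := F) (lam := lam) (good_first p k) hv (phiFirst_pos hv hpos)
    obtain ⟨e, c, hc, h⟩ := iD_mul_inl (F := F) hv
    have h1 := mul_mem_ann (iD F p n (mon F p (unit (Sum.inl j) + unit (Sum.inr j) +
      unit (Sum.inr k)))) hw
    rw [h, Submodule.add_mem_iff_right _ (smul_mem_ann _ (mul_mem_ann _ hy)),
      smul_mem_ann_iff hc] at h1
    have h2 := sub_mem h1 (iH_mem_ann (m := k.val) (lam := lam) j)
    rw [sub_sub_cancel, Algebra.algebraMap_eq_smul_one, smul_mem_ann_iff hj] at h2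
    exact one_notMem_ann hR h2
  · intro a ha hmem
    rcases mem_posExp_succ_first hmem with rfl | ⟨h1, h2⟩
    · rw [unit_mul_self_eq_zero hp]; exact zero_mem _
    · by_cases h0 : a (Sum.inr k) = 0
      · obtain ⟨e, he⟩ := iD_mul_inl_of_eq_zero (F := F) (p := p) h0
        rw [he]
        exact smul_mem_ann _ (mul_mem_ann _ (iD_mem_ann ha h1))
      · obtain ⟨s, rfl⟩ := eq_add_unit h0
        obtain ⟨e, c, -, he⟩ := iD_mul_inl (F := F) ha
        have hsk : s (Sum.inr k) = 0 := by
          have := ha.2 k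
          simpa using this
        rw [he]
        refine add_mem (smul_mem_ann _ (mul_mem_ann _ (iD_mem_ann ha h1))) (smul_mem_ann _ ?_)
        rcases sub_inr_mem h1 h2 hsk with rfl | h3
        · rw [iD_mon_zero]; exact zero_mem _
        · exact iD_mem_ann (ha.mono fun v => by simp) h3
  · intro j
    exact iH_mul_mem_ann (iH_mul_inl j k) (ev_sub_eps_sub_delta hp j k)
  · refine iE_mul_mem_ann (iE_mul_inl k) ?_
    rw [LinearMap.sub_apply, LinearMap.sub_apply, eps_euler, delta_euler F p (two_ne_zero' hp)]
    ring

/-- In the special case all `De_f` of degree `0` with respect to `piFirst` that do not involve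
`x_k` and `x_{n+k}` act by zero, as they generate a proper submodule. -/
theorem iD_mem_ann_special {k : Fin n} (hp : 3 < p) (hlam : ∀ j, j ≠ k → ev lam j = 0) :
    ∀ a ∈ {a | Valid p n a ∧ piFirst k a = 0 ∧ a (Sum.inl k) = 0 ∧ a (Sum.inr k) = 0},
      iD F p n (mon F p a) ∈ annIdeal F p n k.val lam := by
  refine iD_mem_ann_of_stable hp (good_first p k) (fun a ha => ha.1) ?_ ?_
  · rintro a ⟨ha, h1, h2, h3⟩ h0
    by_cases hcar : ∀ i : Fin n, a ≠ unit (Sum.inl i) + unit (Sum.inr i)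
    · exact iD_mem_ann_of_nonneg (good_first p k) ha h0 hcar
    · push Not at hcar
      obtain ⟨i, rfl⟩ := hcar
      have hik : i ≠ k := by rintro rfl; simp at h2
      have := iH_mem_ann (F := F) (m := k.val) (lam := lam) i
      rwa [hlam i hik, map_zero, sub_zero] at this
  · rintro z hz h0 - hcar a ⟨ha, h1, h2, h3⟩ c hc
    have h4 := piFirst_contr (k := k) hc
    rw [h1, add_zero] at h4
    rcases (piFirst_nonneg hz h0).lt_or_eq with h5 | h5
    · exact Or.inr (phiFirst_pos hc.1 (h4 ▸ h5))
    · rcases piFirst_cases hz h0 h5.symm with ⟨h6, h7⟩ | h6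
      · refine Or.inl ⟨hc.1, h4.trans h5.symm, ?_⟩
        have := contr_pair hc k
        rw [h2, h3, h6, h7] at this
        omega
      · exact absurd h6 (hcar k)

/-- The special case: the old highest weight vector `v` is still one, since `De_{x_k} v` generates
a proper submodule. -/
theorem step_first_special (hp : 3 < p) (k : Fin n) (hlam : ∀ j, j ≠ k → ev lam j = 0)
    (hI : vermaIdeal F p n k.val lam ≠ ⊤) :
    LIso F p n k.val lam (k.val + 1) lam ∧ vermaIdeal F p n (k.val + 1) lam ≠ ⊤ := by
  have hk := k.2
  have hR := annIdeal_ne_top_of_le hp (by omega) hI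
  have hmain : ∀ x ∈ ({iD F p n (mon F p (unit (Sum.inl k)))} : Set (U F p n)),
      x ∈ annIdeal F p n k.val lam := by
    refine mem_annIdeal_of_stable hp (good_first p k) ?_ ?_ ?_ ?_
    · rintro _ rfl; exact ⟨_, tau_iD_mon _⟩
    · rintro _ rfl z hz h0
      obtain ⟨c, hc⟩ := exists_scalar (F := F) (lam := lam) (good_first p k) hz h0
      have h1 : iD F p n (mon F p (unit (Sum.inl k))) * iD F p n (mon F p z) ∈
          Submodule.span F {iD F p n (mon F p (unit (Sum.inl k)))} ⊔
            (annIdeal F p n k.val lam).restrictScalars F := by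
        have := mul_mem_ann_of_mem_scalar hc (iD F p n (mon F p (unit (Sum.inl k))))
        rw [← sub_add_cancel (_ * iD F p n (mon F p z))
          (c • iD F p n (mon F p (unit (Sum.inl k))))]
        exact add_mem (Submodule.mem_sup_right this) (Submodule.mem_sup_left
          (Submodule.smul_mem _ _ (Submodule.mem_span_singleton_self _)))
      by_cases hzk : z (Sum.inr k) = 0
      · obtain ⟨e, he⟩ := iD_mul_inl_of_eq_zero (F := F) (p := p) hzk
        rw [he]
        exact Submodule.smul_mem _ _ h1
      · have hz1 : z (Sum.inr k) = 1 := by have := hz.2 k; omega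
        obtain ⟨s, rfl⟩ := eq_add_unit hzk
        have hs : Valid p n s := hz.mono fun v => by simp
        obtain ⟨e, c', -, he⟩ := iD_mul_inl (F := F) hz
        rw [he]
        refine add_mem (Submodule.smul_mem _ _ h1) (Submodule.smul_mem _ _ ?_)
        have h2 : piFirst k (s + unit (Sum.inr k)) = piFirst k s + 1 := by
          rw [piFirst, piFirst, lw_add, lw_unit_inr]; simp; ring
        rcases (piFirst_nonneg hz h0).lt_or_eq with h3 | h3
        · refine Submodule.mem_sup_right ?_
          rcases (show 0 < piFirst k s ∨ piFirst k s = 0 by omega) with h4 | h4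
          · exact iD_mem_ann_of_pos (good_first p k) hs (phiFirst_pos hs h4)
          · have h5 : s (Sum.inl k) = 0 := by
              have := piFirst_one (k := k) (z := s + unit (Sum.inr k)) (by omega) hz1
              simpa using this
            exact iD_mem_ann_special hp hlam s ⟨hs, h4, h5, by simpa using hz1⟩
        · rcases piFirst_cases hz h0 h3.symm with ⟨-, h4⟩ | h4
          · exact absurd h4 hzk
          · rw [add_right_cancel h4]
            exact Submodule.mem_sup_left (Submodule.mem_span_singleton_self _)
    · rintro _ rfl
      have := mul_iE_mem_ann (m := k.val) (lam := lam) (iD F p n (mon F p (unit (Sum.inl k))))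
      rw [iE_mul_inl, ← sub_add_cancel (_ * iE F p n)
        (lam (euler' F p) • iD F p n (mon F p (unit (Sum.inl k))))]
      have h1 : iD F p n (mon F p (unit (Sum.inl k))) ∈
        Submodule.span F {iD F p n (mon F p (unit (Sum.inl k)))} :=
        Submodule.mem_span_singleton_self _
      exact add_mem (add_mem (Submodule.mem_sup_right this)
        (Submodule.mem_sup_left (Submodule.smul_mem _ _ h1)))
        (Submodule.mem_sup_left (Submodule.smul_mem _ _ h1))
    · rintro _ rfl
      refine Submodule.mem_sup_left ?_
      rw [← mul_one (iD F p n _)]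
      refine Submodule.mul_mem_mul (mem_iDS ⟨valid_unit p _, ?_⟩) trivial
      by_contra hneg
      have h1 := piFirst_nonneg (valid_unit p _) (not_lt.1 hneg)
      rw [piFirst, lw_unit_inl] at h1
      simp at h1
  refine lIso_of_singular (two_ne_zero' hp) (annIdeal_ne_top_of_le hp (by omega))
    one_mem_uPart (one_notMem_ann hR) ?_ ?_ ?_
  · intro a ha hmem
    rw [mul_one]
    rcases mem_posExp_succ_first hmem with rfl | ⟨h1, h2⟩
    · exact hmain _ rfl
    · exact iD_mem_ann ha h1
  · intro j
    rw [mul_one, ← Algebra.algebraMap_eq_smul_one]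
    exact iH_mem_ann j
  · rw [mul_one, ← Algebra.algebraMap_eq_smul_one]
    exact iE_mem_ann

end First

/-! ### The reflection in `ε_k - δ` -/

section Binomial

variable {A : Type*} [Ring A]

theorem mul_pow_eq_sum (P : A) (s : ℕ) (f : ℕ → A) (h : ∀ t, f t * P = P * f t - f (t + 1)) :
    f 0 * P ^ s = ∑ ij ∈ Finset.HasAntidiagonal.antidiagonal s,
      s.choose ij.1 • ((-1) ^ ij.1 * (P ^ ij.2 * f ij.1)) := by
  induction s generalizing f with
  | zero => simp
  | succ s ih =>
    rw [Finset.sum_antidiagonal_choose_succ_nsmul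
      (fun i j => (-1) ^ i * (P ^ j * f i)), pow_succ', ← mul_assoc, h, sub_mul, mul_assoc, ih f h,
      ih (fun t => f (t + 1)) fun t => h (t + 1), Finset.mul_sum, sub_eq_add_neg,
      ← Finset.sum_neg_distrib]
    congr 1
    · refine Finset.sum_congr rfl fun ij _ => ?_
      have h1 : P * (-1) ^ ij.1 = (-1) ^ ij.1 * P :=
        ((Commute.neg_one_left P).pow_left ij.1).eq.symm
      rw [mul_smul_comm, ← mul_assoc, h1, pow_succ']
      simp only [mul_assoc]
    · refine Finset.sum_congr rfl fun ij hij => ?_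
      rw [← smul_neg, pow_succ, mul_neg_one, neg_mul,
        Nat.choose_symm_of_eq_add (Finset.HasAntidiagonal.mem_antidiagonal.1 hij).symm]

/-- Only two terms of the commutator expansion survive modulo a left ideal. -/
theorem mul_pow_sub_mem (R : Submodule A A) (P : A) (s r : ℕ) (f : ℕ → A)
    (h : ∀ t, f t * P = P * f t - f (t + 1)) (hf : ∀ t, t ≠ r → t ≠ r + 1 → f t ∈ R) :
    f 0 * P ^ s - (s.choose r • ((-1) ^ r * (P ^ (s - r) * f r)) +
      s.choose (r + 1) • ((-1) ^ (r + 1) * (P ^ (s - (r + 1)) * f (r + 1)))) ∈ R := by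
  rw [mul_pow_eq_sum P s f h, Finset.Nat.sum_antidiagonal_eq_sum_range_succ
    (fun i j => s.choose i • ((-1) ^ i * (P ^ j * f i))), ← Submodule.Quotient.mk_eq_zero,
    Submodule.Quotient.mk_sub, ← Submodule.mkQ_apply, ← Submodule.mkQ_apply, map_sum, map_add,
    sub_eq_zero]
  refine Finset.sum_eq_add r (r + 1) (by omega) (fun t _ ht => ?_) (fun ht => ?_) fun ht => ?_
  · rw [Submodule.mkQ_apply, Submodule.Quotient.mk_eq_zero]
    refine nsmul_mem ?_ _
    rw [← mul_assoc]
    exact R.smul_mem _ (hf t ht.1 ht.2)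
  · rw [Nat.choose_eq_zero_of_lt (by simpa using ht), zero_smul, map_zero]
  · rw [Nat.choose_eq_zero_of_lt (by simpa using ht), zero_smul, map_zero]

end Binomial

section Second

variable {F : Type*} [Field F] {p n m : ℕ}

theorem lw_smul (c d : Fin n → ℤ) (t : ℕ) (a : Var n → ℕ) : lw c d (t • a) = t * lw c d a := by
  induction t with
  | zero => simp [lw_zero]
  | succ t ih => rw [succ_nsmul, lw_add, ih]; push_cast; ring

theorem second_sub (k : Fin n) (z : Var n → ℕ) (t : ℕ) :
    aSecond k (z + t • unit (Sum.inl k)) = aSecond k z ∧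
      oSecond (z + t • unit (Sum.inl k)) = oSecond z ∧
      kSecond k (z + t • unit (Sum.inl k)) = kSecond k z + t := by
  refine ⟨?_, ?_, ?_⟩
  · rw [aSecond, aSecond, lw_add, lw_smul, lw_unit_inl]; simp
  · simp only [oSecond, oddDeg]
    simp
  · simp only [kSecond]
    simp; ring

theorem pd_pow_mon (k : Fin n) {z : Var n → ℕ} (hz : Valid p n z) (t : ℕ) :
    (∃ z', z = z' + t • unit (Sum.inl k) ∧ (pd F p (Sum.inl k) ^ t) (mon F p z) = mon F p z') ∨
      (z (Sum.inl k) < t ∧ (pd F p (Sum.inl k) ^ t) (mon F p z) = 0) := by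
  induction t with
  | zero => exact Or.inl ⟨z, by simp, by simp⟩
  | succ t ih =>
    rw [pow_succ', Module.End.mul_apply]
    rcases ih with ⟨z', h1, h2⟩ | ⟨h1, h2⟩
    · rw [h2]
      by_cases h0 : z' (Sum.inl k) = 0
      · refine Or.inr ⟨?_, pd_mon_of_eq_zero h0⟩
        rw [h1]; simp [h0]
      · obtain ⟨s, rfl⟩ := eq_add_unit h0
        refine Or.inl ⟨s, by rw [h1, succ_nsmul']; abel, pd_mon_inl (hz.mono fun v => ?_)⟩
        rw [h1]; simp
    · rw [h2, map_zero]
      exact Or.inr ⟨by omega, rfl⟩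

theorem valid_of_add {z s : Var n → ℕ} (h : Valid p n (z + s)) : Valid p n z :=
  h.mono fun v => by simp

variable (F p) in
/-- The lowering operator `-De_{x_{n+k}}`. -/
def lowOp (k : Fin n) : U F p n := (-1 : F) • iD F p n (mon F p (unit (Sum.inr k)))

theorem lowOp_mem_uPart (k : Fin n) (s : ℕ) : lowOp F p k ^ s ∈ uPart F p n 0 := by
  induction s with
  | zero => rw [pow_zero]; exact one_mem_uPart
  | succ s ih =>
    have h1 : lowOp F p k ∈
        uPart F p n ((oddDeg (unit (Sum.inr k) : Var n → ℕ) + 1 : ℕ) : ZMod 2) :=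
      Submodule.smul_mem _ _ (iD_mem_uPart (isPar_mon _))
    have h2 : ((oddDeg (unit (Sum.inr k) : Var n → ℕ) + 1 : ℕ) : ZMod 2) = 0 := by
      rw [oddDeg_unit_inr]; rfl
    rw [h2] at h1
    have h3 := mul_mem_uPart ih h1
    rwa [add_zero, ← pow_succ] at h3

variable [Fact p.Prime]

theorem tau_lowOp (k : Fin n) (s : ℕ) : tau F p n (lowOp F p k ^ s) = lowOp F p k ^ s := by
  have := tau_of_mem_uPart (lowOp_mem_uPart (F := F) (p := p) k s)
  rwa [ZMod.val_zero, pow_zero, one_smul] at this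

theorem De_unit_inr_apply (k : Fin n) (f : O F p n) :
    De F p n (mon F p (unit (Sum.inr k))) f = (-1 : F) • pd F p (Sum.inl k) f := by
  induction f using mon_induction with
  | zero => simp
  | add a b ha hb => simp only [map_add, ha, hb, smul_add]
  | smul c a ha => rw [map_smul, map_smul, ha, smul_comm]
  | mon r hr =>
    rw [De_antisymm (isPar_mon _) (isPar_mon r), De_unit_inr (isPar_mon r), oddDeg_unit_inr]
    have : (-1 : F) ^ ((1 + 1) * (oddDeg r + 1)) = 1 := by
      rw [pow_mul]; norm_num
    rw [this]

theorem iE_mul_lowOp_pow (k : Fin n) (s : ℕ) : iE F p n * lowOp F p k ^ s =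
    lowOp F p k ^ s * iE F p n + (-(s : F)) • lowOp F p k ^ s := by
  have h1 : iE F p n * lowOp F p k =
      lowOp F p k * iE F p n + (-1 : F) • lowOp F p k := by
    have e : ((deg (unit (Sum.inr k) : Var n → ℕ) : F) - 2) = -1 := by
      rw [deg_unit]; push_cast; ring
    rw [lowOp, mul_smul_comm, iE_iD, e, smul_mul_assoc, smul_add]
  induction s with
  | zero => simp
  | succ s ih =>
    rw [pow_succ, ← mul_assoc, ih, add_mul, mul_assoc, h1, mul_add, smul_mul_assoc, mul_smul_comm,
      add_assoc, ← add_smul_U, mul_assoc]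
    congr 2
    push_cast; ring

variable [CharP F p] {lam : Module.Dual F (hBar F p n)}

theorem iD_mul_lowOp (k : Fin n) (f : O F p n) : iD F p n f * lowOp F p k =
    lowOp F p k * iD F p n f - iD F p n (pd F p (Sum.inl k) f) := by
  induction f using mon_induction with
  | zero => simp
  | add a b ha hb => simp only [map_add, add_mul, mul_add, ha, hb]; abel
  | smul c a ha =>
    simp only [map_smul, smul_mul_assoc, mul_smul_comm, ha]
    exact smul_sub _ _ _
  | mon r hr =>
    have h := iD_bracket (F := F) (p := p) (isPar_mon (unit (Sum.inr k) : Var n → ℕ)) (isPar_mon r)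
    have : (-1 : F) ^ ((1 + 1) * (oddDeg r + 1)) = 1 := by
      rw [pow_mul]; norm_num
    rw [oddDeg_unit_inr, this, one_smul, De_unit_inr_apply, map_smul] at h
    rw [lowOp, mul_smul_comm, smul_mul_assoc, h, smul_add, smul_smul, neg_mul_neg, one_mul,
      one_smul, add_sub_cancel_right]

theorem iD_pow_mul_lowOp (k : Fin n) (f : O F p n) (t : ℕ) :
    iD F p n ((pd F p (Sum.inl k) ^ t) f) * lowOp F p k =
      lowOp F p k * iD F p n ((pd F p (Sum.inl k) ^ t) f) -
        iD F p n ((pd F p (Sum.inl k) ^ (t + 1)) f) := by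
  rw [iD_mul_lowOp, pow_succ', Module.End.mul_apply]

theorem lowOp_pow_char (hp : 3 < p) (k : Fin n) : lowOp F p k ^ p = 0 := by
  have h : iD F p n (mon F p (unit (Sum.inr k))) ^ p = 0 := by
    refine iD_pow_char hp (valid_unit p _) (by rw [oddDeg_unit_inr]; exact odd_one) fun i hi => ?_
    have := congrArg deg hi
    rw [deg_add, deg_unit, deg_unit, deg_unit] at this
    omega
  rw [lowOp, smul_pow, h, smul_zero]

theorem iH_mul_lowOp_pow (j k : Fin n) (s : ℕ) : iH F p j * lowOp F p k ^ s =
    lowOp F p k ^ s * iH F p j + ((s : F) * if k = j then 1 else 0) • lowOp F p k ^ s := by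
  have h1 : iH F p j * lowOp F p k =
      lowOp F p k * iH F p j + (if k = j then 1 else 0 : F) • lowOp F p k := by
    have e : ((unit (Sum.inr k) : Var n → ℕ) (Sum.inr j) : F) -
        (unit (Sum.inr k) : Var n → ℕ) (Sum.inl j) = if k = j then 1 else 0 := by
      by_cases h : k = j
      · subst h; simp
      · simp [h, Ne.symm h]
    rw [lowOp, mul_smul_comm, iH_iD, e, smul_mul_assoc, smul_add, smul_comm]
  induction s with
  | zero => simp
  | succ s ih =>
    rw [pow_succ, ← mul_assoc, ih, add_mul, mul_assoc, h1, mul_add, smul_mul_assoc, mul_smul_comm,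
      add_assoc, ← add_smul_U, mul_assoc]
    congr 2
    push_cast; ring

theorem mem_posExp_succ_second {k : Fin n} (hm : m + k.val + 1 = 2 * n) {a : Var n → ℕ}
    (h : a ∈ posExp n (m + 1)) : a = unit (Sum.inr k) ∨ (a ∈ posExp n m ∧ a ∉ W₂ k) := by
  have := k.2
  rcases posExp_succ_cases (n := n) m with ⟨h1, h2⟩ | ⟨k', h1, h2⟩ | ⟨h1, h2⟩
  · omega
  · have : k' = k := Fin.ext (by omega)
    subst this
    rw [h2] at h
    rcases h with h | h
    · exact Or.inr h
    · exact Or.inl h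
  · omega

theorem sub_smul_inl_mem {k : Fin n} (hm : m + k.val + 1 = 2 * n) (t : ℕ) {s : Var n → ℕ}
    (h : s + t • unit (Sum.inl k) ∈ posExp n m) (hW : s + t • unit (Sum.inl k) ∉ W₂ k) :
    s = 0 ∨ (s ∈ posExp n m ∧ s ∉ W₂ k) := by
  induction t with
  | zero => simp only [zero_smul, add_zero] at h hW; exact Or.inr ⟨h, hW⟩
  | succ t ih =>
    rw [succ_nsmul, ← add_assoc] at h hW
    rcases sub_inl_mem hm h hW with h1 | ⟨h1, h2⟩
    · refine Or.inl (funext fun v => ?_)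
      have := congrFun h1 v
      simp only [Pi.add_apply, Pi.zero_apply] at this ⊢
      omega
    · exact ih h1 h2

/-- The powers `P ^ s v` are killed by the elements common to `𝔫_m^+` and `𝔫_{m+1}^+`. -/
theorem iD_mul_lowOp_pow_mem {k : Fin n} (hm : m + k.val + 1 = 2 * n) (s : ℕ) {a : Var n → ℕ}
    (ha : Valid p n a) (h : a ∈ posExp n m) (hW : a ∉ W₂ k) :
    iD F p n (mon F p a) * lowOp F p k ^ s ∈ annIdeal F p n m lam := by
  have key : ∀ t, iD F p n ((pd F p (Sum.inl k) ^ t) (mon F p a)) ∈ annIdeal F p n m lam := by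
    intro t
    rcases pd_pow_mon (F := F) k ha t with ⟨z, rfl, h2⟩ | ⟨-, h2⟩ <;> rw [h2]
    · rcases sub_smul_inl_mem hm t h hW with rfl | ⟨h3, -⟩
      · rw [iD_mon_zero]; exact zero_mem _
      · exact iD_mem_ann (valid_of_add ha) h3
    · rw [map_zero]; exact zero_mem _
  have h1 := mul_pow_eq_sum (lowOp F p k) s
    (fun t => iD F p n ((pd F p (Sum.inl k) ^ t) (mon F p a))) (iD_pow_mul_lowOp k _)
  simp only [pow_zero, Module.End.one_apply] at h1
  rw [h1]
  refine sum_mem fun ij _ => nsmul_mem ?_ _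
  exact mul_mem_ann _ (mul_mem_ann _ (key _))

/-- If `P ^ s v` does not vanish but `P ^ (s + 1) v` does, then it is the new highest weight
vector. -/
theorem step_second [NeZero n] (hp : 3 < p) {k : Fin n} (hm : m + k.val + 1 = 2 * n) (s : ℕ)
    (h0 : lowOp F p k ^ s ∉ annIdeal F p n m lam)
    (h1 : lowOp F p k ^ (s + 1) ∈ annIdeal F p n m lam) :
    LIso F p n m lam (m + 1) (lam + (s : F) • (eps F p k - delta F p n)) ∧
      vermaIdeal F p n (m + 1) (lam + (s : F) • (eps F p k - delta F p n)) ≠ ⊤ := by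
  have hkn := k.2
  refine lIso_of_singular (two_ne_zero' hp) (annIdeal_ne_top_of_le hp (by omega))
    (lowOp_mem_uPart k s) h0 ?_ ?_ ?_
  · intro a ha hmem
    rcases mem_posExp_succ_second hm hmem with rfl | ⟨h2, h3⟩
    · have : iD F p n (mon F p (unit (Sum.inr k))) * lowOp F p k ^ s =
          (-1 : F) • lowOp F p k ^ (s + 1) := by
        rw [pow_succ', ← smul_mul_assoc]
        nth_rewrite 2 [lowOp]
        rw [smul_smul, neg_mul_neg, one_mul, one_smul]
      rw [this]
      exact smul_mem_ann _ h1
    · exact iD_mul_lowOp_pow_mem hm s ha h2 h3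
  · intro j
    refine iH_mul_mem_ann (iH_mul_lowOp_pow j k s) ?_
    rw [LinearMap.add_apply, LinearMap.smul_apply, LinearMap.sub_apply,
      eps_hDe F p (two_ne_zero' hp), delta_hDe, sub_zero, smul_eq_mul]
  · refine iE_mul_mem_ann (iE_mul_lowOp_pow k s) ?_
    rw [LinearMap.add_apply, LinearMap.smul_apply, LinearMap.sub_apply, eps_euler,
      delta_euler F p (two_ne_zero' hp), smul_eq_mul]
    ring

end Second

section SecondSteps

variable {F : Type*} [Field F] {p n m : ℕ}

theorem pd_pow_add (k : Fin n) {z : Var n → ℕ} (t : ℕ)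
    (hz : Valid p n (z + t • unit (Sum.inl k))) :
    (pd F p (Sum.inl k) ^ t) (mon F p (z + t • unit (Sum.inl k))) = mon F p z := by
  rcases pd_pow_mon (F := F) k hz t with ⟨z', h1, h2⟩ | ⟨h1, -⟩
  · rw [h2, add_right_cancel h1]
  · simp at h1

theorem oSecond_pair (k : Fin n) :
    oSecond (unit (Sum.inl k) + unit (Sum.inr k) : Var n → ℕ) = 0 := by
  rw [oSecond, oddDeg_pair]; rfl

theorem aSecond_pair (k j : Fin n) :
    aSecond k (unit (Sum.inl j) + unit (Sum.inr j) : Var n → ℕ) = 0 := by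
  rw [aSecond, lw_add, lw_unit_inl, lw_unit_inr]; split_ifs <;> rfl

theorem kSecond_pair (k j : Fin n) :
    kSecond k (unit (Sum.inl j) + unit (Sum.inr j) : Var n → ℕ) = 0 := by
  rw [kSecond_eq, lw_add, lw_unit_inl, lw_unit_inr]; split_ifs <;> rfl

theorem valid_inl_smul_add {k : Fin n} {t : ℕ} {z : Var n → ℕ} (hz : Valid p n z)
    (h : z (Sum.inl k) + t < p) : Valid p n (z + t • unit (Sum.inl k)) := by
  refine ⟨fun i => ?_, fun i => ?_⟩
  · by_cases hi : i = k
    · subst hi; simpa using h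
    · simpa [hi] using hz.1 i
  · simpa using hz.2 i

theorem mem_ann_of_mul_sub_mem {lam : Module.Dual F (hBar F p n)} {y w x : U F p n}
    (hw : w ∈ annIdeal F p n m lam) (h : y * w - x ∈ annIdeal F p n m lam) :
    x ∈ annIdeal F p n m lam := by
  have := sub_mem (mul_mem_ann y hw) h
  rwa [sub_sub_cancel] at this

variable [Fact p.Prime]

theorem valid_top_inr (k : Fin n) {t : ℕ} (ht : t < p) :
    Valid p n (unit (Sum.inr k) + t • unit (Sum.inl k)) :=
  valid_inl_smul_add (valid_unit p _) (by simpa using ht)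

theorem pd_pow_top_inr (k : Fin n) {t : ℕ} (ht : t + 1 < p) :
    (pd F p (Sum.inl k) ^ t) (mon F p (unit (Sum.inr k) + (t + 1) • unit (Sum.inl k))) =
      mon F p (unit (Sum.inl k) + unit (Sum.inr k)) := by
  have h1 : (unit (Sum.inr k) + (t + 1) • unit (Sum.inl k) : Var n → ℕ) =
      unit (Sum.inl k) + unit (Sum.inr k) + t • unit (Sum.inl k) := by
    rw [succ_nsmul]; abel
  rw [h1, pd_pow_add]
  rw [← h1]
  exact valid_top_inr k ht

variable [CharP F p] {lam : Module.Dual F (hBar F p n)}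

/-- The action of `De_{x^{(z)}}` of degree zero on `P ^ s v`: only the two terms remain in which
`x_k` is removed as often as it exceeds `x_{n+k}`, or once more. -/
theorem iD_mul_lowOp_pow_sub_mem {k : Fin n} (hm : m + k.val + 1 = 2 * n) (s r : ℕ) {z : Var n → ℕ}
    (hz : Valid p n z) (hA : aSecond k z = 0) (hO : oSecond z = 0) (hK : kSecond k z = r) :
    iD F p n (mon F p z) * lowOp F p k ^ s -
      (((s.choose r : F) * (-1) ^ r) • (lowOp F p k ^ (s - r) *
          iD F p n ((pd F p (Sum.inl k) ^ r) (mon F p z))) +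
        ((s.choose (r + 1) : F) * (-1) ^ (r + 1)) • (lowOp F p k ^ (s - (r + 1)) *
          iD F p n ((pd F p (Sum.inl k) ^ (r + 1)) (mon F p z)))) ∈ annIdeal F p n m lam := by
  have h := mul_pow_sub_mem (annIdeal F p n m lam) (lowOp F p k) s r
    (fun t => iD F p n ((pd F p (Sum.inl k) ^ t) (mon F p z))) (iD_pow_mul_lowOp k _) (by
      intro t h1 h2
      rcases pd_pow_mon (F := F) k hz t with ⟨z', rfl, h3⟩ | ⟨h3, h4⟩
      · simp only [h3]
        obtain ⟨e1, e2, e3⟩ := second_sub k z' t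
        have hz' := valid_of_add hz
        rcases lt_or_gt_of_ne h1 with h4 | h4
        · refine iD_mem_ann_of_pos (good_second p k hm) hz' (phiSecond_pos k hz' ?_)
          omega
        · have := hz.2 k
          rw [kSecond] at hK
          simp at hK this
          omega
      · simp only [h4, map_zero]
        exact zero_mem _)
  have e : ∀ (a b : ℕ) (x : U F p n), a • ((-1) ^ b * x) = ((a : F) * (-1) ^ b) • x := by
    intro a b x
    rw [← Nat.cast_smul_eq_nsmul F, mul_smul, Algebra.smul_def ((-1 : F) ^ b), map_pow, map_neg,
      map_one]
  rw [e, e] at h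
  exact h

/-- The generic case: `De_{x_k^{(p-1)} x_j x_{n+j}}` maps `P ^ (p - 1) v` to `h_j v`. -/
theorem step_second_generic [NeZero n] (hp : 3 < p) {k : Fin n} (hm : m + k.val + 1 = 2 * n)
    (hlam : ∃ j, j ≠ k ∧ ev lam j ≠ 0) (hI : vermaIdeal F p n m lam ≠ ⊤) :
    LIso F p n m lam (m + 1) (lam + ((p - 1 : ℕ) : F) • (eps F p k - delta F p n)) ∧
      vermaIdeal F p n (m + 1) (lam + ((p - 1 : ℕ) : F) • (eps F p k - delta F p n)) ≠ ⊤ := by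
  have hkn := k.2
  have hR := annIdeal_ne_top_of_le hp (by omega) hI
  obtain ⟨j, hjk, hj⟩ := hlam
  refine step_second hp hm (p - 1) (fun hmem => ?_) ?_
  · have hv : Valid p n (unit (Sum.inl j) + unit (Sum.inr j) + (p - 1) • unit (Sum.inl k)) :=
      valid_inl_smul_add (valid_pair p j) (by simp [hjk.symm]; omega)
    obtain ⟨e1, e2, e3⟩ := second_sub k (unit (Sum.inl j) + unit (Sum.inr j)) (p - 1)
    rw [aSecond_pair] at e1
    rw [oSecond_pair] at e2
    rw [kSecond_pair, zero_add] at e3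
    have h := iD_mul_lowOp_pow_sub_mem (F := F) (lam := lam) hm (p - 1) (p - 1) hv e1 e2 e3
    rw [pd_pow_add k (p - 1) hv, Nat.choose_succ_self, Nat.choose_self, Nat.sub_self, pow_zero,
      one_mul, Nat.cast_zero, zero_mul, zero_smul, add_zero, Nat.cast_one, one_mul] at h
    have h1 := mem_ann_of_mul_sub_mem hmem h
    rw [smul_mem_ann_iff (pow_ne_zero _ (neg_ne_zero.2 one_ne_zero))] at h1
    have h2 := sub_mem h1 (iH_mem_ann (m := m) (lam := lam) j)
    rw [sub_sub_cancel, Algebra.algebraMap_eq_smul_one, smul_mem_ann_iff hj] at h2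
    exact one_notMem_ann hR h2
  · rw [Nat.sub_add_cancel (by omega), lowOp_pow_char hp]
    exact zero_mem _

/-- On the trivial weights for `𝔫_m^+` the whole Hamiltonian superalgebra acts by zero. -/
theorem iD_mem_ann_of_trivial (hp : 3 < p) {k : Fin n} (hm : m + k.val + 1 = 2 * n)
    (hlam : ∀ j, ev lam j = 0) : ∀ a, Valid p n a →
      iD F p n (mon F p a) ∈ annIdeal F p n m lam := by
  have hφ := good_second p k hm
  refine iD_mem_ann_of_stable (S := {a | Valid p n a}) hp hφ (fun a ha => ha) ?_ ?_
  · intro a ha h0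
    by_cases hcar : ∀ i : Fin n, a ≠ unit (Sum.inl i) + unit (Sum.inr i)
    · exact iD_mem_ann_of_nonneg hφ ha h0 hcar
    · push Not at hcar
      obtain ⟨i, rfl⟩ := hcar
      have := iH_mem_ann (F := F) (m := m) (lam := lam) i
      rwa [hlam i, map_zero, sub_zero] at this
  · intro z _ _ _ _ a _ c hc
    exact Or.inl hc.1

/-- For a trivial weight the old highest weight vector is still one. -/
theorem step_second_trivial [NeZero n] (hp : 3 < p) {k : Fin n} (hm : m + k.val + 1 = 2 * n)
    (hlam : ∀ j, ev lam j = 0) (hI : vermaIdeal F p n m lam ≠ ⊤) :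
    LIso F p n m lam (m + 1) lam ∧ vermaIdeal F p n (m + 1) lam ≠ ⊤ := by
  have hkn := k.2
  have hR := annIdeal_ne_top_of_le hp (by omega) hI
  have h := step_second (lam := lam) hp hm 0 (by rw [pow_zero]; exact one_notMem_ann hR) (by
    rw [zero_add, pow_one, lowOp]
    exact smul_mem_ann _ (iD_mem_ann_of_trivial hp hm hlam _ (valid_unit p _)))
  rwa [Nat.cast_zero, zero_smul, add_zero] at h

theorem second_top_inr (k : Fin n) (t : ℕ) :
    aSecond k (unit (Sum.inr k) + t • unit (Sum.inl k)) = 0 ∧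
    oSecond (unit (Sum.inr k) + t • unit (Sum.inl k)) = 0 ∧
    kSecond k (unit (Sum.inr k) + t • unit (Sum.inl k)) = t - 1 := by
  obtain ⟨e1, e2, e3⟩ := second_sub k (unit (Sum.inr k)) t
  refine ⟨e1.trans ?_, e2.trans ?_, e3.trans ?_⟩
  · rw [aSecond, lw_unit_inr]; simp
  · rw [oSecond, oddDeg_unit_inr]; rfl
  · rw [kSecond]; simp; ring

/-- `De_{x_k^{(p-1)} x_{n+k}}` maps `P ^ (p - 2) v` to a nonzero multiple of `h_k v`. -/
theorem lowOp_pow_sub_two_notMem (hp : 3 < p) {k : Fin n} (hm : m + k.val + 1 = 2 * n)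
    (hk : ev lam k ≠ 0) (hR : annIdeal F p n m lam ≠ ⊤) :
    lowOp F p k ^ (p - 2) ∉ annIdeal F p n m lam := by
  intro hmem
  obtain ⟨e1, e2, e3⟩ := second_top_inr k (p - 1)
  have h := iD_mul_lowOp_pow_sub_mem (F := F) (lam := lam) hm (p - 2) (p - 2)
    (valid_top_inr k (by omega)) e1 e2 (by rw [e3]; omega)
  have e4 : p - 1 = p - 2 + 1 := by omega
  rw [e4, pd_pow_top_inr k (by omega), Nat.choose_succ_self, Nat.choose_self, Nat.sub_self,
    pow_zero, one_mul, Nat.cast_zero, zero_mul, zero_smul, add_zero, Nat.cast_one, one_mul] at h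
  have h1 := mem_ann_of_mul_sub_mem hmem h
  rw [smul_mem_ann_iff (pow_ne_zero _ (neg_ne_zero.2 one_ne_zero))] at h1
  have h2 := sub_mem h1 (iH_mem_ann (m := m) (lam := lam) k)
  rw [sub_sub_cancel, Algebra.algebraMap_eq_smul_one, smul_mem_ann_iff hk] at h2
  exact one_notMem_ann hR h2

/-- `De_{x_k^{(2)} x_{n+k}}` maps `P v` to `-h_k v`. -/
theorem lowOp_notMem (hp : 3 < p) {k : Fin n} (hm : m + k.val + 1 = 2 * n)
    (hk : ev lam k ≠ 0) (hR : annIdeal F p n m lam ≠ ⊤) :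
    lowOp F p k ∉ annIdeal F p n m lam := by
  intro hmem
  obtain ⟨e1, e2, e3⟩ := second_top_inr k 2
  have h := iD_mul_lowOp_pow_sub_mem (F := F) (lam := lam) hm 1 1
    (valid_top_inr k (by omega)) e1 e2 (by rw [e3]; rfl)
  rw [pd_pow_top_inr k (t := 1) (by omega), Nat.choose_succ_self, Nat.choose_self, Nat.sub_self,
    pow_zero, one_mul, Nat.cast_zero, zero_mul, zero_smul, add_zero, Nat.cast_one, one_mul,
    pow_one] at h
  have h1 := mem_ann_of_mul_sub_mem hmem h
  rw [smul_mem_ann_iff (pow_ne_zero _ (neg_ne_zero.2 one_ne_zero))] at h1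
  have h2 := sub_mem h1 (iH_mem_ann (m := m) (lam := lam) k)
  rw [sub_sub_cancel, Algebra.algebraMap_eq_smul_one, smul_mem_ann_iff hk] at h2
  exact one_notMem_ann hR h2

/-- `De_{x_k^{(p-1)} x_{n+k}}` maps `P ^ (p - 1) v` to `(lam(h_k) - 1) P v`. -/
theorem lowOp_pow_sub_one_notMem (hp : 3 < p) {k : Fin n} (hm : m + k.val + 1 = 2 * n)
    (hk : ev lam k ≠ 0) (hk1 : ev lam k ≠ 1) (hR : annIdeal F p n m lam ≠ ⊤) :
    lowOp F p k ^ (p - 1) ∉ annIdeal F p n m lam := by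
  intro hmem
  obtain ⟨e1, e2, e3⟩ := second_top_inr k (p - 1)
  have h := iD_mul_lowOp_pow_sub_mem (F := F) (lam := lam) hm (p - 1) (p - 2)
    (valid_top_inr k (by omega)) e1 e2 (by rw [e3]; omega)
  have e4 : p - 1 = p - 2 + 1 := by omega
  have e5 := pd_pow_add (F := F) (p := p) k (z := unit (Sum.inr k)) (p - 1)
    (valid_top_inr k (by omega))
  have hodd : Odd p := (Fact.out : p.Prime).odd_of_ne_two (by omega)
  obtain ⟨q, hq⟩ := hodd
  have e6 : (-1 : F) ^ (p - 2) = -1 := by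
    have : p - 2 = 2 * (q - 1) + 1 := by omega
    rw [this]; exact (odd_two_mul_add_one _).neg_one_pow
  have e7 : (-1 : F) ^ (p - 2 + 1) = 1 := by rw [pow_succ, e6]; ring
  have e8 : ((p - 1 : ℕ) : F) = -1 := by
    rw [Nat.cast_sub (by omega), CharP.cast_eq_zero]; simp
  have e9 : (p - 1).choose (p - 2) = p - 1 := by
    rw [e4]; exact Nat.choose_succ_self_right _
  rw [← e4, e5, Nat.choose_self, Nat.sub_self, e9, e8, e6] at h
  have e12 := pd_pow_top_inr (F := F) (p := p) k (t := p - 2) (by omega)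
  rw [← e4] at e7 e12
  rw [e7, e12, pow_zero] at h
  have e10 : p - 1 - (p - 2) = 1 := by omega
  have e11 : iD F p n (mon F p (unit (Sum.inr k))) = (-1 : F) • lowOp F p k := by
    rw [lowOp, smul_smul, neg_mul_neg, one_mul, one_smul]
  rw [e10, pow_one, neg_mul_neg, one_mul, one_smul, Nat.cast_one, one_mul, one_smul, one_mul,
    e11] at h
  have h1 := mem_ann_of_mul_sub_mem hmem h
  have h2 := sub_mem h1 (mul_iH_mem_ann (m := m) (lam := lam) (lowOp F p k) k)
  rw [add_sub_right_comm, sub_sub_cancel, ← add_smul_U,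
    smul_mem_ann_iff (by rw [← sub_eq_add_neg]; exact sub_ne_zero.2 hk1)] at h2
  exact lowOp_notMem hp hm hk hR h2

/-- The rank one case with a generic eigenvalue of `h_k`. -/
theorem step_second_rank_one [NeZero n] (hp : 3 < p) {k : Fin n} (hm : m + k.val + 1 = 2 * n)
    (hk : ev lam k ≠ 0) (hk1 : ev lam k ≠ 1) (hI : vermaIdeal F p n m lam ≠ ⊤) :
    LIso F p n m lam (m + 1) (lam + ((p - 1 : ℕ) : F) • (eps F p k - delta F p n)) ∧
      vermaIdeal F p n (m + 1) (lam + ((p - 1 : ℕ) : F) • (eps F p k - delta F p n)) ≠ ⊤ := by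
  have hkn := k.2
  refine step_second hp hm (p - 1)
    (lowOp_pow_sub_one_notMem hp hm hk hk1 (annIdeal_ne_top_of_le hp (by omega) hI)) ?_
  rw [Nat.sub_add_cancel (by omega), lowOp_pow_char hp]
  exact zero_mem _

end SecondSteps

/-! ### The exceptional case of the reflection in `ε_k - δ` -/

section TailExponents

variable {F : Type*} [Field F] {p n : ℕ}

theorem second_add (k : Fin n) (a b : Var n → ℕ) :
    aSecond k (a + b) = aSecond k a + aSecond k b ∧ oSecond (a + b) = oSecond a + oSecond b + 1 ∧
      kSecond k (a + b) = kSecond k a + kSecond k b ∧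
      psiSecond (a + b) = psiSecond a + psiSecond b := by
  refine ⟨lw_add _ _, ?_, ?_, lw_add _ _⟩
  · rw [oSecond, oSecond, oSecond, oddDeg_add]; push_cast; ring
  · rw [kSecond_eq, lw_add, ← kSecond_eq, ← kSecond_eq]

/-- The exponents of the monomials in the even variables `x_j`, `j > k`. -/
def Tail (p : ℕ) (k : Fin n) : Set (Var n → ℕ) :=
  {b | Valid p n b ∧ (∀ i, b (Sum.inr i) = 0) ∧ ∀ i, i ≤ k → b (Sum.inl i) = 0}

variable (F p) in
/-- The subalgebra of `O(n)` generated by the divided powers of the even variables `x_j`,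
`j > k`. -/
def tailAlg (k : Fin n) : Submodule F (O F p n) := Submodule.span F (mon F p '' Tail p k)

/-- The exponents of degree `0` with respect to the dominant parts of `phiSecond` that do not
involve `x_k` and `x_{n+k}`. -/
def Levi (p : ℕ) (k : Fin n) : Set (Var n → ℕ) :=
  {a | Valid p n a ∧ aSecond k a = 0 ∧ oSecond a = 0 ∧ kSecond k a = 0 ∧ a (Sum.inl k) = 0 ∧
    a (Sum.inr k) = 0}

theorem aSecond_eq_natCast {k : Fin n} {b : Var n → ℕ} (hb : ∀ i, b (Sum.inr i) = 0) :
    aSecond k b = ((∑ i, if i < k then b (Sum.inl i) else 0 : ℕ) : ℤ) := by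
  rw [aSecond, lw]
  push_cast
  refine Finset.sum_congr rfl fun i _ => ?_
  rw [hb i]
  split_ifs <;> simp

theorem tail_second {k : Fin n} {b : Var n → ℕ} (h : b ∈ Tail p k) :
    aSecond k b = 0 ∧ oSecond b = -1 ∧ kSecond k b = 0 := by
  obtain ⟨-, h1, h2⟩ := h
  refine ⟨?_, ?_, ?_⟩
  · rw [aSecond_eq_natCast h1, Finset.sum_eq_zero]
    · rfl
    · intro i _
      split_ifs with hi
      · exact h2 i hi.le
      · rfl
  · have : oddDeg b = 0 := Finset.sum_eq_zero fun i _ => h1 i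
    rw [oSecond, this]; rfl
  · rw [kSecond, h1, h2 k le_rfl]; rfl

theorem tail_psi {k : Fin n} {b : Var n → ℕ} (h : b ∈ Tail p k) (h0 : b ≠ 0) : psiSecond b < 0 :=
  lw_neg (fun i _ => by omega) (fun i hi => absurd (h.2.1 i) hi) h0

theorem mem_tail {k : Fin n} {b : Var n → ℕ} (hb : Valid p n b) (hA : aSecond k b = 0)
    (hO : oSecond b = -1) (hk : b (Sum.inl k) = 0) : b ∈ Tail p k := by
  have h1 : oddDeg b = 0 := by rw [oSecond] at hO; omega
  have h2 : ∀ i, b (Sum.inr i) = 0 := fun i => Finset.sum_eq_zero_iff.1 h1 i (Finset.mem_univ i)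
  refine ⟨hb, h2, fun i hi => ?_⟩
  rcases hi.lt_or_eq with hi | rfl
  · rw [aSecond_eq_natCast h2, Nat.cast_eq_zero, Finset.sum_eq_zero_iff] at hA
    have := hA i (Finset.mem_univ i)
    rwa [if_pos hi] at this
  · exact hk

theorem mon_mem_tailAlg {k : Fin n} {b : Var n → ℕ} (h : b ∈ Tail p k) :
    mon F p b ∈ tailAlg F p k := Submodule.subset_span ⟨b, h, rfl⟩

theorem tailAlg_induction {k : Fin n} {P : O F p n → Prop} {f : O F p n} (hf : f ∈ tailAlg F p k)
    (mon : ∀ b ∈ Tail p k, P (mon F p b)) (zero : P 0)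
    (add : ∀ f g, P f → P g → P (f + g)) (smul : ∀ (c : F) f, P f → P (c • f)) : P f := by
  induction hf using Submodule.span_induction with
  | mem x hx => obtain ⟨b, hb, rfl⟩ := hx; exact mon b hb
  | zero => exact zero
  | add x y _ _ hx hy => exact add x y hx hy
  | smul c x _ hx => exact smul c x hx

theorem isPar_tailAlg {k : Fin n} {f : O F p n} (hf : f ∈ tailAlg F p k) : IsPar 0 f := by
  refine tailAlg_induction (P := fun f => IsPar 0 f) hf (fun b hb => ?_)
    (by rw [IsPar]; simp) (fun f g => IsPar.add) fun c f hf => hf.smul c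
  have h1 := (tail_second hb).2.1
  have h2 : oddDeg b = 0 := by rw [oSecond] at h1; omega
  rw [← h2]; exact isPar_mon b

theorem pd_tailAlg {k : Fin n} {f : O F p n} (hf : f ∈ tailAlg F p k) :
    pd F p (Sum.inl k) f = 0 ∧ pd F p (Sum.inr k) f = 0 := by
  refine tailAlg_induction (P := fun f => pd F p (Sum.inl k) f = 0 ∧
    pd F p (Sum.inr k) f = 0) hf
    (fun b hb => ?_) (by simp) (fun f g hf hg => ?_) fun c f hf => ?_
  · exact ⟨pd_mon_of_eq_zero (hb.2.2 k le_rfl), pd_mon_of_eq_zero (hb.2.1 k)⟩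
  · rw [map_add, map_add, hf.1, hf.2, hg.1, hg.2, add_zero]; exact ⟨rfl, rfl⟩
  · rw [map_smul, map_smul, hf.1, hf.2, smul_zero]; exact ⟨rfl, rfl⟩

theorem mul_mem_tailAlg {k : Fin n} {f g : O F p n} (hf : f ∈ tailAlg F p k)
    (hg : g ∈ tailAlg F p k) : mul F p n f g ∈ tailAlg F p k := by
  refine tailAlg_induction (P := fun f => mul F p n f g ∈ tailAlg F p k) hf
    (fun b hb => ?_) (by simp) (fun f g hf hg => ?_) fun c f hf => ?_
  · refine tailAlg_induction (P := fun g => mul F p n (mon F p b) g ∈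
      tailAlg F p k) hg (fun c hc => ?_) (by simp) (fun f g hf hg => ?_) fun c f hf => ?_
    · rw [mul_mon_mon]
      refine Submodule.smul_mem _ _ ?_
      by_cases hv : Valid p n (b + c)
      · refine mon_mem_tailAlg ⟨hv, fun i => ?_, fun i hi => ?_⟩
        · rw [Pi.add_apply, hb.2.1, hc.2.1]
        · rw [Pi.add_apply, hb.2.2 i hi, hc.2.2 i hi]
      · rw [mon_of_not_valid hv]; exact zero_mem _
    · rw [map_add]; exact add_mem hf hg
    · rw [map_smul]; exact Submodule.smul_mem _ _ hf
  · rw [map_add]; exact add_mem hf hg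
  · rw [map_smul]; exact Submodule.smul_mem _ _ hf

/-- No binomial coefficients or signs occur in a product with a monomial in other variables, all
of them even. -/
theorem mul_mon_of_disjoint {r b : Var n → ℕ} (hb : ∀ i, b (Sum.inr i) = 0)
    (h : ∀ i, r (Sum.inl i) = 0 ∨ b (Sum.inl i) = 0) :
    mul F p n (mon F p r) (mon F p b) = mon F p (r + b) := by
  have h1 : signExp r b = 0 := Finset.sum_eq_zero fun j _ => Finset.sum_eq_zero fun i _ => by
    rw [hb i]; simp
  rw [mul_mon_mon, mulCoeff, h1, pow_zero, one_mul, Finset.prod_eq_one, one_smul]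
  rintro (i | i) -
  · rcases h i with h | h <;> simp [h]
  · simp [hb i]

theorem De_Levi_mem {k : Fin n} {l : Var n → ℕ} (hl : l ∈ Levi p k) {f : O F p n}
    (hf : f ∈ tailAlg F p k) : De F p n (mon F p l) f ∈ tailAlg F p k := by
  refine tailAlg_induction (P := fun f => De F p n (mon F p l) f ∈ tailAlg F p k) hf
    (fun b hb => ?_) (by simp) (fun f g hf hg => ?_) fun c f hf => ?_
  · refine (Submodule.span_le.2 ?_ : Submodule.span F (mon F p '' Contr p l b) ≤ tailAlg F p k)
      (De_mon_mem l b)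
    rintro _ ⟨c, hc, rfl⟩
    obtain ⟨-, h1, h2, h3, h4, h5⟩ := hl
    obtain ⟨e1, e2, e3⟩ := tail_second hb
    obtain ⟨c1, c2, c3, -⟩ := second_contr k hc
    refine mon_mem_tailAlg (mem_tail hc.1 (by omega) (by omega) ?_)
    have := contr_pair hc k
    have := hb.2.2 k le_rfl
    omega
  · rw [map_add]; exact add_mem hf hg
  · rw [map_smul]; exact Submodule.smul_mem _ _ hf

theorem isPar_of_oSecond {l : Var n → ℕ} (h : oSecond l = 0) : IsPar 1 (mon F p l) := by
  have : oddDeg l = 1 := by rw [oSecond] at h; omega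
  rw [← this]; exact isPar_mon l

theorem De_antisymm_odd {α : ℕ} {f g : O F p n} (hf : IsPar 1 f) (hg : IsPar α g) :
    De F p n f g = (-1 : F) • De F p n g f := by
  have h : (-1 : F) ^ ((1 + 1) * (α + 1)) = 1 := by rw [pow_mul]; norm_num
  rw [De_antisymm hf hg, h]

theorem levi_add_tail {k : Fin n} {l b : Var n → ℕ} (hl : l ∈ Levi p k) (hb : b ∈ Tail p k)
    (hv : Valid p n (l + b)) : l + b ∈ Levi p k := by
  obtain ⟨-, h1, h2, h3, h4, h5⟩ := hl
  obtain ⟨e1, e2, e3⟩ := tail_second hb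
  obtain ⟨c1, c2, c3, -⟩ := second_add k l b
  have := hb.2.2 k le_rfl
  have := hb.2.1 k
  refine ⟨hv, by omega, by omega, by omega, ?_, ?_⟩ <;> rw [Pi.add_apply] <;> omega

variable [Fact p.Prime]

theorem De_Levi_pair {k : Fin n} {l : Var n → ℕ} (hl : l ∈ Levi p k) :
    De F p n (mon F p l) (mon F p (unit (Sum.inl k) + unit (Sum.inr k))) = 0 := by
  rw [De_antisymm_odd (isPar_of_oSecond hl.2.2.1) (isPar_mon _), ← hDe_eq_De, hDe_mon,
    hl.2.2.2.2.1, hl.2.2.2.2.2, sub_self, zero_smul, smul_zero]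

theorem hDe_tailAlg {k : Fin n} {f : O F p n} (hf : f ∈ tailAlg F p k) :
    De F p n (mon F p (unit (Sum.inl k) + unit (Sum.inr k))) f = 0 := by
  refine tailAlg_induction (P := fun f => De F p n
    (mon F p (unit (Sum.inl k) + unit (Sum.inr k))) f = 0) hf
    (fun b hb => ?_) (by simp) (fun f g hf hg => ?_) fun c f hf => ?_
  · rw [← hDe_eq_De, hDe_mon, hb.2.1, hb.2.2 k le_rfl, sub_self, zero_smul]
  · rw [map_add, hf, hg, add_zero]
  · rw [map_smul, hf, smul_zero]

theorem euler_mul (f g : O F p n) : euler F p n (mul F p n f g) =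
    mul F p n (euler F p n f) g + mul F p n f (euler F p n g) := by
  induction f using mon_induction with
  | zero => simp
  | add a b ha hb => simp only [map_add, LinearMap.add_apply, ha, hb]; abel
  | smul c a ha => simp only [map_smul, LinearMap.smul_apply, ha, smul_add]
  | mon r hr =>
    induction g using mon_induction with
    | zero => simp
    | add a b ha hb => simp only [map_add, ha, hb]; abel
    | smul c a ha => simp only [map_smul, ha, smul_add]
    | mon s hs =>
      rw [euler_mon, euler_mon, map_smul, map_smul, LinearMap.smul_apply, ← add_smul, mul_mon_mon,
        map_smul, euler_mon, smul_comm, deg_add, Nat.cast_add]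

theorem euler_mem_tailAlg {k : Fin n} {f : O F p n} (hf : f ∈ tailAlg F p k) :
    euler F p n f ∈ tailAlg F p k := by
  refine tailAlg_induction (P := fun f => euler F p n f ∈ tailAlg F p k) hf
    (fun b hb => ?_) (by simp) (fun f g hf hg => ?_) fun c f hf => ?_
  · rw [euler_mon]; exact Submodule.smul_mem _ _ (mon_mem_tailAlg hb)
  · rw [map_add]; exact add_mem hf hg
  · rw [map_smul]; exact Submodule.smul_mem _ _ hf

theorem iE_mul_iD (f : O F p n) : iE F p n * iD F p n f =
    iD F p n f * iE F p n + (iD F p n (euler F p n f) + (-2 : F) • iD F p n f) := by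
  induction f using mon_induction with
  | zero => simp
  | add a b ha hb => simp only [map_add, mul_add, add_mul, ha, hb, smul_add]; abel
  | smul c a ha =>
    simp only [map_smul, mul_smul_comm, smul_mul_assoc, ha, smul_add]
    rw [smul_comm c (-2 : F)]
  | mon r hr =>
    rw [iE_iD, euler_mon, map_smul, ← add_smul_U, ← sub_eq_add_neg]

variable [CharP F p]

theorem iD_comm_odd {α : ℕ} {f g : O F p n} (hf : IsPar 1 f) (hg : IsPar α g) :
    iD F p n f * iD F p n g = iD F p n g * iD F p n f + iD F p n (De F p n f g) := by
  have h : (-1 : F) ^ ((1 + 1) * (α + 1)) = 1 := by rw [pow_mul]; norm_num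
  rw [iD_bracket hf hg, h, one_smul]

theorem De_odd_mul {l f : O F p n} (hl : IsPar 1 l) (g : O F p n) :
    De F p n l (mul F p n f g) = mul F p n (De F p n l f) g + mul F p n f (De F p n l g) := by
  rw [SDer.De hl f g, pow_two, sig_sq, Module.End.one_apply]

end TailExponents

section Exceptional

variable {F : Type*} [Field F] {p n m : ℕ}

/-- The exponents that are positive with respect to `aSecond`, `-oSecond`, `kSecond - t + 1` in the
lexicographic order. -/
def Upper (p : ℕ) (k : Fin n) (t : ℤ) : Set (Var n → ℕ) :=
  {z | Valid p n z ∧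
    (0 < aSecond k z ∨ aSecond k z = 0 ∧ (oSecond z < 0 ∨ oSecond z = 0 ∧ t ≤ kSecond k z))}

theorem contr_mem_upper {k : Fin n} {t s : ℤ} {z w c : Var n → ℕ} (hz : z ∈ Upper p k t)
    (hA : aSecond k w = 0) (hO : oSecond w = 0) (hK : kSecond k w = s) (hc : c ∈ Contr p z w) :
    c ∈ Upper p k (t + s) := by
  obtain ⟨c1, c2, c3, -⟩ := second_contr k hc
  have := hz.2
  exact ⟨hc.1, by omega⟩

theorem exists_eq_of_inr_eq_zero {k : Fin n} {z : Var n → ℕ} {r : ℕ} (hz : Valid p n z)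
    (hA : aSecond k z = 0) (hO : oSecond z = 0) (hK : kSecond k z = r) (h : z (Sum.inr k) = 0) :
    ∃ l ∈ Levi p k, z = l + r • unit (Sum.inl k) := by
  have h1 : z (Sum.inl k) = r := by rw [kSecond, h] at hK; omega
  have h2 : z = (z - r • unit (Sum.inl k)) + r • unit (Sum.inl k) := by
    refine (tsub_add_cancel_of_le fun v => ?_).symm
    by_cases hv : v = Sum.inl k
    · subst hv; simp [h1]
    · simp [hv]
  refine ⟨_, ?_, h2⟩
  generalize z - r • unit (Sum.inl k) = l at h2
  subst h2
  obtain ⟨e1, e2, e3⟩ := second_sub k l r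
  refine ⟨valid_of_add hz, by omega, by omega, by omega, ?_, by simpa using h⟩
  simpa using h1

theorem exists_eq_of_inr_eq_one {k : Fin n} {z : Var n → ℕ} {r : ℕ} (hz : Valid p n z)
    (hA : aSecond k z = 0) (hO : oSecond z = 0) (hK : kSecond k z = r) (h : z (Sum.inr k) = 1) :
    ∃ b ∈ Tail p k, z = unit (Sum.inr k) + (r + 1) • unit (Sum.inl k) + b := by
  have h1 : z (Sum.inl k) = r + 1 := by rw [kSecond, h] at hK; omega
  have h2 : z = (z - (unit (Sum.inr k) + (r + 1) • unit (Sum.inl k))) +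
      (unit (Sum.inr k) + (r + 1) • unit (Sum.inl k)) := by
    refine (tsub_add_cancel_of_le fun v => ?_).symm
    by_cases hv : v = Sum.inl k
    · subst hv; simp [h1]
    · by_cases hv' : v = Sum.inr k
      · subst hv'; simp [h]
      · simp [hv, hv']
  refine ⟨_, ?_, h2.trans (add_comm _ _)⟩
  generalize z - (unit (Sum.inr k) + (r + 1) • unit (Sum.inl k)) = b at h2
  subst h2
  obtain ⟨e1, e2, -⟩ := second_add k b (unit (Sum.inr k) + (r + 1) • unit (Sum.inl k))
  obtain ⟨f1, f2, -⟩ := second_top_inr k (r + 1)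
  refine mem_tail (valid_of_add hz) (by omega) (by omega) ?_
  simpa using h1

section

variable {k : Fin n}

/-- An exponent of nonnegative weight has positive dominant part, or lies in `Levi`, or belongs to
`h_k`. -/
theorem upper_or_levi {z : Var n → ℕ} (hz : Valid p n z) (h0 : 0 ≤ phiSecond p k z) :
    z ∈ Upper p k 1 ∨ z ∈ Levi p k ∨ z = unit (Sum.inl k) + unit (Sum.inr k) := by
  have h1 := phiSecond_nonneg k hz h0
  by_cases h2 : aSecond k z = 0 ∧ oSecond z = 0 ∧ kSecond k z = 0 ∧ 0 ≤ psiSecond z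
  · obtain ⟨hA, hO, hK, hψ⟩ := h2
    have h3 := hz.2 k
    rcases (show z (Sum.inr k) = 0 ∨ z (Sum.inr k) = 1 by omega) with h4 | h4
    · refine Or.inr (Or.inl ⟨hz, hA, hO, hK, ?_, h4⟩)
      rw [kSecond, h4] at hK; omega
    · obtain ⟨b, hb, rfl⟩ := exists_eq_of_inr_eq_one (r := 0) hz hA hO hK h4
      by_cases hb0 : b = 0
      · subst hb0
        exact Or.inr (Or.inr (by rw [zero_add, one_smul, add_zero, add_comm]))
      · have h5 := tail_psi hb hb0
        obtain ⟨-, -, -, e1⟩ := second_add k (unit (Sum.inr k) + (0 + 1) • unit (Sum.inl k)) b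
        have e2 : psiSecond (unit (Sum.inr k) + (0 + 1) • unit (Sum.inl k) : Var n → ℕ) = 0 := by
          rw [zero_add, one_smul, psiSecond, lw_add, lw_unit_inl, lw_unit_inr]; ring
        omega
  · exact Or.inl ⟨hz, by omega⟩

theorem phiSecond_neg {z : Var n → ℕ} (hz : Valid p n z) (hA : aSecond k z = 0)
    (hO : oSecond z = 0) (h : kSecond k z < 0 ∨ kSecond k z = 0 ∧ psiSecond z < 0) :
    phiSecond p k z < 0 := by
  by_contra hneg
  have := phiSecond_nonneg k hz (not_lt.1 hneg)
  omega

end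

variable (F p) in
/-- `f ↦ De_{x_k x_{n+k} f}`. -/
def opH (k : Fin n) : O F p n →ₗ[F] U F p n :=
  iD F p n ∘ₗ mul F p n (mon F p (unit (Sum.inl k) + unit (Sum.inr k)))

variable (F p) in
/-- `f ↦ De_{x_{n+k} f}`. -/
def opQ (k : Fin n) : O F p n →ₗ[F] U F p n :=
  iD F p n ∘ₗ mul F p n (mon F p (unit (Sum.inr k)))

theorem opH_apply (k : Fin n) (f : O F p n) : opH F p k f =
    iD F p n (mul F p n (mon F p (unit (Sum.inl k) + unit (Sum.inr k))) f) := rfl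

theorem opQ_apply (k : Fin n) (f : O F p n) : opQ F p k f =
    iD F p n (mul F p n (mon F p (unit (Sum.inr k))) f) := rfl

theorem opH_mon {k : Fin n} {b : Var n → ℕ} (hb : b ∈ Tail p k) :
    opH F p k (mon F p b) = iD F p n (mon F p (unit (Sum.inl k) + unit (Sum.inr k) + b)) := by
  rw [opH_apply, mul_mon_of_disjoint hb.2.1 fun i => ?_]
  by_cases hi : i = k
  · subst hi; exact Or.inr (hb.2.2 i le_rfl)
  · left; simp [hi]

theorem opQ_mon {k : Fin n} {b : Var n → ℕ} (hb : b ∈ Tail p k) :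
    opQ F p k (mon F p b) = iD F p n (mon F p (unit (Sum.inr k) + b)) := by
  rw [opQ_apply, mul_mon_of_disjoint hb.2.1 fun i => ?_]
  left; simp

variable (F p) in
/-- The failure `De_{x_k x_{n+k} f} De_{x_k x_{n+k} g} - De_{x_k x_{n+k} f g}` of `opH` to be
multiplicative. -/
def opT (k : Fin n) (f g : O F p n) : U F p n :=
  opH F p k f * opH F p k g - opH F p k (mul F p n f g)

variable (F p) in
/-- The difference `De_{x_{n+k}} De_{x_k x_{n+k} f} - De_{x_{n+k} f}`. -/
def opU (k : Fin n) (f : O F p n) : U F p n :=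
  opQ F p k (mon F p 0) * opH F p k f - opQ F p k f

theorem smul_sub_U (c : F) (x y : U F p n) : c • (x - y) = c • x - c • y := smul_sub c x y

theorem opT_add_left (k : Fin n) (f f' g : O F p n) :
    opT F p k (f + f') g = opT F p k f g + opT F p k f' g := by
  simp only [opT, map_add, LinearMap.add_apply, add_mul]; abel

theorem opT_smul_left (k : Fin n) (c : F) (f g : O F p n) :
    opT F p k (c • f) g = c • opT F p k f g := by
  simp only [opT, map_smul, LinearMap.smul_apply, smul_mul_assoc]
  exact (smul_sub_U _ _ _).symm

/-- The element `x` of the enveloping algebra acts on the operators `opH f` and `opQ f` by a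
derivation `D` of the algebra of the `f`, up to a multiple of `opQ f` in the second case. -/
structure TailDer (k : Fin n) (x : U F p n) (D : Module.End F (O F p n)) (e : F) : Prop where
  mem : ∀ f ∈ tailAlg F p k, D f ∈ tailAlg F p k
  one : D (mon F p 0) = 0
  leibniz : ∀ f ∈ tailAlg F p k, ∀ g, D (mul F p n f g) = mul F p n (D f) g + mul F p n f (D g)
  opH : ∀ f ∈ tailAlg F p k, x * opH F p k f = opH F p k f * x + opH F p k (D f)
  opQ : ∀ f ∈ tailAlg F p k, x * opQ F p k f =
    opQ F p k f * x + (opQ F p k (D f) + e • opQ F p k f)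

theorem TailDer.opT {k : Fin n} {x : U F p n} {D : Module.End F (O F p n)} {e : F}
    (h : TailDer k x D e) {f g : O F p n} (hf : f ∈ tailAlg F p k) (hg : g ∈ tailAlg F p k) :
    x * opT F p k f g = opT F p k f g * x + (opT F p k (D f) g + opT F p k f (D g)) := by
  simp only [OddHam.opT]
  rw [mul_sub, ← mul_assoc, h.opH f hf, add_mul, mul_assoc, h.opH g hg,
    h.opH _ (mul_mem_tailAlg hf hg), h.leibniz f hf, map_add, mul_add, sub_mul, mul_assoc]
  abel

variable [Fact p.Prime]

theorem mon_zero_mem_tailAlg (k : Fin n) : mon F p 0 ∈ tailAlg F p k :=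
  mon_mem_tailAlg ⟨valid_zero, fun _ => rfl, fun _ _ => rfl⟩

theorem TailDer.opU {k : Fin n} {x : U F p n} {D : Module.End F (O F p n)} {e : F}
    (h : TailDer k x D e) {f : O F p n} (hf : f ∈ tailAlg F p k) :
    x * opU F p k f = opU F p k f * x + (opU F p k (D f) + e • opU F p k f) := by
  have e1 : e • (OddHam.opQ F p k (mon F p 0) * OddHam.opH F p k f - OddHam.opQ F p k f) =
      e • (OddHam.opQ F p k (mon F p 0) * OddHam.opH F p k f) - e • OddHam.opQ F p k f :=
    smul_sub_U _ _ _
  simp only [OddHam.opU]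
  rw [e1, mul_sub, ← mul_assoc, h.opQ _ (mon_zero_mem_tailAlg k), h.one, map_zero, zero_add,
    add_mul, mul_assoc, h.opH f hf, h.opQ f hf, mul_add, sub_mul, mul_assoc, smul_mul_assoc]
  abel

theorem pd_pair (k : Fin n) : pd F p (Sum.inl k)
    (mon F p (unit (Sum.inl k) + unit (Sum.inr k))) = mon F p (unit (Sum.inr k)) := by
  rw [add_comm, pd_mon_inl (by rw [add_comm]; exact valid_pair p k)]

theorem tailDer_euler (k : Fin n) : TailDer k (iE F p n) (euler F p n) (-1) where
  mem f hf := euler_mem_tailAlg hf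
  one := by rw [euler_mon]; simp [deg]
  leibniz f _ g := euler_mul f g
  opH f hf := by
    rw [opH_apply, opH_apply, iE_mul_iD, euler_mul, euler_mon, deg_add, deg_unit, deg_unit,
      map_smul, LinearMap.smul_apply, map_add, map_smul, add_right_comm (_ • _), ← add_smul_U]
    norm_num
  opQ f hf := by
    rw [opQ_apply, opQ_apply, iE_mul_iD, euler_mul, euler_mon, deg_unit,
      map_smul, LinearMap.smul_apply, map_add, map_smul, add_right_comm (_ • _), ← add_smul_U,
      add_comm (iD F p n _)]
    norm_num

variable [CharP F p]

theorem tailDer_Levi {k : Fin n} {l : Var n → ℕ} (hl : l ∈ Levi p k) :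
    TailDer k (iD F p n (mon F p l)) (De F p n (mon F p l)) 0 where
  mem f hf := De_Levi_mem hl hf
  one := (SDer.De (isPar_mon l)).apply_mon_zero
  leibniz f _ g := De_odd_mul (isPar_of_oSecond hl.2.2.1) g
  opH f hf := by
    have h := isPar_of_oSecond (F := F) (p := p) hl.2.2.1
    rw [opH_apply, opH_apply, iD_comm_odd h ((isPar_mon _).mul (isPar_tailAlg hf)), De_odd_mul h,
      De_Levi_pair hl, map_zero, LinearMap.zero_apply, zero_add]
  opQ f hf := by
    have h := isPar_of_oSecond (F := F) (p := p) hl.2.2.1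
    rw [opQ_apply, opQ_apply, iD_comm_odd h ((isPar_mon _).mul (isPar_tailAlg hf)), De_odd_mul h,
      De_unit_inr (isPar_mon l), pd_mon_of_eq_zero hl.2.2.2.2.1, map_zero, LinearMap.zero_apply,
      zero_add, zero_smul, add_zero]

theorem tailDer_pair (k : Fin n) : TailDer k (iH F p k)
    (De F p n (mon F p (unit (Sum.inl k) + unit (Sum.inr k)))) 1 where
  mem f hf := by rw [hDe_tailAlg hf]; exact zero_mem _
  one := (SDer.De (isPar_mon _)).apply_mon_zero
  leibniz f _ g := De_odd_mul (isPar_of_oSecond (oSecond_pair k)) g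
  opH f hf := by
    have h := isPar_of_oSecond (F := F) (p := p) (oSecond_pair k)
    rw [opH_apply, opH_apply, iD_comm_odd h ((isPar_mon _).mul (isPar_tailAlg hf)), De_odd_mul h]
    congr 2
    rw [← hDe_eq_De, hDe_mon]
    simp
  opQ f hf := by
    have h := isPar_of_oSecond (F := F) (p := p) (oSecond_pair k)
    rw [opQ_apply, opQ_apply, iD_comm_odd h ((isPar_mon _).mul (isPar_tailAlg hf)), De_odd_mul h,
      De_unit_inr (isPar_mon _), pd_pair, map_add, one_smul, add_comm (iD F p n _) (iD F p n _)]

variable {lam : Module.Dual F (hBar F p n)} {k : Fin n}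

theorem upper_mem_ann (hm : m + k.val + 1 = 2 * n) {t : ℤ} (ht : 1 ≤ t) {z : Var n → ℕ}
    (hz : z ∈ Upper p k t) : iD F p n (mon F p z) ∈ annIdeal F p n m lam := by
  refine iD_mem_ann_of_pos (good_second p k hm) hz.1 (phiSecond_pos k hz.1 ?_)
  have := hz.2
  omega

theorem upper_iD_mul_mem {t s : ℤ} (hs : s ≤ 0) {w : Var n → ℕ} (hA : aSecond k w = 0)
    (hO : oSecond w = 0) (hK : kSecond k w = s) {x : U F p n}
    (hx : ∀ z ∈ Upper p k (t + s), iD F p n (mon F p z) * x ∈ annIdeal F p n m lam) :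
    ∀ z ∈ Upper p k t, iD F p n (mon F p z) * (iD F p n (mon F p w) * x) ∈
      annIdeal F p n m lam := by
  intro z hz
  have hw := isPar_of_oSecond (F := F) (p := p) hO
  rw [← mul_assoc, iD_bracket (isPar_mon z) hw, add_mul, smul_mul_assoc, mul_assoc]
  refine add_mem (smul_mem_ann _ (mul_mem_ann _ (hx z ⟨hz.1, ?_⟩))) ?_
  · have := hz.2; omega
  · have h : iDS F p (Contr p z w) ≤ ((annIdeal F p n m lam).restrictScalars F).comap
        (LinearMap.mulRight F x) := by
      rw [iDS, Submodule.span_le]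
      rintro _ ⟨c, hc, rfl⟩
      exact hx c (contr_mem_upper hz hA hO hK hc)
    exact h (iD_mem_iDS (De_mon_mem z w))

theorem upper_opH_mul_mem {t : ℤ} {f : O F p n} (hf : f ∈ tailAlg F p k) {x : U F p n}
    (hx : ∀ z ∈ Upper p k t, iD F p n (mon F p z) * x ∈ annIdeal F p n m lam) :
    ∀ z ∈ Upper p k t, iD F p n (mon F p z) * (opH F p k f * x) ∈ annIdeal F p n m lam := by
  refine tailAlg_induction (P := fun f => ∀ z ∈ Upper p k t,
    iD F p n (mon F p z) * (opH F p k f * x) ∈ annIdeal F p n m lam) hf (fun b hb => ?_)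
    (fun z _ => by simp) (fun f g hf hg z hz => ?_) fun c f hf z hz => ?_
  · obtain ⟨e1, e2, e3, -⟩ := second_add k (unit (Sum.inl k) + unit (Sum.inr k)) b
    obtain ⟨f1, f2, f3⟩ := tail_second hb
    rw [aSecond_pair] at e1
    rw [oSecond_pair] at e2
    rw [kSecond_pair] at e3
    rw [opH_mon hb]
    exact upper_iD_mul_mem le_rfl (by omega) (by omega) (by omega) (by rwa [add_zero])
  · rw [map_add, add_mul, mul_add]; exact add_mem (hf z hz) (hg z hz)
  · rw [map_smul, smul_mul_assoc, mul_smul_comm]; exact smul_mem_ann _ (hf z hz)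

theorem upper_opH_mem (hm : m + k.val + 1 = 2 * n) {f : O F p n} (hf : f ∈ tailAlg F p k)
    {z : Var n → ℕ} (hz : z ∈ Upper p k 1) :
    iD F p n (mon F p z) * opH F p k f ∈ annIdeal F p n m lam := by
  have := upper_opH_mul_mem (x := 1) (m := m) (lam := lam) hf (fun z hz => by
    rw [mul_one]; exact upper_mem_ann hm le_rfl hz) z hz
  rwa [mul_one] at this

theorem upper_opQ_mul_mem {t : ℤ} {f : O F p n} (hf : f ∈ tailAlg F p k) {x : U F p n}
    (hx : ∀ z ∈ Upper p k (t - 1), iD F p n (mon F p z) * x ∈ annIdeal F p n m lam) :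
    ∀ z ∈ Upper p k t, iD F p n (mon F p z) * (opQ F p k f * x) ∈ annIdeal F p n m lam := by
  refine tailAlg_induction (P := fun f => ∀ z ∈ Upper p k t,
    iD F p n (mon F p z) * (opQ F p k f * x) ∈ annIdeal F p n m lam) hf (fun b hb => ?_)
    (fun z _ => by simp) (fun f g hf hg z hz => ?_) fun c f hf z hz => ?_
  · obtain ⟨e1, e2, e3, -⟩ := second_add k (unit (Sum.inr k)) b
    obtain ⟨f1, f2, f3⟩ := tail_second hb
    obtain ⟨g1, g2, g3⟩ := second_top_inr k 0
    rw [zero_smul, add_zero] at g1 g2 g3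
    rw [opQ_mon hb]
    exact upper_iD_mul_mem (s := -1) (by norm_num) (by omega) (by omega) (by omega) hx
  · rw [map_add, add_mul, mul_add]; exact add_mem (hf z hz) (hg z hz)
  · rw [map_smul, smul_mul_assoc, mul_smul_comm]; exact smul_mem_ann _ (hf z hz)

/-- If only `h_k` acts by a nonzero scalar, then the exponents in `Levi` act by zero. -/
theorem levi_mem_ann (hp : 3 < p) (hm : m + k.val + 1 = 2 * n)
    (hlam : ∀ j, j ≠ k → ev lam j = 0) :
    ∀ l ∈ Levi p k, iD F p n (mon F p l) ∈ annIdeal F p n m lam := by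
  refine iD_mem_ann_of_stable hp (good_second p k hm) (fun a ha => ha.1) ?_ ?_
  · intro a ha h0
    by_cases hcar : ∀ i : Fin n, a ≠ unit (Sum.inl i) + unit (Sum.inr i)
    · exact iD_mem_ann_of_nonneg (good_second p k hm) ha.1 h0 hcar
    · push Not at hcar
      obtain ⟨i, rfl⟩ := hcar
      have hik : i ≠ k := by
        rintro rfl
        have := ha.2.2.2.2.1
        simp at this
      have := iH_mem_ann (F := F) (m := m) (lam := lam) i
      rwa [hlam i hik, map_zero, sub_zero] at this
  · intro z hz h0 _ hcar a ha c hc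
    obtain ⟨c1, c2, c3, -⟩ := second_contr k hc
    obtain ⟨-, a1, a2, a3, a4, a5⟩ := ha
    rcases upper_or_levi hz h0 with h | h | h
    · refine Or.inr (phiSecond_pos k hc.1 ?_)
      have := h.2
      omega
    · obtain ⟨-, h1, h2, h3, h4, h5⟩ := h
      have := contr_pair hc k
      exact Or.inl ⟨hc.1, by omega, by omega, by omega, by omega, by omega⟩
    · exact absurd h (hcar k)

end Exceptional

section ExceptionalStep

variable {F : Type*} [Field F] {p n m : ℕ} {lam : Module.Dual F (hBar F p n)} {k : Fin n}

theorem phiSecond_unit_inr_neg {b : Var n → ℕ} (hb : b ∈ Tail p k)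
    (hv : Valid p n (unit (Sum.inr k) + b)) : phiSecond p k (unit (Sum.inr k) + b) < 0 := by
  obtain ⟨e1, e2, e3, -⟩ := second_add k (unit (Sum.inr k)) b
  obtain ⟨f1, f2, f3⟩ := tail_second hb
  obtain ⟨g1, g2, g3⟩ := second_top_inr k 0
  rw [zero_smul, add_zero] at g1 g2 g3
  exact phiSecond_neg hv (by omega) (by omega) (by omega)

theorem opH_mem_negPart {b : Var n → ℕ} (hb : b ∈ Tail p k) (h0 : b ≠ 0) :
    opH F p k (mon F p b) ∈ negPart F p (phiSecond p k) := by
  rw [opH_mon hb]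
  by_cases hv : Valid p n (unit (Sum.inl k) + unit (Sum.inr k) + b)
  · refine mem_iDS ⟨hv, ?_⟩
    obtain ⟨e1, e2, e3, e4⟩ := second_add k (unit (Sum.inl k) + unit (Sum.inr k)) b
    obtain ⟨f1, f2, f3⟩ := tail_second hb
    rw [aSecond_pair] at e1
    rw [oSecond_pair] at e2
    rw [kSecond_pair] at e3
    have h1 := tail_psi hb h0
    have h2 : psiSecond (unit (Sum.inl k) + unit (Sum.inr k) : Var n → ℕ) = 0 := by
      rw [psiSecond, lw_add, lw_unit_inl, lw_unit_inr]; ring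
    exact phiSecond_neg hv (by omega) (by omega) (by omega)
  · rw [mon_of_not_valid hv, map_zero]; exact zero_mem _

theorem opQ_mem_negPart {f : O F p n} (hf : f ∈ tailAlg F p k) :
    opQ F p k f ∈ negPart F p (phiSecond p k) := by
  refine tailAlg_induction (P := fun f => opQ F p k f ∈ negPart F p (phiSecond p k)) hf
    (fun b hb => ?_) (by rw [map_zero]; exact zero_mem _)
    (fun f g hf hg => by rw [map_add]; exact add_mem hf hg)
    fun c f hf => by rw [map_smul]; exact Submodule.smul_mem _ _ hf
  rw [opQ_mon hb]
  by_cases hv : Valid p n (unit (Sum.inr k) + b)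
  · exact mem_iDS ⟨hv, phiSecond_unit_inr_neg hb hv⟩
  · rw [mon_of_not_valid hv, map_zero]; exact zero_mem _

/-- An element acting by a derivation of the tail algebra preserves the span of a family `w f`
modulo the annihilator. -/
theorem mul_mem_span_sup {X : Set (U F p n)} {x w y : U F p n} {c : F}
    (hx : x - algebraMap F _ c ∈ annIdeal F p n m lam) (hw : w ∈ Submodule.span F X)
    (hy : y ∈ Submodule.span F X) (h : x * w = w * x + y) :
    x * w ∈ Submodule.span F X ⊔ (annIdeal F p n m lam).restrictScalars F := by
  have h1 := mul_mem_ann_of_mem_scalar hx w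
  rw [h, ← sub_add_cancel (w * x) (c • w)]
  exact add_mem (add_mem (Submodule.mem_sup_right h1)
    (Submodule.mem_sup_left (Submodule.smul_mem _ _ hw))) (Submodule.mem_sup_left hy)

variable [Fact p.Prime]

theorem tau_opH {f : O F p n} (hf : f ∈ tailAlg F p k) :
    tau F p n (opH F p k f) = opH F p k f := by
  have h := (isPar_of_oSecond (F := F) (p := p) (oSecond_pair k)).mul (isPar_tailAlg hf)
  rw [opH_apply, tau_iD h]
  norm_num

theorem tau_opQ {f : O F p n} (hf : f ∈ tailAlg F p k) :
    tau F p n (opQ F p k f) = opQ F p k f := by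
  have h1 : IsPar 1 (mon F p (unit (Sum.inr k) : Var n → ℕ)) := by
    have := isPar_mon (F := F) (p := p) (unit (Sum.inr k) : Var n → ℕ)
    rwa [oddDeg_unit_inr] at this
  rw [opQ_apply, tau_iD (h1.mul (isPar_tailAlg hf))]
  norm_num

theorem opH_one_mem_ann (hk : ev lam k = 1) :
    opH F p k (mon F p 0) - algebraMap F _ 1 ∈ annIdeal F p n m lam := by
  rw [← hk, opH_apply, mul_mon_zero]
  exact iH_mem_ann k

theorem opU_eq (k : Fin n) (f : O F p n) : opU F p k f =
    iD F p n (mon F p (unit (Sum.inr k))) * opH F p k f - opQ F p k f := by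
  rw [opU, opQ_apply k (mon F p 0), mul_mon_zero]

theorem cast_choose_pred (r : ℕ) [CharP F p] (hr : r < p) :
    (((p - 1).choose r : ℕ) : F) * (-1) ^ r = 1 := by
  have hp := (Fact.out : p.Prime).two_le
  induction r with
  | zero => simp
  | succ r ih =>
    have h1 : (((p - 1).choose r : ℕ) : F) + ((p - 1).choose (r + 1) : ℕ) = 0 := by
      rw [← Nat.cast_add, ← Nat.choose_succ_succ', Nat.sub_add_cancel (by omega),
        CharP.cast_eq_zero_iff F p]
      exact (Fact.out : p.Prime).dvd_choose_self (by omega) hr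
    have h2 := ih (by omega)
    rw [eq_neg_of_add_eq_zero_right h1, pow_succ]
    linear_combination h2

theorem lowOp_eq (k : Fin n) : lowOp F p k = (-1 : F) • opQ F p k (mon F p 0) := by
  rw [lowOp, opQ_apply, mul_mon_zero]

variable [CharP F p]

theorem tailDer_of_nonneg {z : Var n → ℕ} (hz : z ∈ Levi p k ∨
    z = unit (Sum.inl k) + unit (Sum.inr k)) :
    ∃ D e, TailDer k (iD F p n (mon F p z)) D e := by
  rcases hz with h | rfl
  · exact ⟨_, _, tailDer_Levi h⟩
  · exact ⟨_, _, tailDer_pair k⟩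

/-- If `h_k` acts by `1`, then on the highest weight vector the operators `De_{x_k x_{n+k} f}` are
multiplicative in `f`: the defects `opT f g` generate a proper submodule. -/
theorem opT_mem_ann (hp : 3 < p) (hm : m + k.val + 1 = 2 * n) (hk : ev lam k = 1)
    {f g : O F p n} (hf : f ∈ tailAlg F p k) (hg : g ∈ tailAlg F p k) :
    opT F p k f g ∈ annIdeal F p n m lam := by
  have key : ∀ x ∈ {x | ∃ f ∈ tailAlg F p k, ∃ g ∈ tailAlg F p k, x = opT F p k f g},
      x ∈ annIdeal F p n m lam := by
    set X := {x | ∃ f ∈ tailAlg F p k, ∃ g ∈ tailAlg F p k, x = opT F p k f g} with hXdef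
    have hder : ∀ {x D e c}, TailDer k x D e → x - algebraMap F _ c ∈ annIdeal F p n m lam →
        ∀ w ∈ X, x * w ∈ Submodule.span F X ⊔ (annIdeal F p n m lam).restrictScalars F := by
      rintro x D e c hx hc _ ⟨f, hf, g, hg, rfl⟩
      refine mul_mem_span_sup hc (Submodule.subset_span ⟨f, hf, g, hg, rfl⟩) ?_ (hx.opT hf hg)
      exact add_mem (Submodule.subset_span ⟨_, hx.mem f hf, g, hg, rfl⟩)
        (Submodule.subset_span ⟨f, hf, _, hx.mem g hg, rfl⟩)
    refine mem_annIdeal_of_stable hp (good_second p k hm) ?_ ?_ ?_ ?_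
    · rintro _ ⟨f, hf, g, hg, rfl⟩
      refine ⟨1, ?_⟩
      rw [opT, map_sub, map_mul, tau_opH hf, tau_opH hg, tau_opH (mul_mem_tailAlg hf hg),
        one_smul]
    · rintro x hx z hz h0
      rcases upper_or_levi hz h0 with h | h
      · obtain ⟨f, hf, g, hg, rfl⟩ := hx
        refine Submodule.mem_sup_right ?_
        rw [opT, mul_sub]
        exact sub_mem (upper_opH_mul_mem hf (fun z hz => upper_opH_mem hm hg hz) z h)
          (upper_opH_mem hm (mul_mem_tailAlg hf hg) h)
      · obtain ⟨D, e, hD⟩ := tailDer_of_nonneg (F := F) h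
        obtain ⟨c, hc⟩ := exists_scalar (F := F) (lam := lam) (good_second p k hm) hz h0
        exact hder hD hc x hx
    · exact fun x hx => hder (tailDer_euler k) iE_mem_ann x hx
    · rintro _ ⟨f, hf, g, hg, rfl⟩
      set K := negPart F p (phiSecond p k) * ⊤ ⊔ (annIdeal F p n m lam).restrictScalars F
      refine tailAlg_induction (P := fun f => opT F p k f g ∈ K) hf (fun b hb => ?_) ?_
        (fun f f' hf hf' => by rw [opT_add_left]; exact add_mem hf hf')
        fun c f hf => by rw [opT_smul_left]; exact Submodule.smul_mem _ _ hf
      · by_cases hb0 : b = 0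
        · subst hb0
          refine Submodule.mem_sup_right ?_
          have h1 := mul_mem_ann_of_mem_scalar (opH_one_mem_ann (m := m) hk) (opH F p k g)
          have h2 := (tailDer_pair (F := F) (p := p) k).opH g hg
          rw [hDe_tailAlg hg, map_zero, add_zero] at h2
          rw [one_smul] at h1
          rw [opT, mul_zero_mon, Module.End.one_apply]
          rw [opH_apply k (mon F p 0), mul_mon_zero] at h1 ⊢
          change iH F p k * _ - _ ∈ _
          rw [h2]
          exact h1
        · refine Submodule.mem_sup_left (sub_mem (Submodule.mul_mem_mul (opH_mem_negPart hb hb0)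
            trivial) ?_)
          refine tailAlg_induction (P := fun g => opH F p k (mul F p n (mon F p b) g) ∈
            negPart F p (phiSecond p k) * ⊤) hg (fun c hc => ?_) (by simp)
            (fun f g hf hg => by rw [map_add, map_add]; exact add_mem hf hg)
            fun c f hf => by rw [map_smul, map_smul]; exact Submodule.smul_mem _ _ hf
          rw [mul_mon_mon, map_smul]
          refine Submodule.smul_mem _ _ ?_
          by_cases hv : Valid p n (b + c)
          · rw [← mul_one (opH F p k _)]
            refine Submodule.mul_mem_mul (opH_mem_negPart ⟨hv, fun i => ?_, fun i hi => ?_⟩ ?_)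
              trivial
            · rw [Pi.add_apply, hb.2.1, hc.2.1]
            · rw [Pi.add_apply, hb.2.2 i hi, hc.2.2 i hi]
            · intro h
              refine hb0 (funext fun v => ?_)
              have := congrFun h v
              simp only [Pi.add_apply, Pi.zero_apply] at this ⊢
              omega
          · rw [mon_of_not_valid hv, map_zero]; exact zero_mem _
      · rw [opT, map_zero, map_zero, LinearMap.zero_apply, map_zero, zero_mul, sub_zero]
        exact zero_mem _
  exact key _ ⟨f, hf, g, hg, rfl⟩

theorem mul_iD_inr {z : Var n → ℕ} (hO : oSecond z = 0) :
    iD F p n (mon F p z) * iD F p n (mon F p (unit (Sum.inr k))) =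
      iD F p n (mon F p (unit (Sum.inr k))) * iD F p n (mon F p z) +
        iD F p n (pd F p (Sum.inl k) (mon F p z)) := by
  rw [iD_comm_odd (isPar_of_oSecond hO) (isPar_mon _), De_unit_inr (isPar_mon _)]

theorem mul_opU {z : Var n → ℕ} (hO : oSecond z = 0) {f : O F p n} (hf : f ∈ tailAlg F p k) :
    iD F p n (mon F p z) * opU F p k f =
      iD F p n (mon F p (unit (Sum.inr k))) * (iD F p n (mon F p z) * opH F p k f) -
        opQ F p k f * iD F p n (mon F p z) +
      (iD F p n (pd F p (Sum.inl k) (mon F p z)) * opH F p k f -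
        iD F p n (mul F p n (pd F p (Sum.inl k) (mon F p z)) f) -
        opQ F p k (De F p n (mon F p z) f)) := by
  have hz := isPar_of_oSecond (F := F) (p := p) hO
  have h1 : iD F p n (mon F p z) * opQ F p k f = opQ F p k f * iD F p n (mon F p z) +
      (iD F p n (mul F p n (pd F p (Sum.inl k) (mon F p z)) f) +
        opQ F p k (De F p n (mon F p z) f)) := by
    rw [opQ_apply, iD_comm_odd hz ((isPar_mon _).mul (isPar_tailAlg hf)), De_odd_mul hz,
      De_unit_inr (isPar_mon _), map_add, opQ_apply]
  rw [opU_eq, mul_sub, ← mul_assoc, mul_iD_inr hO, add_mul, mul_assoc, h1]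
  abel

theorem De_mul_tail {r s : O F p n} {f : O F p n} (hr : IsPar 0 r) (h : IsPar 1 (mul F p n r s))
    (hf : f ∈ tailAlg F p k) (h0 : De F p n f r = 0) (hs : IsPar 1 s) :
    De F p n (mul F p n r s) f = mul F p n r (De F p n s f) := by
  have hf' := isPar_tailAlg hf
  rw [De_antisymm_odd h hf', SDer.De hf' r s, h0, map_zero, LinearMap.zero_apply, zero_add,
    hr.sig_pow, mul_zero, pow_zero, one_smul, De_antisymm_odd hs hf', map_smul]

/-- If `h_k` acts by `1` and the other `h_j` act by `0`, then the vectors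
`De_{x_{n+k} f} v` are determined by the `De_{x_k x_{n+k} f} v`: the differences `opU f` generate a
proper submodule. -/
theorem opU_mem_ann (hp : 3 < p) (hm : m + k.val + 1 = 2 * n) (hk : ev lam k = 1)
    (hlam : ∀ j, j ≠ k → ev lam j = 0) {f : O F p n} (hf : f ∈ tailAlg F p k) :
    opU F p k f ∈ annIdeal F p n m lam := by
  have key : ∀ x ∈ opU F p k '' tailAlg F p k, x ∈ annIdeal F p n m lam := by
    set X := opU F p k '' tailAlg F p k with hXdef
    have hder : ∀ {x D e c}, TailDer k x D e → x - algebraMap F _ c ∈ annIdeal F p n m lam →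
        ∀ w ∈ X, x * w ∈ Submodule.span F X ⊔ (annIdeal F p n m lam).restrictScalars F := by
      rintro x D e c hx hc _ ⟨f, hf, rfl⟩
      refine mul_mem_span_sup hc (Submodule.subset_span ⟨f, hf, rfl⟩) ?_ (hx.opU hf)
      exact add_mem (Submodule.subset_span ⟨_, hx.mem f hf, rfl⟩)
        (Submodule.smul_mem _ _ (Submodule.subset_span ⟨f, hf, rfl⟩))
    refine mem_annIdeal_of_stable hp (good_second p k hm) ?_ ?_ ?_ ?_
    · rintro _ ⟨f, hf, rfl⟩
      refine ⟨1, ?_⟩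
      rw [opU, map_sub, map_mul, tau_opH hf, tau_opQ hf, tau_opQ (mon_zero_mem_tailAlg k),
        one_smul]
    · rintro x hx z hz h0
      rcases upper_or_levi hz h0 with h | h
      swap
      · obtain ⟨D, e, hD⟩ := tailDer_of_nonneg (F := F) h
        obtain ⟨c, hc⟩ := exists_scalar (F := F) (lam := lam) (good_second p k hm) hz h0
        exact hder hD hc x hx
      obtain ⟨f, hf, rfl⟩ := hx
      have hf' : f ∈ tailAlg F p k := hf
      refine Submodule.mem_sup_right ?_
      by_cases h2 : z ∈ Upper p k 2
      · rw [opU, mul_sub]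
        refine sub_mem (upper_opQ_mul_mem (mon_zero_mem_tailAlg k)
          (fun z hz => upper_opH_mem hm hf hz) z h2) ?_
        have := upper_opQ_mul_mem (x := 1) (m := m) (lam := lam) (t := 2) hf (fun z hz => by
          rw [mul_one]; exact upper_mem_ann hm le_rfl hz) z h2
        rwa [mul_one] at this
      have hAOK : aSecond k z = 0 ∧ oSecond z = 0 ∧ kSecond k z = (1 : ℕ) := by
        have h3 := h.2
        have h4 : ¬ (0 < aSecond k z ∨ aSecond k z = 0 ∧
            (oSecond z < 0 ∨ oSecond z = 0 ∧ 2 ≤ kSecond k z)) := fun h5 => h2 ⟨hz, h5⟩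
        push_cast
        omega
      obtain ⟨hA, hO, hK⟩ := hAOK
      -- it remains to raise `opU f` by `De_{x_k l}`, with `l` in `Levi`, and by
      -- `De_{x_k^{(2)} x_{n+k} b}`; the latter gives `opT b f`
      rw [mul_opU hO hf]
      refine add_mem (sub_mem (mul_mem_ann _ (upper_opH_mem hm hf h))
        (mul_mem_ann _ (upper_mem_ann hm le_rfl h))) ?_
      have h3 := hz.2 k
      rcases (show z (Sum.inr k) = 0 ∨ z (Sum.inr k) = 1 by omega) with h4 | h4
      · obtain ⟨l, hl, rfl⟩ := exists_eq_of_inr_eq_zero hz hA hO hK h4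
        rw [one_smul] at hz ⊢
        have hl1 := isPar_of_oSecond (F := F) (p := p) hl.2.2.1
        have e1 : mon F p (l + unit (Sum.inl k)) =
            mul F p n (mon F p (unit (Sum.inl k))) (mon F p l) := by
          rw [mul_mon_mon, mulCoeff, signExp_unit_inl_left, pow_zero, one_mul, Finset.prod_eq_one,
            one_smul, add_comm]
          intro v _
          by_cases hv : v = Sum.inl k
          · subst hv; simp [hl.2.2.2.2.1]
          · simp [hv]
        have e2 : De F p n (mon F p (l + unit (Sum.inl k))) f =
            mul F p n (mon F p (unit (Sum.inl k))) (De F p n (mon F p l) f) := by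
          have hpar := isPar_mon (F := F) (p := p) (unit (Sum.inl k) : Var n → ℕ)
          rw [oddDeg_unit_inl] at hpar
          rw [e1]
          refine De_mul_tail hpar ?_ hf ?_ hl1
          · rw [← e1]; rw [one_smul] at hO; exact isPar_of_oSecond hO
          · rw [De_unit_inl (isPar_tailAlg hf'), (pd_tailAlg hf').2, smul_zero]
        have e3 : opQ F p k (De F p n (mon F p (l + unit (Sum.inl k))) f) =
            opH F p k (De F p n (mon F p l) f) := by
          rw [e2, opQ_apply, ← mul_assoc', mul_mon_of_disjoint (fun i => by simp)
            (fun i => by simp), opH_apply, add_comm (unit (Sum.inr k))]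
        rw [pd_mon_inl hz, e3, (tailDer_Levi hl).opH f hf, add_sub_right_comm, add_sub_assoc,
          sub_self, add_zero]
        refine sub_mem (mul_mem_ann _ (levi_mem_ann hp hm hlam l hl)) ?_
        refine tailAlg_induction (P := fun f => iD F p n (mul F p n (mon F p l) f) ∈
          annIdeal F p n m lam) hf' (fun b hb => ?_) (by simp)
          (fun f g hf hg => by rw [map_add, map_add]; exact add_mem hf hg)
          fun c f hf => by rw [map_smul, map_smul]; exact smul_mem_ann _ hf
        rw [mul_mon_mon, map_smul]
        refine smul_mem_ann _ ?_
        by_cases hv : Valid p n (l + b)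
        · exact levi_mem_ann hp hm hlam _ (levi_add_tail hl hb hv)
        · rw [mon_of_not_valid hv, map_zero]; exact zero_mem _
      · obtain ⟨b, hb, rfl⟩ := exists_eq_of_inr_eq_one hz hA hO hK h4
        have hbk := hb.2.2 k le_rfl
        have e1 : pd F p (Sum.inl k) (mon F p (unit (Sum.inr k) + (1 + 1) • unit (Sum.inl k) + b)) =
            mul F p n (mon F p (unit (Sum.inl k) + unit (Sum.inr k))) (mon F p b) := by
          have e : unit (Sum.inr k) + (1 + 1) • unit (Sum.inl k) + b =
              (unit (Sum.inl k) + unit (Sum.inr k) + b) + unit (Sum.inl k) := by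
            rw [one_add_one_eq_two, two_smul]; abel
          rw [e, pd_mon_inl (by rwa [← e]), mul_mon_of_disjoint hb.2.1 fun i => ?_]
          by_cases hi : i = k
          · subst hi; exact Or.inr hbk
          · left; simp [hi]
        have hv : Valid p n ((1 + 1) • unit (Sum.inl k) + b) := by
          refine hz.mono fun v => ?_
          simp only [Pi.add_apply]
          omega
        have e2 : mon F p (unit (Sum.inr k) + (1 + 1) • unit (Sum.inl k) + b) =
            mul F p n (mon F p (unit (Sum.inr k))) (mon F p ((1 + 1) • unit (Sum.inl k) + b)) := by
          rw [mul_mon_of_disjoint (fun i => by simp [hb.2.1]) (fun i => by simp), add_assoc]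
        have e3 : De F p n (mon F p (unit (Sum.inr k) + (1 + 1) • unit (Sum.inl k) + b)) f =
            mul F p n (mon F p (unit (Sum.inr k)))
              (De F p n f (mon F p ((1 + 1) • unit (Sum.inl k) + b))) := by
          have hsig : (sig F p n ^ (0 + 1)) (mon F p (unit (Sum.inr k) : Var n → ℕ)) =
              (-1 : F) • mon F p (unit (Sum.inr k)) := by
            rw [zero_add, pow_one, sig_mon', oddDeg_unit_inr, pow_one]
          rw [De_antisymm_odd (isPar_of_oSecond hO) (isPar_tailAlg hf'), e2,
            SDer.De (isPar_tailAlg hf'), De_unit_inr (isPar_tailAlg hf'), (pd_tailAlg hf').1,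
            map_zero, LinearMap.zero_apply, zero_add, hsig, map_smul, LinearMap.smul_apply,
            smul_smul, neg_mul_neg, one_mul, one_smul]
        have e4 : opQ F p k (De F p n
            (mon F p (unit (Sum.inr k) + (1 + 1) • unit (Sum.inl k) + b)) f) = 0 := by
          rw [e3, opQ_apply, ← mul_assoc', mul_mon_mon,
            mon_of_not_valid (fun h => by have := h.2 k; simp at this)]
          simp
        have e5 := opT_mem_ann hp hm hk (mon_mem_tailAlg hb) hf'
        rw [opT, opH_apply k (mon F p b), opH_apply k (mul F p n _ f), ← mul_assoc'] at e5
        rw [e1, e4, sub_zero]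
        exact e5
    · exact fun x hx => hder (tailDer_euler k) iE_mem_ann x hx
    · rintro _ ⟨f, hf, rfl⟩
      refine Submodule.mem_sup_left (sub_mem (Submodule.mul_mem_mul
        (opQ_mem_negPart (mon_zero_mem_tailAlg k)) trivial) ?_)
      rw [← mul_one (opQ F p k f)]
      exact Submodule.mul_mem_mul (opQ_mem_negPart hf) trivial
  exact key _ ⟨f, hf, rfl⟩

theorem upper_lowOp_pow_mem (hm : m + k.val + 1 = 2 * n) (s : ℕ) : ∀ z ∈ Upper p k (s + 1),
    iD F p n (mon F p z) * lowOp F p k ^ s ∈ annIdeal F p n m lam := by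
  induction s with
  | zero => intro z hz; rw [pow_zero, mul_one]; exact upper_mem_ann hm (by simp) hz
  | succ s ih =>
    intro z hz
    rw [pow_succ', lowOp_eq, smul_mul_assoc, mul_smul_comm, ← lowOp_eq]
    refine smul_mem_ann _ (upper_opQ_mul_mem (mon_zero_mem_tailAlg k) ?_ z hz)
    rwa [Nat.cast_succ, add_sub_cancel_right]

/-- In the exceptional case `P ^ (p - 1) v` vanishes: it generates a proper submodule. All the
binomial coefficients of `p - 1` are `± 1`, so that the element `De_{x_k^{(r+1)} x_{n+k} b}` maps
`P ^ (p - 1) v` to a multiple of `P ^ (p - 2 - r) opU(b) v`, which is zero. -/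
theorem lowOp_pow_pred_mem_ann (hp : 3 < p) (hm : m + k.val + 1 = 2 * n) (hk : ev lam k = 1)
    (hlam : ∀ j, j ≠ k → ev lam j = 0) : lowOp F p k ^ (p - 1) ∈ annIdeal F p n m lam := by
  have key : ∀ x ∈ ({lowOp F p k ^ (p - 1)} : Set (U F p n)), x ∈ annIdeal F p n m lam := by
    refine mem_annIdeal_of_stable hp (good_second p k hm) ?_ ?_ ?_ ?_
    · rintro _ rfl; exact ⟨1, by rw [tau_lowOp, one_smul]⟩
    · rintro _ rfl z hz h0
      refine Submodule.mem_sup_right ?_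
      by_cases hAO : aSecond k z = 0 ∧ oSecond z = 0
      swap
      · refine upper_lowOp_pow_mem hm (p - 1) z ⟨hz, ?_⟩
        have := phiSecond_nonneg k hz h0
        omega
      obtain ⟨hA, hO⟩ := hAO
      obtain ⟨r, hr⟩ : ∃ r : ℕ, kSecond k z = r := Int.eq_ofNat_of_zero_le (by
        have := phiSecond_nonneg k hz h0
        omega)
      have h := iD_mul_lowOp_pow_sub_mem (F := F) (lam := lam) hm (p - 1) r hz hA hO hr
      refine (Submodule.sub_mem_iff_left _ ?_).1 h
      have h3 := hz.2 k
      rcases (show z (Sum.inr k) = 0 ∨ z (Sum.inr k) = 1 by omega) with h4 | h4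
      · obtain ⟨l, hl, rfl⟩ := exists_eq_of_inr_eq_zero hz hA hO hr h4
        rw [pow_succ' (pd F p (Sum.inl k)), Module.End.mul_apply, pd_pow_add k r hz,
          pd_mon_of_eq_zero hl.2.2.2.2.1, map_zero, mul_zero, smul_zero, add_zero]
        exact smul_mem_ann _ (mul_mem_ann _ (levi_mem_ann hp hm hlam l hl))
      · obtain ⟨b, hb, rfl⟩ := exists_eq_of_inr_eq_one hz hA hO hr h4
        have hbk := hb.2.2 k le_rfl
        have e1 : unit (Sum.inr k) + (r + 1) • unit (Sum.inl k) + b =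
            unit (Sum.inr k) + b + (r + 1) • unit (Sum.inl k) := by abel
        have e2 : unit (Sum.inr k) + (r + 1) • unit (Sum.inl k) + b =
            unit (Sum.inl k) + unit (Sum.inr k) + b + r • unit (Sum.inl k) := by
          rw [succ_nsmul]; abel
        have hrp : r + 1 < p := by
          have := hz.1 k
          simp [hbk] at this
          exact this
        have e3 : (pd F p (Sum.inl k) ^ (r + 1))
            (mon F p (unit (Sum.inr k) + (r + 1) • unit (Sum.inl k) + b)) =
              mon F p (unit (Sum.inr k) + b) := by
          rw [e1, pd_pow_add k (r + 1) (by rwa [← e1])]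
        have e4 : (pd F p (Sum.inl k) ^ r)
            (mon F p (unit (Sum.inr k) + (r + 1) • unit (Sum.inl k) + b)) =
              mon F p (unit (Sum.inl k) + unit (Sum.inr k) + b) := by
          rw [e2, pd_pow_add k r (by rwa [← e2])]
        rw [e3, e4, cast_choose_pred r (by omega), cast_choose_pred (r + 1) hrp, one_smul, one_smul,
          ← opH_mon hb, ← opQ_mon hb]
        have e5 : p - 1 - r = p - 1 - (r + 1) + 1 := by omega
        have e6 : lowOp F p k * opH F p k (mon F p b) + opQ F p k (mon F p b) =
            (-1 : F) • opU F p k (mon F p b) := by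
          rw [lowOp_eq, smul_mul_assoc, neg_one_smul_U, neg_one_smul_U, opU, neg_sub,
            neg_add_eq_sub]
        rw [e5, pow_succ, mul_assoc, ← mul_add, e6]
        exact mul_mem_ann _ (smul_mem_ann _ (opU_mem_ann hp hm hk hlam (mon_mem_tailAlg hb)))
    · rintro _ rfl
      have h1 : lowOp F p k ^ (p - 1) ∈ Submodule.span F {lowOp F p k ^ (p - 1)} :=
        Submodule.mem_span_singleton_self _
      exact mul_mem_span_sup iE_mem_ann h1 (Submodule.smul_mem _ _ h1) (iE_mul_lowOp_pow k (p - 1))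
    · rintro _ rfl
      refine Submodule.mem_sup_left ?_
      have : p - 1 = p - 2 + 1 := by omega
      rw [this, pow_succ', lowOp_eq, smul_mul_assoc]
      exact Submodule.smul_mem _ _ (Submodule.mul_mem_mul
        (opQ_mem_negPart (mon_zero_mem_tailAlg k)) trivial)
  exact key _ rfl

/-- The rank one case with eigenvalue `1` of `h_k`, in which `P ^ (p - 2) v` is the last nonzero
vector. -/
theorem step_second_exceptional [NeZero n] (hp : 3 < p) (hm : m + k.val + 1 = 2 * n)
    (hk : ev lam k = 1) (hlam : ∀ j, j ≠ k → ev lam j = 0) (hI : vermaIdeal F p n m lam ≠ ⊤) :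
    LIso F p n m lam (m + 1) (lam + ((p - 2 : ℕ) : F) • (eps F p k - delta F p n)) ∧
      vermaIdeal F p n (m + 1) (lam + ((p - 2 : ℕ) : F) • (eps F p k - delta F p n)) ≠ ⊤ := by
  have hkn := k.2
  refine step_second hp hm (p - 2) (lowOp_pow_sub_two_notMem hp hm (by rw [hk]; exact one_ne_zero)
    (annIdeal_ne_top_of_le hp (by omega) hI)) ?_
  have : p - 2 + 1 = p - 1 := by omega
  rw [this]
  exact lowOp_pow_pred_mem_ann hp hm hk hlam

end ExceptionalStep

/-! ### Highest weights with respect to different Borel subalgebras -/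

section HighestWeights

variable {F : Type*} [Field F] {p n m : ℕ} {lam lam' : Module.Dual F (hBar F p n)}

theorem LIso.trans {m' m'' : ℕ} {lam'' : Module.Dual F (hBar F p n)} (h : LIso F p n m lam m' lam')
    (h' : LIso F p n m' lam' m'' lam'') : LIso F p n m lam m'' lam'' := by
  obtain ⟨e, θ, he⟩ := h
  obtain ⟨e', θ', he'⟩ := h'
  refine ⟨e.trans e', θ + θ', fun η x => ?_⟩
  rw [he, he', LinearEquiv.trans_apply, add_assoc]

theorem lPart_zero_mem (θ : ZMod 2) : (0 : L F p n m lam) ∈ lPart F p n m lam θ :=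
  mem_lPart.2 ⟨0, zero_mem _, map_zero _⟩

theorem subsingleton_L (h : vermaIdeal F p n m lam = ⊤) : Subsingleton (L F p n m lam) := by
  refine subsingleton_of_forall_eq 0 fun x => ?_
  obtain ⟨u, rfl⟩ := toL_surjective x
  exact toL_eq_zero.2 (vermaIdeal_le_annIdeal (by rw [h]; trivial))

theorem lIso_of_eq_top {m' : ℕ} (h : vermaIdeal F p n m lam = ⊤)
    (h' : vermaIdeal F p n m' lam' = ⊤) : LIso F p n m lam m' lam' := by
  have := subsingleton_L h
  have := subsingleton_L h'
  refine ⟨0, 0, fun η x => ?_⟩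
  rw [Subsingleton.elim x 0, map_zero]
  exact ⟨fun _ => lPart_zero_mem _, fun _ => lPart_zero_mem _⟩

theorem dual_ext (h1 : ∀ j, lam (hDe' F p j) = lam' (hDe' F p j))
    (h2 : lam (euler' F p) = lam' (euler' F p)) : lam = lam' := by
  have key : ∀ (y) (hy : y ∈ hBar F p n), lam ⟨y, hy⟩ = lam' ⟨y, hy⟩ := fun y hy => by
    induction hy using Submodule.span_induction with
    | zero => exact (map_zero lam).trans (map_zero lam').symm
    | add y z hy hz e1 e2 =>
      exact (map_add lam ⟨y, hy⟩ ⟨z, hz⟩).trans ((congrArg₂ _ e1 e2).trans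
        (map_add lam' ⟨y, hy⟩ ⟨z, hz⟩).symm)
    | smul c y hy e1 =>
      exact (map_smul lam c ⟨y, hy⟩).trans ((congrArg _ e1).trans (map_smul lam' c ⟨y, hy⟩).symm)
    | mem y hy =>
      rcases hy with ⟨j, rfl⟩ | rfl
      · exact h1 j
      · exact h2
  exact LinearMap.ext fun y => key y.1 y.2

theorem piDeg_pos {a : Var n → ℕ} (ha : Valid p n a) (h : a ∈ pos0 n) :
    0 < bigX p n * ((deg a : ℤ) - 2) + psiFirst a := by
  have h1 := abs_le.1 (psiFirst_abs ha)
  have h2 : (0 : ℤ) ≤ n * ((p + 1) * (n + 1)) := by positivity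
  rcases h with (h | ⟨i, j, hij, rfl⟩) | ⟨i, j, rfl⟩
  · have h3 : (3 : ℤ) ≤ deg a := by exact_mod_cast h
    have h4 : bigX p n ≤ bigX p n * ((deg a : ℤ) - 2) := by
      have : 0 < bigX p n := by rw [bigX]; omega
      nlinarith
    rw [bigX] at h4 ⊢
    omega
  · have h3 : i.val < j.val := hij
    rw [deg_add, deg_unit, deg_unit, psiFirst, lw_add, lw_unit_inl, lw_unit_inr]
    push_cast
    rw [mul_zero]
    omega
  · rw [deg_add, deg_unit, deg_unit, psiFirst, lw_add, lw_unit_inl, lw_unit_inl]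
    push_cast
    rw [mul_zero]
    have := i.2
    have := j.2
    omega

variable [Fact p.Prime] [CharP F p] {φ : (Var n → ℕ) → ℤ}

/-- The highest weight is an invariant of the irreducible module: it is the weight of the quotient
of the module by the image of the negative part, which is one-dimensional. -/
theorem highest_weight_unique (hp : 3 < p) (hm : m ≤ 2 * n) (hI : vermaIdeal F p n m lam ≠ ⊤)
    (h : LIso F p n m lam m lam') : lam = lam' := by
  obtain ⟨φ, hφ⟩ := exists_good p hm
  obtain ⟨M, hM⟩ := negPart_nilpotent (F := F) hp hφ.toIsGrading
  have hR := annIdeal_ne_top hp hφ hI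
  obtain ⟨e, -, -⟩ := h
  obtain ⟨w, hw⟩ := toL_surjective (e.symm (toL F p n m lam' 1))
  set N := negPart F p φ with hN
  set R := annIdeal F p n m lam with hRdef
  have hmul : ∀ u, toL F p n m lam (u * w) = e.symm (toL F p n m lam' u) := fun u => by
    have h1 : toL F p n m lam (u * w) = u • toL F p n m lam w := map_smul _ u w
    have h2 : toL F p n m lam' u = u • toL F p n m lam' 1 := by
      rw [← map_smul, smul_eq_mul, mul_one]
    rw [h1, hw, h2, map_smul]
  have hann : ∀ u ∈ annIdeal F p n m lam', u * w ∈ R := fun u hu => by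
    rw [← toL_eq_zero, hmul, toL_eq_zero.2 hu, map_zero]
  obtain ⟨u₁, hu₁⟩ := toL_surjective (e (toL F p n m lam 1))
  have h1w : 1 - u₁ * w ∈ R := by
    rw [← toL_eq, hmul, hu₁, LinearEquiv.symm_apply_apply]
  -- both the class of `1` and that of `w` span the module modulo the image of the negative part
  set K : Submodule F (U F p n) := N * ⊤ ⊔ R.restrictScalars F with hK
  have hspan : ∀ (x : U F p n) (M₀ : Submodule F (U F p n)), x ∈ M₀ →
      nonnegPart F p φ * M₀ ≤ M₀ ⊔ R.restrictScalars F → ∀ u, u * x ∈ M₀ ⊔ K := by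
    intro x M₀ hx hB u
    have h3 := straighten_leftIdeal hM R hB u x (Submodule.mem_sup_left (by
      rw [← one_mul x]
      exact Submodule.mul_mem_mul (Submodule.one_le.1 (one_le_one_sup_pow N M)) hx))
    refine (sup_le ?_ (le_sup_right.trans le_sup_right) :
      (1 ⊔ N) ^ M * M₀ ⊔ R.restrictScalars F ≤ M₀ ⊔ K) h3
    refine (sub_mul_mono_left (one_sup_pow_le' N M)).trans ?_
    rw [Submodule.sup_mul, one_mul, mul_assoc]
    exact sup_le_sup_left (le_sup_of_le_left (sub_mul_mono_right le_top)) _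
  have h1K : (1 : U F p n) ∉ K := by
    intro h1
    refine hR (eq_top_of_le_negPart_mul_sup hM R fun u _ => ?_)
    have h3 := hspan 1 1 (Submodule.one_le.1 le_rfl) (by
      rw [mul_one]
      exact (nonnegPart_le hφ).trans (sup_le_sup_left (fun x hx => vermaIdeal_le_annIdeal hx) _)) u
    rw [mul_one] at h3
    refine (sup_le ?_ le_rfl : 1 ⊔ K ≤ K) h3
    exact Submodule.one_le.2 h1
  have hw1 : u₁ * w ∈ Submodule.span F {w} ⊔ K := by
    refine hspan w _ (Submodule.mem_span_singleton_self _) ?_ u₁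
    refine (sub_mul_mono_left (nonnegPart_le (lam := lam') hφ)).trans ?_
    rw [Submodule.sup_mul, one_mul]
    refine sup_le_sup_left ?_ _
    rw [Submodule.mul_le]
    intro i hi x hx
    obtain ⟨c, rfl⟩ := Submodule.mem_span_singleton.1 hx
    rw [mul_smul_comm]
    exact Submodule.smul_mem _ _ (hann i (vermaIdeal_le_annIdeal hi))
  have h1wK : (1 : U F p n) ∈ Submodule.span F {w} ⊔ K := by
    rw [← sub_add_cancel 1 (u₁ * w)]
    exact add_mem (Submodule.mem_sup_right (Submodule.mem_sup_right h1w)) hw1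
  obtain ⟨x, hx, k, hk, hxk⟩ := Submodule.mem_sup.1 h1wK
  obtain ⟨c, rfl⟩ := Submodule.mem_span_singleton.1 hx
  -- the Cartan subalgebra preserves the image of the negative part
  have hcompare : ∀ (x : U F p n) (a b : F), (x - algebraMap F _ a ∈ R) →
      (x - algebraMap F _ b ∈ annIdeal F p n m lam') → (∀ y ∈ K, x * y ∈ K) → a = b := by
    intro x a b h2 h3 h4
    by_contra hab
    have h5 : x * 1 = c • (x * w) + x * k := by rw [← hxk, mul_add, mul_smul_comm]
    have h6 := hann _ h3
    rw [sub_mul, ← Algebra.smul_def] at h6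
    have h7 : (a - b) • (1 : U F p n) = (x * k - b • k) + c • (x * w - b • w) -
        (x - algebraMap F _ a) := by
      have e1 : (a - b) • (1 : U F p n) = a • (1 : U F p n) - b • (1 : U F p n) := by
        rw [eq_sub_iff_add_eq, ← add_smul_U, sub_add_cancel]
      have e2 : b • (1 : U F p n) = c • b • w + b • k := by
        rw [smul_comm c b, ← smul_add, hxk]
      have e3 : x = c • (x * w) + x * k := by rw [← h5, mul_one]
      rw [e1, Algebra.algebraMap_eq_smul_one, smul_sub_U]
      rw [e2, sub_sub_eq_add_sub, eq_sub_iff_add_eq]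
      nth_rewrite 1 [e3]
      abel
    have h8 : (a - b) • (1 : U F p n) ∈ K := by
      rw [h7]
      refine sub_mem (add_mem (sub_mem (h4 k hk) (Submodule.smul_mem _ _ hk))
        (Submodule.mem_sup_right ?_)) (Submodule.mem_sup_right h2)
      exact smul_mem_ann _ h6
    exact h1K ((Submodule.smul_mem_iff _ (sub_ne_zero.2 hab)).1 h8)
  have hstab : ∀ x : U F p n, (∀ a, ∃ d : F, x * iD F p n (mon F p a) =
      iD F p n (mon F p a) * x + d • iD F p n (mon F p a)) → ∀ y ∈ K, x * y ∈ K := by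
    intro x hx y hy
    have h2 : K ≤ K.comap (LinearMap.mulLeft F x) := by
      refine sup_le ?_ fun r hr => Submodule.mem_sup_right (mul_mem_ann x hr)
      rw [hN, negPart, iDS, Submodule.mul_le]
      intro z hz u _
      induction hz using Submodule.span_induction with
      | zero => rw [zero_mul]; exact zero_mem _
      | add z z' _ _ h h' => rw [add_mul]; exact add_mem h h'
      | smul d z _ h => rw [smul_mul_assoc]; exact Submodule.smul_mem _ _ h
      | mem z hz =>
        obtain ⟨a, ha, rfl⟩ := hz
        obtain ⟨d, hd⟩ := hx a
        change x * (iD F p n (mon F p a) * u) ∈ K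
        rw [← mul_assoc, hd, add_mul, mul_assoc, smul_mul_assoc]
        have h3 : ∀ v, iD F p n (mon F p a) * v ∈ K := fun v =>
          Submodule.mem_sup_left (Submodule.mul_mem_mul (mem_iDS ha) trivial)
        exact add_mem (h3 _) (Submodule.smul_mem _ _ (h3 _))
    exact h2 hy
  exact dual_ext
    (fun j => hcompare _ _ _ (iH_mem_ann j) (iH_mem_ann j) (hstab _ fun a => ⟨_, iH_iD j a⟩))
    (hcompare _ _ _ iE_mem_ann iE_mem_ann (hstab _ fun a => ⟨_, iE_iD a⟩))

/-- The grading whose negative part contains `𝔫_0^+`. -/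
theorem isGrading_deg (p n : ℕ) :
    IsGrading p n fun a => -(bigX p n * ((deg a : ℤ) - 2) + psiFirst a) where
  contr a b c h := by
    have h1 := contr_deg h
    have h2 : psiFirst c = psiFirst a + psiFirst b := by
      have := lw_contr (c := fun i : Fin n => (n - i.val : ℤ)) (d := fun i => (i.val - n : ℤ))
        (D := 0) (fun i => by ring) h
      simpa [psiFirst] using this
    have h3 : (deg c : ℤ) = deg a + deg b - 2 := by omega
    rw [h2, h3]; ring
  cartan i := by
    rw [deg_add, deg_unit, deg_unit, psiFirst, lw_add, lw_unit_inl, lw_unit_inr]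
    push_cast; ring

open scoped Pointwise in
/-- Products of the `De_{x^{(a)}}` are homogeneous weight vectors. -/
theorem weight_of_mem_pow {S : Set (Var n → ℕ)} (j : ℕ) :
    ∀ w ∈ ((fun a => iD F p n (mon F p a)) '' S) ^ j, (∃ θ, w ∈ uPart F p n θ) ∧
      (∃ c : Fin n → F, ∀ i, iH F p i * w = w * iH F p i + c i • w) ∧
        ∃ d : F, iE F p n * w = w * iE F p n + d • w := by
  induction j with
  | zero =>
    rintro w hw
    rw [pow_zero] at hw
    rw [Set.mem_one.1 hw]
    exact ⟨⟨0, one_mem_uPart⟩, ⟨fun _ => 0, fun i => by simp⟩, 0, by simp⟩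
  | succ j ih =>
    rintro _ h
    rw [pow_succ] at h
    obtain ⟨w, hw, _, ⟨a, -, rfl⟩, rfl⟩ := Set.mem_mul.1 h
    obtain ⟨⟨θ, hθ⟩, ⟨c, hc⟩, d, hd⟩ := ih w hw
    refine ⟨⟨_, mul_mem_uPart hθ (iD_mem_uPart (isPar_mon a))⟩,
      ⟨fun i => ((a (Sum.inr i) : F) - a (Sum.inl i)) + c i, fun i => ?_⟩,
      ((deg a : F) - 2) + d, ?_⟩
    · rw [← mul_assoc, hc, add_mul, mul_assoc, iH_iD, mul_add, mul_smul_comm, smul_mul_assoc,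
        add_assoc, ← add_smul_U, mul_assoc]
    · rw [← mul_assoc, hd, add_mul, mul_assoc, iE_iD, mul_add, mul_smul_comm, smul_mul_assoc,
        add_assoc, ← add_smul_U, mul_assoc]

open scoped Pointwise in
/-- Every irreducible module has a highest weight vector with respect to `𝔟_0`: a longest product
of elements of `𝔫_0^+` that does not kill the given highest weight vector produces one. -/
theorem exists_lIso_zero [NeZero n] (hp : 3 < p) (hm : m ≤ 2 * n)
    (hI : vermaIdeal F p n m lam ≠ ⊤) :
    ∃ lam₀, LIso F p n m lam 0 lam₀ ∧ vermaIdeal F p n 0 lam₀ ≠ ⊤ := by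
  have hR := annIdeal_ne_top_of_le hp hm hI
  obtain ⟨M, hM⟩ := negPart_nilpotent (F := F) hp (isGrading_deg p n)
  set S : Set (Var n → ℕ) :=
    {a | Valid p n a ∧ -(bigX p n * ((deg a : ℤ) - 2) + psiFirst a) < 0} with hS
  have hex : ∃ j, iDS F p S ^ j ≤ (annIdeal F p n m lam).restrictScalars F :=
    ⟨M, by rw [hM]; exact bot_le⟩
  classical
  have hspec := Nat.find_spec hex
  have hmin := fun j => Nat.find_min hex (m := j)
  set t := Nat.find hex
  have ht0 : t ≠ 0 := fun h => by
    rw [h, pow_zero] at hspec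
    exact one_notMem_ann hR (hspec (Submodule.one_le.1 le_rfl))
  obtain ⟨s, hs⟩ := Nat.exists_eq_succ_of_ne_zero ht0
  have hns := hmin s (by omega)
  obtain ⟨w, hwS, hw⟩ : ∃ w ∈ ((fun a => iD F p n (mon F p a)) '' S) ^ s,
      w ∉ annIdeal F p n m lam := by
    by_contra! hcon
    refine hns ?_
    rw [iDS, Submodule.span_pow, Submodule.span_le]
    exact fun w hw => hcon w hw
  obtain ⟨⟨θ, hθ⟩, ⟨c, hc⟩, d, hd⟩ := weight_of_mem_pow s w hwS
  have h2 := two_ne_zero' (F := F) (p := p) hp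
  refine ⟨lam + (∑ i, c i • eps F p i + d • delta F p n), lIso_of_singular h2
    (annIdeal_ne_top_of_le hp (Nat.zero_le _)) hθ hw (fun a ha ha0 => ?_) (fun j => ?_) ?_⟩
  · have h3 : iD F p n (mon F p a) * w ∈ iDS F p S ^ t := by
      rw [hs, Nat.succ_eq_add_one, pow_succ']
      refine Submodule.mul_mem_mul (mem_iDS ⟨ha, ?_⟩) ?_
      · have := piDeg_pos ha ha0
        omega
      · rw [iDS, Submodule.span_pow]
        exact Submodule.subset_span hwS
    exact hspec h3
  · refine iH_mul_mem_ann (hc j) ?_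
    rw [LinearMap.add_apply, LinearMap.add_apply, LinearMap.sum_apply, LinearMap.smul_apply,
      delta_hDe, smul_zero, add_zero, Finset.sum_eq_single j]
    · rw [LinearMap.smul_apply, eps_hDe F p h2, if_pos rfl, smul_eq_mul, mul_one]
    · intro i _ hi
      rw [LinearMap.smul_apply, eps_hDe F p h2, if_neg hi, smul_zero]
    · simp
  · refine iE_mul_mem_ann hd ?_
    rw [LinearMap.add_apply, LinearMap.add_apply, LinearMap.sum_apply, LinearMap.smul_apply,
      delta_euler F p h2, smul_eq_mul, mul_one, Finset.sum_eq_zero, zero_add]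
    intro i _
    rw [LinearMap.smul_apply, eps_euler, smul_zero]

end HighestWeights

/-! ### Reflections of weights -/

section Reflections

variable {F : Type*} [Field F] {p n m : ℕ} {lam lam' : Module.Dual F (hBar F p n)}

theorem ev_add (j : Fin n) : ev (lam + lam') j = ev lam j + ev lam' j := rfl

theorem ev_sub (j : Fin n) : ev (lam - lam') j = ev lam j - ev lam' j := rfl

theorem ev_smul (c : F) (j : Fin n) : ev (c • lam) j = c * ev lam j := rfl

theorem ev_eq_zero_iff {i : Fin n} :
    (∀ h : hBar F p n, h.1 ∈ hSub F p i → lam h = 0) ↔ ∀ j, j ≠ i → ev lam j = 0 := by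
  refine ⟨fun h j hj => h _ (Submodule.subset_span ⟨j, hj, rfl⟩), fun h => ?_⟩
  suffices key : hSub F p i ≤ (LinearMap.ker lam).map (hBar F p n).subtype by
    intro x hx
    obtain ⟨y, hy, hyx⟩ := key hx
    rw [← Subtype.ext hyx]
    exact hy
  refine Submodule.span_le.2 ?_
  rintro _ ⟨j, hj, rfl⟩
  exact ⟨hDe' F p j, h j hj, rfl⟩

theorem cast_pred_eq (hp : 3 < p) : ((p - 1 : ℕ) : F) = (p : F) - 1 := by
  rw [Nat.cast_sub (by omega), Nat.cast_one]

theorem cast_sub_two_eq (hp : 3 < p) : ((p - 2 : ℕ) : F) = (p : F) - 2 := by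
  rw [Nat.cast_sub (by omega), Nat.cast_ofNat]

section Definitions

variable [NeZero n]

open scoped Classical in
/-- The highest weight with respect to the next Borel subalgebra, for the reflection
in `-ε_k - δ`. -/
def reflFirst (k : Fin n) (lam : Module.Dual F (hBar F p n)) : Module.Dual F (hBar F p n) :=
  if ∀ j, j ≠ k → ev lam j = 0 then lam else lam - eps F p k - delta F p n

open scoped Classical in
/-- The number of times the root `ε_k - δ` is added to the highest weight by the reflection in
this root. -/
def reflLength (k : Fin n) (lam : Module.Dual F (hBar F p n)) : ℕ :=
  if ∀ j, j ≠ k → ev lam j = 0 then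
    if ev lam k = 0 then 0 else if ev lam k = 1 then p - 2 else p - 1
  else p - 1

/-- The highest weight with respect to the next Borel subalgebra, for the reflection
in `ε_k - δ`. -/
def reflSecond (k : Fin n) (lam : Module.Dual F (hBar F p n)) : Module.Dual F (hBar F p n) :=
  lam + (reflLength k lam : F) • (eps F p k - delta F p n)

theorem reflFirst_of_forall {k : Fin n} (h : ∀ j, j ≠ k → ev lam j = 0) :
    reflFirst k lam = lam := if_pos h

theorem reflFirst_of_exists {k : Fin n} (h : ¬ ∀ j, j ≠ k → ev lam j = 0) :
    reflFirst k lam = lam - eps F p k - delta F p n := if_neg h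

end Definitions

variable [Fact p.Prime]

theorem ev_eps (h2 : (2 : F) ≠ 0) (k j : Fin n) : ev (eps F p k) j = if k = j then 1 else 0 :=
  eps_hDe F p h2 k j

theorem ev_delta [NeZero n] (j : Fin n) : ev (delta F p n) j = 0 := delta_hDe F p j

variable [NeZero n] [CharP F p]

theorem ev_reflFirst (hp : 3 < p) {k j : Fin n} (hj : j ≠ k) :
    ev (reflFirst k lam) j = ev lam j := by
  have h2 := two_ne_zero' (F := F) hp
  rw [reflFirst]
  split_ifs
  · rfl
  · rw [ev_sub, ev_sub, ev_eps h2, if_neg (Ne.symm hj), ev_delta, sub_zero, sub_zero]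

theorem reflFirst_injective (hp : 3 < p) (k : Fin n) :
    Function.Injective (reflFirst (F := F) (p := p) k) := by
  intro lam lam' h
  have key : (∀ j, j ≠ k → ev lam j = 0) ↔ ∀ j, j ≠ k → ev lam' j = 0 := by
    refine forall₂_congr fun j hj => ?_
    rw [← ev_reflFirst hp hj, h, ev_reflFirst hp hj]
  by_cases h' : ∀ j, j ≠ k → ev lam j = 0
  · rwa [reflFirst_of_forall h', reflFirst_of_forall (key.1 h')] at h
  · rw [reflFirst_of_exists h', reflFirst_of_exists (mt key.2 h')] at h
    exact sub_left_injective (sub_left_injective h)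

theorem ev_reflSecond (hp : 3 < p) {k j : Fin n} (hj : j ≠ k) :
    ev (reflSecond k lam) j = ev lam j := by
  have h2 := two_ne_zero' (F := F) hp
  rw [reflSecond, ev_add, ev_smul, ev_sub, ev_eps h2, if_neg (Ne.symm hj), ev_delta, sub_zero,
    mul_zero, add_zero]

theorem ev_reflSecond_self (hp : 3 < p) {k : Fin n} :
    ev (reflSecond k lam) k = ev lam k + reflLength k lam := by
  have h2 := two_ne_zero' (F := F) hp
  rw [reflSecond, ev_add, ev_smul, ev_sub, ev_eps h2, if_pos rfl, ev_delta, sub_zero, mul_one]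

/-- The length of the reflection can be read off from the reflected weight: in the rank one case
the value of the latter at `h_k` is `0`, `-1`, or neither of them. -/
theorem reflSecond_injective (hp : 3 < p) (k : Fin n) :
    Function.Injective (reflSecond (F := F) (p := p) k) := by
  intro lam lam' h
  suffices hlen : (reflLength k lam : F) = reflLength k lam' by
    rw [reflSecond, reflSecond, hlen] at h
    exact add_left_injective _ h
  have key : (∀ j, j ≠ k → ev lam j = 0) ↔ ∀ j, j ≠ k → ev lam' j = 0 := by
    refine forall₂_congr fun j hj => ?_
    rw [← ev_reflSecond hp hj, h, ev_reflSecond hp hj]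
  have hk : ev lam k + reflLength k lam = ev lam' k + reflLength k lam' := by
    rw [← ev_reflSecond_self hp, h, ev_reflSecond_self hp]
  have h1 : (1 : F) ≠ 0 := one_ne_zero
  have hp0 : (p : F) = 0 := CharP.cast_eq_zero F p
  by_cases hl : ∀ j, j ≠ k → ev lam j = 0
  · simp only [reflLength, if_pos hl, if_pos (key.1 hl)] at hk ⊢
    split_ifs at hk ⊢ <;>
      simp only [cast_pred_eq hp, cast_sub_two_eq hp, hp0, Nat.cast_zero] at hk ⊢ <;> grind
  · rw [reflLength, reflLength, if_neg hl, if_neg (mt key.2 hl)]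

theorem lIso_reflFirst (hp : 3 < p) (k : Fin n) (hI : vermaIdeal F p n k.val lam ≠ ⊤) :
    LIso F p n k.val lam (k.val + 1) (reflFirst k lam) ∧
      vermaIdeal F p n (k.val + 1) (reflFirst k lam) ≠ ⊤ := by
  by_cases h : ∀ j, j ≠ k → ev lam j = 0
  · rw [reflFirst_of_forall h]
    exact step_first_special hp k h hI
  · rw [reflFirst_of_exists h]
    push Not at h
    exact step_first_generic hp k h hI

theorem lIso_reflSecond (hp : 3 < p) {k : Fin n} (hm : m + k.val + 1 = 2 * n)
    (hI : vermaIdeal F p n m lam ≠ ⊤) :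
    LIso F p n m lam (m + 1) (reflSecond k lam) ∧
      vermaIdeal F p n (m + 1) (reflSecond k lam) ≠ ⊤ := by
  rw [reflSecond, reflLength]
  split_ifs with h h0 h1
  · rw [Nat.cast_zero, zero_smul, add_zero]
    refine step_second_trivial hp hm (fun j => ?_) hI
    by_cases hj : j = k
    · rw [hj, h0]
    · exact h j hj
  · exact step_second_exceptional hp hm h1 h hI
  · exact step_second_rank_one hp hm h0 h1 hI
  · push Not at h
    exact step_second_generic hp hm h hI

/-- An irreducible quotient of a nonzero Verma module for `𝔟_0` has a highest weight with respect to
each of the Borel subalgebras. -/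
theorem exists_lIso_of_zero (hp : 3 < p) (hm : m ≤ 2 * n) {lam₀ : Module.Dual F (hBar F p n)}
    (hI : vermaIdeal F p n 0 lam₀ ≠ ⊤) :
    ∃ lam, LIso F p n 0 lam₀ m lam ∧ vermaIdeal F p n m lam ≠ ⊤ := by
  induction m with
  | zero => exact ⟨lam₀, ⟨LinearEquiv.refl _ _, 0, fun η x => by simp⟩, hI⟩
  | succ m ih =>
    obtain ⟨lam, h, hI'⟩ := ih (by omega)
    by_cases hmn : m < n
    · obtain ⟨h1, h2⟩ := lIso_reflFirst hp ⟨m, hmn⟩ hI'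
      exact ⟨_, h.trans h1, h2⟩
    · obtain ⟨h1, h2⟩ := lIso_reflSecond (k := ⟨2 * n - 1 - m, by omega⟩) hp
        (by change m + (2 * n - 1 - m) + 1 = _; omega) hI'
      exact ⟨_, h.trans h1, h2⟩

/-- An injective change of highest weights that is valid for the nonzero Verma modules maps the
weights of the zero Verma modules to such weights: the irreducible module of highest weight
`f lam` with respect to `𝔟_{m+1}` has a highest weight with respect to `𝔟_m`, via `𝔟_0`, and by
injectivity this is `lam`. -/
theorem lIso_of_injective (hp : 3 < p) (hm : m + 1 ≤ 2 * n)
    {f : Module.Dual F (hBar F p n) → Module.Dual F (hBar F p n)} (hf : Function.Injective f)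
    (hstep : ∀ lam, vermaIdeal F p n m lam ≠ ⊤ →
      LIso F p n m lam (m + 1) (f lam) ∧ vermaIdeal F p n (m + 1) (f lam) ≠ ⊤)
    (lam : Module.Dual F (hBar F p n)) : LIso F p n m lam (m + 1) (f lam) := by
  by_cases hI : vermaIdeal F p n m lam = ⊤
  · refine lIso_of_eq_top hI ?_
    by_contra hI'
    obtain ⟨lam₀, h₀, hI₀⟩ := exists_lIso_zero hp hm hI'
    obtain ⟨lam₁, h₁, hI₁⟩ := exists_lIso_of_zero (m := m) hp (by omega) hI₀
    have h := highest_weight_unique hp hm hI' ((h₀.trans h₁).trans (hstep lam₁ hI₁).1)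
    rw [hf h] at hI
    exact hI₁ hI
  · exact (hstep lam hI).1

end Reflections

end OddHam

end

theorem proposition2p1 {F : Type*} [Field F] [IsAlgClosed F] (p : ℕ) [Fact p.Prime] [CharP F p]
    (hp : 3 < p) (n : ℕ) [NeZero n] (i : Fin n)
    (lam : Module.Dual F (OddHam.hBar F p n)) (hlam : lam ∈ OddHam.Lam F p n) :
    -- the reflection in `-ε_i - δ`
    ((∀ h : OddHam.hBar F p n, h.1 ∈ OddHam.hSub F p i → lam h = 0) →
      OddHam.LIso F p n i.val lam (i.val + 1) lam) ∧
    ((¬ ∀ h : OddHam.hBar F p n, h.1 ∈ OddHam.hSub F p i → lam h = 0) →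
      OddHam.LIso F p n i.val lam (i.val + 1) (lam - OddHam.eps F p i - OddHam.delta F p n)) ∧
    -- the reflection in `ε_{n-i+1} - δ`; the index `n - i + 1` is `i.rev`
    ((¬ ∀ h : OddHam.hBar F p n, h.1 ∈ OddHam.hSub F p i.rev → lam h = 0) →
      OddHam.LIso F p n (n + i.val) lam (n + i.val + 1)
        (lam + ((p : F) - 1) • (OddHam.eps F p i.rev - OddHam.delta F p n))) ∧
    (∀ a ∈ (⊥ : Subfield F), lam = a • OddHam.delta F p n →
      OddHam.LIso F p n (n + i.val) lam (n + i.val + 1) lam) ∧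
    (∀ a ∈ (⊥ : Subfield F), ∀ b ∈ (⊥ : Subfield F), a ≠ 0 → a ≠ 1 →
      lam = a • OddHam.eps F p i.rev + b • OddHam.delta F p n →
      OddHam.LIso F p n (n + i.val) lam (n + i.val + 1)
        (lam + ((p : F) - 1) • (OddHam.eps F p i.rev - OddHam.delta F p n))) ∧
    (∀ b ∈ (⊥ : Subfield F), lam = OddHam.eps F p i.rev + b • OddHam.delta F p n →
      OddHam.LIso F p n (n + i.val) lam (n + i.val + 1)
        (lam + ((p : F) - 2) • (OddHam.eps F p i.rev - OddHam.delta F p n))) := by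
  have h2 := OddHam.two_ne_zero' (F := F) hp
  have hi := i.2
  have hfirst := OddHam.lIso_of_injective (m := i.val) hp (by omega)
    (OddHam.reflFirst_injective hp i) (fun _ => OddHam.lIso_reflFirst hp i) lam
  have hm : n + i.val + i.rev.val + 1 = 2 * n := by rw [Fin.val_rev]; omega
  have hsecond := OddHam.lIso_of_injective (m := n + i.val) hp (by omega)
    (OddHam.reflSecond_injective hp i.rev) (fun _ => OddHam.lIso_reflSecond hp hm) lam
  rw [OddHam.reflSecond] at hsecond
  have hev : ∀ (a b : F), lam = a • OddHam.eps F p i.rev + b • OddHam.delta F p n →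
      ∀ j, OddHam.ev lam j = if i.rev = j then a else 0 := by
    rintro a b rfl j
    rw [OddHam.ev_add, OddHam.ev_smul, OddHam.ev_smul, OddHam.ev_eps h2, OddHam.ev_delta,
      mul_zero, add_zero, mul_ite, mul_one, mul_zero]
  refine ⟨fun h => ?_, fun h => ?_, fun h => ?_, fun a _ ha => ?_, fun a _ b _ ha ha' hab => ?_,
    fun b _ hb => ?_⟩
  · rw [OddHam.ev_eq_zero_iff] at h
    rwa [OddHam.reflFirst_of_forall h] at hfirst
  · rw [OddHam.ev_eq_zero_iff] at h
    rwa [OddHam.reflFirst_of_exists h] at hfirst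
  · rw [OddHam.ev_eq_zero_iff] at h
    rwa [OddHam.reflLength, if_neg h, OddHam.cast_pred_eq hp] at hsecond
  · have h := hev 0 a (by rw [zero_smul, zero_add, ha])
    rwa [OddHam.reflLength, if_pos fun j hj => by rw [h, if_neg (Ne.symm hj)],
      if_pos (by rw [h, if_pos rfl]), Nat.cast_zero, zero_smul, add_zero] at hsecond
  · have h := hev a b hab
    rwa [OddHam.reflLength, if_pos fun j hj => by rw [h, if_neg (Ne.symm hj)],
      if_neg (by rwa [h, if_pos rfl]), if_neg (by rwa [h, if_pos rfl]),
      OddHam.cast_pred_eq hp] at hsecond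
  · have h := hev 1 b (by rw [one_smul, hb])
    rwa [OddHam.reflLength, if_pos fun j hj => by rw [h, if_neg (Ne.symm hj)],
      if_neg (by rw [h, if_pos rfl]; exact one_ne_zero), if_pos (by rw [h, if_pos rfl]),
      OddHam.cast_sub_two_eq hp] at hsecond
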